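/- Let $k$ be a finite field and let $G$ be a split connected reductive group over $k$ with split maximal torus $T$. Let $\lambda:\mathbb G_m\to T$ be a coweight (for instance a dominant one). Let $P_\lambda\subset G$ be the parabolic subgroup containing $T$ whose unipotent radical $U_\lambda$ is generated by the root subgroups of the roots $\alpha$ with $\langle\lambda,\alpha\rangle>0$, let $P_\lambda^-$, with unipotent radical $U_\lambda^-$, be the opposite parabolic, and let $M_\lambda=P_\lambda\cap P_\lambda^-$ be the common Levi subgroup. Let $$X_\lambda=G/U_\lambda\underset{M_\lambda}{\times}G/U_\lambda^-$$ be the quotient of $G/U_\lambda\times G/U_\lambda^-$ by the diagonal right action of $M_\lambda$ (a quotient of étale sheaves). Equivalently, $X_\lambda$ parametrizes triples consisting of a $P_\lambda$-reduction of the trivial $G$-torsor, a $P_\lambda^-$-reduction of the trivial $G$-torsor, and an isomorphism of the two associated $M_\lambda$-torsors. Let $\mathcal H$ be the stack over $k$ whose objects over a $k$-algebra $A$ are 5-tuples $(\mathcal F_1,\mathcal F_2,\phi_1,\phi_2,\kappa)$, where $\mathcal F_i$ is a $G$-bundle on $\operatorname{Spec}A[[t]]$, $\phi_i$ is a trivialization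 of $\mathcal F_i|_{t=0}$, and $\kappa:\mathcal F_1\to\mathcal F_2$ is an isomorphism over $\operatorname{Spec}A((t))$. Let $\mathcal H^\lambda\subset\mathcal H$ be the stratum of those 5-tuples for which, étale locally on $\operatorname{Spec}A$, the triple $(\mathcal F_1,\mathcal F_2,\kappa)$ is isomorphic to (trivial bundle, trivial bundle, $t^\lambda$). Then there is a morphism $\Phi:\mathcal H^\lambda\to X_\lambda$ with the following properties. 1. $\Phi$ is given by Jantzen filtrations. Let $V$ be a finite-dimensional representation of $G$, and let $\xi=(\mathcal F_1,\mathcal F_2,\phi_1,\phi_2,\kappa)$ be an object of $\mathcal H^\lambda$ over $A$. Let $\mathcal E=\mathcal F_1\times^GV$ and $\mathcal E'=\mathcal F_2\times^GV$ be the associated bundles on $\operatorname{Spec}A[[t]]$, and identify their fibres at $t=0$ with $A\otimes V$ by $\phi_1$ and $\phi_2$. Put $$E_i=\{s(0): s\in\mathcal E,\ t^{-i}\kappa(s)\in\mathcal E'\},\qquad E'_i=\{s'(0): s'\in\mathcal E',\ t^{-i}\kappa^{-1}(s')\in\mathcal E\}.$$ If $\Phi(\xi)$ is the class of $(g,h)\in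 G(A)\times G(A)$, then for all $i$ one has $E_i=g\cdot V_{\ge i}$ and $E'_i=h\cdot V_{\le -i}$, where $V_{\ge i}$ and $V_{\le -i}$ are the sums of the weight spaces of $\lambda$ in $A\otimes V$ of weights $\ge i$ and $\le -i$. Moreover, for every $v\in A\otimes V$ of weight $i$ there is a section $s\in\mathcal E$ with $s(0)=gv$, $t^{-i}\kappa(s)\in\mathcal E'$ and $(t^{-i}\kappa(s))(0)\in hv+E'_{-i+1}$; that is, the isomorphism $\mathrm{gr}_i(E)\cong\mathrm{gr}_{-i}(E')$ induced by $\kappa$ sends the class of $gv$ to the class of $hv$. 2. $\Phi$ is surjective on $k$-points. 3. For every field extension $L/k$ and every $x\in X_\lambda(L)$, the fibre of $\Phi$ over $x$ is equivalent, as a stack over $L$, to the classifying stack $BK$ of a pro-unipotent group scheme $K$ over $L$. 4. In particular, $\Phi$ induces a bijection from the set of isomorphism classes of $k$-points of $\mathcal H^\lambda$ onto $X_\lambda(k)$. -/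

import Mathlib

open CategoryTheory TensorProduct

universe u

noncomputable section

namespace KOneHecke

/-! ## Affine group schemes, their points and representations

An affine group scheme `G` over a field `k` is given by its commutative Hopf algebra `R = k[G]`. -/

section Groups

variable (k : Type u) [Field k] (R : Type u) [CommRing R] [HopfAlgebra k R]

/-- The group `G(A) = Hom_k(R, A)` of `A`-points (with the convolution product). -/
abbrev Pts (A : Type u) [CommRing A] [Algebra k A] : Type u := WithConv (R →ₐ[k] A)

instance Pts.instInv (A : Type u) [CommRing A] [Algebra k A] : Inv (Pts k R A) where
  inv g := .toConv (g.ofConv.comp (HopfAlgebra.antipodeAlgHom k R))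

instance Pts.instGroup (A : Type u) [CommRing A] [Algebra k A] : Group (Pts k R A) where
  inv_mul_cancel g := by
    apply WithConv.ext
    apply AlgHom.ext
    intro c
    have H := congrArg (fun f => g.ofConv (f.ofConv c))
      (LinearMap.antipode_mul_id (R := k) (C := R))
    rw [AlgHom.convMul_apply]
    simp only [LinearMap.convMul_def, LinearMap.convOne_def] at H
    refine Eq.trans ?_ (H.trans ?_)
    · simp only [LinearMap.comp_apply]
      generalize Coalgebra.comul (R := k) c = z
      induction z with
      | zero => simp
      | add x y hx hy => simp only [map_add, hx, hy]
      | tmul x y => simp [Inv.inv]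
    · simp

variable {k R} in
/-- Functoriality of `G(A)` in the `k`-algebra `A`. -/
def Pts.map {A B : Type u} [CommRing A] [Algebra k A] [CommRing B] [Algebra k B]
    (f : A →ₐ[k] B) : Pts k R A →* Pts k R B where
  toFun g := .toConv (f.comp g.ofConv)
  map_one' := by
    apply WithConv.ext
    ext x
    simp [AlgHom.convOne_def]
  map_mul' g h := by
    apply WithConv.ext
    exact AlgHom.comp_convMul_distrib f g h

/-- A finite-dimensional representation of `G`, i.e. a finite-dimensional right `R`-comodule. -/
structure FinRep where
  V : Type u
  [addCommGroup : AddCommGroup V]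
  [module : Module k V]
  [finite : Module.Finite k V]
  coact : V →ₗ[k] V ⊗[k] R
  coassoc : (TensorProduct.assoc k V R R).toLinearMap ∘ₗ coact.rTensor R ∘ₗ coact =
    (Coalgebra.comul (R := k) (A := R)).lTensor V ∘ₗ coact
  counit : (TensorProduct.rid k V).toLinearMap ∘ₗ
    (Coalgebra.counit (R := k) (A := R)).lTensor V ∘ₗ coact = LinearMap.id

attribute [instance] FinRep.addCommGroup FinRep.module FinRep.finite

variable {k R} in
/-- The action of `g ∈ G(C)` on `C ⊗ V`. -/
def FinRep.act (V : FinRep k R) {C : Type u} [CommRing C] [Algebra k C] (g : Pts k R C) :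
    C ⊗[k] V.V →ₗ[C] C ⊗[k] V.V :=
  LinearMap.liftBaseChange C
    ((TensorProduct.comm k V.V C).toLinearMap ∘ₗ g.ofConv.toLinearMap.lTensor V.V ∘ₗ V.coact)

/-- `G` is unipotent: every nonzero (finite-dimensional) representation has a nonzero fixed
vector. -/
def IsUnipotent : Prop :=
  ∀ V : FinRep k R, Nontrivial V.V → ∃ v : V.V, v ≠ 0 ∧ V.coact v = v ⊗ₜ[k] (1 : R)

/-- `G` is pro-unipotent, i.e. an inverse limit of unipotent algebraic groups: its Hopf algebra
is the directed union of Hopf subalgebras which are coordinate rings of unipotent groups of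
finite type. -/
def IsProUnipotent : Prop :=
  ∀ s : Finset R, ∃ (R' : Type u) (_ : CommRing R') (_ : HopfAlgebra k R') (j : R' →ₐc[k] R),
    Function.Injective j ∧ Algebra.FiniteType k R' ∧ IsUnipotent k R' ∧ (s : Set R) ⊆ Set.range j

variable {k R} in
/-- The closed subgroup `N ⊆ G` given by a surjection `π : k[G] → k[N]` is normal. -/
def IsNormal {N : Type u} [CommRing N] [HopfAlgebra k N] (π : R →ₐc[k] N) : Prop :=
  ∀ (C : Type u) [CommRing C] [Algebra k C] (g : Pts k R C) (n : Pts k N C),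
    ∃ n' : Pts k N C,
      g * WithConv.toConv (n.ofConv.comp (π : R →ₐ[k] N)) * g⁻¹ =
        WithConv.toConv (n'.ofConv.comp (π : R →ₐ[k] N))

/-- `G` is a connected reductive group: a smooth connected affine algebraic group such that
every smooth connected unipotent normal closed subgroup of `G` over the algebraic closure
is trivial. -/
structure IsConnectedReductive : Prop where
  smooth : Algebra.Smooth k R
  connected : ConnectedSpace (PrimeSpectrum R)
  unipotentRadical_trivial :
    ∀ (N : Type u) [CommRing N] [HopfAlgebra (AlgebraicClosure k) N]
      (π : (AlgebraicClosure k ⊗[k] R) →ₐc[AlgebraicClosure k] N),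
      Function.Surjective π → IsNormal π → Algebra.Smooth (AlgebraicClosure k) N →
      ConnectedSpace (PrimeSpectrum N) → IsUnipotent (AlgebraicClosure k) N →
      Function.Bijective (algebraMap (AlgebraicClosure k) N)

/-- A split maximal torus `T ⊆ G`: a closed subgroup isomorphic to `𝔾_m ^ rank` which, over the
algebraic closure, is not properly contained in another torus of `G`. -/
structure SplitMaximalTorus where
  rank : ℕ
  incl : R →ₐc[k] AddMonoidAlgebra k (Fin rank → ℤ)
  surjective : Function.Surjective incl
  maximal : ∀ (m : ℕ) (π : (AlgebraicClosure k ⊗[k] R) →ₐc[AlgebraicClosure k]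
      AddMonoidAlgebra (AlgebraicClosure k) (Fin m → ℤ)), Function.Surjective π →
    RingHom.ker (π : (AlgebraicClosure k ⊗[k] R) →ₐ[AlgebraicClosure k]
        AddMonoidAlgebra (AlgebraicClosure k) (Fin m → ℤ)) ≤
      RingHom.ker (Algebra.TensorProduct.map (AlgHom.id (AlgebraicClosure k) (AlgebraicClosure k))
        (incl : R →ₐ[k] AddMonoidAlgebra k (Fin rank → ℤ))) →
    RingHom.ker (π : (AlgebraicClosure k ⊗[k] R) →ₐ[AlgebraicClosure k]
        AddMonoidAlgebra (AlgebraicClosure k) (Fin m → ℤ)) =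
      RingHom.ker (Algebra.TensorProduct.map (AlgHom.id (AlgebraicClosure k) (AlgebraicClosure k))
        (incl : R →ₐ[k] AddMonoidAlgebra k (Fin rank → ℤ)))

variable {k R}

/-- The coweight lattice `Λ = Hom(𝔾_m, T)`. -/
abbrev SplitMaximalTorus.Coweight (T : SplitMaximalTorus k R) : Type u :=
  AddMonoidAlgebra k (Fin T.rank → ℤ) →ₐc[k] LaurentPolynomial k

/-- The cocharacter `𝔾_m → T → G` attached to `lam ∈ Λ`, as the point `lam(T)` of
`G(k[T, T⁻¹])`. -/
def SplitMaximalTorus.cochar (T : SplitMaximalTorus k R) (lam : T.Coweight) :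
    Pts k R (LaurentPolynomial k) :=
  .toConv ((lam : _ →ₐ[k] LaurentPolynomial k).comp
    (T.incl : R →ₐ[k] AddMonoidAlgebra k (Fin T.rank → ℤ)))

end Groups

/-! ## The groups `U_λ`, `M_λ` attached to a cocharacter -/

section Dynamic

variable {k : Type u} [Field k] {R : Type u} [CommRing R] [HopfAlgebra k R]
variable (A : Type u) [CommRing A] [Algebra k A]

variable (k) in
/-- The `k`-algebra map `k[T, T⁻¹] → A[T, T⁻¹]`. -/
def laurentBaseChange : LaurentPolynomial k →ₐ[k] LaurentPolynomial A :=
  AddMonoidAlgebra.lift k (LaurentPolynomial A) ℤ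
    { toFun := fun n => LaurentPolynomial.T n.toAdd
      map_one' := LaurentPolynomial.T_zero
      map_mul' := fun m n => LaurentPolynomial.T_add m.toAdd n.toAdd }

variable (k) in
/-- The inclusion `A[T] → A[T, T⁻¹]`. -/
def polyToLaurent : Polynomial A →ₐ[k] LaurentPolynomial A :=
  (Polynomial.toLaurentAlg (R := A)).restrictScalars k

variable (k) in
/-- Evaluation at `0`, `A[T] → A`. -/
def evalZero : Polynomial A →ₐ[k] A := (Polynomial.aeval (0 : A)).restrictScalars k

variable (ell : Pts k R (LaurentPolynomial k))

/-- `G(A) → G(A[T, T⁻¹])`, `g ↦ λ(T) g λ(T)⁻¹`. -/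
def conjBy : Pts k R A →* Pts k R (LaurentPolynomial A) :=
  (MulAut.conj (Pts.map (laurentBaseChange k A) ell)).toMonoidHom.comp
    (Pts.map (IsScalarTower.toAlgHom k A (LaurentPolynomial A)))

/-- `U_λ(A) = {g : lim_{T → 0} λ(T) g λ(T)⁻¹ = 1}`: the unipotent radical of the parabolic
subgroup `P_λ = {g : lim_{T → 0} λ(T) g λ(T)⁻¹ exists}`, whose roots are those `α` with
`⟨λ, α⟩ > 0`. -/
def unipotentRadical : Subgroup (Pts k R A) :=
  ((Pts.map (R := R) (evalZero k A)).ker.map (Pts.map (polyToLaurent k A))).comap (conjBy A ell)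

/-- `M_λ(A)`: the centralizer of `λ`, i.e. the Levi subgroup `P_λ ∩ P_λ⁻` of `P_λ`. -/
def levi : Subgroup (Pts k R A) :=
  (conjBy A ell).eqLocus (Pts.map (IsScalarTower.toAlgHom k A (LaurentPolynomial A)))

/-- The set `(G(A)/U_λ(A) × G(A)/U_λ⁻(A)) / M_λ(A)`, for the diagonal right action of `M_λ(A)`. -/
def PreQuot : Type u :=
  Quot (fun x y : (Pts k R A ⧸ unipotentRadical A ell) × (Pts k R A ⧸ unipotentRadical A ell⁻¹) =>
    ∃ (g h : Pts k R A) (m : Pts k R A), m ∈ levi A ell ∧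
      x = (QuotientGroup.mk g, QuotientGroup.mk h) ∧
      y = (QuotientGroup.mk (g * m), QuotientGroup.mk (h * m)))

variable {A} in
/-- The class of `(g, h)`. -/
def PreQuot.mk (x : Pts k R A × Pts k R A) : PreQuot A ell :=
  Quot.mk _ (QuotientGroup.mk x.1, QuotientGroup.mk x.2)

end Dynamic

/-! ## The scheme `X_λ = G/U_λ ×_{M_λ} G/U_λ⁻` -/

section QuotientScheme

variable {k : Type u} [Field k] {R : Type u} [CommRing R] [HopfAlgebra k R]

/-- A faithfully flat étale homomorphism of `k`-algebras: an affine étale covering. -/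
def IsEtaleCover {A B : CommAlgCat.{u} k} (f : A ⟶ B) : Prop :=
  f.hom.toRingHom.Etale ∧ f.hom.toRingHom.FaithfullyFlat

/-- The map `(G × G)(A) → (G × G)(B)` induced by `f : A → B`. -/
def mapPair {A B : CommAlgCat.{u} k} (f : A ⟶ B) (x : Pts k R A × Pts k R A) :
    Pts k R B × Pts k R B :=
  (Pts.map f.hom x.1, Pts.map f.hom x.2)

/-- An `A`-point of `X_λ = G/U_λ ×_{M_λ} G/U_λ⁻`, i.e. of the étale sheaf quotient of
`G/U_λ × G/U_λ⁻` by `M_λ`. Such a point is given by its preimage in `(G × G)_A`: a subfunctor of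
`(G × G)_A` which is local for the étale topology, is étale locally nonempty, and is a full fibre
of `(g, h) ↦ [gU_λ, hU_λ⁻]` over every `A`-algebra over which it has a point. -/
@[ext]
structure QuotPt (ell : Pts k R (LaurentPolynomial k)) (A : CommAlgCat.{u} k) where
  carrier : ∀ (C : CommAlgCat.{u} k), (A ⟶ C) → Set (Pts k R C × Pts k R C)
  map_mem : ∀ {C D : CommAlgCat.{u} k} (f : A ⟶ C) (g : C ⟶ D) (x : Pts k R C × Pts k R C),
    x ∈ carrier C f → mapPair g x ∈ carrier D (f ≫ g)
  descent : ∀ {C D : CommAlgCat.{u} k} (f : A ⟶ C) (g : C ⟶ D) (x : Pts k R C × Pts k R C),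
    IsEtaleCover g → mapPair g x ∈ carrier D (f ≫ g) → x ∈ carrier C f
  fibre : ∀ {C : CommAlgCat.{u} k} (f : A ⟶ C) (x y : Pts k R C × Pts k R C),
    x ∈ carrier C f → (y ∈ carrier C f ↔ PreQuot.mk ell x = PreQuot.mk ell y)
  locally_nonempty : ∃ (C : CommAlgCat.{u} k) (f : A ⟶ C), IsEtaleCover f ∧ (carrier C f).Nonempty

/-- Functoriality of `X_λ(A)` in `A`. -/
def QuotPt.map {ell : Pts k R (LaurentPolynomial k)} {A B : CommAlgCat.{u} k} (f : A ⟶ B)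
    (x : QuotPt ell A) : QuotPt ell B where
  carrier C g := x.carrier C (f ≫ g)
  map_mem g h y hy := by
    simpa using x.map_mem (f ≫ g) h y hy
  descent g h y hh hy := x.descent (f ≫ g) h y hh (by simpa using hy)
  fibre g y z hy := x.fibre (f ≫ g) y z hy
  locally_nonempty := by
    obtain ⟨C, g, ⟨hg₁, hg₂⟩, ⟨y, hy⟩⟩ := x.locally_nonempty
    let _ := f.hom.toRingHom.toAlgebra
    let _ := g.hom.toRingHom.toAlgebra
    have hg₁' : (algebraMap A C).Etale := hg₁
    have hg₂' : (algebraMap A C).FaithfullyFlat := hg₂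
    have : IsScalarTower k A C := .of_algebraMap_eq' g.hom.comp_algebraMap.symm
    have : IsScalarTower k A B := .of_algebraMap_eq' f.hom.comp_algebraMap.symm
    let j : B ⟶ CommAlgCat.of k (B ⊗[A] C) := CommAlgCat.ofHom
      ((Algebra.TensorProduct.includeLeft : B →ₐ[A] B ⊗[A] C).restrictScalars k)
    let i : C ⟶ CommAlgCat.of k (B ⊗[A] C) := CommAlgCat.ofHom
      ((Algebra.TensorProduct.includeRight : C →ₐ[A] B ⊗[A] C).restrictScalars k)
    have hij : g ≫ i = f ≫ j := by
      apply CommAlgCat.hom_ext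
      apply AlgHom.ext
      intro a
      exact (Algebra.TensorProduct.includeRight (R := A) (A := B) (B := C)).commutes a
    refine ⟨_, j, ⟨?_, ?_⟩, mapPair i y, ?_⟩
    · exact RingHom.Etale.isStableUnderBaseChange.tensorProduct B hg₁'
    · exact RingHom.FaithfullyFlat.isStableUnderBaseChange.tensorProduct B hg₂'
    · rw [← hij]
      exact x.map_mem g i y hy

/-- The point `x ∈ X_λ(A)` is the class `[gU_λ, hU_λ⁻]` of `g, h ∈ G(A)`. -/
def QuotPt.IsClassOf {ell : Pts k R (LaurentPolynomial k)} {A : CommAlgCat.{u} k}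
    (x : QuotPt ell A) (g h : Pts k R A) : Prop :=
  (g, h) ∈ x.carrier A (𝟙 A)

end QuotientScheme

/-! ## Torsors -/

section Torsors

variable (k : Type u) [Field k] (R : Type u) [CommRing R] [HopfAlgebra k R]

/-- A right `G`-torsor (`G`-bundle) over `Spec B`, given by its coordinate ring `S`: an
`R`-comodule algebra, faithfully flat over `B`, such that
`F × G → F ×_B F`, `(p, g) ↦ (p, p g)` is an isomorphism. -/
structure Torsor (B : Type u) [CommRing B] [Algebra k B] where
  S : Type u
  [commRing : CommRing S]
  [algebraBase : Algebra k S]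
  [algebra : Algebra B S]
  [isScalarTower : IsScalarTower k B S]
  coact : S →ₐ[B] S ⊗[k] R
  coassoc : (Algebra.TensorProduct.assoc k k k S R R).toAlgHom.comp
      ((Algebra.TensorProduct.map (coact.restrictScalars k) (AlgHom.id k R)).comp
        (coact.restrictScalars k)) =
    (Algebra.TensorProduct.map (AlgHom.id k S) (Bialgebra.comulAlgHom k R)).comp
      (coact.restrictScalars k)
  counit : (Algebra.TensorProduct.rid k k S).toAlgHom.comp
      ((Algebra.TensorProduct.map (AlgHom.id k S) (Bialgebra.counitAlgHom k R)).comp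
        (coact.restrictScalars k)) = AlgHom.id k S
  faithfullyFlat : Module.FaithfullyFlat B S
  bijective : Function.Bijective
    (Algebra.TensorProduct.lift (Algebra.TensorProduct.includeLeft : S →ₐ[B] S ⊗[k] R) coact
      (fun _ _ => Commute.all _ _) : S ⊗[B] S →ₐ[B] S ⊗[k] R)

attribute [instance] Torsor.commRing Torsor.algebraBase Torsor.algebra Torsor.isScalarTower

variable {k R}

/-- The right action `F(C) × G(C) → F(C)` for a `B`-algebra `C`. -/
def Torsor.rmul {B : Type u} [CommRing B] [Algebra k B] (F : Torsor k R B) {C : Type u}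
    [CommRing C] [Algebra k C] [Algebra B C] [IsScalarTower k B C]
    (p : F.S →ₐ[B] C) (g : Pts k R C) : F.S →ₐ[B] C :=
  (Algebra.TensorProduct.lift p g.ofConv (fun _ _ => Commute.all _ _)).comp F.coact

/-- The restriction `C ⊗_B S` of a torsor along `B → C`, with its coaction. -/
def Torsor.coactBaseChange {B : Type u} [CommRing B] [Algebra k B] (F : Torsor k R B)
    (C : Type u) [CommRing C] [Algebra k C] [Algebra B C] [IsScalarTower k B C] :
    C ⊗[B] F.S →ₐ[C] (C ⊗[B] F.S) ⊗[k] R :=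
  (Algebra.TensorProduct.assoc k B C C F.S R).symm.toAlgHom.comp
    (Algebra.TensorProduct.map (AlgHom.id C C) F.coact)

/-- A morphism of torsors over a morphism `Spec B' → Spec B` of base schemes: an equivariant
morphism `F' → F` over `Spec B' → Spec B`. (It identifies `F'` with the pull-back of `F`.) -/
@[ext]
structure TorsorHom {B B' : Type u} [CommRing B] [Algebra k B] [CommRing B'] [Algebra k B']
    (b : B →+* B') (F : Torsor k R B) (F' : Torsor k R B') where
  toAlgHom : F.S →ₐ[k] F'.S
  map_base : ∀ x : B, toAlgHom (algebraMap B F.S x) = algebraMap B' F'.S (b x)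
  map_coact : ∀ s : F.S, Algebra.TensorProduct.map toAlgHom (AlgHom.id k R) (F.coact s) =
    F'.coact (toAlgHom s)

/-- The identity morphism. -/
def TorsorHom.id {B : Type u} [CommRing B] [Algebra k B] (F : Torsor k R B) {b : B →+* B}
    (hb : ∀ x, b x = x) : TorsorHom b F F where
  toAlgHom := AlgHom.id k F.S
  map_base x := by simp [hb]
  map_coact s := by simp

/-- Composition of morphisms. -/
def TorsorHom.comp {B B' B'' : Type u} [CommRing B] [Algebra k B] [CommRing B'] [Algebra k B']
    [CommRing B''] [Algebra k B''] {b : B →+* B'} {b' : B' →+* B''} {b'' : B →+* B''}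
    (hb : ∀ x, b'' x = b' (b x)) {F : Torsor k R B} {F' : Torsor k R B'} {F'' : Torsor k R B''}
    (f : TorsorHom b F F') (f' : TorsorHom b' F' F'') : TorsorHom b'' F F'' where
  toAlgHom := f'.toAlgHom.comp f.toAlgHom
  map_base x := by simp [hb, f.map_base, f'.map_base]
  map_coact s := by
    rw [AlgHom.comp_apply, ← f'.map_coact, ← f.map_coact, ← AlgHom.comp_apply,
      ← Algebra.TensorProduct.map_comp]
    simp

/-- The value `s(p) ∈ C ⊗ V` of a function `s : F → V` at a point `p ∈ F(C)`. -/
def Torsor.evalAt {B : Type u} [CommRing B] [Algebra k B] (F : Torsor k R B) (V : FinRep k R)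
    {C : Type u} [CommRing C] [Algebra k C] (p : F.S →ₐ[k] C) :
    F.S ⊗[k] V.V →ₗ[k] C ⊗[k] V.V :=
  p.toLinearMap.rTensor V.V

/-- The sections of the associated bundle `F ×^G V`: functions `s : F → V` with
`s(p g) = g⁻¹ s(p)`. -/
def Torsor.assocSections {B : Type u} [CommRing B] [Algebra k B] (F : Torsor k R B)
    (V : FinRep k R) : Set (F.S ⊗[k] V.V) :=
  {s | ∀ (C : Type u) [CommRing C] [Algebra k C] [Algebra B C] [IsScalarTower k B C]
    (p : F.S →ₐ[B] C) (g : Pts k R C),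
    V.act g (F.evalAt V ((F.rmul p g).restrictScalars k) s) =
      F.evalAt V (p.restrictScalars k) s}

end Torsors

/-! ## Classifying stacks

Stacks are presented by their categories of objects over variable algebras; since we use
algebras and not their spectra, these categories are the opposites of the usual ones. -/

section ClassifyingStack

variable (k : Type u) [Field k] (R : Type u) [CommRing R] [HopfAlgebra k R]

/-- The (opposite of the) category of all torsors under `G` over affine `k`-schemes. -/
structure BG where
  base : CommAlgCat.{u} k
  torsor : Torsor k R base

variable {k R}

/-- Morphisms of torsors over a variable base. -/
@[ext]
structure BG.Hom (X Y : BG k R) where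
  base : X.base ⟶ Y.base
  hom : TorsorHom base.hom.toRingHom X.torsor Y.torsor

instance : Category (BG k R) where
  Hom := BG.Hom
  id X := ⟨𝟙 _, TorsorHom.id _ (fun _ => rfl)⟩
  comp f g := ⟨f.base ≫ g.base, TorsorHom.comp (fun _ => rfl) f.hom g.hom⟩

variable (k R) in
/-- The structure functor of the classifying stack `BG`. -/
def BG.proj : BG k R ⥤ CommAlgCat.{u} k where
  obj X := X.base
  map f := f.base

end ClassifyingStack

/-! ## The Hecke stack -/

section Hecke

variable {k : Type u} [Field k] {R : Type u} [CommRing R] [HopfAlgebra k R]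

/-- The ring `A((t))`. (A copy of `LaurentSeries A`, whose algebra structures over `k` and over
`A[[t]]` are compatible by definition.) -/
def Laur (A : Type u) [CommRing A] : Type u := LaurentSeries A

instance (A : Type u) [CommRing A] : CommRing (Laur A) := inferInstanceAs (CommRing (LaurentSeries A))

instance (A : Type u) [CommRing A] : Algebra (PowerSeries A) (Laur A) :=
  inferInstanceAs (Algebra (PowerSeries A) (LaurentSeries A))

instance (A : Type u) [CommRing A] [Algebra k A] : Algebra k (Laur A) :=
  ((algebraMap (PowerSeries A) (Laur A)).comp (algebraMap k (PowerSeries A))).toAlgebra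

instance (A : Type u) [CommRing A] [Algebra k A] : IsScalarTower k (PowerSeries A) (Laur A) :=
  .of_algebraMap_eq' rfl

/-- The element `t ^ n` of `A((t))`. -/
def Laur.tpow (A : Type u) [CommRing A] (n : ℤ) : Laur A :=
  (HahnSeries.single n (1 : A) : LaurentSeries A)

lemma Laur.tpow_zero (A : Type u) [CommRing A] : Laur.tpow A 0 = 1 := rfl

lemma Laur.tpow_add (A : Type u) [CommRing A] (m n : ℤ) :
    Laur.tpow A (m + n) = Laur.tpow A m * Laur.tpow A n :=
  ((HahnSeries.single_mul_single (R := A) (Γ := ℤ) (a := m) (b := n) (r := 1) (s := 1)).trans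
    (by rw [mul_one]; rfl)).symm

/-- The homomorphism `A((t)) → B((t))` induced by `A → B`. -/
def Laur.map {A B : Type u} [CommRing A] [CommRing B] (f : A →+* B) : Laur A →+* Laur B where
  toFun x := HahnSeries.map (x : LaurentSeries A) f
  map_one' := HahnSeries.map_one f.toMonoidWithZeroHom
  map_mul' _ _ := HahnSeries.map_mul (f : A →ₙ+* B)
  map_zero' := HahnSeries.map_zero (f : ZeroHom A B)
  map_add' _ _ := HahnSeries.map_add (f : A →+ B)

lemma Laur.map_comp_algebraMap {A B : Type u} [CommRing A] [CommRing B] (f : A →+* B) :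
    (Laur.map f).comp (algebraMap (PowerSeries A) (Laur A)) =
      (algebraMap (PowerSeries B) (Laur B)).comp (PowerSeries.map f) := by
  refine RingHom.ext fun x => HahnSeries.ext (funext fun n => ?_)
  change f ((HahnSeries.ofPowerSeries ℤ A x).coeff n) =
    (HahnSeries.ofPowerSeries ℤ B (PowerSeries.map f x)).coeff n
  by_cases hn : 0 ≤ n
  · lift n to ℕ using hn
    simp [HahnSeries.ofPowerSeries_apply_coeff]
  · rw [HahnSeries.ofPowerSeries_apply, HahnSeries.ofPowerSeries_apply,
      HahnSeries.embDomain_of_notMem_range, HahnSeries.embDomain_of_notMem_range, map_zero] <;>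
    · rintro ⟨m, rfl⟩
      exact hn (Int.natCast_nonneg m)

/-- The `k`-algebra map `k[T, T⁻¹] → A((t))`, `T ↦ t`. -/
def laurentToLaur (k : Type u) [Field k] (A : Type u) [CommRing A] [Algebra k A] :
    LaurentPolynomial k →ₐ[k] Laur A :=
  AddMonoidAlgebra.lift k (Laur A) ℤ
    { toFun := fun n => Laur.tpow A n.toAdd
      map_one' := Laur.tpow_zero A
      map_mul' := fun m n => Laur.tpow_add A m.toAdd n.toAdd }

/-- An object over `A` of the stack `H`: a 5-tuple `(F₁, F₂, φ₁, φ₂, κ)`, where the `Fᵢ` are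
`G`-bundles on `Spec A[[t]]`, `φᵢ` is a trivialization of the restriction of `Fᵢ` to `t = 0`,
and `κ` is an isomorphism `F₁ → F₂` over `Spec A((t))`.

The trivialization `φᵢ` of the restriction of `Fᵢ` to `t = 0` is given by the point
`eᵢ = φᵢ⁻¹(1)` of that restriction. On coordinate rings, `κ` goes from `F₂` to `F₁`. -/
structure HeckeTuple (k : Type u) [Field k] (R : Type u) [CommRing R] [HopfAlgebra k R]
    (A : Type u) [CommRing A] [Algebra k A] where
  F₁ : Torsor k R (PowerSeries A)
  F₂ : Torsor k R (PowerSeries A)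
  e₁ : F₁.S →ₐ[k] A
  e₁_base : ∀ x, e₁ (algebraMap (PowerSeries A) F₁.S x) = PowerSeries.constantCoeff x
  e₂ : F₂.S →ₐ[k] A
  e₂_base : ∀ x, e₂ (algebraMap (PowerSeries A) F₂.S x) = PowerSeries.constantCoeff x
  kappa : (Laur A ⊗[PowerSeries A] F₂.S) ≃ₐ[Laur A]
    (Laur A ⊗[PowerSeries A] F₁.S)
  kappa_coact : (Algebra.TensorProduct.map kappa.toAlgHom (AlgHom.id k R)).comp
      (F₂.coactBaseChange (Laur A)) =
    (F₁.coactBaseChange (Laur A)).comp kappa.toAlgHom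

/-- The equivariant map on coordinate rings `k[F₂] → A((t)) ⊗ k[F₁]` given by `κ`. -/
def HeckeTuple.kappaIncl {A : Type u} [CommRing A] [Algebra k A] (X : HeckeTuple k R A) :
    X.F₂.S →ₐ[PowerSeries A] Laur A ⊗[PowerSeries A] X.F₁.S :=
  (X.kappa.toAlgHom.restrictScalars (PowerSeries A)).comp Algebra.TensorProduct.includeRight

/-- The map `κ : F₁(C) → F₂(C)` on points with values in an `A((t))`-algebra `C`. -/
def HeckeTuple.kappaPt {A : Type u} [CommRing A] [Algebra k A] (X : HeckeTuple k R A)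
    {C : Type u} [CommRing C] [Algebra (PowerSeries A) C] [Algebra (Laur A) C]
    [IsScalarTower (PowerSeries A) (Laur A) C] (p : X.F₁.S →ₐ[PowerSeries A] C) :
    X.F₂.S →ₐ[PowerSeries A] C :=
  ((Algebra.TensorProduct.lift (Algebra.ofId (Laur A) C) p
    (fun _ _ => Commute.all _ _)).restrictScalars (PowerSeries A)).comp X.kappaIncl

/-- The `A((t))`-point underlying an `A[[t]]`-point of a torsor over `A[[t]]`. -/
def genericPt {A : Type u} [CommRing A] [Algebra k A] {F : Torsor k R (PowerSeries A)}
    (p : F.S →ₐ[PowerSeries A] PowerSeries A) : F.S →ₐ[PowerSeries A] Laur A :=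
  (Algebra.ofId (PowerSeries A) (Laur A)).comp p

/-- There are trivializations `σᵢ` of `Fᵢ` over `Spec A[[t]]` in which `κ` is `t^λ`. -/
def HeckeTuple.IsStandard (ell : Pts k R (LaurentPolynomial k)) {A : Type u} [CommRing A]
    [Algebra k A] (X : HeckeTuple k R A) : Prop :=
  ∃ (σ₁ : X.F₁.S →ₐ[PowerSeries A] PowerSeries A) (σ₂ : X.F₂.S →ₐ[PowerSeries A] PowerSeries A),
    X.kappaPt (genericPt σ₁) = X.F₂.rmul (genericPt σ₂) (Pts.map (laurentToLaur k A) ell)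

/-- A morphism between objects of `H` over a homomorphism `f : A → B`: a pair of morphisms of
`G`-bundles over `Spec B[[t]] → Spec A[[t]]` compatible with the trivializations and with `κ`. -/
@[ext]
structure HeckeTuple.Hom {A B : Type u} [CommRing A] [Algebra k A] [CommRing B] [Algebra k B]
    (f : A →ₐ[k] B) (X : HeckeTuple k R A) (Y : HeckeTuple k R B) where
  hom₁ : TorsorHom (PowerSeries.map f.toRingHom) X.F₁ Y.F₁
  hom₂ : TorsorHom (PowerSeries.map f.toRingHom) X.F₂ Y.F₂
  map_e₁ : ∀ s, Y.e₁ (hom₁.toAlgHom s) = f (X.e₁ s)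
  map_e₂ : ∀ s, Y.e₂ (hom₂.toAlgHom s) = f (X.e₂ s)
  map_kappa : ∀ s, Algebra.TensorProduct.mapRingHom (PowerSeries.map f.toRingHom)
      (Laur.map f.toRingHom) hom₁.toAlgHom.toRingHom (Laur.map_comp_algebraMap f.toRingHom)
      (RingHom.ext hom₁.map_base) (X.kappaIncl s) = Y.kappaIncl (hom₂.toAlgHom s)

/-- The identity morphism. -/
def HeckeTuple.Hom.id {A : Type u} [CommRing A] [Algebra k A] (X : HeckeTuple k R A)
    {f : A →ₐ[k] A} (hf : ∀ x, f x = x) : HeckeTuple.Hom f X X where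
  hom₁ := TorsorHom.id _ (fun x => PowerSeries.ext fun n => by simp [hf])
  hom₂ := TorsorHom.id _ (fun x => PowerSeries.ext fun n => by simp [hf])
  map_e₁ s := by simp [TorsorHom.id, hf]
  map_e₂ s := by simp [TorsorHom.id, hf]
  map_kappa s := by
    change _ = X.kappaIncl s
    generalize X.kappaIncl s = z
    induction z with
    | zero => simp
    | add x y hx hy => simp only [map_add, hx, hy]
    | tmul x y =>
      rw [Algebra.TensorProduct.mapRingHom_tmul]
      congr 1
      exact HahnSeries.ext (funext fun n => hf _)

/-- Composition of morphisms. -/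
def HeckeTuple.Hom.comp {A B C : Type u} [CommRing A] [Algebra k A] [CommRing B] [Algebra k B]
    [CommRing C] [Algebra k C] {f : A →ₐ[k] B} {g : B →ₐ[k] C} {h : A →ₐ[k] C}
    (hh : ∀ x, h x = g (f x)) {X : HeckeTuple k R A} {Y : HeckeTuple k R B}
    {Z : HeckeTuple k R C} (φ : HeckeTuple.Hom f X Y) (ψ : HeckeTuple.Hom g Y Z) :
    HeckeTuple.Hom h X Z where
  hom₁ := TorsorHom.comp (fun x => PowerSeries.ext fun n => by simp [hh]) φ.hom₁ ψ.hom₁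
  hom₂ := TorsorHom.comp (fun x => PowerSeries.ext fun n => by simp [hh]) φ.hom₂ ψ.hom₂
  map_e₁ s := by simp [TorsorHom.comp, ψ.map_e₁, φ.map_e₁, hh]
  map_e₂ s := by simp [TorsorHom.comp, ψ.map_e₂, φ.map_e₂, hh]
  map_kappa s := by
    change _ = Z.kappaIncl (ψ.hom₂.toAlgHom (φ.hom₂.toAlgHom s))
    rw [← ψ.map_kappa, ← φ.map_kappa]
    generalize X.kappaIncl s = z
    induction z with
    | zero => simp
    | add x y hx hy => simp only [map_add, hx, hy]
    | tmul x y =>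
      simp only [Algebra.TensorProduct.mapRingHom_tmul]
      congr 1
      exact HahnSeries.ext (funext fun n => hh _)

/-- `X` belongs to the stratum `H^λ`, the preimage of the orbit of `t^λ` in the stack
`G(O)\G(K)/G(O)` of triples `(F₁, F₂, κ)`: étale locally on the base, the triple `(F₁, F₂, κ)` is
isomorphic to the pair of trivial bundles with `κ = t^λ`. -/
def HeckeTuple.InStratum (ell : Pts k R (LaurentPolynomial k)) {A : CommAlgCat.{u} k}
    (X : HeckeTuple k R A) : Prop :=
  ∃ (B : CommAlgCat.{u} k) (f : A ⟶ B) (Y : HeckeTuple k R B), IsEtaleCover f ∧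
    Nonempty (HeckeTuple.Hom f.hom X Y) ∧ Y.IsStandard ell

/-- The (opposite of the) category of objects of the stack `H^λ` over affine `k`-schemes. -/
structure HeckeStratum (ell : Pts k R (LaurentPolynomial k)) where
  base : CommAlgCat.{u} k
  tuple : HeckeTuple k R base
  mem : tuple.InStratum ell

/-- Morphisms in `H^λ`. -/
@[ext]
structure HeckeStratum.Hom {ell : Pts k R (LaurentPolynomial k)} (X Y : HeckeStratum ell) where
  base : X.base ⟶ Y.base
  hom : HeckeTuple.Hom base.hom X.tuple Y.tuple

instance (ell : Pts k R (LaurentPolynomial k)) : Category (HeckeStratum ell) where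
  Hom := HeckeStratum.Hom
  id X := ⟨𝟙 _, HeckeTuple.Hom.id _ (fun _ => rfl)⟩
  comp f g := ⟨f.base ≫ g.base, HeckeTuple.Hom.comp (fun _ => rfl) f.hom g.hom⟩

/-- A morphism from the stack `H^λ` to the scheme `X_λ = G/U_λ ×_{M_λ} G/U_λ⁻`: a map from the
objects of `H^λ` over `A` to `X_λ(A)`, compatible with all morphisms of `H^λ`, i.e. with
pull-back and isomorphisms. -/
structure StackMap (ell : Pts k R (LaurentPolynomial k)) where
  obj : ∀ X : HeckeStratum ell, QuotPt ell X.base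
  map : ∀ {X Y : HeckeStratum ell} (f : X ⟶ Y), obj Y = (obj X).map f.base

/-! ### Fibres -/

section Fibres

variable (L : Type u) [Field L] [Algebra k L]

/-- An `L`-algebra regarded as a `k`-algebra. -/
def resAlg (B : CommAlgCat.{u} L) : CommAlgCat.{u} k :=
  letI : Algebra k B := Algebra.compHom B (algebraMap k L)
  CommAlgCat.of k B

variable {L} in
/-- An `L`-algebra homomorphism regarded as a `k`-algebra homomorphism. -/
def resHom {B C : CommAlgCat.{u} L} (f : B ⟶ C) : resAlg (k := k) L B ⟶ resAlg (k := k) L C :=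
  letI : Algebra k B := Algebra.compHom B (algebraMap k L)
  letI : Algebra k C := Algebra.compHom C (algebraMap k L)
  CommAlgCat.ofHom
    { toRingHom := f.hom.toRingHom
      commutes' := fun x => f.hom.commutes (algebraMap k L x) }

/-- The structure map `L → B` of an `L`-algebra, as a homomorphism of `k`-algebras. -/
def structHom (B : CommAlgCat.{u} L) : CommAlgCat.of k L ⟶ resAlg (k := k) L B :=
  letI : Algebra k B := Algebra.compHom B (algebraMap k L)
  CommAlgCat.ofHom
    { toRingHom := algebraMap L B
      commutes' := fun _ => rfl }

variable {L} {ell : Pts k R (LaurentPolynomial k)}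

/-- The (opposite of the) category of objects, over affine `L`-schemes, of the fibre of the
morphism `Φ : H^λ → X_λ` over a point `x ∈ X_λ(L)`. -/
structure Fibre (Φ : StackMap ell) (x : QuotPt ell (CommAlgCat.of k L)) where
  base : CommAlgCat.{u} L
  tuple : HeckeTuple k R (resAlg (k := k) L base)
  mem : tuple.InStratum ell
  obj_eq : Φ.obj ⟨_, tuple, mem⟩ = x.map (structHom L base)

/-- Morphisms in the fibre. -/
@[ext]
structure Fibre.Hom {Φ : StackMap ell} {x : QuotPt ell (CommAlgCat.of k L)}
    (X Y : Fibre Φ x) where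
  base : X.base ⟶ Y.base
  hom : HeckeTuple.Hom (resHom (k := k) base).hom X.tuple Y.tuple

instance (Φ : StackMap ell) (x : QuotPt ell (CommAlgCat.of k L)) : Category (Fibre Φ x) where
  Hom := Fibre.Hom
  id X := ⟨𝟙 _, HeckeTuple.Hom.id _ (fun _ => rfl)⟩
  comp f g := ⟨f.base ≫ g.base, HeckeTuple.Hom.comp (fun _ => rfl) f.hom g.hom⟩

/-- The structure functor of the fibre. -/
def Fibre.proj (Φ : StackMap ell) (x : QuotPt ell (CommAlgCat.of k L)) :
    Fibre Φ x ⥤ CommAlgCat.{u} L where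
  obj X := X.base
  map f := f.base

/-- The fibre over `x` is equivalent, as a stack over `L`, to the classifying stack of the group
with Hopf algebra `K`. -/
def Fibre.IsClassifyingStack (Φ : StackMap ell) (x : QuotPt ell (CommAlgCat.of k L))
    (K : Type u) [CommRing K] [HopfAlgebra L K] : Prop :=
  ∃ F : Fibre Φ x ⥤ BG L K, F.IsEquivalence ∧ Nonempty (F ⋙ BG.proj L K ≅ Fibre.proj Φ x)

end Fibres

/-! ### Jantzen filtrations -/

section Jantzen

/-- For sections `s₁`, `s₂` of the vector bundles `E = F₁ ×^G V` and `E' = F₂ ×^G V` on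
`Spec A[[t]]`: the relation `κ(s₁) = t^i s₂` over `Spec A((t))`. -/
def HeckeTuple.KappaRel {A : Type u} [CommRing A] [Algebra k A] (X : HeckeTuple k R A)
    (V : FinRep k R) (i : ℤ) (s₁ : X.F₁.S ⊗[k] V.V) (s₂ : X.F₂.S ⊗[k] V.V) : Prop :=
  X.F₁.evalAt V ((Algebra.TensorProduct.includeRight :
      X.F₁.S →ₐ[PowerSeries A] Laur A ⊗[PowerSeries A] X.F₁.S).restrictScalars k) s₁ =
    Laur.tpow A i • X.F₂.evalAt V (X.kappaIncl.restrictScalars k) s₂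

/-- The step `E_i` of the Jantzen filtration on the fibre at `0` of `E = F₁ ×^G V`, which is
identified with `A ⊗ V` by `φ₁`: the values `s₁(0)` of the sections `s₁` of `E` such that
`t^{-i} κ(s₁)` is a section of `E' = F₂ ×^G V`. -/
def HeckeTuple.jantzen₁ {A : Type u} [CommRing A] [Algebra k A] (X : HeckeTuple k R A)
    (V : FinRep k R) (i : ℤ) : Set (A ⊗[k] V.V) :=
  {w | ∃ s₁ ∈ X.F₁.assocSections V, ∃ s₂ ∈ X.F₂.assocSections V,
    X.KappaRel V i s₁ s₂ ∧ X.F₁.evalAt V X.e₁ s₁ = w}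

/-- The step `E'_i` of the Jantzen filtration on the fibre at `0` of `E' = F₂ ×^G V`, defined in
the same way with `κ⁻¹` in place of `κ`. -/
def HeckeTuple.jantzen₂ {A : Type u} [CommRing A] [Algebra k A] (X : HeckeTuple k R A)
    (V : FinRep k R) (i : ℤ) : Set (A ⊗[k] V.V) :=
  {w | ∃ s₁ ∈ X.F₁.assocSections V, ∃ s₂ ∈ X.F₂.assocSections V,
    X.KappaRel V (-i) s₁ s₂ ∧ X.F₂.evalAt V X.e₂ s₂ = w}

variable (ell : Pts k R (LaurentPolynomial k))

/-- The vector `λ(T) w` in `A[T, T⁻¹] ⊗ V`, for `w ∈ A ⊗ V`. -/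
def cocharAct (V : FinRep k R) {A : Type u} [CommRing A] [Algebra k A] (w : A ⊗[k] V.V) :
    LaurentPolynomial A ⊗[k] V.V :=
  V.act (Pts.map (laurentBaseChange k A) ell)
    ((IsScalarTower.toAlgHom k A (LaurentPolynomial A)).toLinearMap.rTensor V.V w)

/-- The vectors of weight `i` for `λ` in `A ⊗ V`. -/
def weightEq (V : FinRep k R) (A : Type u) [CommRing A] [Algebra k A] (i : ℤ) :
    Set (A ⊗[k] V.V) :=
  {w | cocharAct ell V w = (LaurentPolynomial.T i : LaurentPolynomial A) •
    (IsScalarTower.toAlgHom k A (LaurentPolynomial A)).toLinearMap.rTensor V.V w}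

/-- The vectors of weights `≥ i` for `λ` in `A ⊗ V`, i.e. those with
`λ(T) w ∈ T^i (A[T] ⊗ V)`. -/
def weightGE (V : FinRep k R) (A : Type u) [CommRing A] [Algebra k A] (i : ℤ) :
    Set (A ⊗[k] V.V) :=
  {w | ∃ w' : Polynomial A ⊗[k] V.V, cocharAct ell V w =
    (LaurentPolynomial.T i : LaurentPolynomial A) •
      (polyToLaurent k A).toLinearMap.rTensor V.V w'}

variable {ell}

/-- The morphism `Φ : H^λ → G/U_λ ×_{M_λ} G/U_λ⁻` is the one given by Jantzen filtrations.
A point `[gU_λ, hU_λ⁻]` consists of the `P_λ`-reduction `gP_λ` and the `P_λ⁻`-reduction `hP_λ⁻`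
of the trivial `G`-torsor together with an isomorphism, `gm ↦ hm`, of their `M_λ`-torsors. If this
is `Φ(X)`, then for every representation `V` of `G`, these reductions give the Jantzen filtrations
`E_•` and `E'_•` on `A ⊗ V`, and the isomorphism gives the isomorphisms
`gr_i(E) → gr_{-i}(E')` induced by `κ`. -/
def StackMap.IsJantzen (Φ : StackMap ell) : Prop :=
  ∀ (X : HeckeStratum ell) (g h : Pts k R X.base), (Φ.obj X).IsClassOf g h →
    ∀ (V : FinRep k R) (i : ℤ),
      X.tuple.jantzen₁ V i = V.act g '' weightGE ell V X.base i ∧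
      X.tuple.jantzen₂ V i = V.act h '' weightGE ell⁻¹ V X.base i ∧
      ∀ v ∈ weightEq ell V X.base i,
        ∃ s₁ ∈ X.tuple.F₁.assocSections V, ∃ s₂ ∈ X.tuple.F₂.assocSections V,
          X.tuple.KappaRel V i s₁ s₂ ∧ X.tuple.F₁.evalAt V X.tuple.e₁ s₁ = V.act g v ∧
          X.tuple.F₂.evalAt V X.tuple.e₂ s₂ - V.act h v ∈ X.tuple.jantzen₂ V (-i + 1)

end Jantzen

end Hecke

end KOneHecke

/-! Everything is read on points with values in variable algebras. A framing of an object (F₁, F₂,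
φ₁, φ₂, κ) over a base change C consists of sections σ₁, σ₂ of the two bundles over C[[t]] with
κ(σ₁) = σ₂ t^λ. Comparing its values at t = 0 with φ₁ and φ₂ gives a pair (g, h) in G(C) × G(C). The
morphism Φ (`jantzenMap`) is defined by declaring the set of all pairs so obtained to be the
preimage of Φ(ξ) in G × G. For this to be a point of X_λ, two facts are needed.

Dependence on the framing. Two framings differ by arcs a, b in G(C[[t]]) with b t^λ = t^λ a. The
functions on G decompose into weight spaces for conjugation by λ, and on a function f of weight n
the equation says f(b) = t^n f(a). At t = 0 this puts a(0) in P_λ and b(0) in P_λ⁻ with the same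
Levi component. Conversely every such pair of values occurs, so the pairs (g, h) fill exactly one
fibre of G × G → X_λ (`HeckeTuple.Framed.iff_preQuot`).

Descent. Framings with given values (g, h) are permuted simply transitively by `arcGroup`, the group
of arcs a with a(0) = 1 such that t^λ a t^(-λ) is again an arc starting at 1. As G is smooth,
homogeneous coordinates x_i at the unit element, of weights d_i, identify this group with the
families of power series divisible by t^(1 + max(0, -d_i)) (`Coords.exists_arc`,
`Coords.mem_arcGroup_iff`). To leading order in t the group law is addition, so its first Čech
cohomology vanishes for every faithfully flat affine covering, one power of t at a time and then in
the limit (`CechData.exists_eq_of_cocycle`). The same coordinates make the group an affine scheme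
with polynomial coordinate ring, graded by the order in t. This grading gives pro-unipotence
(`Coords.isProUnipotent`).

Jantzen filtrations. A framing turns κ into t^λ, which is diagonal with entries t^(deg j) in a basis
of weight vectors, and both filtrations can be read off.

Fibres. Let x be a point of X_λ over a field L, the class of a pair (g, h) over an étale covering.
The first cohomology of twisted forms of U_λ and U_λ⁻ vanishes, so g and h can be chosen such that
their pull-backs differ by one and the same element of M_λ (`QuotPt.exists_levi`). Then h g⁻¹ and
the cocharacter g λ g⁻¹ are defined over L, and so is κ₀ = h t^λ g⁻¹ = (h g⁻¹)(g t^λ g⁻¹)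
(`QuotPt.nonempty_chart`). The trivial bundles with κ₀ form an object over x. Every object over x
has, locally, sections with values (1, 1) which turn κ into κ₀. They descend, because the relevant
group of arcs is the one attached to the cocharacter g λ g⁻¹ over L (`QuotPt.Chart.framed`). So all
objects over x on a given base are isomorphic and their morphisms are points of a pro-unipotent
group K. As K-torsors over affine bases are trivial, the fibre is BK. The statements on k-points are
the case L = k. -/

namespace KOneHecke

section

/-! ### Points of G and of torsors with values in arbitrary algebras. -/

section PointCalculus

variable {k : Type u} [Field k] {R : Type u} [CommRing R] [HopfAlgebra k R]
variable {A B C D : Type u} [CommRing A] [Algebra k A] [CommRing B] [Algebra k B]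
  [CommRing C] [Algebra k C] [CommRing D] [Algebra k D]

theorem Pts.ext {g h : Pts k R A} (H : ∀ x, g.ofConv x = h.ofConv x) : g = h :=
  WithConv.ext (AlgHom.ext H)

@[simp]
theorem Pts.map_apply (f : A →ₐ[k] B) (g : Pts k R A) (x : R) :
    (Pts.map f g).ofConv x = f (g.ofConv x) := rfl

theorem Pts.mul_apply (g h : Pts k R A) (x : R) :
    (g * h).ofConv x = Algebra.TensorProduct.lift g.ofConv h.ofConv (fun _ _ => Commute.all _ _)
      (Coalgebra.comul (R := k) x) :=
  AlgHom.convMul_apply g h x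

theorem Pts.one_apply (x : R) :
    (1 : Pts k R A).ofConv x = algebraMap k A (Coalgebra.counit (R := k) x) := rfl

theorem Pts.inv_apply (g : Pts k R A) (x : R) :
    (g⁻¹).ofConv x = g.ofConv (HopfAlgebra.antipode k x) := rfl

theorem Pts.map_map (f : A →ₐ[k] B) (f' : B →ₐ[k] C) (g : Pts k R A) :
    Pts.map f' (Pts.map f g) = Pts.map (f'.comp f) g := rfl

@[simp]
theorem Pts.map_id (g : Pts k R A) : Pts.map (AlgHom.id k A) g = g := rfl

theorem Pts.map_injective {f : A →ₐ[k] B} (hf : Function.Injective f) :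
    Function.Injective (Pts.map (R := R) f) := fun _ _ H =>
  Pts.ext fun x => hf (congrArg (fun z : Pts k R B => z.ofConv x) H)

theorem exists_algHom_comp_eq {S : Type*} [CommRing S] [Algebra k S] {j : A →ₐ[k] B}
    (hj : Function.Injective j) (g : S →ₐ[k] B) (hg : ∀ x, ∃ y, j y = g x) :
    ∃ g' : S →ₐ[k] A, j.comp g' = g := by
  let e := AlgEquiv.ofInjective j hj
  refine ⟨e.symm.toAlgHom.comp (g.codRestrict j.range fun x => ?_), ?_⟩
  · obtain ⟨y, hy⟩ := hg x
    exact ⟨y, hy⟩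
  · ext x
    exact congrArg Subtype.val (e.apply_symm_apply (g.codRestrict j.range _ x))

theorem Pts.exists_map_eq {j : A →ₐ[k] B} (hj : Function.Injective j) (g : Pts k R B)
    (hg : ∀ x, ∃ y, j y = g.ofConv x) : ∃ g' : Pts k R A, Pts.map j g' = g := by
  obtain ⟨g', h⟩ := exists_algHom_comp_eq hj g.ofConv hg
  exact ⟨.toConv g', WithConv.ext h⟩

variable (k R) in
/-- The universal point of an affine group scheme. -/
def Pts.univ : Pts k R R := .toConv (AlgHom.id k R)

@[simp]
theorem Pts.map_univ (g : Pts k R A) : Pts.map g.ofConv (Pts.univ k R) = g := rfl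

theorem Pts.map_toConv_univ (g : R →ₐ[k] A) : Pts.map g (Pts.univ k R) = .toConv g := rfl

/-- The right action of `G(D)` on the `D`-points of a torsor. -/
def Torsor.pmul (F : Torsor k R B) (p : F.S →ₐ[k] D) (g : Pts k R D) : F.S →ₐ[k] D :=
  (Algebra.TensorProduct.lift p g.ofConv (fun _ _ => Commute.all _ _)).comp
    (F.coact.restrictScalars k)

theorem Torsor.pmul_apply (F : Torsor k R B) (p : F.S →ₐ[k] D) (g : Pts k R D) (s : F.S) :
    F.pmul p g s =
      Algebra.TensorProduct.lift p g.ofConv (fun _ _ => Commute.all _ _) (F.coact s) := rfl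

theorem Torsor.comp_pmul (F : Torsor k R B) (f : C →ₐ[k] D) (p : F.S →ₐ[k] C) (g : Pts k R C) :
    f.comp (F.pmul p g) = F.pmul (f.comp p) (Pts.map f g) := by
  rw [Torsor.pmul, Torsor.pmul, ← AlgHom.comp_assoc]
  congr 1
  ext <;> simp

theorem Torsor.pmul_algebraMap (F : Torsor k R B) (p : F.S →ₐ[k] D) (g : Pts k R D) (b : B) :
    F.pmul p g (algebraMap B F.S b) = p (algebraMap B F.S b) := by
  rw [Torsor.pmul_apply, AlgHom.commutes, Algebra.TensorProduct.algebraMap_apply]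
  simp

theorem Torsor.pmul_pmul (F : Torsor k R B) (p : F.S →ₐ[k] D) (g h : Pts k R D) :
    F.pmul (F.pmul p g) h = F.pmul p (g * h) := by
  have H := congrArg (fun f : F.S →ₐ[k] F.S ⊗[k] (R ⊗[k] R) =>
    (Algebra.TensorProduct.lift p (Algebra.TensorProduct.lift g.ofConv h.ofConv
      (fun _ _ => Commute.all _ _)) (fun _ _ => Commute.all _ _)).comp f) F.coassoc
  simp only [← AlgHom.comp_assoc] at H
  have e1 : F.pmul (F.pmul p g) h = (((Algebra.TensorProduct.lift p
      (Algebra.TensorProduct.lift g.ofConv h.ofConv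
      (fun _ _ => Commute.all _ _)) (fun _ _ => Commute.all _ _)).comp
      (Algebra.TensorProduct.assoc k k k F.S R R).toAlgHom).comp
      (Algebra.TensorProduct.map (F.coact.restrictScalars k) (AlgHom.id k R))).comp
        (F.coact.restrictScalars k) := by
    rw [Torsor.pmul]
    congr 1
    apply Algebra.TensorProduct.ext
    · ext s
      simp only [AlgHom.comp_apply, Algebra.TensorProduct.includeLeft_apply,
        Algebra.TensorProduct.lift_tmul, Algebra.TensorProduct.map_tmul, map_one, mul_one]
      rw [Torsor.pmul_apply]
      rw [AlgHom.restrictScalars_apply]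
      generalize F.coact s = z
      induction z with
      | zero => simp
      | add x y hx hy => rw [map_add, add_tmul, map_add, map_add, hx, hy]
      | tmul x y => simp
    · ext x
      simp [Algebra.TensorProduct.one_def]
  have e2 : F.pmul p (g * h) = ((Algebra.TensorProduct.lift p
      (Algebra.TensorProduct.lift g.ofConv h.ofConv
      (fun _ _ => Commute.all _ _)) (fun _ _ => Commute.all _ _)).comp
      (Algebra.TensorProduct.map (AlgHom.id k F.S) (Bialgebra.comulAlgHom k R))).comp
        (F.coact.restrictScalars k) := by
    rw [Torsor.pmul]
    congr 1
    apply Algebra.TensorProduct.ext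
    · ext s
      simp
    · ext x
      simp [Pts.mul_apply]
  rw [e1, e2]
  exact H

theorem Torsor.pmul_one (F : Torsor k R B) (p : F.S →ₐ[k] D) : F.pmul p 1 = p := by
  have e1 : F.pmul p 1 = ((p.comp (Algebra.TensorProduct.rid k k F.S).toAlgHom).comp
      (Algebra.TensorProduct.map (AlgHom.id k F.S) (Bialgebra.counitAlgHom k R))).comp
        (F.coact.restrictScalars k) := by
    rw [Torsor.pmul]
    congr 1
    apply Algebra.TensorProduct.ext
    · ext s
      simp
    · ext x
      simp [Algebra.algebraMap_eq_smul_one]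
  rw [e1, AlgHom.comp_assoc, AlgHom.comp_assoc, F.counit]
  rfl

/-- As p and q induce the same homomorphism B → D, they define a D-point of F ×_B F. The torsor
isomorphism turns it into a D-point of F × G, whose second component is g. -/
theorem Torsor.exists_pmul_eq (F : Torsor k R B) (p q : F.S →ₐ[k] D)
    (h : ∀ b : B, p (algebraMap B F.S b) = q (algebraMap B F.S b)) :
    ∃ g : Pts k R D, q = F.pmul p g := by
  let _ : Algebra B D := ((p : F.S →+* D).comp (algebraMap B F.S)).toAlgebra
  let p' : F.S →ₐ[B] D := { p with commutes' := fun b => rfl }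
  let q' : F.S →ₐ[B] D := { q with commutes' := fun b => (h b).symm }
  let e := AlgEquiv.ofBijective _ F.bijective
  let r : F.S ⊗[B] F.S →ₐ[B] D := Algebra.TensorProduct.lift p' q' (fun _ _ => Commute.all _ _)
  let v : F.S ⊗[k] R →+* D := (r.comp e.symm.toAlgHom : F.S ⊗[k] R →ₐ[B] D)
  have hv : ∀ x : F.S ⊗[B] F.S, v (e x) = r x := fun x => by simp [v]
  have hp : ∀ s : F.S, v (s ⊗ₜ 1) = p s := fun s => by
    have : e (s ⊗ₜ[B] 1) = s ⊗ₜ[k] (1 : R) := by simp [e]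
    rw [← this, hv]
    simp only [r, Algebra.TensorProduct.lift_tmul, map_one, mul_one]
    rfl
  have hq : ∀ s : F.S, v (F.coact s) = q s := fun s => by
    have : e (1 ⊗ₜ[B] s) = F.coact s := by
      simp [e, ← Algebra.TensorProduct.one_def]
    rw [← this, hv]
    simp only [r, Algebra.TensorProduct.lift_tmul, map_one, one_mul]
    rfl
  let v' : F.S ⊗[k] R →ₐ[k] D := { v with
    commutes' := fun c => by
      have := hp (algebraMap k F.S c)
      rw [p.commutes] at this
      exact this }
  refine ⟨.toConv (v'.comp Algebra.TensorProduct.includeRight), AlgHom.ext fun s => ?_⟩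
  rw [Torsor.pmul_apply, ← hq]
  change v' (F.coact s) = _
  congr 1
  apply Algebra.TensorProduct.ext
  · ext s
    simpa using! hp s
  · ext x
    simp

/-- By the torsor isomorphism 1 ⊗ x is the image of some z in S ⊗_B S, and the value of z depends
only on p and on the translated point. -/
theorem Torsor.pmul_left_injective (F : Torsor k R B) (p : F.S →ₐ[k] D) :
    Function.Injective (F.pmul p) := by
  intro g h H
  have key : ∀ z : F.S ⊗[B] F.S,
      Algebra.TensorProduct.lift p g.ofConv (fun _ _ => Commute.all _ _)
        ((Algebra.TensorProduct.lift (Algebra.TensorProduct.includeLeft : F.S →ₐ[B] F.S ⊗[k] R)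
          F.coact (fun _ _ => Commute.all _ _)) z) =
      Algebra.TensorProduct.lift p h.ofConv (fun _ _ => Commute.all _ _)
        ((Algebra.TensorProduct.lift (Algebra.TensorProduct.includeLeft : F.S →ₐ[B] F.S ⊗[k] R)
          F.coact (fun _ _ => Commute.all _ _)) z) := by
    intro z
    induction z with
    | zero => simp
    | add x y hx hy => simp only [map_add, hx, hy]
    | tmul x y =>
      have := congrArg (fun f : F.S →ₐ[k] D => f y) H
      simp only [Torsor.pmul_apply] at this
      simp [this]
  refine Pts.ext fun x => ?_
  obtain ⟨z, hz⟩ := F.bijective.2 ((1 : F.S) ⊗ₜ[k] x)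
  have := key z
  rw [hz] at this
  simpa using this

theorem TorsorHom.pmul_comp {b : B →+* C} {F : Torsor k R B} {F' : Torsor k R C}
    (φ : TorsorHom b F F') (p : F'.S →ₐ[k] D) (g : Pts k R D) :
    F.pmul (p.comp φ.toAlgHom) g = (F'.pmul p g).comp φ.toAlgHom := by
  ext s
  rw [AlgHom.comp_apply, Torsor.pmul_apply, Torsor.pmul_apply, ← φ.map_coact]
  generalize F.coact s = z
  induction z with
  | zero => simp
  | add x y hx hy => simp only [map_add, hx, hy]
  | tmul x y => simp

end PointCalculus

end

section

/-! ### The trivial torsor. -/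

section TrivialTorsor

variable (k : Type u) [Field k] (R : Type u) [CommRing R] [HopfAlgebra k R]
variable (B : Type u) [CommRing B] [Algebra k B]

/-- The coaction on the trivial torsor. -/
def trivCoact : B ⊗[k] R →ₐ[B] (B ⊗[k] R) ⊗[k] R :=
  (Algebra.TensorProduct.assoc k k B B R R).symm.toAlgHom.comp
    (Algebra.TensorProduct.map (AlgHom.id B B) (Bialgebra.comulAlgHom k R))

variable {k R B} in
-- A point of the trivial torsor is a pair (β, g), and the coaction is right translation of g by h.
-- The torsor axioms are derived from this description.
theorem lift_trivCoact {D : Type u} [CommRing D] [Algebra k D] (β : B →ₐ[k] D)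
    (g h : Pts k R D) :
    (Algebra.TensorProduct.lift (Algebra.TensorProduct.lift β g.ofConv (fun _ _ => Commute.all _ _))
      h.ofConv (fun _ _ => Commute.all _ _)).comp ((trivCoact k R B).restrictScalars k) =
    Algebra.TensorProduct.lift β (g * h).ofConv (fun _ _ => Commute.all _ _) := by
  apply Algebra.TensorProduct.ext
  · ext b
    simp [trivCoact, Algebra.TensorProduct.one_def]
  · ext x
    simp only [AlgHom.comp_apply, AlgHom.restrictScalars_apply,
      Algebra.TensorProduct.includeRight_apply, trivCoact, Algebra.TensorProduct.map_tmul,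
      Algebra.TensorProduct.lift_tmul, map_one, one_mul, Pts.mul_apply,
      Bialgebra.comulAlgHom_apply]
    generalize Coalgebra.comul (R := k) x = z
    induction z with
    | zero => simp
    | add x y hx hy => simp only [map_add, hx, hy, tmul_add]
    | tmul x y => simp

theorem trivCoact_includeLeft (b : B) : trivCoact k R B (b ⊗ₜ 1) = (b ⊗ₜ 1) ⊗ₜ 1 := by
  simp [trivCoact, Algebra.TensorProduct.one_def]

/-- The universal case of `lift_trivCoact`: it expresses the coaction on R as a product in a group
of points, so identities between coactions become identities in a group. -/
theorem trivCoact_right :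
    (WithConv.toConv (((trivCoact k R B).restrictScalars k).comp
      Algebra.TensorProduct.includeRight) : Pts k R ((B ⊗[k] R) ⊗[k] R)) =
    WithConv.toConv ((Algebra.TensorProduct.includeLeft : B ⊗[k] R →ₐ[k] (B ⊗[k] R) ⊗[k] R).comp
      Algebra.TensorProduct.includeRight) * WithConv.toConv Algebra.TensorProduct.includeRight := by
  have := lift_trivCoact (k := k) (R := R) (B := B)
    ((Algebra.TensorProduct.includeLeft : B ⊗[k] R →ₐ[k] (B ⊗[k] R) ⊗[k] R).comp
      Algebra.TensorProduct.includeLeft)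
    (WithConv.toConv ((Algebra.TensorProduct.includeLeft : B ⊗[k] R →ₐ[k] (B ⊗[k] R) ⊗[k] R).comp
      Algebra.TensorProduct.includeRight)) (WithConv.toConv Algebra.TensorProduct.includeRight)
  apply_fun (fun f => (WithConv.toConv (f.comp Algebra.TensorProduct.includeRight) :
    Pts k R ((B ⊗[k] R) ⊗[k] R))) at this
  refine Eq.trans ?_ (this.trans ?_)
  · congr 1
    rw [← AlgHom.id_comp ((trivCoact k R B).restrictScalars k)]
    congr 2
    apply Algebra.TensorProduct.ext
    · apply Algebra.TensorProduct.ext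
      · ext b
        simp
      · ext x
        simp
    · ext x
      simp [Algebra.TensorProduct.one_def]
  · exact Pts.ext fun x => by simp

/-- On points the inverse sends a pair of group elements (u₁, u₂) over the same base point to (u₁,
u₁⁻¹u₂). The map n is this formula at the universal pair. -/
theorem trivCoact_bijective : Function.Bijective
    (Algebra.TensorProduct.lift
      (Algebra.TensorProduct.includeLeft : B ⊗[k] R →ₐ[B] (B ⊗[k] R) ⊗[k] R) (trivCoact k R B)
      (fun _ _ => Commute.all _ _) : (B ⊗[k] R) ⊗[B] (B ⊗[k] R) →ₐ[B] (B ⊗[k] R) ⊗[k] R) := by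
  set S := B ⊗[k] R
  set m : S ⊗[B] S →ₐ[B] S ⊗[k] R := Algebra.TensorProduct.lift
      (Algebra.TensorProduct.includeLeft : S →ₐ[B] S ⊗[k] R) (trivCoact k R B)
      (fun _ _ => Commute.all _ _) with hm
  let i₁ : S →ₐ[B] S ⊗[B] S := Algebra.TensorProduct.includeLeft
  let i₂ : S →ₐ[B] S ⊗[B] S := Algebra.TensorProduct.includeRight
  let r : R →ₐ[k] S := Algebra.TensorProduct.includeRight
  let u₁ : Pts k R (S ⊗[B] S) := .toConv ((i₁.restrictScalars k).comp r)
  let u₂ : Pts k R (S ⊗[B] S) := .toConv ((i₂.restrictScalars k).comp r)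
  let c : Pts k R (S ⊗[k] R) := .toConv Algebra.TensorProduct.includeRight
  let n : S ⊗[k] R →ₐ[k] S ⊗[B] S :=
    Algebra.TensorProduct.lift (i₁.restrictScalars k) (u₁⁻¹ * u₂).ofConv
      (fun _ _ => Commute.all _ _)
  have hm1 : ∀ s : S, m (s ⊗ₜ 1) = s ⊗ₜ 1 := fun s => by simp [hm]
  have hm2 : Pts.map (m.restrictScalars k) u₂ = Pts.map (m.restrictScalars k) u₁ * c := by
    refine Eq.trans ?_ ((trivCoact_right k R B).trans ?_)
    · refine Pts.ext fun x => ?_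
      change m (1 ⊗ₜ[B] (1 ⊗ₜ[k] x : S)) = _
      rw [hm, Algebra.TensorProduct.lift_tmul, map_one, one_mul]
      rfl
    · congr 1
      exact Pts.ext fun x => (hm1 _).symm
  have hn2 : Pts.map n c = u₁⁻¹ * u₂ := Pts.ext fun x => by simp [n, c]
  have h1 : ∀ z, m (n z) = z := by
    have : (m.restrictScalars k).comp n = AlgHom.id k _ := by
      apply Algebra.TensorProduct.ext
      · apply AlgHom.ext
        intro s
        simp [n, i₁, hm]
      · have : Pts.map ((m.restrictScalars k).comp n) c = c := by
          rw [← Pts.map_map, hn2, map_mul, map_inv, hm2, inv_mul_cancel_left]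
        exact congrArg WithConv.ofConv this
    exact fun z => congrArg (fun f : S ⊗[k] R →ₐ[k] S ⊗[k] R => f z) this
  have h2 : ∀ z, n (m z) = z := by
    have hA : ∀ s : S, n (m (s ⊗ₜ 1)) = s ⊗ₜ 1 := fun s => by
      rw [hm1]
      simp [n, i₁]
    have hB : ∀ x : R, n (m (1 ⊗ₜ[B] (1 ⊗ₜ[k] x : S))) = 1 ⊗ₜ[B] (1 ⊗ₜ[k] x : S) := by
      have : Pts.map n (Pts.map (m.restrictScalars k) u₂) = u₂ := by
        rw [hm2, map_mul, hn2]
        have : Pts.map n (Pts.map (m.restrictScalars k) u₁) = u₁ := Pts.ext fun x => hA _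
        rw [this, mul_inv_cancel_left]
      exact fun x => congrArg (fun f : Pts k R (S ⊗[B] S) => f.ofConv x) this
    intro z
    induction z with
    | zero => simp
    | add x y hx hy => simp only [map_add, hx, hy]
    | tmul s t =>
      induction t using TensorProduct.induction_on with
      | zero => simp
      | add x y hx hy => simp only [map_add, hx, hy, tmul_add]
      | tmul b x =>
        have e : s ⊗ₜ[B] (b ⊗ₜ[k] x : S) = ((b • s) ⊗ₜ[B] 1) * (1 ⊗ₜ[B] (1 ⊗ₜ[k] x : S)) := by
          rw [Algebra.TensorProduct.tmul_mul_tmul, one_mul, mul_one, smul_tmul,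
            smul_tmul', smul_eq_mul, mul_one]
        rw [e, map_mul, map_mul, hA, hB]
  exact ⟨Function.LeftInverse.injective h2, Function.RightInverse.surjective h1⟩

/-- The trivial torsor. -/
abbrev trivTorsor : Torsor k R B where
  S := B ⊗[k] R
  coact := trivCoact k R B
  coassoc := by
    apply Algebra.TensorProduct.ext
    · ext b
      simp [trivCoact_includeLeft, Algebra.TensorProduct.one_def]
    · have h := trivCoact_right k R B
      -- This evaluates the coaction along an arbitrary homomorphism f. The two sides of
      -- coassociativity then become (P P₁) P₂ and P (P₁ P₂).
      have key : ∀ {D : Type u} [CommRing D] [Algebra k D] (f : (B ⊗[k] R) ⊗[k] R →ₐ[k] D),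
          Pts.map f (WithConv.toConv (((trivCoact k R B).restrictScalars k).comp
            Algebra.TensorProduct.includeRight) : Pts k R ((B ⊗[k] R) ⊗[k] R)) =
          WithConv.toConv (f.comp ((Algebra.TensorProduct.includeLeft :
            B ⊗[k] R →ₐ[k] (B ⊗[k] R) ⊗[k] R).comp Algebra.TensorProduct.includeRight)) *
          WithConv.toConv (f.comp Algebra.TensorProduct.includeRight) := by
        intro D _ _ f
        rw [h, map_mul]
        rfl
      refine AlgHom.ext fun x => congrArg (fun f : Pts k R ((B ⊗[k] R) ⊗[k] (R ⊗[k] R)) =>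
        f.ofConv x) ((key ((Algebra.TensorProduct.assoc k k k (B ⊗[k] R) R R).toAlgHom.comp
          (Algebra.TensorProduct.map ((trivCoact k R B).restrictScalars k)
            (AlgHom.id k R)))).trans (Eq.trans ?_
          (key (Algebra.TensorProduct.map (AlgHom.id k (B ⊗[k] R))
            (Bialgebra.comulAlgHom k R))).symm))
      clear x
      set i : R →ₐ[k] (B ⊗[k] R) ⊗[k] (R ⊗[k] R) :=
        (Algebra.TensorProduct.includeLeft : B ⊗[k] R →ₐ[k] _).comp
          Algebra.TensorProduct.includeRight
      set i₁ : R →ₐ[k] (B ⊗[k] R) ⊗[k] (R ⊗[k] R) :=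
        Algebra.TensorProduct.includeRight.comp Algebra.TensorProduct.includeLeft
      set i₂ : R →ₐ[k] (B ⊗[k] R) ⊗[k] (R ⊗[k] R) :=
        Algebra.TensorProduct.includeRight.comp Algebra.TensorProduct.includeRight
      let P : Pts k R ((B ⊗[k] R) ⊗[k] (R ⊗[k] R)) := .toConv i
      let P₁ : Pts k R ((B ⊗[k] R) ⊗[k] (R ⊗[k] R)) := .toConv i₁
      let P₂ : Pts k R ((B ⊗[k] R) ⊗[k] (R ⊗[k] R)) := .toConv i₂
      refine Eq.trans (b := P * P₁ * P₂) ?_ ((mul_assoc P P₁ P₂).trans ?_)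
      · have := key ((Algebra.TensorProduct.assoc k k k (B ⊗[k] R) R R).toAlgHom.comp
          (Algebra.TensorProduct.includeLeft (R := k) (S := k) (B := R)))
        refine congrArg₂ (fun a b : Pts k R ((B ⊗[k] R) ⊗[k] (R ⊗[k] R)) => a * b) ?_ ?_
        · refine Eq.trans (Pts.ext fun x => ?_) (this.trans ?_)
          · simp
          · refine congrArg₂ (fun a b : Pts k R ((B ⊗[k] R) ⊗[k] (R ⊗[k] R)) => a * b) ?_ ?_
            · exact Pts.ext fun x => by simp [P, i, Algebra.TensorProduct.one_def]
            · exact Pts.ext fun x => by simp [P₁, i₁]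
        · exact Pts.ext fun x => by
            simp [P₂, i₂, Algebra.TensorProduct.one_def, trivCoact_includeLeft]
      · refine congrArg₂ (fun a b : Pts k R ((B ⊗[k] R) ⊗[k] (R ⊗[k] R)) => a * b) ?_ ?_
        · exact Pts.ext fun x => by simp [P, i]
        · refine Pts.ext fun x => ?_
          rw [Pts.mul_apply]
          simp only [AlgHom.comp_apply, Algebra.TensorProduct.includeRight_apply,
            Algebra.TensorProduct.map_tmul, map_one, Bialgebra.comulAlgHom_apply]
          generalize Coalgebra.comul (R := k) x = z
          induction z with
          | zero => simp
          | add x y hx hy => simp only [map_add, hx, hy, tmul_add]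
          | tmul x y => simp [P₁, P₂, i₁, i₂]
  counit := by
    apply Algebra.TensorProduct.ext
    · ext b
      simp [trivCoact_includeLeft]
    · have h := congrArg (Pts.map ((Algebra.TensorProduct.rid k k (B ⊗[k] R)).toAlgHom.comp
        (Algebra.TensorProduct.map (AlgHom.id k (B ⊗[k] R)) (Bialgebra.counitAlgHom k R))))
        (trivCoact_right k R B)
      refine AlgHom.ext fun x => congrArg (fun f : Pts k R (B ⊗[k] R) => f.ofConv x) (h.trans ?_)
      clear x
      rw [map_mul]
      trans (WithConv.toConv Algebra.TensorProduct.includeRight : Pts k R (B ⊗[k] R)) * 1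
      · congr 1
        · exact Pts.ext fun x => by simp
        · exact Pts.ext fun x => by simp [Algebra.algebraMap_eq_smul_one]
      · rw [mul_one]
        rfl
  faithfullyFlat := by
    have : Nontrivial R := Bialgebra.nontrivial k
    infer_instance
  bijective := trivCoact_bijective k R B

end TrivialTorsor

end

section

/-! ### Morphisms to the trivial torsor. -/

section TorsorMaps

variable {k : Type u} [Field k] {R : Type u} [CommRing R] [HopfAlgebra k R]
variable {A B C D E : Type u} [CommRing A] [Algebra k A] [CommRing B] [Algebra k B]
  [CommRing C] [Algebra k C] [CommRing D] [Algebra k D] [CommRing E] [Algebra k E]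

/-- The point of the trivial torsor given by a point of the base and an element of the group. -/
def trivPt (β : B →ₐ[k] D) (g : Pts k R D) : B ⊗[k] R →ₐ[k] D :=
  Algebra.TensorProduct.lift β g.ofConv (fun _ _ => Commute.all _ _)

@[simp]
theorem trivPt_tmul (β : B →ₐ[k] D) (g : Pts k R D) (b : B) (x : R) :
    trivPt β g (b ⊗ₜ x) = β b * g.ofConv x := by
  simp [trivPt]

theorem trivPt_algebraMap (β : B →ₐ[k] D) (g : Pts k R D) (b : B) :
    trivPt β g (algebraMap B (B ⊗[k] R) b) = β b := by
  change trivPt β g (b ⊗ₜ 1) = _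
  simp

/-- The group component of a point of the trivial torsor. -/
def trivCoord (p : B ⊗[k] R →ₐ[k] D) : Pts k R D :=
  .toConv (p.comp Algebra.TensorProduct.includeRight)

@[simp]
theorem trivCoord_trivPt (β : B →ₐ[k] D) (g : Pts k R D) : trivCoord (trivPt β g) = g :=
  Pts.ext fun x => by simp [trivCoord]

theorem trivPt_trivCoord (β : B →ₐ[k] D) (p : B ⊗[k] R →ₐ[k] D)
    (h : ∀ b, p (algebraMap B (B ⊗[k] R) b) = β b) : trivPt β (trivCoord p) = p := by
  apply Algebra.TensorProduct.ext
  · ext b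
    simpa using (h b).symm
  · ext x
    simp [trivCoord]

theorem map_trivCoord (f : D →ₐ[k] E) (p : B ⊗[k] R →ₐ[k] D) :
    Pts.map f (trivCoord p) = trivCoord (f.comp p) := rfl

theorem comp_trivPt (f : D →ₐ[k] E) (β : B →ₐ[k] D) (g : Pts k R D) :
    f.comp (trivPt β g) = trivPt (f.comp β) (Pts.map f g) := by
  apply Algebra.TensorProduct.ext
  · ext b
    simp
  · ext x
    simp

theorem pmul_trivPt (β : B →ₐ[k] D) (g h : Pts k R D) :
    (trivTorsor k R B).pmul (trivPt β g) h = trivPt β (g * h) :=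
  lift_trivCoact β g h

/-- Equivariance need only be tested on the universal pair, consisting of the universal point of F'
and the universal element of G. -/
theorem torsorHom_coact_iff (F : Torsor k R B) (F' : Torsor k R C) (φ : F.S →ₐ[k] F'.S) :
    (∀ s, Algebra.TensorProduct.map φ (AlgHom.id k R) (F.coact s) = F'.coact (φ s)) ↔
    F.pmul ((Algebra.TensorProduct.includeLeft : F'.S →ₐ[k] F'.S ⊗[k] R).comp φ)
      (.toConv Algebra.TensorProduct.includeRight) = (F'.coact.restrictScalars k).comp φ := by
  have : F.pmul ((Algebra.TensorProduct.includeLeft : F'.S →ₐ[k] F'.S ⊗[k] R).comp φ)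
      (.toConv Algebra.TensorProduct.includeRight) =
      (Algebra.TensorProduct.map φ (AlgHom.id k R)).comp (F.coact.restrictScalars k) := by
    rw [Torsor.pmul]
    congr 1
    apply Algebra.TensorProduct.ext <;> (ext; simp)
  rw [this, AlgHom.ext_iff]
  rfl

/-- The equivariant map from a torsor to the trivial one given by a section. -/
def TorsorHom.ofPt (F : Torsor k R B) (b : B →ₐ[k] C) (σ : F.S →ₐ[k] C)
    (h : ∀ x, σ (algebraMap B F.S x) = b x) {b' : B →+* C} (hb : ∀ x, b' x = b x) :
    TorsorHom b' F (trivTorsor k R C) where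
  toAlgHom := F.pmul ((Algebra.TensorProduct.includeLeft : C →ₐ[k] C ⊗[k] R).comp σ)
    (.toConv Algebra.TensorProduct.includeRight)
  map_base x := by
    rw [Torsor.pmul_algebraMap, AlgHom.comp_apply, h, hb]
    rfl
  map_coact := by
    rw [torsorHom_coact_iff]
    rw [Torsor.comp_pmul, Torsor.comp_pmul, Torsor.pmul_pmul]
    congr 1
    · ext s
      simp [trivCoact_includeLeft]
    · exact (trivCoact_right k R C).symm

theorem TorsorHom.comp_ofPt (F : Torsor k R B) (b : B →ₐ[k] C) (σ : F.S →ₐ[k] C)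
    (h : ∀ x, σ (algebraMap B F.S x) = b x) {b' : B →+* C} (hb : ∀ x, b' x = b x)
    (γ : C →ₐ[k] D) (g : Pts k R D) :
    (trivPt γ g).comp (TorsorHom.ofPt F b σ h hb).toAlgHom = F.pmul (γ.comp σ) g := by
  refine (Torsor.comp_pmul F _ _ _).trans ?_
  congr 1
  · ext s
    simp
  · exact Pts.ext fun x => by simp

end TorsorMaps

/-! ### The isomorphism κ on points over A((t)). -/

section Kappa

variable {k : Type u} [Field k] {R : Type u} [CommRing R] [HopfAlgebra k R]
variable {A B C D E : Type u} [CommRing A] [Algebra k A] [CommRing B] [Algebra k B]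
  [CommRing C] [Algebra k C] [CommRing D] [Algebra k D] [CommRing E] [Algebra k E]

/-- The point of the restriction of a torsor given by compatible points of the new base and of
the torsor. -/
def baseLift {F : Torsor k R A} [Algebra A B] [IsScalarTower k A B] (ω : B →ₐ[k] D)
    (p : F.S →ₐ[k] D) (h : ∀ a, p (algebraMap A F.S a) = ω (algebraMap A B a)) :
    B ⊗[A] F.S →ₐ[k] D :=
  letI : Algebra A D := ((ω : B →+* D).comp (algebraMap A B)).toAlgebra
  letI : IsScalarTower k A D := .of_algebraMap_eq fun x => by
    change _ = ω (algebraMap A B (algebraMap k A x))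
    rw [← IsScalarTower.algebraMap_apply, AlgHom.commutes]
  (Algebra.TensorProduct.lift ({ ω with commutes' := fun _ => rfl } : B →ₐ[A] D)
    ({ p with commutes' := h } : F.S →ₐ[A] D) (fun _ _ => Commute.all _ _)).restrictScalars k

@[simp]
theorem baseLift_tmul {F : Torsor k R A} [Algebra A B] [IsScalarTower k A B] (ω : B →ₐ[k] D)
    (p : F.S →ₐ[k] D) (h : ∀ a, p (algebraMap A F.S a) = ω (algebraMap A B a)) (b : B) (s : F.S) :
    baseLift ω p h (b ⊗ₜ s) = ω b * p s := by
  simp only [baseLift, AlgHom.restrictScalars_apply, Algebra.TensorProduct.lift_tmul]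
  rfl

/-- The inclusion of the coordinate ring of a torsor in that of its restriction. -/
abbrev resIncl (F : Torsor k R A) (B : Type u) [CommRing B] [Algebra k B] [Algebra A B]
    [IsScalarTower k A B] : F.S →ₐ[k] B ⊗[A] F.S :=
  (Algebra.TensorProduct.includeRight : F.S →ₐ[A] B ⊗[A] F.S).restrictScalars k

theorem algHom_ext_base {F : Torsor k R A} [Algebra A B] [IsScalarTower k A B]
    {f g : B ⊗[A] F.S →ₐ[k] D} (h₁ : ∀ b, f (b ⊗ₜ 1) = g (b ⊗ₜ 1))
    (h₂ : f.comp (resIncl F B) = g.comp (resIncl F B)) : f = g := by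
  apply AlgHom.ext
  intro z
  induction z with
  | zero => simp
  | add x y hx hy => simp only [map_add, hx, hy]
  | tmul b s =>
    have e : b ⊗ₜ[A] s = (b ⊗ₜ[A] 1) * (1 ⊗ₜ[A] s) := by simp
    rw [e, map_mul, map_mul, h₁]
    congr 1
    exact congrArg (fun f => f s) h₂

theorem lift_comp_coactBaseChange (F : Torsor k R A) [Algebra A B] [IsScalarTower k A B]
    (ω : B →ₐ[k] D) (p : F.S →ₐ[k] D) (h : ∀ a, p (algebraMap A F.S a) = ω (algebraMap A B a))
    (g : Pts k R D) :
    (Algebra.TensorProduct.lift (baseLift ω p h) g.ofConv (fun _ _ => Commute.all _ _)).comp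
      ((F.coactBaseChange B).restrictScalars k) =
    baseLift ω (F.pmul p g) (fun a => (F.pmul_algebraMap p g a).trans (h a)) := by
  apply algHom_ext_base
  · intro b
    simp [Torsor.coactBaseChange, Algebra.TensorProduct.one_def]
  · ext s
    simp only [AlgHom.comp_apply, AlgHom.restrictScalars_apply,
      Algebra.TensorProduct.includeRight_apply, Torsor.coactBaseChange,
      Algebra.TensorProduct.map_tmul, map_one, baseLift_tmul, one_mul, Torsor.pmul_apply]
    generalize F.coact s = z
    induction z with
    | zero => simp
    | add x y hx hy => simp only [map_add, hx, hy, tmul_add]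
    | tmul x y => simp

namespace HeckeTuple

variable (X : HeckeTuple k R A)

/-- The map `κ : F₁ → F₂` on points over `A((t))`. -/
def kapPt (ω : Laur A →ₐ[k] D) (p : X.F₁.S →ₐ[k] D)
    (h : ∀ a, p (algebraMap _ X.F₁.S a) = ω (algebraMap (PowerSeries A) (Laur A) a)) :
    X.F₂.S →ₐ[k] D :=
  (baseLift ω p h).comp (X.kappaIncl.restrictScalars k)

theorem kapPt_algebraMap (ω : Laur A →ₐ[k] D) (p : X.F₁.S →ₐ[k] D)
    (h : ∀ a, p (algebraMap _ X.F₁.S a) = ω (algebraMap (PowerSeries A) (Laur A) a))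
    (a : PowerSeries A) :
    X.kapPt ω p h (algebraMap _ X.F₂.S a) = ω (algebraMap (PowerSeries A) (Laur A) a) := by
  rw [kapPt, AlgHom.comp_apply, AlgHom.restrictScalars_apply, AlgHom.commutes,
    Algebra.TensorProduct.algebraMap_apply]
  simp

theorem comp_kapPt (f : D →ₐ[k] E) (ω : Laur A →ₐ[k] D) (p : X.F₁.S →ₐ[k] D)
    (h : ∀ a, p (algebraMap _ X.F₁.S a) = ω (algebraMap (PowerSeries A) (Laur A) a)) :
    f.comp (X.kapPt ω p h) = X.kapPt (f.comp ω) (f.comp p) (fun a => by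
      rw [AlgHom.comp_apply, AlgHom.comp_apply, h a]) := by
  unfold kapPt
  rw [← AlgHom.comp_assoc]
  congr 1
  apply algHom_ext_base
  · intro b
    simp
  · ext s
    simp

theorem baseLift_comp_kappa (ω : Laur A →ₐ[k] D) (p : X.F₁.S →ₐ[k] D)
    (h : ∀ a, p (algebraMap _ X.F₁.S a) = ω (algebraMap (PowerSeries A) (Laur A) a)) :
    (baseLift ω p h).comp (X.kappa.toAlgHom.restrictScalars k) =
      baseLift ω (X.kapPt ω p h) (X.kapPt_algebraMap ω p h) := by
  apply algHom_ext_base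
  · intro b
    have : b ⊗ₜ[PowerSeries A] (1 : X.F₂.S) = algebraMap (Laur A) _ b := by
      simp [Algebra.TensorProduct.algebraMap_apply]
    rw [AlgHom.comp_apply, this, AlgHom.restrictScalars_apply, AlgHom.commutes,
      Algebra.TensorProduct.algebraMap_apply, Algebra.TensorProduct.algebraMap_apply]
    simp
  · ext s
    simp [kapPt, kappaIncl]

/-- This is `kappa_coact` read on points: both sides of that identity are followed by the
homomorphism given by the pair (p, g). -/
theorem kapPt_pmul (ω : Laur A →ₐ[k] D) (p : X.F₁.S →ₐ[k] D)
    (h : ∀ a, p (algebraMap _ X.F₁.S a) = ω (algebraMap (PowerSeries A) (Laur A) a))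
    (g : Pts k R D) :
    X.kapPt ω (X.F₁.pmul p g) (fun a => (X.F₁.pmul_algebraMap p g a).trans (h a)) =
      X.F₂.pmul (X.kapPt ω p h) g := by
  have e := congrArg (fun f : Laur A ⊗[PowerSeries A] X.F₂.S →ₐ[Laur A] _ =>
    (Algebra.TensorProduct.lift (baseLift ω p h) g.ofConv (fun _ _ => Commute.all _ _)).comp
      (f.restrictScalars k)) X.kappa_coact
  have e1 : (Algebra.TensorProduct.lift (baseLift ω p h) g.ofConv (fun _ _ => Commute.all _ _)).comp
      (((Algebra.TensorProduct.map X.kappa.toAlgHom (AlgHom.id k R)).comp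
      (X.F₂.coactBaseChange (Laur A))).restrictScalars k) =
      baseLift ω (X.F₂.pmul (X.kapPt ω p h) g)
        (fun a => (X.F₂.pmul_algebraMap _ g a).trans (X.kapPt_algebraMap ω p h a)) := by
    rw [← lift_comp_coactBaseChange X.F₂ ω (X.kapPt ω p h) (X.kapPt_algebraMap ω p h),
      ← baseLift_comp_kappa]
    ext z
    simp only [AlgHom.comp_apply, AlgHom.restrictScalars_apply]
    generalize Torsor.coactBaseChange X.F₂ (Laur A) z = y
    induction y with
    | zero => simp
    | add x y hx hy => simp only [map_add, hx, hy]
    | tmul x y => simp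
  have e2 : (Algebra.TensorProduct.lift (baseLift ω p h) g.ofConv (fun _ _ => Commute.all _ _)).comp
      (((X.F₁.coactBaseChange (Laur A)).comp X.kappa.toAlgHom).restrictScalars k) =
      baseLift ω (X.kapPt ω (X.F₁.pmul p g) (fun a => (X.F₁.pmul_algebraMap p g a).trans (h a)))
        (X.kapPt_algebraMap _ _ _) := by
    rw [← baseLift_comp_kappa, ← lift_comp_coactBaseChange]
    rfl
  have e3 := e2.symm.trans (e.symm.trans e1)
  have e4 := congrArg (fun f : Laur A ⊗[PowerSeries A] X.F₂.S →ₐ[k] D =>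
    f.comp (resIncl X.F₂ (Laur A))) e3
  ext s
  simpa using! congrArg (fun f => f s) e4

theorem kapPt_congr {ω ω' : Laur A →ₐ[k] D} {p p' : X.F₁.S →ₐ[k] D}
    {h : ∀ a, p (algebraMap _ X.F₁.S a) = ω (algebraMap (PowerSeries A) (Laur A) a)}
    {h' : ∀ a, p' (algebraMap _ X.F₁.S a) = ω' (algebraMap (PowerSeries A) (Laur A) a)}
    (e₁ : ω = ω') (e₂ : p = p') : X.kapPt ω p h = X.kapPt ω' p' h' := by
  subst e₁ e₂
  rfl

end HeckeTuple

end Kappa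

end

section

/-! ### Functoriality of A[[t]] and A((t)). -/

section SeriesMaps

variable (k : Type u) [Field k]
variable {A B C : Type u} [CommRing A] [Algebra k A] [CommRing B] [Algebra k B]
  [CommRing C] [Algebra k C]

variable (A) in
/-- The constant coefficient `A[[t]] → A`. -/
def psEval : PowerSeries A →ₐ[k] A :=
  { PowerSeries.constantCoeff with
    commutes' := fun c => by
      change PowerSeries.constantCoeff (algebraMap k (PowerSeries A) c) = _
      rw [PowerSeries.algebraMap_apply]
      simp }

variable (A) in
/-- The inclusion of constants `A → A[[t]]`. -/
def psConst : A →ₐ[k] PowerSeries A :=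
  { PowerSeries.C with
    commutes' := fun c => by
      change PowerSeries.C (algebraMap k A c) = _
      rw [PowerSeries.algebraMap_apply] }

variable (A) in
/-- The inclusion `A[[t]] → A((t))`. -/
abbrev psLaur : PowerSeries A →ₐ[k] Laur A := IsScalarTower.toAlgHom k (PowerSeries A) (Laur A)

variable {k}

/-- The homomorphism `A[[t]] → B[[t]]` induced by `A → B`. -/
def psMap (f : A →ₐ[k] B) : PowerSeries A →ₐ[k] PowerSeries B :=
  { PowerSeries.map f.toRingHom with
    commutes' := fun c => by
      change PowerSeries.map f.toRingHom (algebraMap k (PowerSeries A) c) = _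
      rw [PowerSeries.algebraMap_apply, PowerSeries.algebraMap_apply]
      simp }

@[simp]
theorem coeff_psMap (f : A →ₐ[k] B) (n : ℕ) (x : PowerSeries A) :
    PowerSeries.coeff n (psMap f x) = f (PowerSeries.coeff n x) :=
  PowerSeries.coeff_map _ _ _

theorem psMap_comp (f : A →ₐ[k] B) (g : B →ₐ[k] C) : (psMap g).comp (psMap f) = psMap (g.comp f) :=
  AlgHom.ext fun x => PowerSeries.ext fun n => by simp

theorem psMap_id : psMap (AlgHom.id k A) = AlgHom.id k (PowerSeries A) :=
  AlgHom.ext fun x => PowerSeries.ext fun n => by simp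

theorem psMap_injective {f : A →ₐ[k] B} (hf : Function.Injective f) :
    Function.Injective (psMap f) := fun x y h => PowerSeries.ext fun n => hf (by
      rw [← coeff_psMap, ← coeff_psMap, h])

theorem psEval_comp_psMap (f : A →ₐ[k] B) : (psEval k B).comp (psMap f) = f.comp (psEval k A) :=
  AlgHom.ext fun x => by
    change PowerSeries.constantCoeff (psMap f x) = f (PowerSeries.constantCoeff x)
    rw [← PowerSeries.coeff_zero_eq_constantCoeff_apply,
      ← PowerSeries.coeff_zero_eq_constantCoeff_apply, coeff_psMap]

theorem psEval_comp_psConst : (psEval k A).comp (psConst k A) = AlgHom.id k A :=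
  AlgHom.ext fun x => PowerSeries.constantCoeff_C x

theorem psMap_comp_psConst (f : A →ₐ[k] B) : (psMap f).comp (psConst k A) = (psConst k B).comp f :=
  AlgHom.ext fun x => PowerSeries.map_C _ x

theorem laurMap_algebraMap (f : A →+* B) (x : PowerSeries A) :
    Laur.map f (algebraMap _ (Laur A) x) = algebraMap _ (Laur B) (PowerSeries.map f x) :=
  congrArg (fun g : PowerSeries A →+* Laur B => g x) (Laur.map_comp_algebraMap f)

/-- The homomorphism `A((t)) → B((t))` induced by `A → B`. -/
def laurMap (f : A →ₐ[k] B) : Laur A →ₐ[k] Laur B :=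
  { Laur.map f.toRingHom with
    commutes' := fun c => by
      change Laur.map f.toRingHom (algebraMap k (Laur A) c) = _
      rw [IsScalarTower.algebraMap_apply k (PowerSeries A) (Laur A), laurMap_algebraMap,
        IsScalarTower.algebraMap_apply k (PowerSeries B) (Laur B)]
      exact congrArg _ ((psMap f).commutes c) }

theorem laurMap_comp_psLaur (f : A →ₐ[k] B) :
    (laurMap f).comp (psLaur k A) = (psLaur k B).comp (psMap f) :=
  AlgHom.ext fun x => laurMap_algebraMap f.toRingHom x

theorem laurMap_comp (f : A →ₐ[k] B) (g : B →ₐ[k] C) :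
    (laurMap g).comp (laurMap f) = laurMap (g.comp f) := rfl

theorem laurMap_id : laurMap (AlgHom.id k A) = AlgHom.id k (Laur A) :=
  AlgHom.ext fun _ => HahnSeries.ext (funext fun _ => rfl)

theorem laurMap_injective {f : A →ₐ[k] B} (hf : Function.Injective f) :
    Function.Injective (laurMap f) := fun _ _ h =>
  HahnSeries.ext (funext fun n => hf (congrArg (fun z : LaurentSeries B => z.coeff n) h))

theorem laurMap_tpow (f : A →ₐ[k] B) (n : ℤ) : laurMap f (Laur.tpow A n) = Laur.tpow B n := by
  refine (HahnSeries.ext (funext fun m => ?_) : (_ : LaurentSeries B) = _)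
  change f ((HahnSeries.single n (1 : A)).coeff m) = (HahnSeries.single n (1 : B)).coeff m
  by_cases h : m = n
  · subst h
    simp
  · simp [HahnSeries.coeff_single_of_ne h]

theorem psLaur_injective : Function.Injective (psLaur k A) := by
  change Function.Injective (algebraMap (PowerSeries A) (LaurentSeries A))
  exact HahnSeries.ofPowerSeries_injective

end SeriesMaps

/-! ### Objects of H given by trivial bundles and a loop κ. -/

section TrivialTuple

variable {k : Type u} [Field k] {R : Type u} [CommRing R] [HopfAlgebra k R]
variable {A B C D : Type u} [CommRing A] [Algebra k A] [CommRing B] [Algebra k B]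
  [CommRing C] [Algebra k C] [CommRing D] [Algebra k D]

/-- The coordinate ring of the trivial torsor over `A((t))`. -/
abbrev LoopCoord (k : Type u) [Field k] (R : Type u) [CommRing R] [HopfAlgebra k R] (A : Type u)
    [CommRing A] [Algebra k A] : Type u :=
  Laur A ⊗[PowerSeries A] (trivTorsor k R (PowerSeries A)).S

/-- The `A((t))`-algebra structure of the coordinate ring of the trivial torsor over `A((t))`. -/
def loopIncl : Laur A →ₐ[k] LoopCoord k R A :=
  (Algebra.TensorProduct.includeLeft : Laur A →ₐ[PowerSeries A] LoopCoord k R A).restrictScalars k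

variable (k R A) in
/-- The universal element of `G` over the trivial torsor over `A((t))`. -/
def loopUniv : Pts k R (LoopCoord k R A) :=
  trivCoord (resIncl (trivTorsor k R (PowerSeries A)) (Laur A))

theorem loopIncl_apply (b : Laur A) : loopIncl b = algebraMap (Laur A) (LoopCoord k R A) b := by
  rw [Algebra.TensorProduct.algebraMap_apply]
  rfl

theorem resIncl_triv : resIncl (trivTorsor k R (PowerSeries A)) (Laur A) =
    trivPt ((loopIncl (R := R)).comp (psLaur k A)) (loopUniv k R A) := by
  refine (trivPt_trivCoord _ _ fun b => ?_).symm
  change (1 : Laur A) ⊗ₜ[PowerSeries A] algebraMap _ (PowerSeries A ⊗[k] R) b =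
    (algebraMap _ (Laur A) b) ⊗ₜ[PowerSeries A] (1 : PowerSeries A ⊗[k] R)
  rw [Algebra.algebraMap_eq_smul_one, Algebra.algebraMap_eq_smul_one, smul_tmul]

/-- The point of the trivial torsor over `A((t))` with given components. -/
def loopPt (ω : Laur A →ₐ[k] D) (g : Pts k R D) : LoopCoord k R A →ₐ[k] D :=
  baseLift (F := trivTorsor k R (PowerSeries A)) ω (trivPt (ω.comp (psLaur k A)) g)
    (fun a => trivPt_algebraMap _ _ a)

theorem baseLift_triv (ω : Laur A →ₐ[k] D) (β : PowerSeries A →ₐ[k] D) (g : Pts k R D) (h) :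
    baseLift (F := trivTorsor k R (PowerSeries A)) ω (trivPt β g) h = loopPt ω g := by
  have hβ : β = ω.comp (psLaur k A) := AlgHom.ext fun a => by
    rw [← trivPt_algebraMap β g a]
    exact h a
  subst hβ
  rfl

theorem loopPt_comp_loopIncl (ω : Laur A →ₐ[k] D) (g : Pts k R D) :
    (loopPt ω g).comp loopIncl = ω := by
  apply AlgHom.ext
  intro b
  refine (baseLift_tmul (F := trivTorsor k R (PowerSeries A)) _ _ _ _ _).trans ?_
  rw [map_one, mul_one]

theorem loopPt_comp_resIncl (ω : Laur A →ₐ[k] D) (g : Pts k R D) :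
    (loopPt ω g).comp (resIncl (trivTorsor k R (PowerSeries A)) (Laur A)) =
      trivPt (ω.comp (psLaur k A)) g := by
  apply AlgHom.ext
  intro s
  refine (baseLift_tmul (F := trivTorsor k R (PowerSeries A)) _ _ _ _ _).trans ?_
  rw [map_one, one_mul]

theorem map_loopPt (ω : Laur A →ₐ[k] D) (g : Pts k R D) :
    Pts.map (loopPt ω g) (loopUniv k R A) = g := by
  rw [loopUniv, map_trivCoord, loopPt_comp_resIncl, trivCoord_trivPt]

/-- The `A((t))`-algebra homomorphism corresponding to left multiplication. -/
def loopMul (κ : Pts k R (Laur A)) : LoopCoord k R A →ₐ[Laur A] LoopCoord k R A where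
  toRingHom := (loopPt loopIncl (Pts.map loopIncl κ * (loopUniv k R A)) :
    LoopCoord k R A →ₐ[k] LoopCoord k R A)
  commutes' b := by
    rw [← loopIncl_apply]
    exact congrArg (fun f : Laur A →ₐ[k] LoopCoord k R A => f b) (loopPt_comp_loopIncl _ _)

theorem loopMul_restrictScalars (κ : Pts k R (Laur A)) :
    (loopMul κ).restrictScalars k = loopPt loopIncl (Pts.map loopIncl κ * (loopUniv k R A)) := rfl

theorem map_loopMul (κ : Pts k R (Laur A)) :
    Pts.map ((loopMul κ).restrictScalars k) (loopUniv k R A) = Pts.map loopIncl κ * (loopUniv k R A) := by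
  rw [loopMul_restrictScalars, map_loopPt]

theorem loopCoord_ext {f g : LoopCoord k R A →ₐ[k] D} (h₁ : f.comp loopIncl = g.comp loopIncl)
    (h₂ : Pts.map f (loopUniv k R A) = Pts.map g (loopUniv k R A)) : f = g := by
  apply algHom_ext_base (F := trivTorsor k R (PowerSeries A))
  · exact fun b => congrArg (fun f => f b) h₁
  · rw [resIncl_triv, comp_trivPt, comp_trivPt, h₂, ← AlgHom.comp_assoc, ← AlgHom.comp_assoc, h₁]

theorem loopMul_comp_loopIncl (κ : Pts k R (Laur A)) :
    ((loopMul κ).restrictScalars k).comp loopIncl = loopIncl := by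
  rw [loopMul_restrictScalars, loopPt_comp_loopIncl]

theorem algHom_comp_loopIncl [Algebra (Laur A) D] [IsScalarTower k (Laur A) D]
    (f : LoopCoord k R A →ₐ[Laur A] D) :
    (f.restrictScalars k).comp loopIncl = IsScalarTower.toAlgHom k (Laur A) D :=
  AlgHom.ext fun b => by
    rw [AlgHom.comp_apply, loopIncl_apply, AlgHom.restrictScalars_apply, f.commutes]
    rfl

theorem coactBaseChange_comp_resIncl (F : Torsor k R A) [Algebra A B] [IsScalarTower k A B] :
    ((F.coactBaseChange B).restrictScalars k).comp (resIncl F B) =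
      F.pmul ((Algebra.TensorProduct.includeLeft : B ⊗[A] F.S →ₐ[k] (B ⊗[A] F.S) ⊗[k] R).comp
        (resIncl F B)) (.toConv Algebra.TensorProduct.includeRight) := by
  ext s
  rw [Torsor.pmul_apply]
  simp only [AlgHom.comp_apply, AlgHom.restrictScalars_apply,
    Algebra.TensorProduct.includeRight_apply, Torsor.coactBaseChange,
    Algebra.TensorProduct.map_tmul, map_one]
  generalize F.coact s = z
  induction z with
  | zero => simp
  | add x y hx hy => simp only [map_add, hx, hy, tmul_add]
  | tmul x y => simp

theorem map_coactBaseChange_loopUniv :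
    Pts.map (((trivTorsor k R (PowerSeries A)).coactBaseChange (Laur A)).restrictScalars k)
      (loopUniv k R A) = Pts.map (Algebra.TensorProduct.includeLeft :
        LoopCoord k R A →ₐ[k] LoopCoord k R A ⊗[k] R) (loopUniv k R A) *
        .toConv Algebra.TensorProduct.includeRight := by
  have h := coactBaseChange_comp_resIncl (B := Laur A) (trivTorsor k R (PowerSeries A))
  rw [resIncl_triv, comp_trivPt, comp_trivPt, pmul_trivPt] at h
  exact (trivCoord_trivPt _ _).symm.trans ((congrArg trivCoord h).trans (trivCoord_trivPt _ _))

theorem loopMul_comp (κ κ' : Pts k R (Laur A)) (h : κ * κ' = 1) :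
    (loopMul κ').comp (loopMul κ) = AlgHom.id (Laur A) (LoopCoord k R A) := by
  apply AlgHom.restrictScalars_injective k
  apply loopCoord_ext
  · rw [algHom_comp_loopIncl, algHom_comp_loopIncl]
  · change Pts.map ((loopMul κ').restrictScalars k)
      (Pts.map ((loopMul κ).restrictScalars k) (loopUniv k R A)) = _
    rw [map_loopMul, map_mul, map_loopMul, Pts.map_map, loopMul_comp_loopIncl, ← mul_assoc,
      ← map_mul, h, map_one, one_mul]
    rfl

variable (A) in
/-- The object of `H` consisting of trivial bundles and left multiplication by `κ`. -/
abbrev trivTuple (κ : Pts k R (Laur A)) : HeckeTuple k R A where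
  F₁ := trivTorsor k R (PowerSeries A)
  F₂ := trivTorsor k R (PowerSeries A)
  e₁ := trivPt (psEval k A) 1
  e₁_base x := trivPt_algebraMap _ _ x
  e₂ := trivPt (psEval k A) 1
  e₂_base x := trivPt_algebraMap _ _ x
  kappa := AlgEquiv.ofAlgHom (loopMul κ) (loopMul κ⁻¹)
    (loopMul_comp _ _ (inv_mul_cancel κ)) (loopMul_comp _ _ (mul_inv_cancel κ))
  kappa_coact := by
    change (Algebra.TensorProduct.map (loopMul κ) (AlgHom.id k R)).comp
      ((trivTorsor k R (PowerSeries A)).coactBaseChange (Laur A)) =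
      ((trivTorsor k R (PowerSeries A)).coactBaseChange (Laur A)).comp (loopMul κ)
    apply AlgHom.restrictScalars_injective k
    refine loopCoord_ext (D := LoopCoord k R A ⊗[k] R) ?_ ?_
    · exact (algHom_comp_loopIncl (D := LoopCoord k R A ⊗[k] R) _).trans
        (algHom_comp_loopIncl (D := LoopCoord k R A ⊗[k] R) _).symm
    · let i : LoopCoord k R A →ₐ[k] LoopCoord k R A ⊗[k] R := Algebra.TensorProduct.includeLeft
      let c : Pts k R (LoopCoord k R A ⊗[k] R) := .toConv Algebra.TensorProduct.includeRight
      let γ : LoopCoord k R A →ₐ[k] LoopCoord k R A ⊗[k] R :=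
        ((trivTorsor k R (PowerSeries A)).coactBaseChange (Laur A)).restrictScalars k
      have hγ₁ : γ.comp loopIncl = i.comp loopIncl := by
        refine (algHom_comp_loopIncl (D := LoopCoord k R A ⊗[k] R) _).trans (AlgHom.ext fun b => ?_)
        rw [AlgHom.comp_apply, loopIncl_apply]
        rfl
      have hγ₂ : Pts.map γ (loopUniv k R A) = Pts.map i (loopUniv k R A) * c := map_coactBaseChange_loopUniv
      let μ : LoopCoord k R A ⊗[k] R →ₐ[k] LoopCoord k R A ⊗[k] R :=
        Algebra.TensorProduct.map ((loopMul κ).restrictScalars k) (AlgHom.id k R)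
      have hμ₁ : μ.comp i = i.comp ((loopMul κ).restrictScalars k) := by
        apply AlgHom.ext
        intro x
        simp [μ, i]
      have hμ₂ : Pts.map μ c = c := Pts.ext fun x => by simp [μ, c]
      trans Pts.map i (Pts.map loopIncl κ * (loopUniv k R A)) * c
      · change Pts.map (A := LoopCoord k R A ⊗[k] R) (B := LoopCoord k R A ⊗[k] R) μ
          (Pts.map (A := LoopCoord k R A) (B := LoopCoord k R A ⊗[k] R) γ (loopUniv k R A)) = _
        rw [hγ₂, map_mul, hμ₂, Pts.map_map, hμ₁, ← Pts.map_map, map_loopMul]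
      · change _ = Pts.map (A := LoopCoord k R A) (B := LoopCoord k R A ⊗[k] R) γ (Pts.map ((loopMul κ).restrictScalars k) (loopUniv k R A))
        rw [map_loopMul, map_mul, map_mul, hγ₂, Pts.map_map, Pts.map_map, hγ₁, mul_assoc]

theorem kapPt_trivTuple (κ : Pts k R (Laur A)) (ω : Laur A →ₐ[k] D) (β : PowerSeries A →ₐ[k] D)
    (g : Pts k R D) (h) :
    (trivTuple A κ).kapPt ω (trivPt β g) h = trivPt β (Pts.map ω κ * g) := by
  have hβ : β = ω.comp (psLaur k A) := AlgHom.ext fun a => by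
    rw [← trivPt_algebraMap β g a]
    exact h a
  have e : (trivTuple A κ).kapPt ω (trivPt β g) h = (loopPt ω g).comp
      (((loopMul κ).restrictScalars k).comp
        (resIncl (trivTorsor k R (PowerSeries A)) (Laur A))) := by
    rw [← baseLift_triv ω β g h]
    rfl
  rw [e, loopMul_restrictScalars, loopPt_comp_resIncl, comp_trivPt, map_mul, Pts.map_map,
    ← AlgHom.comp_assoc, loopPt_comp_loopIncl, map_loopPt, ← hβ]

end TrivialTuple

end

section

/-! ### Sections of the two bundles and the matrix of κ. -/

section Sections

variable {k : Type u} [Field k] {R : Type u} [CommRing R] [HopfAlgebra k R]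
variable {A B C D : Type u} [CommRing A] [Algebra k A] [CommRing B] [Algebra k B]
  [CommRing C] [Algebra k C] [CommRing D] [Algebra k D]

namespace HeckeTuple

theorem Hom.mapRingHom_eq {f : A →ₐ[k] B} {F : Torsor k R (PowerSeries A)}
    {F' : Torsor k R (PowerSeries B)} (φ : TorsorHom (PowerSeries.map f.toRingHom) F F')
    (ω : Laur B →ₐ[k] D) (p : F'.S →ₐ[k] D)
    (h : ∀ a, p (algebraMap _ F'.S a) = ω (algebraMap (PowerSeries B) (Laur B) a))
    (z : Laur A ⊗[PowerSeries A] F.S) :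
    baseLift ω p h (Algebra.TensorProduct.mapRingHom (PowerSeries.map f.toRingHom)
      (Laur.map f.toRingHom) φ.toAlgHom.toRingHom (Laur.map_comp_algebraMap f.toRingHom)
      (RingHom.ext φ.map_base) z) =
    baseLift (ω.comp (laurMap f)) (p.comp φ.toAlgHom) (fun a => by
      rw [AlgHom.comp_apply, φ.map_base, h, ← laurMap_algebraMap]
      rfl) z := by
  induction z with
  | zero => simp only [map_zero]
  | add x y hx hy => simp only [map_add, hx, hy]
  | tmul x y =>
    rw [Algebra.TensorProduct.mapRingHom_tmul, baseLift_tmul, baseLift_tmul]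
    rfl

theorem Hom.kapPt_comp {f : A →ₐ[k] B} {X : HeckeTuple k R A} {Y : HeckeTuple k R B}
    (φ : HeckeTuple.Hom f X Y) (ω : Laur B →ₐ[k] D) (p : Y.F₁.S →ₐ[k] D)
    (h : ∀ a, p (algebraMap _ Y.F₁.S a) = ω (algebraMap (PowerSeries B) (Laur B) a)) :
    X.kapPt (ω.comp (laurMap f)) (p.comp φ.hom₁.toAlgHom) (fun a => by
      rw [AlgHom.comp_apply, φ.hom₁.map_base, h, ← laurMap_algebraMap]
      rfl) = (Y.kapPt ω p h).comp φ.hom₂.toAlgHom := by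
  apply AlgHom.ext
  intro s
  refine (Hom.mapRingHom_eq φ.hom₁ ω p h (X.kappaIncl s)).symm.trans ?_
  rw [φ.map_kappa]
  rfl

variable (A) in
/-- The inclusion of `A((t))` in the coordinate ring of the restriction of a torsor. -/
abbrev laurIncl (F : Torsor k R (PowerSeries A)) : Laur A →ₐ[k] Laur A ⊗[PowerSeries A] F.S :=
  (Algebra.TensorProduct.includeLeft :
    Laur A →ₐ[PowerSeries A] Laur A ⊗[PowerSeries A] F.S).restrictScalars k

theorem resIncl_algebraMap (F : Torsor k R (PowerSeries A)) (a : PowerSeries A) :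
    resIncl F (Laur A) (algebraMap _ F.S a) =
      laurIncl A F (algebraMap (PowerSeries A) (Laur A) a) := by
  change (1 : Laur A) ⊗ₜ[PowerSeries A] algebraMap _ F.S a =
    (algebraMap _ (Laur A) a) ⊗ₜ[PowerSeries A] (1 : F.S)
  rw [Algebra.algebraMap_eq_smul_one, Algebra.algebraMap_eq_smul_one, smul_tmul]

theorem baseLift_incl (F : Torsor k R (PowerSeries A)) :
    baseLift (laurIncl A F) (resIncl F (Laur A)) (resIncl_algebraMap F) = AlgHom.id k _ := by
  apply algHom_ext_base
  · intro b
    simp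
  · ext s
    simp

/-- A converse of `Hom.kapPt_comp`: compatibility with κ need only be tested at the universal point
of the restriction of `Y.F₁` to B((t)). -/
theorem map_kappa_of {f : A →ₐ[k] B} {X : HeckeTuple k R A} {Y : HeckeTuple k R B}
    (φ₁ : TorsorHom (PowerSeries.map f.toRingHom) X.F₁ Y.F₁)
    (φ₂ : TorsorHom (PowerSeries.map f.toRingHom) X.F₂ Y.F₂) (h)
    (H : X.kapPt ((laurIncl B Y.F₁).comp (laurMap f)) ((resIncl Y.F₁ (Laur B)).comp φ₁.toAlgHom) h =
      (Y.kapPt (laurIncl B Y.F₁) (resIncl Y.F₁ (Laur B)) (resIncl_algebraMap Y.F₁)).comp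
        φ₂.toAlgHom) (s : X.F₂.S) :
    Algebra.TensorProduct.mapRingHom (PowerSeries.map f.toRingHom)
      (Laur.map f.toRingHom) φ₁.toAlgHom.toRingHom (Laur.map_comp_algebraMap f.toRingHom)
      (RingHom.ext φ₁.map_base) (X.kappaIncl s) = Y.kappaIncl (φ₂.toAlgHom s) := by
  have e := Hom.mapRingHom_eq φ₁ (laurIncl B Y.F₁) (resIncl Y.F₁ (Laur B))
    (resIncl_algebraMap Y.F₁) (X.kappaIncl s)
  rw [baseLift_incl, AlgHom.id_apply] at e
  refine e.trans ((congrArg (fun q => q s) H).trans ?_)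
  change (baseLift _ _ _) (Y.kappaIncl (φ₂.toAlgHom s)) = _
  rw [baseLift_incl, AlgHom.id_apply]

/-- A pair of sections, over the base change along `A → C`, of the bundles of an object of `H`
in which `κ` is left multiplication by a given element. -/
structure IsSections (X : HeckeTuple k R A) (f : A →ₐ[k] C) (κ : Pts k R (Laur C))
    (σ₁ : X.F₁.S →ₐ[k] PowerSeries C) (σ₂ : X.F₂.S →ₐ[k] PowerSeries C) : Prop where
  base₁ : ∀ a, σ₁ (algebraMap _ X.F₁.S a) = psMap f a
  base₂ : ∀ a, σ₂ (algebraMap _ X.F₂.S a) = psMap f a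
  kap : X.kapPt (laurMap f) ((psLaur k C).comp σ₁) (fun a => by
    rw [AlgHom.comp_apply, base₁]
    exact (laurMap_algebraMap f.toRingHom a).symm) = X.F₂.pmul ((psLaur k C).comp σ₂) κ

theorem kapPt_psLaur_pmul (X : HeckeTuple k R A) (f : A →ₐ[k] C)
    (σ : X.F₁.S →ₐ[k] PowerSeries C) (g : Pts k R (PowerSeries C)) (h) (h') :
    X.kapPt (laurMap f) ((psLaur k C).comp (X.F₁.pmul σ g)) h =
      X.F₂.pmul (X.kapPt (laurMap f) ((psLaur k C).comp σ) h') (Pts.map (psLaur k C) g) := by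
  rw [← kapPt_pmul]
  exact X.kapPt_congr rfl (Torsor.comp_pmul _ _ _ _)

namespace IsSections

variable {X : HeckeTuple k R A} {f : A →ₐ[k] C} {κ κ' : Pts k R (Laur C)}
  {σ₁ σ₁' : X.F₁.S →ₐ[k] PowerSeries C} {σ₂ σ₂' : X.F₂.S →ₐ[k] PowerSeries C}

theorem compat (h : X.IsSections f κ σ₁ σ₂) (a : PowerSeries A) :
    ((psLaur k C).comp σ₁) (algebraMap _ X.F₁.S a) =
      laurMap f (algebraMap (PowerSeries A) (Laur A) a) := by
  rw [AlgHom.comp_apply, h.base₁]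
  exact (laurMap_algebraMap f.toRingHom a).symm

theorem pmul (h : X.IsSections f κ σ₁ σ₂) (a b : Pts k R (PowerSeries C))
    (hab : Pts.map (psLaur k C) b * κ' = κ * Pts.map (psLaur k C) a) :
    X.IsSections f κ' (X.F₁.pmul σ₁ a) (X.F₂.pmul σ₂ b) where
  base₁ x := (X.F₁.pmul_algebraMap σ₁ a x).trans (h.base₁ x)
  base₂ x := (X.F₂.pmul_algebraMap σ₂ b x).trans (h.base₂ x)
  kap := by
    rw [kapPt_psLaur_pmul (h' := h.compat), h.kap, Torsor.pmul_pmul, ← hab, Torsor.comp_pmul, Torsor.pmul_pmul]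

theorem relation {a b : Pts k R (PowerSeries C)} (h : X.IsSections f κ σ₁ σ₂)
    (h' : X.IsSections f κ' (X.F₁.pmul σ₁ a) (X.F₂.pmul σ₂ b)) :
    Pts.map (psLaur k C) b * κ' = κ * Pts.map (psLaur k C) a := by
  have e := h'.kap
  rw [kapPt_psLaur_pmul (h' := h.compat), h.kap, Torsor.comp_pmul, Torsor.pmul_pmul, Torsor.pmul_pmul] at e
  exact (X.F₂.pmul_left_injective _ e).symm

theorem exists_pmul (h : X.IsSections f κ σ₁ σ₂) (h' : X.IsSections f κ' σ₁' σ₂') :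
    ∃ a b : Pts k R (PowerSeries C), σ₁' = X.F₁.pmul σ₁ a ∧ σ₂' = X.F₂.pmul σ₂ b ∧
      Pts.map (psLaur k C) b * κ' = κ * Pts.map (psLaur k C) a := by
  obtain ⟨a, rfl⟩ := X.F₁.exists_pmul_eq σ₁ σ₁' fun x => (h.base₁ x).trans (h'.base₁ x).symm
  obtain ⟨b, rfl⟩ := X.F₂.exists_pmul_eq σ₂ σ₂' fun x => (h.base₂ x).trans (h'.base₂ x).symm
  exact ⟨a, b, rfl, rfl, h.relation h'⟩

theorem kap_map (g : C →ₐ[k] D) (σ : X.F₁.S →ₐ[k] PowerSeries C) (h) (h') :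
    (laurMap g).comp (X.kapPt (laurMap f) ((psLaur k C).comp σ) h) =
      X.kapPt (laurMap (g.comp f)) ((psLaur k D).comp ((psMap g).comp σ)) h' := by
  rw [comp_kapPt]
  exact X.kapPt_congr (laurMap_comp _ _) (by
    rw [← AlgHom.comp_assoc, laurMap_comp_psLaur, AlgHom.comp_assoc])

theorem map (h : X.IsSections f κ σ₁ σ₂) (g : C →ₐ[k] D) :
    X.IsSections (g.comp f) (Pts.map (laurMap g) κ) ((psMap g).comp σ₁) ((psMap g).comp σ₂) where
  base₁ x := by
    rw [AlgHom.comp_apply, h.base₁, ← psMap_comp, AlgHom.comp_apply]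
  base₂ x := by
    rw [AlgHom.comp_apply, h.base₂, ← psMap_comp, AlgHom.comp_apply]
  kap := by
    rw [← kap_map (h := h.compat), h.kap, Torsor.comp_pmul, ← AlgHom.comp_assoc,
      laurMap_comp_psLaur, AlgHom.comp_assoc]

theorem of_map {g : C →ₐ[k] D} (hg : Function.Injective g)
    (h : X.IsSections (g.comp f) (Pts.map (laurMap g) κ) ((psMap g).comp σ₁)
      ((psMap g).comp σ₂)) : X.IsSections f κ σ₁ σ₂ := by
  have b₁ : ∀ a, σ₁ (algebraMap _ X.F₁.S a) = psMap f a := fun a => psMap_injective hg (by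
    have := h.base₁ a
    rwa [← psMap_comp] at this)
  have b₂ : ∀ a, σ₂ (algebraMap _ X.F₂.S a) = psMap f a := fun a => psMap_injective hg (by
    have := h.base₂ a
    rwa [← psMap_comp] at this)
  refine ⟨b₁, b₂, ?_⟩
  have e := h.kap
  rw [← kap_map (h := fun a => by
      rw [AlgHom.comp_apply, b₁]
      exact (laurMap_algebraMap f.toRingHom a).symm), ← AlgHom.comp_assoc (psLaur k D),
      ← laurMap_comp_psLaur, AlgHom.comp_assoc, ← Torsor.comp_pmul] at e
  exact AlgHom.ext fun s => laurMap_injective hg (congrArg (fun q => q s) e)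

theorem comp_hom {Y : HeckeTuple k R B} {j : A →ₐ[k] B} {i : B →ₐ[k] C}
    (φ : HeckeTuple.Hom j X Y)
    {τ₁ : Y.F₁.S →ₐ[k] PowerSeries C} {τ₂ : Y.F₂.S →ₐ[k] PowerSeries C}
    (h : Y.IsSections i κ τ₁ τ₂) :
    X.IsSections (i.comp j) κ (τ₁.comp φ.hom₁.toAlgHom) (τ₂.comp φ.hom₂.toAlgHom) where
  base₁ x := by
    rw [AlgHom.comp_apply, φ.hom₁.map_base, h.base₁, ← psMap_comp]
    rfl
  base₂ x := by
    rw [AlgHom.comp_apply, φ.hom₂.map_base, h.base₂, ← psMap_comp]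
    rfl
  kap := by
    have e := Hom.kapPt_comp φ (laurMap i) ((psLaur k C).comp τ₁) h.compat
    refine Eq.trans (X.kapPt_congr ?_ ?_) (e.trans ?_)
    · rfl
    · rfl
    · rw [h.kap, ← TorsorHom.pmul_comp, AlgHom.comp_assoc]

end IsSections

theorem trivTuple_isSections (κ : Pts k R (Laur B)) :
    (trivTuple B κ).IsSections (AlgHom.id k B) κ (trivPt (AlgHom.id k (PowerSeries B)) 1)
      (trivPt (AlgHom.id k (PowerSeries B)) 1) where
  base₁ a := by
    rw [psMap_id]
    exact trivPt_algebraMap _ _ a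
  base₂ a := by
    rw [psMap_id]
    exact trivPt_algebraMap _ _ a
  kap := by
    simp only [comp_trivPt, kapPt_trivTuple, pmul_trivPt, map_one, one_mul, mul_one, laurMap_id,
      Pts.map_id]

/-- By equivariance κ is determined by its value at the one section σ₁, since every point over the
same base point has the form σ₁ u. -/
theorem IsSections.kapPt_eq {X : HeckeTuple k R A} {f : A →ₐ[k] C} {κ : Pts k R (Laur C)}
    {σ₁ : X.F₁.S →ₐ[k] PowerSeries C} {σ₂ : X.F₂.S →ₐ[k] PowerSeries C}
    (h : X.IsSections f κ σ₁ σ₂) (ω : Laur C →ₐ[k] D) (u : Pts k R D) (h') :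
    X.kapPt (ω.comp (laurMap f)) (X.F₁.pmul ((ω.comp (psLaur k C)).comp σ₁) u) h' =
      X.F₂.pmul ((ω.comp (psLaur k C)).comp σ₂) (Pts.map ω κ * u) := by
  have hb : ∀ a, ((ω.comp (psLaur k C)).comp σ₁) (algebraMap _ X.F₁.S a) =
      (ω.comp (laurMap f)) (algebraMap (PowerSeries A) (Laur A) a) :=
    fun a => congrArg ω (h.compat a)
  rw [kapPt_pmul _ _ _ hb, ← Torsor.pmul_pmul]
  congr 1
  refine (comp_kapPt X ω (laurMap f) _ h.compat).symm.trans ?_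
  rw [h.kap, Torsor.comp_pmul]
  rfl

/-- The universal point of `Y.F₁` over B((t)) is τ₁ u for some group element u. In the sections τ
and in their pull-backs κ has the same matrix, so both sides of the compatibility send it to τ₂ κ u.
-/
theorem map_kappa_of_isSections {f : A →ₐ[k] B} {X : HeckeTuple k R A} {Y : HeckeTuple k R B}
    {κ : Pts k R (Laur B)} {τ₁ : Y.F₁.S →ₐ[k] PowerSeries B} {τ₂ : Y.F₂.S →ₐ[k] PowerSeries B}
    (hτ : Y.IsSections (AlgHom.id k B) κ τ₁ τ₂)
    (φ₁ : TorsorHom (PowerSeries.map f.toRingHom) X.F₁ Y.F₁)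
    (φ₂ : TorsorHom (PowerSeries.map f.toRingHom) X.F₂ Y.F₂)
    (h : X.IsSections f κ (τ₁.comp φ₁.toAlgHom) (τ₂.comp φ₂.toAlgHom)) (s : X.F₂.S) :
    Algebra.TensorProduct.mapRingHom (PowerSeries.map f.toRingHom)
      (Laur.map f.toRingHom) φ₁.toAlgHom.toRingHom (Laur.map_comp_algebraMap f.toRingHom)
      (RingHom.ext φ₁.map_base) (X.kappaIncl s) = Y.kappaIncl (φ₂.toAlgHom s) := by
  obtain ⟨u, hu⟩ := Y.F₁.exists_pmul_eq (((laurIncl B Y.F₁).comp (psLaur k B)).comp τ₁)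
    (resIncl Y.F₁ (Laur B)) (fun b => by
      rw [AlgHom.comp_apply, hτ.base₁, psMap_id, resIncl_algebraMap]
      rfl)
  have e : (resIncl Y.F₁ (Laur B)).comp φ₁.toAlgHom =
      X.F₁.pmul (((laurIncl B Y.F₁).comp (psLaur k B)).comp (τ₁.comp φ₁.toAlgHom)) u := by
    rw [hu, ← φ₁.pmul_comp]
    rfl
  have hc : ∀ a, ((resIncl Y.F₁ (Laur B)).comp φ₁.toAlgHom) (algebraMap _ X.F₁.S a) =
      ((laurIncl B Y.F₁).comp (laurMap f)) (algebraMap (PowerSeries A) (Laur A) a) := fun a => by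
    rw [e, Torsor.pmul_algebraMap]
    exact congrArg (laurIncl B Y.F₁) (h.compat a)
  refine map_kappa_of φ₁ φ₂ hc ?_ s
  have hY := hτ.kapPt_eq (laurIncl B Y.F₁) u (fun a => by
    rw [← hu, laurMap_id]
    exact resIncl_algebraMap _ a)
  have hX := h.kapPt_eq (laurIncl B Y.F₁) u (fun a => by
    rw [← e]
    exact hc a)
  refine (X.kapPt_congr rfl e).trans (hX.trans ?_)
  refine Eq.trans ?_ (congrArg (fun q : Y.F₂.S →ₐ[k] _ => q.comp φ₂.toAlgHom)
    (hY.symm.trans (Y.kapPt_congr ?_ hu.symm)))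
  · rw [← φ₂.pmul_comp]
    rfl
  · rw [laurMap_id, AlgHom.comp_id]

theorem isStandard_iff (ell : Pts k R (LaurentPolynomial k)) (X : HeckeTuple k R A) :
    X.IsStandard ell ↔ ∃ σ₁ σ₂, X.IsSections (AlgHom.id k A)
      (Pts.map (laurentToLaur k A) ell) σ₁ σ₂ := by
  -- The two ways of evaluating κ at a section agree: `kappaPt` uses a structure of A((t))-algebra
  -- on the target, `kapPt` an explicit homomorphism, here the identity.
  have key : ∀ (σ₁ : X.F₁.S →ₐ[PowerSeries A] PowerSeries A) (h),
      (X.kappaPt (genericPt σ₁)).restrictScalars k =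
      X.kapPt (laurMap (AlgHom.id k A)) ((psLaur k A).comp (σ₁.restrictScalars k)) h := by
    intro σ₁ h
    have e : (Algebra.TensorProduct.lift (Algebra.ofId (Laur A) (Laur A)) (genericPt σ₁)
        (fun _ _ => Commute.all _ _)).restrictScalars k = baseLift (laurMap (AlgHom.id k A))
          ((psLaur k A).comp (σ₁.restrictScalars k)) h := by
      apply algHom_ext_base
      · intro b
        rw [baseLift_tmul, laurMap_id, map_one, mul_one, AlgHom.restrictScalars_apply,
          Algebra.TensorProduct.lift_tmul, map_one, mul_one]
        rfl
      · apply AlgHom.ext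
        intro s
        refine Eq.trans ?_ (baseLift_tmul _ _ _ _ _).symm
        rw [map_one, one_mul, AlgHom.comp_apply, AlgHom.restrictScalars_apply]
        refine (Algebra.TensorProduct.lift_tmul _ _ _ _ _).trans ?_
        rw [map_one, one_mul]
        rfl
    exact congrArg (fun q : Laur A ⊗[PowerSeries A] X.F₁.S →ₐ[k] Laur A =>
      q.comp (X.kappaIncl.restrictScalars k)) e
  constructor
  · rintro ⟨σ₁, σ₂, h⟩
    refine ⟨σ₁.restrictScalars k, σ₂.restrictScalars k, ?_, ?_, ?_⟩
    · intro a
      rw [psMap_id]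
      exact σ₁.commutes a
    · intro a
      rw [psMap_id]
      exact σ₂.commutes a
    · rw [← key, h]
      rfl
  · rintro ⟨σ₁, σ₂, h⟩
    refine ⟨{ σ₁ with commutes' := fun a => ?_ }, { σ₂ with commutes' := fun a => ?_ }, ?_⟩
    · have := h.base₁ a
      rwa [psMap_id] at this
    · have := h.base₂ a
      rwa [psMap_id] at this
    · apply AlgHom.restrictScalars_injective k
      rw [key]
      exact h.kap

end HeckeTuple

end Sections

end

section

/-! ### Comodules over k[T, T⁻¹]. -/

section Weights

variable {k : Type u} [Field k]

/-- Because T^m is group-like, applying the n-th coefficient to the second factor of the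
comultiplication leaves only the term T^n. -/
theorem lTensor_coeff_comul (n : ℤ) :
    (TensorProduct.rid k (LaurentPolynomial k)).toLinearMap ∘ₗ
      ((Finsupp.lapply n ∘ₗ (AddMonoidAlgebra.coeffLinearEquiv k).toLinearMap :
        LaurentPolynomial k →ₗ[k] k).lTensor (LaurentPolynomial k)) ∘ₗ
      Coalgebra.comul (R := k) (A := LaurentPolynomial k) =
    LinearMap.toSpanSingleton k (LaurentPolynomial k) (LaurentPolynomial.T n) ∘ₗ
      (Finsupp.lapply n ∘ₗ (AddMonoidAlgebra.coeffLinearEquiv k).toLinearMap) := by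
  refine LinearMap.ext fun z => ?_
  induction z using LaurentPolynomial.induction_on' with
  | add p q hp hq => rw [map_add, hp, hq, map_add]
  | C_mul_T m a =>
    rw [← LaurentPolynomial.smul_eq_C_mul, map_smul, map_smul]
    congr 1
    simp only [LinearMap.comp_apply, LaurentPolynomial.comul_T, LinearMap.lTensor_tmul]
    simp [LaurentPolynomial.T, -LaurentPolynomial.single_eq_C_mul_T,
      AddMonoidAlgebra.coeff_single, Finsupp.single_apply]
    split_ifs with h <;> simp [h]

/-- The counit is the sum of all coefficients. The sum is taken over any sufficiently large finite
set so that such formulas can be added. -/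
theorem exists_counit_eq_sum_coeff (z : LaurentPolynomial k) : ∃ s : Finset ℤ, ∀ t, s ⊆ t →
    Coalgebra.counit (R := k) z = ∑ n ∈ t, z.coeff n := by
  induction z using LaurentPolynomial.induction_on' with
  | add p q hp hq =>
    classical
    obtain ⟨s, hs⟩ := hp
    obtain ⟨s', hs'⟩ := hq
    refine ⟨s ∪ s', fun t ht => ?_⟩
    rw [map_add, hs t (Finset.union_subset_left ht), hs' t (Finset.union_subset_right ht),
      ← Finset.sum_add_distrib]
    rfl
  | C_mul_T m a =>
    refine ⟨{m}, fun t ht => ?_⟩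
    rw [← LaurentPolynomial.smul_eq_C_mul, map_smul, LaurentPolynomial.counit_T]
    rw [Finset.sum_eq_single m]
    · simp [LaurentPolynomial.T, -LaurentPolynomial.single_eq_C_mul_T,
        AddMonoidAlgebra.coeff_single]
    · intro n _ hn
      simp [LaurentPolynomial.T, -LaurentPolynomial.single_eq_C_mul_T,
        AddMonoidAlgebra.coeff_single, Ne.symm hn]
    · intro h
      exact absurd (ht (Finset.mem_singleton_self m)) h

variable {M : Type*} [AddCommGroup M] [Module k M]

/-- A comodule over `k[T, T⁻¹]` is spanned by its weight vectors. -/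
theorem mem_span_weightVectors (ρ : M →ₗ[k] M ⊗[k] LaurentPolynomial k)
    (hρ : (TensorProduct.assoc k M _ _).toLinearMap ∘ₗ ρ.rTensor (LaurentPolynomial k) ∘ₗ ρ =
      (Coalgebra.comul (R := k) (A := LaurentPolynomial k)).lTensor M ∘ₗ ρ)
    (hρ' : (TensorProduct.rid k M).toLinearMap ∘ₗ
      (Coalgebra.counit (R := k) (A := LaurentPolynomial k)).lTensor M ∘ₗ ρ = LinearMap.id)
    (m : M) : m ∈ Submodule.span k {m | ∃ n : ℤ, ρ m = m ⊗ₜ LaurentPolynomial.T n} := by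
  let c (n : ℤ) : LaurentPolynomial k →ₗ[k] k :=
    Finsupp.lapply n ∘ₗ (AddMonoidAlgebra.coeffLinearEquiv k).toLinearMap
  let π (n : ℤ) : M →ₗ[k] M := (TensorProduct.rid k M).toLinearMap ∘ₗ (c n).lTensor M ∘ₗ ρ
  -- Coassociativity, with the n-th coefficient functional applied to the last factor, shows that
  -- the component π n m has weight n.
  have h1 : ∀ n, ρ (π n m) = π n m ⊗ₜ LaurentPolynomial.T n := by
    intro n
    have e1 : ∀ z : M ⊗[k] LaurentPolynomial k,
        ((TensorProduct.rid k (LaurentPolynomial k)).toLinearMap ∘ₗ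
          (c n).lTensor (LaurentPolynomial k)).lTensor M
          (TensorProduct.assoc k M _ _ (ρ.rTensor (LaurentPolynomial k) z)) =
        ρ (TensorProduct.rid k M ((c n).lTensor M z)) := by
      intro z
      induction z with
      | zero => simp
      | add x y hx hy => simp only [map_add, hx, hy]
      | tmul x y =>
        rw [LinearMap.rTensor_tmul, LinearMap.lTensor_tmul, TensorProduct.rid_tmul, map_smul]
        generalize ρ x = w
        induction w with
        | zero => simp
        | add x y hx hy => simp only [map_add, add_tmul, hx, hy, smul_add]
        | tmul x' y' => simp
    have e2 : ∀ z : M ⊗[k] LaurentPolynomial k,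
        ((TensorProduct.rid k (LaurentPolynomial k)).toLinearMap ∘ₗ
          (c n).lTensor (LaurentPolynomial k)).lTensor M
          ((Coalgebra.comul (R := k) (A := LaurentPolynomial k)).lTensor M z) =
        TensorProduct.rid k M ((c n).lTensor M z) ⊗ₜ LaurentPolynomial.T n := by
      intro z
      rw [← LinearMap.comp_apply, ← LinearMap.lTensor_comp, LinearMap.comp_assoc,
        lTensor_coeff_comul]
      induction z with
      | zero => simp
      | add x y hx hy => simp only [map_add, add_tmul, hx, hy]
      | tmul x y => simp [c, smul_tmul]
    have := congrArg (fun f => ((TensorProduct.rid k (LaurentPolynomial k)).toLinearMap ∘ₗ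
          (c n).lTensor (LaurentPolynomial k)).lTensor M (f m)) hρ
    exact (e1 (ρ m)).symm.trans (this.trans (e2 (ρ m)))
  -- The counit axiom then says that m is the sum of its components.
  have h2 : ∀ z : M ⊗[k] LaurentPolynomial k, ∃ s : Finset ℤ, ∀ t, s ⊆ t →
      TensorProduct.rid k M ((Coalgebra.counit (R := k) (A := LaurentPolynomial k)).lTensor M z) =
      ∑ n ∈ t, TensorProduct.rid k M ((c n).lTensor M z) := by
    classical
    intro z
    induction z with
    | zero => exact ⟨∅, by simp⟩
    | add x y hx hy =>
      obtain ⟨s, hs⟩ := hx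
      obtain ⟨s', hs'⟩ := hy
      refine ⟨s ∪ s', fun t ht => ?_⟩
      simp only [map_add, Finset.sum_add_distrib]
      rw [hs t (Finset.union_subset_left ht), hs' t (Finset.union_subset_right ht)]
    | tmul x y =>
      obtain ⟨s, hs⟩ := exists_counit_eq_sum_coeff y
      refine ⟨s, fun t ht => ?_⟩
      simp only [LinearMap.lTensor_tmul, TensorProduct.rid_tmul, hs t ht, Finset.sum_smul]
      rfl
  obtain ⟨s, hs⟩ := h2 (ρ m)
  have h3 := hs s subset_rfl
  have h4 := congrArg (fun f : M →ₗ[k] M => f m) hρ'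
  rw [show m = _ from h4.symm.trans h3]
  exact Submodule.sum_mem _ fun n _ => Submodule.subset_span ⟨n, h1 n⟩

end Weights

/-! ### Weights of functions on G for conjugation by a cocharacter. -/

section Conjugation

variable {k : Type u} [Field k] {R : Type u} [CommRing R] [HopfAlgebra k R]
variable {D : Type u} [CommRing D] [Algebra k D]

/-- The point `ell ∈ G(k[T, T⁻¹])` is a cocharacter `𝔾_m → G`. -/
def IsCochar (ell : Pts k R (LaurentPolynomial k)) : Prop :=
  ∀ (D : Type u) [CommRing D] [Algebra k D] (z₁ z₂ : Pts k (LaurentPolynomial k) D),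
    Pts.map z₁.ofConv ell * Pts.map z₂.ofConv ell = Pts.map (z₁ * z₂).ofConv ell

theorem lift_comp_inclLeft {A B : Type u} [CommRing A] [Algebra k A] [CommRing B] [Algebra k B]
    (f : A →ₐ[k] D) (g : B →ₐ[k] D) :
    (Algebra.TensorProduct.lift f g (fun _ _ => Commute.all _ _)).comp
      Algebra.TensorProduct.includeLeft = f := AlgHom.ext fun x => by simp

theorem lift_comp_inclRight {A B : Type u} [CommRing A] [Algebra k A] [CommRing B] [Algebra k B]
    (f : A →ₐ[k] D) (g : B →ₐ[k] D) :
    (Algebra.TensorProduct.lift f g (fun _ _ => Commute.all _ _)).comp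
      Algebra.TensorProduct.includeRight = g := AlgHom.ext fun x => by simp

theorem isCochar_of_bialgHom (l : R →ₐc[k] LaurentPolynomial k) :
    IsCochar (.toConv (l : R →ₐ[k] LaurentPolynomial k) : Pts k R (LaurentPolynomial k)) := by
  intro D _ _ z₁ z₂
  exact WithConv.ext (AlgHom.convMul_comp_bialgHom_distrib z₁ z₂ l).symm

theorem SplitMaximalTorus.isCochar (T : SplitMaximalTorus k R) (lam : T.Coweight) :
    IsCochar (T.cochar lam) :=
  isCochar_of_bialgHom (lam.comp T.incl)

variable {ell : Pts k R (LaurentPolynomial k)}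

theorem IsCochar.commute (hell : IsCochar ell) (z₁ z₂ : LaurentPolynomial k →ₐ[k] D) :
    Pts.map z₁ ell * Pts.map z₂ ell = Pts.map z₂ ell * Pts.map z₁ ell := by
  have h1 := hell D (.toConv z₁) (.toConv z₂)
  have h2 := hell D (.toConv z₂) (.toConv z₁)
  rw [mul_comm] at h2
  exact h1.trans h2.symm

theorem IsCochar.map_counit (hell : IsCochar ell) :
    Pts.map (Bialgebra.counitAlgHom k (LaurentPolynomial k)) ell = 1 := by
  have := hell k 1 1
  rw [mul_one] at this
  exact mul_eq_left.1 this

theorem IsCochar.map_one_eq (hell : IsCochar ell) :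
    Pts.map (1 : Pts k (LaurentPolynomial k) D).ofConv ell = 1 := by
  have := hell D 1 1
  rw [mul_one] at this
  exact mul_eq_left.1 this

theorem IsCochar.map_inv_eq (hell : IsCochar ell) (z : Pts k (LaurentPolynomial k) D) :
    Pts.map (z⁻¹).ofConv ell = (Pts.map z.ofConv ell)⁻¹ := by
  rw [eq_inv_iff_mul_eq_one, hell D z⁻¹ z, inv_mul_cancel, hell.map_one_eq]

theorem IsCochar.inv (hell : IsCochar ell) : IsCochar ell⁻¹ := by
  intro D _ _ z₁ z₂
  rw [_root_.map_inv, _root_.map_inv, _root_.map_inv, ← mul_inv_rev, hell.commute, hell]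

/-- The homomorphism property at the universal pair of points of 𝔾_m is compatibility with
comultiplication. It allows representations of G to be restricted along λ. -/
theorem IsCochar.comul_comp (hell : IsCochar ell) :
    (Bialgebra.comulAlgHom k (LaurentPolynomial k)).comp ell.ofConv =
      (Algebra.TensorProduct.map ell.ofConv ell.ofConv).comp (Bialgebra.comulAlgHom k R) := by
  have h := hell (LaurentPolynomial k ⊗[k] LaurentPolynomial k)
    (.toConv Algebra.TensorProduct.includeLeft) (.toConv Algebra.TensorProduct.includeRight)
  refine AlgHom.ext fun x => ?_
  have h' := congrArg (fun p : Pts k R _ => p.ofConv x) h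
  simp only [Pts.mul_apply, Pts.map_apply] at h'
  rw [AlgHom.comp_apply, AlgHom.comp_apply]
  refine Eq.trans ?_ (h'.symm.trans ?_)
  · rw [Bialgebra.comulAlgHom_apply]
    generalize ell.ofConv x = y
    generalize Coalgebra.comul (R := k) y = z
    induction z with
    | zero => rw [map_zero]
    | add x y hx hy => rw [map_add, ← hx, ← hy]
    | tmul x y =>
      rw [Algebra.TensorProduct.lift_tmul]
      simp only [Algebra.TensorProduct.includeLeft_apply, Algebra.TensorProduct.includeRight_apply,
        Algebra.TensorProduct.tmul_mul_tmul, mul_one, one_mul]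
  · rw [Bialgebra.comulAlgHom_apply]
    generalize Coalgebra.comul (R := k) x = z
    induction z with
    | zero => simp
    | add x y hx hy => simp only [map_add, hx, hy]
    | tmul x y => simp

variable (ell) in
/-- The coaction of `𝔾_m` on `k[G]` for the action `g ↦ λ(T) g λ(T)⁻¹` on `G`. -/
def adj : R →ₐ[k] R ⊗[k] LaurentPolynomial k :=
  (Pts.map (Algebra.TensorProduct.includeRight : LaurentPolynomial k →ₐ[k] _) ell *
    Pts.map Algebra.TensorProduct.includeLeft (Pts.univ k R) *
    (Pts.map Algebra.TensorProduct.includeRight ell)⁻¹ :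
      Pts k R (R ⊗[k] LaurentPolynomial k)).ofConv

theorem map_adj (f : R ⊗[k] LaurentPolynomial k →ₐ[k] D) :
    Pts.map f (.toConv (adj ell)) =
      Pts.map (f.comp Algebra.TensorProduct.includeRight) ell *
      Pts.map (f.comp Algebra.TensorProduct.includeLeft) (Pts.univ k R) *
      (Pts.map (f.comp Algebra.TensorProduct.includeRight) ell)⁻¹ := by
  rw [adj, WithConv.toConv_ofConv, map_mul, map_mul, _root_.map_inv, Pts.map_map, Pts.map_map]

theorem conj_apply (z : LaurentPolynomial k →ₐ[k] D) (g : Pts k R D) (x : R) :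
    (Pts.map z ell * g * (Pts.map z ell)⁻¹).ofConv x =
      Algebra.TensorProduct.lift g.ofConv z (fun _ _ => Commute.all _ _) (adj ell x) := by
  have := map_adj (ell := ell)
    (Algebra.TensorProduct.lift g.ofConv z (fun _ _ => Commute.all _ _))
  rw [lift_comp_inclRight, lift_comp_inclLeft, Pts.map_univ] at this
  exact congrArg (fun p : Pts k R D => p.ofConv x) this.symm

variable (ell) in
/-- The functions on `G` of weight `n`, for the action of `𝔾_m` on `G` by conjugation. -/
def wt (n : ℤ) : Submodule k R where
  carrier := {x | adj ell x = x ⊗ₜ LaurentPolynomial.T n}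
  add_mem' {x y} hx hy := by
    rw [Set.mem_ofPred_eq] at *
    rw [map_add, hx, hy, add_tmul]
  zero_mem' := by simp
  smul_mem' c x hx := by
    rw [Set.mem_ofPred_eq] at *
    rw [map_smul, hx, smul_tmul']

theorem mem_wt {n : ℤ} {x : R} : x ∈ wt ell n ↔ adj ell x = x ⊗ₜ LaurentPolynomial.T n := Iff.rfl

theorem conj_apply_of_mem (z : LaurentPolynomial k →ₐ[k] D) (g : Pts k R D) {x : R} {n : ℤ}
    (hx : x ∈ wt ell n) :
    (Pts.map z ell * g * (Pts.map z ell)⁻¹).ofConv x = z (LaurentPolynomial.T n) * g.ofConv x := by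
  rw [conj_apply, mem_wt.1 hx, Algebra.TensorProduct.lift_tmul, mul_comm]

theorem mul_mem_wt {p q : ℤ} {x y : R} (hx : x ∈ wt ell p) (hy : y ∈ wt ell q) :
    x * y ∈ wt ell (p + q) := by
  rw [mem_wt, map_mul, mem_wt.1 hx, mem_wt.1 hy, Algebra.TensorProduct.tmul_mul_tmul,
    LaurentPolynomial.T_add]

theorem one_mem_wt : (1 : R) ∈ wt ell 0 := by
  rw [mem_wt, map_one]
  rfl

theorem IsCochar.comp_adj_eq (hell : IsCochar ell) (i₀ : R →ₐ[k] D)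
    (i₁ i₂ : LaurentPolynomial k →ₐ[k] D) (F₁ F₂ : R ⊗[k] LaurentPolynomial k →ₐ[k] D)
    (h₁ : ∀ y, F₁ (1 ⊗ₜ y) = i₂ y)
    (h₂ : ∀ y, F₁ (y ⊗ₜ 1) =
      Algebra.TensorProduct.lift i₀ i₁ (fun _ _ => Commute.all _ _) (adj ell y))
    (h₃ : ∀ y, F₂ (1 ⊗ₜ y) = Algebra.TensorProduct.lift i₁ i₂ (fun _ _ => Commute.all _ _)
      (Coalgebra.comul (R := k) y))
    (h₄ : ∀ y, F₂ (y ⊗ₜ 1) = i₀ y) : F₁.comp (adj ell) = F₂.comp (adj ell) := by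
  have e1 : F₁.comp Algebra.TensorProduct.includeRight = i₂ := AlgHom.ext h₁
  have e2 : F₁.comp Algebra.TensorProduct.includeLeft =
    (Algebra.TensorProduct.lift i₀ i₁ (fun _ _ => Commute.all _ _)).comp (adj ell) := AlgHom.ext h₂
  have e3 : F₂.comp Algebra.TensorProduct.includeRight =
      ((.toConv i₁ : Pts k (LaurentPolynomial k) D) * .toConv i₂).ofConv :=
    AlgHom.ext fun y => (h₃ y).trans (Pts.mul_apply _ _ _).symm
  have e4 : F₂.comp Algebra.TensorProduct.includeLeft = i₀ := AlgHom.ext h₄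
  have e5 := map_adj (ell := ell) (Algebra.TensorProduct.lift i₀ i₁ (fun _ _ => Commute.all _ _))
  rw [lift_comp_inclRight, lift_comp_inclLeft] at e5
  have h1 := map_adj (ell := ell) F₁
  have h2 := map_adj (ell := ell) F₂
  rw [e1, e2, ← Pts.map_map, Pts.map_toConv_univ] at h1
  rw [e3, e4, ← hell] at h2
  have h3 : Pts.map F₁ (.toConv (adj ell)) = Pts.map F₂ (.toConv (adj ell)) := by
    rw [h1, h2, e5]
    simp only
    rw [hell.commute i₁ i₂]
    group
  exact congrArg WithConv.ofConv h3

/-- Conjugation makes R a comodule over k[T, T⁻¹]: coassociativity is `comp_adj_eq`, and the counit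
axiom is λ(1) = 1. So `mem_span_weightVectors` applies. -/
theorem IsCochar.span_wt (hell : IsCochar ell) : ⨆ n, wt ell n = ⊤ := by
  rw [eq_top_iff]
  intro x _
  have hco : (Algebra.TensorProduct.assoc k k k R (LaurentPolynomial k)
        (LaurentPolynomial k)).toAlgHom.comp
      ((Algebra.TensorProduct.map (adj ell) (AlgHom.id k _)).comp (adj ell)) =
      (Algebra.TensorProduct.map (AlgHom.id k R)
        (Bialgebra.comulAlgHom k (LaurentPolynomial k))).comp (adj ell) := by
    rw [← AlgHom.comp_assoc]
    refine hell.comp_adj_eq (D := R ⊗[k] (LaurentPolynomial k ⊗[k] LaurentPolynomial k))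
      Algebra.TensorProduct.includeLeft
      (Algebra.TensorProduct.includeRight.comp Algebra.TensorProduct.includeLeft)
      (Algebra.TensorProduct.includeRight.comp Algebra.TensorProduct.includeRight) _ _
      (fun y => ?_) (fun y => ?_) (fun y => ?_) (fun y => ?_)
    · simp [Algebra.TensorProduct.one_def]
    · simp only [AlgHom.comp_apply, Algebra.TensorProduct.map_tmul, _root_.map_one]
      generalize adj ell y = w
      induction w with
      | zero => simp
      | add x y hx hy => simp only [map_add, add_tmul, hx, hy]
      | tmul a b => simp
    · rw [Algebra.TensorProduct.map_tmul, _root_.map_one, Bialgebra.comulAlgHom_apply]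
      generalize Coalgebra.comul (R := k) y = w
      induction w with
      | zero => simp
      | add x y hx hy => simp only [map_add, tmul_add, hx, hy]
      | tmul a b => simp
    · simp [Algebra.TensorProduct.one_def]
  have hcu : (Algebra.TensorProduct.rid k k R).toAlgHom.comp
      ((Algebra.TensorProduct.map (AlgHom.id k R)
        (Bialgebra.counitAlgHom k (LaurentPolynomial k))).comp (adj ell)) = AlgHom.id k R := by
    have h1 := map_adj (ell := ell) ((Algebra.TensorProduct.rid k k R).toAlgHom.comp
      (Algebra.TensorProduct.map (AlgHom.id k R)
        (Bialgebra.counitAlgHom k (LaurentPolynomial k))))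
    have e1 : ((Algebra.TensorProduct.rid k k R).toAlgHom.comp
      (Algebra.TensorProduct.map (AlgHom.id k R)
        (Bialgebra.counitAlgHom k (LaurentPolynomial k)))).comp
        Algebra.TensorProduct.includeRight = (1 : Pts k (LaurentPolynomial k) R).ofConv := by
      refine AlgHom.ext fun y => ?_
      rw [Pts.one_apply]
      simp [Algebra.algebraMap_eq_smul_one]
    have e2 : ((Algebra.TensorProduct.rid k k R).toAlgHom.comp
      (Algebra.TensorProduct.map (AlgHom.id k R)
        (Bialgebra.counitAlgHom k (LaurentPolynomial k)))).comp
        Algebra.TensorProduct.includeLeft = AlgHom.id k R := by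
      ext
      simp
    rw [e1, e2, hell.map_one_eq] at h1
    simp only [one_mul, inv_one, mul_one] at h1
    exact congrArg WithConv.ofConv h1
  have h := mem_span_weightVectors (adj ell).toLinearMap
    (LinearMap.ext fun y => by
      refine Eq.trans ?_ ((congrArg (fun f : R →ₐ[k] _ => f y) hco).trans ?_)
      · simp only [LinearMap.comp_apply, AlgHom.comp_apply]
        rfl
      · rfl)
    (LinearMap.ext fun y => by
      exact congrArg (fun f : R →ₐ[k] _ => f y) hcu) x
  refine Submodule.span_le.2 ?_ h
  rintro y ⟨n, hy⟩
  exact Submodule.mem_iSup_of_mem n hy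

/-- Conjugation fixes the unit element, whence T^n ε(x) = ε(x). -/
theorem counit_eq_zero_of_mem_wt {n : ℤ} (hn : n ≠ 0) {x : R}
    (hx : x ∈ wt ell n) : Coalgebra.counit (R := k) x = 0 := by
  have h := conj_apply_of_mem (AlgHom.id k (LaurentPolynomial k)) 1 hx
  rw [mul_one, mul_inv_cancel, Pts.one_apply] at h
  by_contra h0
  have h2 : (LaurentPolynomial.T n - 1 : LaurentPolynomial k) = 0 := by
    have h3 : (LaurentPolynomial.T n - 1 : LaurentPolynomial k) *
        algebraMap k _ (Coalgebra.counit (R := k) x) = 0 := by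
      rw [sub_mul, one_mul, sub_eq_zero]
      exact h.symm
    have h4 : IsUnit (algebraMap k (LaurentPolynomial k) (Coalgebra.counit (R := k) x)) :=
      (IsUnit.mk0 _ h0).map _
    exact (h4.mul_left_eq_zero).1 h3
  have h5 := congrArg (fun z : LaurentPolynomial k => z.coeff n) (sub_eq_zero.1 h2)
  rw [← LaurentPolynomial.T_zero] at h5
  simp [LaurentPolynomial.T, -LaurentPolynomial.single_eq_C_mul_T,
    AddMonoidAlgebra.coeff_single, hn.symm] at h5

variable (k R) in
/-- The augmentation ideal of `k[G]`, as a subspace. -/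
def augm : Submodule k R := LinearMap.ker (Coalgebra.counit (R := k) (A := R))

theorem mem_augm {x : R} : x ∈ augm k R ↔ Coalgebra.counit (R := k) x = 0 := Iff.rfl

/-- Subtracting its constant ε(x) from a weight vector leaves a weight vector: constants have weight
0, and ε vanishes on all other weights. -/
theorem IsCochar.augm_le_iSup (hell : IsCochar ell) : augm k R ≤ ⨆ n, wt ell n ⊓ augm k R := by
  have key : ∀ x : R, x - algebraMap k R (Coalgebra.counit (R := k) x) ∈
      ⨆ n, wt ell n ⊓ augm k R := by
    intro x
    have hx : x ∈ ⨆ n, wt ell n := by rw [hell.span_wt]; trivial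
    induction hx using Submodule.iSup_induction' with
    | mem n y hy =>
      refine Submodule.mem_iSup_of_mem n ⟨?_, ?_⟩
      · refine Submodule.sub_mem _ hy ?_
        by_cases hn : n = 0
        · rw [hn, Algebra.algebraMap_eq_smul_one]
          exact Submodule.smul_mem _ _ one_mem_wt
        · rw [counit_eq_zero_of_mem_wt hn hy, map_zero]
          exact Submodule.zero_mem _
      · rw [SetLike.mem_coe, mem_augm, map_sub, Bialgebra.counit_algebraMap, sub_self]
    | zero => simp
    | add y z _ _ hy hz =>
      have : y + z - algebraMap k R (Coalgebra.counit (R := k) (y + z)) =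
        (y - algebraMap k R (Coalgebra.counit (R := k) y)) +
        (z - algebraMap k R (Coalgebra.counit (R := k) z)) := by
        rw [map_add, map_add]
        ring
      rw [this]
      exact Submodule.add_mem _ hy hz
  intro x hx
  simpa [mem_augm.1 hx] using key x

theorem IsCochar.mem_wt_inv (hell : IsCochar ell) {n : ℤ} {x : R} (hx : x ∈ wt ell n) :
    x ∈ wt ell⁻¹ (-n) := by
  let z : Pts k (LaurentPolynomial k) (R ⊗[k] LaurentPolynomial k) :=
    .toConv Algebra.TensorProduct.includeRight
  have h := conj_apply_of_mem (z⁻¹).ofConv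
    (Pts.map Algebra.TensorProduct.includeLeft (Pts.univ k R)) hx
  rw [hell.map_inv_eq, Pts.inv_apply, LaurentPolynomial.antipode_T] at h
  rw [mem_wt, adj, _root_.map_inv]
  refine h.trans ?_
  rw [Pts.map_apply]
  simp [z, Pts.univ]

end Conjugation

end

section

/-! ### Equations of M_λ, P_λ and U_λ in terms of weights. -/

section Membership

variable {k : Type u} [Field k] {R : Type u} [CommRing R] [HopfAlgebra k R]
variable {A : Type u} [CommRing A] [Algebra k A]
variable {ell : Pts k R (LaurentPolynomial k)}

theorem IsCochar.eq_top_of_augm_le (hell : IsCochar ell) {N : Submodule k R} (h1 : 1 ∈ N)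
    (h : ∀ n, wt ell n ⊓ augm k R ≤ N) : N = ⊤ := by
  rw [eq_top_iff]
  intro x _
  have h2 : x - algebraMap k R (Coalgebra.counit (R := k) x) ∈ augm k R := by
    rw [mem_augm, map_sub, Bialgebra.counit_algebraMap, sub_self]
  rw [← sub_add_cancel x (algebraMap k R (Coalgebra.counit (R := k) x))]
  refine N.add_mem (iSup_le h (hell.augm_le_iSup h2)) ?_
  rw [Algebra.algebraMap_eq_smul_one]
  exact N.smul_mem _ h1

theorem IsCochar.eq_top_of_le (hell : IsCochar ell) {N : Submodule k R}
    (h : ∀ n, wt ell n ≤ N) : N = ⊤ :=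
  hell.eq_top_of_augm_le (h 0 one_mem_wt) fun n => inf_le_left.trans (h n)

theorem IsCochar.ext_wt (hell : IsCochar ell) {g h : Pts k R A}
    (H : ∀ n, ∀ x ∈ wt ell n, g.ofConv x = h.ofConv x) : g = h := by
  have := hell.eq_top_of_le (N := LinearMap.eqLocus g.ofConv.toLinearMap h.ofConv.toLinearMap)
    fun n x hx => H n x hx
  exact Pts.ext fun x => this.ge (Submodule.mem_top : x ∈ ⊤)

theorem IsCochar.ext_augm (hell : IsCochar ell) {g h : Pts k R A}
    (H : ∀ n, ∀ x ∈ wt ell n ⊓ augm k R, g.ofConv x = h.ofConv x) : g = h := by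
  have := hell.eq_top_of_augm_le
    (N := LinearMap.eqLocus g.ofConv.toLinearMap h.ofConv.toLinearMap)
    ((_root_.map_one g.ofConv).trans (_root_.map_one h.ofConv).symm) fun n x hx => H n x hx
  exact Pts.ext fun x => this.ge (Submodule.mem_top : x ∈ ⊤)

theorem IsCochar.wt_inv (hell : IsCochar ell) (n : ℤ) : wt ell⁻¹ n = wt ell (-n) := by
  refine le_antisymm (fun x hx => ?_) (fun x hx => ?_)
  · simpa using hell.inv.mem_wt_inv hx
  · simpa using hell.mem_wt_inv hx

theorem laurentBaseChange_T (n : ℤ) :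
    laurentBaseChange k A (LaurentPolynomial.T n) = LaurentPolynomial.T n := by
  simp [laurentBaseChange, LaurentPolynomial.T, -LaurentPolynomial.single_eq_C_mul_T]

theorem conjBy_apply {n : ℤ} {x : R} (hx : x ∈ wt ell n) (g : Pts k R A) :
    (conjBy A ell g).ofConv x = LaurentPolynomial.T n * LaurentPolynomial.C (g.ofConv x) := by
  refine (conj_apply_of_mem (laurentBaseChange k A) _ hx).trans ?_
  rw [laurentBaseChange_T]
  rfl

theorem T_mul_C_eq_C {n : ℤ} (hn : n ≠ 0) {a : A}
    (h : (LaurentPolynomial.T n * LaurentPolynomial.C a : LaurentPolynomial A) =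
      LaurentPolynomial.C a) : a = 0 := by
  rw [mul_comm, ← LaurentPolynomial.single_eq_C_mul_T, ← LaurentPolynomial.single_eq_C] at h
  have := congrArg (fun z : LaurentPolynomial A => z.coeff n) h
  simpa [AddMonoidAlgebra.coeff_single, Finsupp.single_apply, hn.symm,
    -LaurentPolynomial.single_eq_C_mul_T] using this

/-- A function f of weight n takes the value T^n f(g) at λ(T) g λ(T)⁻¹, which equals f(g) for n ≠ 0
only if f(g) = 0. -/
theorem IsCochar.mem_levi_iff (hell : IsCochar ell) {g : Pts k R A} :
    g ∈ levi A ell ↔ ∀ n ≠ 0, ∀ x ∈ wt ell n, g.ofConv x = 0 := by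
  constructor
  · intro h n hn x hx
    have h1 := congrArg (fun p : Pts k R _ => p.ofConv x) h
    rw [conjBy_apply hx] at h1
    exact T_mul_C_eq_C hn h1
  · intro h
    refine hell.ext_wt fun n x hx => ?_
    rw [conjBy_apply hx]
    by_cases hn : n = 0
    · rw [hn, LaurentPolynomial.T_zero, one_mul]
      rfl
    · rw [Pts.map_apply, h n hn x hx]
      simp

theorem IsCochar.levi_inv (hell : IsCochar ell) : levi A ell⁻¹ = levi A ell := by
  ext g
  rw [hell.mem_levi_iff, hell.inv.mem_levi_iff]
  constructor
  · intro h n hn x hx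
    exact h (-n) (neg_ne_zero.2 hn) x (by rwa [hell.wt_inv, neg_neg])
  · intro h n hn x hx
    exact h (-n) (neg_ne_zero.2 hn) x (by rwa [hell.wt_inv] at hx)

theorem IsCochar.levi_ext (hell : IsCochar ell) {g h : Pts k R A} (hg : g ∈ levi A ell)
    (hh : h ∈ levi A ell) (H : ∀ x ∈ wt ell 0, g.ofConv x = h.ofConv x) : g = h := by
  rw [hell.mem_levi_iff] at hg hh
  refine hell.ext_wt fun n x hx => ?_
  by_cases hn : n = 0
  · subst hn
    exact H x hx
  · rw [hg n hn x hx, hh n hn x hx]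

theorem polyToLaurent_injective : Function.Injective (polyToLaurent k A) :=
  Polynomial.toLaurent_injective

/-- The limit `lim_{T → 0} λ(T) p λ(T)⁻¹`. -/
theorem IsCochar.exists_limit (hell : IsCochar ell) {p : Pts k R A}
    (hp : ∀ n < 0, ∀ x ∈ wt ell n, p.ofConv x = 0) : ∃ P : Pts k R (Polynomial A),
      Pts.map (polyToLaurent k A) P = conjBy A ell p ∧
      ∀ n, ∀ x ∈ wt ell n, (Pts.map (evalZero k A) P).ofConv x =
        if n = 0 then p.ofConv x else 0 := by
  -- The value at λ(T) p λ(T)⁻¹ is T^n f(p). It is a polynomial, since f(p) = 0 for n < 0, and at T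
  -- = 0 only weight 0 survives.
  have key : ∀ n, ∀ x ∈ wt ell n, ∃ q : Polynomial A,
      polyToLaurent k A q = (conjBy A ell p).ofConv x ∧
      evalZero k A q = if n = 0 then p.ofConv x else 0 := by
    intro n x hx
    rw [conjBy_apply hx]
    by_cases hn : n < 0
    · refine ⟨0, ?_⟩
      rw [hp n hn x hx]
      simp [hn.ne]
    · obtain ⟨m, rfl⟩ := Int.eq_ofNat_of_zero_le (not_lt.1 hn)
      refine ⟨Polynomial.X ^ m * Polynomial.C (p.ofConv x), ?_, ?_⟩
      · simp [polyToLaurent]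
      · simp [evalZero]
        split_ifs with h <;> simp [h]
  obtain ⟨P, hP⟩ := Pts.exists_map_eq polyToLaurent_injective (conjBy A ell p) (fun x => by
    have := hell.eq_top_of_le (N := (LinearMap.range (polyToLaurent k A).toLinearMap).comap
      (conjBy A ell p).ofConv.toLinearMap) fun n x hx => by
        obtain ⟨q, hq, -⟩ := key n x hx
        exact ⟨q, hq⟩
    exact this.ge (Submodule.mem_top : x ∈ ⊤))
  refine ⟨P, hP, fun n x hx => ?_⟩
  obtain ⟨q, hq, hq'⟩ := key n x hx
  rw [← hP, Pts.map_apply] at hq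
  rw [← hq', polyToLaurent_injective hq, Pts.map_apply]

/-- The limit is 1 exactly when T^n f(g) is a polynomial without constant term for every f of weight
n vanishing at the unit element. This forces f(g) = 0 for n ≤ 0. Constants, of weight 0, have to be
excluded. -/
theorem IsCochar.mem_unipotentRadical_iff (hell : IsCochar ell) {g : Pts k R A} :
    g ∈ unipotentRadical A ell ↔ ∀ n ≤ 0, ∀ x ∈ wt ell n ⊓ augm k R, g.ofConv x = 0 := by
  constructor
  · rintro ⟨p, hp, hpg⟩ n hn x ⟨hx, hx'⟩
    have h1 := congrArg (fun p : Pts k R _ => p.ofConv x) hpg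
    rw [conjBy_apply hx] at h1
    have h2 : evalZero k A (p.ofConv x) = 0 := by
      have := congrArg (fun p : Pts k R _ => p.ofConv x) (MonoidHom.mem_ker.1 hp)
      refine this.trans ?_
      rw [Pts.one_apply, mem_augm.1 hx', map_zero]
    obtain ⟨m, rfl⟩ : ∃ m : ℕ, n = -(m : ℤ) := ⟨n.natAbs, by omega⟩
    -- Multiplication by T^m clears the denominator T^n = T^(-m), so that both sides can be compared
    -- at T = 0.
    have h3 : polyToLaurent k A (Polynomial.X ^ m * p.ofConv x) =
        polyToLaurent k A (Polynomial.C (g.ofConv x)) := by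
      rw [map_mul]
      refine (congrArg (fun z => polyToLaurent k A (Polynomial.X ^ m) * z) h1).trans ?_
      simp only [polyToLaurent, AlgHom.restrictScalars_apply, Polynomial.toLaurentAlg_apply,
        Polynomial.toLaurent_X_pow, Polynomial.toLaurent_C]
      rw [← mul_assoc, ← LaurentPolynomial.T_add]
      simp
    have h4 := congrArg (evalZero k A) (polyToLaurent_injective h3)
    rw [map_mul, h2, mul_zero] at h4
    simpa [evalZero] using h4.symm
  · intro h
    have hp : ∀ n < 0, ∀ x ∈ wt ell n, g.ofConv x = 0 := fun n hn x hx =>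
      h n hn.le x ⟨hx, counit_eq_zero_of_mem_wt hn.ne hx⟩
    obtain ⟨P, hP, hP'⟩ := hell.exists_limit hp
    refine ⟨P, MonoidHom.mem_ker.2 (hell.ext_augm fun n x hx => ?_), hP⟩
    rw [hP' n x hx.1, Pts.one_apply, mem_augm.1 hx.2, map_zero]
    split_ifs with hn
    · exact h n hn.le x hx
    · rfl

/-- The hypothesis says that p lies in P_λ. Its Levi component m is the limit of λ(T) p λ(T)⁻¹ at T
= 0. As m commutes with λ, the limit for p m⁻¹ is 1. -/
theorem IsCochar.exists_levi (hell : IsCochar ell) {p : Pts k R A}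
    (hp : ∀ n < 0, ∀ x ∈ wt ell n, p.ofConv x = 0) : ∃ m ∈ levi A ell,
      p * m⁻¹ ∈ unipotentRadical A ell ∧ ∀ x ∈ wt ell 0, m.ofConv x = p.ofConv x := by
  obtain ⟨P, hP, hP'⟩ := hell.exists_limit hp
  have hm : Pts.map (evalZero k A) P ∈ levi A ell := by
    rw [hell.mem_levi_iff]
    intro n hn x hx
    rw [hP' n x hx, if_neg hn]
  refine ⟨_, hm, ?_, fun x hx => by rw [hP' 0 x hx, if_pos rfl]⟩
  let c : A →ₐ[k] Polynomial A := IsScalarTower.toAlgHom k A (Polynomial A)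
  refine ⟨P * (Pts.map c (Pts.map (evalZero k A) P))⁻¹, ?_, ?_⟩
  · have hc : (evalZero k A).comp c = AlgHom.id k A := AlgHom.ext fun a => by
      simp [evalZero, c]
    rw [SetLike.mem_coe, MonoidHom.mem_ker, map_mul, _root_.map_inv, Pts.map_map, hc, Pts.map_id,
      mul_inv_cancel]
  · have hc : (polyToLaurent k A).comp c = IsScalarTower.toAlgHom k A (LaurentPolynomial A) :=
      AlgHom.ext fun a => by
        simp only [polyToLaurent, c, AlgHom.comp_apply, IsScalarTower.coe_toAlgHom',
          AlgHom.restrictScalars_apply]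
        exact (Polynomial.toLaurentAlg (R := A)).commutes a
    rw [map_mul, _root_.map_inv, hP, Pts.map_map, hc, map_mul, _root_.map_inv]
    congr 2
    exact hm.symm

end Membership

end

section

/-! ### Homogeneous coordinates of G at the unit element. -/

section Coordinates

variable {k : Type u} [Field k] {R : Type u} [CommRing R] [HopfAlgebra k R]
variable {ell : Pts k R (LaurentPolynomial k)}

variable (ell) in
/-- Homogeneous local coordinates of `G` at the unit element: elements `x i` of the augmentation
ideal whose classes form a basis of the cotangent space, with the dual basis `ξ i`. -/
structure Coords where
  ι : Type u
  [fintype : Fintype ι]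
  [decEq : DecidableEq ι]
  deg : ι → ℤ
  x : ι → R
  x_wt : ∀ i, x i ∈ wt ell (deg i)
  x_augm : ∀ i, x i ∈ augm k R
  ξ : ι → R →ₗ[k] k
  ξ_one : ∀ i, ξ i 1 = 0
  ξ_mul : ∀ i, ∀ f ∈ augm k R, ∀ g ∈ augm k R, ξ i (f * g) = 0
  ξ_x : ∀ i j, ξ i (x j) = if i = j then 1 else 0
  sub_mem : ∀ f ∈ augm k R, f - ∑ i, ξ i f • x i ∈ augm k R * augm k R

attribute [instance] Coords.fintype Coords.decEq

theorem sub_algebraMap_counit_mem (f : R) :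
    f - algebraMap k R (Coalgebra.counit (R := k) f) ∈ augm k R := by
  rw [mem_augm, map_sub, Bialgebra.counit_algebraMap, sub_self]

theorem mul_mem_augm {f : R} (hf : f ∈ augm k R) (g : R) : g * f ∈ augm k R := by
  rw [mem_augm, Bialgebra.counit_mul, mem_augm.1 hf, mul_zero]

theorem augm_mul_augm_le : augm k R * augm k R ≤ augm k R :=
  Submodule.mul_le.2 fun _ _ _ hg => mul_mem_augm hg _

/-- The augmentation ideal I is finitely generated because R is noetherian. Since r y ≡ ε(r) y
modulo I², ideal generators also span I/I² over k. -/
theorem exists_finite_augm_le [Algebra.FiniteType k R] : ∃ s : Finset R,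
    (s : Set R) ⊆ augm k R ∧ augm k R ≤ Submodule.span k (s : Set R) ⊔ augm k R * augm k R := by
  have : IsNoetherianRing R := Algebra.FiniteType.isNoetherianRing k R
  obtain ⟨s, hs⟩ := (IsNoetherian.noetherian (R := R) (M := R)
    (RingHom.ker (Bialgebra.counitAlgHom k R)))
  have hs' : (s : Set R) ⊆ augm k R := fun x hx => by
    have : x ∈ RingHom.ker (Bialgebra.counitAlgHom k R) := hs ▸ Submodule.subset_span hx
    exact this
  refine ⟨s, hs', fun x hx => ?_⟩
  have hx' : x ∈ Submodule.span R (s : Set R) := hs ▸ hx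
  clear hx
  induction hx' using Submodule.span_induction with
  | mem y hy => exact Submodule.mem_sup_left (Submodule.subset_span hy)
  | zero => exact Submodule.zero_mem _
  | add y z _ _ hy hz => exact Submodule.add_mem _ hy hz
  | smul r y hy hyr =>
    have hy' : y ∈ augm k R := by
      have : y ∈ RingHom.ker (Bialgebra.counitAlgHom k R) := hs ▸ hy
      exact this
    have : r • y = Coalgebra.counit (R := k) r • y +
        (r - algebraMap k R (Coalgebra.counit (R := k) r)) * y := by
      rw [smul_eq_mul, Algebra.smul_def]
      ring
    rw [this]
    exact Submodule.add_mem _ (Submodule.smul_mem _ _ hyr)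
      (Submodule.mem_sup_right (Submodule.mul_mem_mul (sub_algebraMap_counit_mem r) hy'))

/-- The quotient of k[G] by k + I² is the cotangent space I/I². Being spanned by classes of weight
vectors of I, it has a basis of such classes. -/
theorem IsCochar.nonempty_coords (hell : IsCochar ell) [Algebra.FiniteType k R] :
    Nonempty (Coords ell) := by
  classical
  let N : Submodule k R := Submodule.span k {1} ⊔ augm k R * augm k R
  let W := R ⧸ N
  have hN1 : (1 : R) ∈ N := Submodule.mem_sup_left (Submodule.mem_span_singleton_self _)
  have hN2 : augm k R * augm k R ≤ N := le_sup_right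
  let S : Set W := {w | ∃ n, ∃ f ∈ wt ell n ⊓ augm k R, N.mkQ f = w}
  have hS : ⊤ ≤ Submodule.span k S := by
    rw [← Submodule.range_mkQ N, LinearMap.range_eq_map, Submodule.map_le_iff_le_comap]
    refine (hell.eq_top_of_augm_le ?_ fun n f hf => ?_).ge
    · rw [Submodule.mem_comap, show N.mkQ 1 = 0 from (Submodule.Quotient.mk_eq_zero N).2 hN1]
      exact Submodule.zero_mem _
    · exact Submodule.subset_span ⟨n, f, hf, rfl⟩
  have hfin : Module.Finite k W := by
    obtain ⟨s, -, hs⟩ := exists_finite_augm_le (k := k) (R := R)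
    refine Module.finite_def.2 ⟨s.image N.mkQ, ?_⟩
    rw [eq_top_iff, ← Submodule.range_mkQ N, LinearMap.range_eq_map,
      Submodule.map_le_iff_le_comap]
    intro f _
    have h1 : N.mkQ f = N.mkQ (f - algebraMap k R (Coalgebra.counit (R := k) f)) := by
      rw [map_sub, eq_sub_iff_add_eq, add_eq_left, Algebra.algebraMap_eq_smul_one, map_smul]
      rw [show N.mkQ 1 = 0 from (Submodule.Quotient.mk_eq_zero N).2 hN1, smul_zero]
    rw [Submodule.mem_comap, h1]
    obtain ⟨y, hy, z, hz, hyz⟩ := Submodule.mem_sup.1 (hs (sub_algebraMap_counit_mem (k := k) f))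
    rw [← hyz, map_add, show N.mkQ z = 0 from (Submodule.Quotient.mk_eq_zero N).2 (hN2 hz),
      add_zero, Finset.coe_image, ← Submodule.map_span]
    exact Submodule.mem_map_of_mem hy
  let b := Module.Basis.ofSpan hS
  have : Fintype ((linearIndepOn_empty k id).extend (Set.empty_subset S)) :=
    FiniteDimensional.fintypeBasisIndex b
  have hb : ∀ i, ∃ n, ∃ f ∈ wt ell n ⊓ augm k R, N.mkQ f = b i := fun i =>
    Module.Basis.ofSpan_subset hS (Set.mem_range_self i)
  choose n x hx hxb using hb
  refine ⟨{
    ι := _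
    deg := n
    x := x
    x_wt := fun i => (hx i).1
    x_augm := fun i => (hx i).2
    ξ := fun i => b.coord i ∘ₗ N.mkQ
    ξ_one := fun i => by
      rw [LinearMap.comp_apply, show N.mkQ 1 = 0 from (Submodule.Quotient.mk_eq_zero N).2 hN1,
        map_zero]
    ξ_mul := fun i f hf g hg => by
      rw [LinearMap.comp_apply, show N.mkQ (f * g) = 0 from (Submodule.Quotient.mk_eq_zero N).2
        (hN2 (Submodule.mul_mem_mul hf hg)), map_zero]
    ξ_x := fun i j => by
      rw [LinearMap.comp_apply, hxb, Module.Basis.coord_apply, Module.Basis.repr_self,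
        Finsupp.single_apply]
      simp only [eq_comm]
    sub_mem := fun f hf => ?_ }⟩
  have h1 : f - ∑ i, (b.coord i ∘ₗ N.mkQ) f • x i ∈ N := by
    rw [← Submodule.Quotient.mk_eq_zero N, ← Submodule.mkQ_apply, map_sub, map_sum, sub_eq_zero]
    simp only [map_smul, hxb, LinearMap.comp_apply, Module.Basis.coord_apply]
    exact (b.sum_repr _).symm
  obtain ⟨y, hy, z, hz, hyz⟩ := Submodule.mem_sup.1 h1
  obtain ⟨c, rfl⟩ := Submodule.mem_span_singleton.1 hy
  have h2 : f - ∑ i, (b.coord i ∘ₗ N.mkQ) f • x i ∈ augm k R :=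
    Submodule.sub_mem _ hf (Submodule.sum_mem _ fun i _ => Submodule.smul_mem _ _ (hx i).2)
  rw [← hyz, mem_augm, map_add, mem_augm.1 (augm_mul_augm_le hz), map_smul,
    Bialgebra.counit_one, add_zero, smul_eq_mul, mul_one] at h2
  rw [← hyz, h2, zero_smul, zero_add]
  exact hz

/-- Each ξ i is a tangent vector at the unit element, as it vanishes on 1 and on I². -/
theorem Coords.ξ_mul' (X : Coords ell) (i : X.ι) (f g : R) :
    X.ξ i (f * g) = Coalgebra.counit (R := k) f * X.ξ i g +
      X.ξ i f * Coalgebra.counit (R := k) g := by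
  have h := X.ξ_mul i _ (sub_algebraMap_counit_mem (k := k) f) _
    (sub_algebraMap_counit_mem (k := k) g)
  have e : (f - algebraMap k R (Coalgebra.counit (R := k) f)) *
      (g - algebraMap k R (Coalgebra.counit (R := k) g)) =
      f * g - Coalgebra.counit (R := k) f • g - Coalgebra.counit (R := k) g • f +
      (Coalgebra.counit (R := k) f * Coalgebra.counit (R := k) g) • 1 := by
    simp only [Algebra.smul_def, map_mul]
    ring
  rw [e, map_add, map_sub, map_sub, map_smul, map_smul, map_smul, X.ξ_one] at h
  simp only [smul_eq_mul, mul_zero, add_zero] at h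
  linear_combination h

variable {S : Type u} [CommRing S] [Algebra k S]

/-- The homomorphism `g + ∑ ξ i • d i`. -/
def Coords.deform (X : Coords ell) (g : R →ₐ[k] S) (d : X.ι → S)
    (hd : ∀ i j, d i * d j = 0)
    (hg : ∀ i f, g f * d i = algebraMap k S (Coalgebra.counit (R := k) f) * d i) : R →ₐ[k] S :=
  AlgHom.ofLinearMap (g.toLinearMap + ∑ i, (LinearMap.toSpanSingleton k S (d i)) ∘ₗ X.ξ i)
    (by simp [X.ξ_one])
    (fun f f' => by
      have e : ∀ z, (g.toLinearMap + ∑ i, (LinearMap.toSpanSingleton k S (d i)) ∘ₗ X.ξ i) z =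
          g z + ∑ i, algebraMap k S (X.ξ i z) * d i := fun z => by
        simp [Algebra.smul_def]
      rw [e, e, e, map_mul]
      have h1 : (∑ i, algebraMap k S (X.ξ i f) * d i) * ∑ i, algebraMap k S (X.ξ i f') * d i =
          0 := by
        rw [Finset.sum_mul_sum]
        refine Finset.sum_eq_zero fun i _ => Finset.sum_eq_zero fun j _ => ?_
        linear_combination algebraMap k S (X.ξ i f) * algebraMap k S (X.ξ j f') * hd i j
      -- The Leibniz rule for ξ i applies, because values of g act on d i through the counit.
      have h2 : ∑ i, algebraMap k S (X.ξ i (f * f')) * d i =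
          g f * ∑ i, algebraMap k S (X.ξ i f') * d i +
          (∑ i, algebraMap k S (X.ξ i f) * d i) * g f' := by
        rw [Finset.mul_sum, Finset.sum_mul, ← Finset.sum_add_distrib]
        refine Finset.sum_congr rfl fun i _ => ?_
        rw [X.ξ_mul', map_add, map_mul, map_mul]
        linear_combination
          -algebraMap k S (X.ξ i f') * hg i f - algebraMap k S (X.ξ i f) * hg i f'
      rw [h2]
      linear_combination -h1)

theorem Coords.deform_apply (X : Coords ell) (g : R →ₐ[k] S) (d : X.ι → S) (hd hg) (z : R) :
    X.deform g d hd hg z = g z + ∑ i, algebraMap k S (X.ξ i z) * d i := by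
  simp [Coords.deform, Algebra.smul_def]

theorem Coords.deform_x (X : Coords ell) (g : R →ₐ[k] S) (d : X.ι → S) (hd hg) (i : X.ι) :
    X.deform g d hd hg (X.x i) = g (X.x i) + d i := by
  rw [X.deform_apply]
  simp [X.ξ_x]

end Coordinates

/-! ### Arcs starting at the unit element and their t-adic approximation. -/

section Arcs

variable {k : Type u} [Field k] {R : Type u} [CommRing R] [HopfAlgebra k R]
variable {ell : Pts k R (LaurentPolynomial k)} {B : Type u} [CommRing B] [Algebra k B]

variable (k R B) in
/-- The group of arcs in `G` starting at the unit element. -/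
abbrev arcs : Subgroup (Pts k R (PowerSeries B)) := (Pts.map (psEval k B)).ker

theorem mem_arcs {a : Pts k R (PowerSeries B)} :
    a ∈ arcs k R B ↔ ∀ f ∈ augm k R, PowerSeries.X ∣ a.ofConv f := by
  rw [MonoidHom.mem_ker]
  constructor
  · intro h f hf
    rw [PowerSeries.X_dvd_iff]
    have := congrArg (fun p : Pts k R B => p.ofConv f) h
    exact this.trans (by rw [Pts.one_apply, mem_augm.1 hf, map_zero])
  · intro h
    refine Pts.ext fun f => ?_
    have := h _ (sub_algebraMap_counit_mem (k := k) f)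
    rw [PowerSeries.X_dvd_iff, map_sub, map_sub, sub_eq_zero, AlgHom.commutes] at this
    refine Eq.trans this ?_
    rw [Pts.one_apply]
    exact (psEval k B).commutes _

/-- An arc is determined modulo `X ^ N` by its coordinates modulo `X ^ N`. -/
theorem Coords.dvd_sub (X : Coords ell) {a a' : Pts k R (PowerSeries B)} (ha : a ∈ arcs k R B)
    (ha' : a' ∈ arcs k R B) (N : ℕ)
    (h : ∀ i, PowerSeries.X ^ N ∣ a.ofConv (X.x i) - a'.ofConv (X.x i)) (f : R) :
    PowerSeries.X ^ N ∣ a.ofConv f - a'.ofConv f := by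
  induction N generalizing f with
  | zero => simp
  | succ N ih =>
    have ih' := ih fun i => (pow_dvd_pow _ N.le_succ).trans (h i)
    -- On I² one power of X is gained: the difference of two products is a sum of differences
    -- divisible by X^N times values divisible by X.
    have h2 : ∀ f ∈ augm k R * augm k R, PowerSeries.X ^ (N + 1) ∣ a.ofConv f - a'.ofConv f := by
      intro f hf
      induction hf using Submodule.mul_induction_on' with
      | mem_mul_mem f hf g hg =>
        have e : a.ofConv (f * g) - a'.ofConv (f * g) =
          (a.ofConv f - a'.ofConv f) * a.ofConv g + (a.ofConv g - a'.ofConv g) * a'.ofConv f := by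
          rw [map_mul, map_mul]
          ring
        rw [e, pow_succ]
        exact dvd_add (mul_dvd_mul (ih' f) (mem_arcs.1 ha g hg))
          (mul_dvd_mul (ih' g) (mem_arcs.1 ha' f hf))
      | add f _ g _ hf hg =>
        rw [map_add, map_add, add_sub_add_comm]
        exact dvd_add hf hg
    have h3 : ∀ f ∈ augm k R, PowerSeries.X ^ (N + 1) ∣ a.ofConv f - a'.ofConv f := by
      intro f hf
      have e : a.ofConv f - a'.ofConv f = (a.ofConv (f - ∑ i, X.ξ i f • X.x i) -
          a'.ofConv (f - ∑ i, X.ξ i f • X.x i)) +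
          ∑ i, X.ξ i f • (a.ofConv (X.x i) - a'.ofConv (X.x i)) := by
        simp only [map_sub, map_sum, map_smul, smul_sub, Finset.sum_sub_distrib]
        ring
      rw [e]
      refine dvd_add (h2 _ (X.sub_mem f hf)) (Finset.dvd_sum fun i _ => ?_)
      rw [Algebra.smul_def]
      exact (h i).mul_left _
    have e : a.ofConv f - a'.ofConv f =
        a.ofConv (f - algebraMap k R (Coalgebra.counit (R := k) f)) -
        a'.ofConv (f - algebraMap k R (Coalgebra.counit (R := k) f)) := by
      rw [map_sub, map_sub, AlgHom.commutes, AlgHom.commutes]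
      ring
    rw [e]
    exact h3 _ (sub_algebraMap_counit_mem f)

theorem eq_of_forall_X_pow_dvd {y z : PowerSeries B} (h : ∀ N : ℕ, PowerSeries.X ^ N ∣ y - z) :
    y = z := by
  ext n
  have := PowerSeries.X_pow_dvd_iff.1 (h (n + 1)) n n.lt_succ_self
  rwa [map_sub, sub_eq_zero] at this

theorem Coords.arc_ext (X : Coords ell) {a a' : Pts k R (PowerSeries B)} (ha : a ∈ arcs k R B)
    (ha' : a' ∈ arcs k R B) (h : ∀ i, a.ofConv (X.x i) = a'.ofConv (X.x i)) : a = a' :=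
  Pts.ext fun f => eq_of_forall_X_pow_dvd fun N => X.dvd_sub ha ha' N (fun i => by
    rw [h i, sub_self]; exact dvd_zero _) f

/-- The limit of an `X`-adically convergent sequence of arcs. -/
theorem exists_limit_of_dvd (a : ℕ → Pts k R (PowerSeries B))
    (ha : ∀ N f, PowerSeries.X ^ N ∣ (a (N + 1)).ofConv f - (a N).ofConv f) :
    ∃ b : Pts k R (PowerSeries B),
      ∀ N f, PowerSeries.X ^ N ∣ b.ofConv f - (a N).ofConv f := by
  have h1 : ∀ N M f, N ≤ M → PowerSeries.X ^ N ∣ (a M).ofConv f - (a N).ofConv f := by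
    intro N M f h
    induction M, h using Nat.le_induction with
    | base => simp
    | succ M h ih =>
      rw [← sub_add_sub_cancel _ ((a M).ofConv f)]
      exact dvd_add ((pow_dvd_pow _ h).trans (ha M f)) ih
  -- The coefficient of X^n does not change from the index n + 1 on.
  let b (f : R) : PowerSeries B := PowerSeries.mk fun n => PowerSeries.coeff n ((a (n + 1)).ofConv f)
  have h2 : ∀ N f, PowerSeries.X ^ N ∣ b f - (a N).ofConv f := by
    intro N f
    rw [PowerSeries.X_pow_dvd_iff]
    intro m hm
    have := PowerSeries.X_pow_dvd_iff.1 (h1 (m + 1) N f hm) m m.lt_succ_self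
    rw [map_sub, sub_eq_zero] at this ⊢
    rw [this, PowerSeries.coeff_mk]
  have h3 : ∀ f g, b (f * g) = b f * b g := fun f g => eq_of_forall_X_pow_dvd fun N => by
    have e : b (f * g) - b f * b g = (b (f * g) - (a N).ofConv (f * g)) -
        ((b f - (a N).ofConv f) * b g + (b g - (a N).ofConv g) * (a N).ofConv f) := by
      rw [map_mul]
      ring
    rw [e]
    exact dvd_sub (h2 N _) (dvd_add ((h2 N f).mul_right _) ((h2 N g).mul_right _))
  refine ⟨.toConv (AlgHom.ofLinearMap
    { toFun := b
      map_add' := fun f g => PowerSeries.ext fun n => by simp [b]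
      map_smul' := fun c f => PowerSeries.ext fun n => by simp [b] }
    (PowerSeries.ext fun n => by simp [b]) h3), h2⟩

theorem mk_eq_mk_iff_X_pow_dvd (N : ℕ) (y z : PowerSeries B) :
    Ideal.Quotient.mk (Ideal.span {PowerSeries.X} ^ N) y =
      Ideal.Quotient.mk (Ideal.span {PowerSeries.X} ^ N) z ↔ PowerSeries.X ^ N ∣ y - z := by
  rw [Ideal.Quotient.mk_eq_mk_iff_sub_mem, Ideal.span_singleton_pow, Ideal.mem_span_singleton]

end Arcs

end

section

/-! ### Arcs with prescribed coordinates in a smooth group. -/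

section ArcExistence

variable {k : Type u} [Field k] {R : Type u} [CommRing R] [HopfAlgebra k R]
variable {ell : Pts k R (LaurentPolynomial k)} {B : Type u} [CommRing B] [Algebra k B]

/-- The truncation `B[[X]] / X ^ N`. -/
abbrev TruncPS (B : Type u) [CommRing B] (N : ℕ) : Type u :=
  PowerSeries B ⧸ (Ideal.span {(PowerSeries.X : PowerSeries B)} ^ N)

/-- `f` is a truncated arc starting at the unit element, with given coordinates. -/
def Coords.IsTruncArc (X : Coords ell) (c : X.ι → PowerSeries B) (N : ℕ)
    (f : R →ₐ[k] TruncPS B N) : Prop :=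
  (∀ i, f (X.x i) = Ideal.Quotient.mk _ (c i)) ∧
  ∀ z, ∃ y : PowerSeries B, f z = Ideal.Quotient.mk _ y ∧
    PowerSeries.X ∣ y - algebraMap k _ (Coalgebra.counit (R := k) z)

/-- Formal smoothness lifts f one step, with coordinates wrong by multiples of X^(N+1). Modulo
X^(N+2) such multiples have square zero, as N + 1 ≥ 1, and are killed by X. So values of the lift
act on them through the counit, and `Coords.deform` may add them to correct the coordinates. -/
theorem Coords.IsTruncArc.exists_succ [Algebra.FormallySmooth k R] {X : Coords ell}
    {c : X.ι → PowerSeries B} {N : ℕ} {f : R →ₐ[k] TruncPS B (N + 1)}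
    (hf : X.IsTruncArc c (N + 1) f) : ∃ f' : R →ₐ[k] TruncPS B (N + 2),
      X.IsTruncArc c (N + 2) f' ∧
      (Ideal.Quotient.factorₐ k (Ideal.pow_le_pow_right (N + 1).le_succ)).comp f' = f := by
  let π : TruncPS B (N + 2) →ₐ[k] TruncPS B (N + 1) :=
    Ideal.Quotient.factorₐ k (Ideal.pow_le_pow_right (N + 1).le_succ)
  have hπ : ∀ y : PowerSeries B, π (Ideal.Quotient.mk _ y) = Ideal.Quotient.mk _ y := fun y => rfl
  have hπs : Function.Surjective π := fun y => by
    obtain ⟨y, rfl⟩ := Ideal.Quotient.mk_surjective y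
    exact ⟨_, hπ y⟩
  have hker : ∀ z, π z = 0 → ∃ y : PowerSeries B,
      z = Ideal.Quotient.mk _ (PowerSeries.X ^ (N + 1) * y) := fun z hz => by
    obtain ⟨z, rfl⟩ := Ideal.Quotient.mk_surjective z
    rw [hπ, ← map_zero (Ideal.Quotient.mk _), mk_eq_mk_iff_X_pow_dvd, sub_zero] at hz
    obtain ⟨y, rfl⟩ := hz
    exact ⟨y, rfl⟩
  have hnil : IsNilpotent (RingHom.ker π) := by
    refine ⟨2, (pow_two (RingHom.ker π)).trans (le_bot_iff.1 (Ideal.mul_le.2 ?_))⟩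
    intro a ha b hb
    obtain ⟨y, rfl⟩ := hker a ha
    obtain ⟨z, rfl⟩ := hker b hb
    rw [← map_mul, Ideal.mem_bot, ← map_zero (Ideal.Quotient.mk _), mk_eq_mk_iff_X_pow_dvd]
    exact ⟨PowerSeries.X ^ N * (y * z), by ring⟩
  let g : R →ₐ[k] TruncPS B (N + 2) := Algebra.FormallySmooth.liftOfSurjective f π hπs hnil
  have hg : ∀ z, π (g z) = f z := Algebra.FormallySmooth.liftOfSurjective_apply f π hπs hnil
  have hd : ∀ i, ∃ y : PowerSeries B, Ideal.Quotient.mk _ (c i) - g (X.x i) =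
      Ideal.Quotient.mk (Ideal.span {PowerSeries.X} ^ (N + 2)) (PowerSeries.X ^ (N + 1) * y) :=
    fun i => hker _ (by rw [map_sub, hπ, hg, hf.1, sub_self])
  choose y hy using hd
  have hga : ∀ z, ∃ w : PowerSeries B, g z = Ideal.Quotient.mk _ w ∧
      PowerSeries.X ∣ w - algebraMap k _ (Coalgebra.counit (R := k) z) := fun z => by
    obtain ⟨v, hv, hv'⟩ := hf.2 z
    obtain ⟨w, hw⟩ := Ideal.Quotient.mk_surjective (g z)
    refine ⟨w, hw.symm, ?_⟩
    have h1 := hg z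
    rw [← hw, hπ, hv, mk_eq_mk_iff_X_pow_dvd] at h1
    rw [← sub_add_sub_cancel _ v]
    exact dvd_add ((Dvd.intro_left _ rfl).trans h1) hv'
  let d (i : X.ι) : TruncPS B (N + 2) := Ideal.Quotient.mk _ (PowerSeries.X ^ (N + 1) * y i)
  let f' := X.deform g d
    (fun i j => by
      rw [← map_mul, ← map_zero (Ideal.Quotient.mk _), mk_eq_mk_iff_X_pow_dvd]
      exact ⟨PowerSeries.X ^ N * (y i * y j), by ring⟩)
    (fun i z => by
      obtain ⟨w, hw, q, hq⟩ := hga z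
      have e : algebraMap k (TruncPS B (N + 2)) (Coalgebra.counit (R := k) z) =
        Ideal.Quotient.mk _ (algebraMap k _ (Coalgebra.counit (R := k) z)) := rfl
      rw [hw, e, ← map_mul, ← map_mul, mk_eq_mk_iff_X_pow_dvd, ← sub_mul, hq]
      exact ⟨q * y i, by ring⟩)
  have hf' : ∀ z, f' z = g z + Ideal.Quotient.mk _ (PowerSeries.X ^ (N + 1) *
      ∑ i, algebraMap k (PowerSeries B) (X.ξ i z) * y i) := fun z => by
    rw [X.deform_apply, Finset.mul_sum, map_sum]
    congr 1
    refine Finset.sum_congr rfl fun i _ => ?_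
    have e : algebraMap k (TruncPS B (N + 2)) (X.ξ i z) =
        Ideal.Quotient.mk _ (algebraMap k _ (X.ξ i z)) := rfl
    rw [e, ← map_mul]
    congr 1
    ring
  refine ⟨f', ⟨fun i => ?_, fun z => ?_⟩, AlgHom.ext fun z => ?_⟩
  · rw [X.deform_x, show d i = _ from (hy i).symm, add_sub_cancel]
  · obtain ⟨w, hw, hw'⟩ := hga z
    refine ⟨w + PowerSeries.X ^ (N + 1) * ∑ i, algebraMap k (PowerSeries B) (X.ξ i z) * y i, ?_, ?_⟩
    · rw [hf', hw, ← map_add]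
    · rw [add_sub_right_comm]
      exact dvd_add hw' (Dvd.dvd.mul_right (dvd_pow_self _ N.succ_ne_zero) _)
  · have e : π (Ideal.Quotient.mk _ (PowerSeries.X ^ (N + 1) *
      ∑ i, algebraMap k (PowerSeries B) (X.ξ i z) * y i)) = 0 := by
      rw [hπ, ← map_zero (Ideal.Quotient.mk _), mk_eq_mk_iff_X_pow_dvd, sub_zero]
      exact dvd_mul_right _ _
    change π (f' z) = f z
    rw [hf', map_add, hg, e, add_zero]

/-- For a smooth group `G`, an arc in `G` starting at the unit element can be prescribed by its
coordinates. -/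
theorem Coords.exists_arc [Algebra.FormallySmooth k R] (X : Coords ell) (c : X.ι → PowerSeries B)
    (hc : ∀ i, PowerSeries.X ∣ c i) : ∃ a ∈ arcs k R B, ∀ i, a.ofConv (X.x i) = c i := by
  -- Modulo X the only arc starting at the unit element is the constant one, and all prescribed
  -- coordinates vanish.
  let f0 : R →ₐ[k] TruncPS B 1 := (Algebra.ofId k _).comp (Bialgebra.counitAlgHom k R)
  have hf0 : X.IsTruncArc c 1 f0 := by
    refine ⟨fun i => ?_, fun z => ⟨algebraMap k _ (Coalgebra.counit (R := k) z), rfl, by simp⟩⟩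
    have e : f0 (X.x i) = algebraMap k _ (Coalgebra.counit (R := k) (X.x i)) := rfl
    rw [e, mem_augm.1 (X.x_augm i), map_zero, ← map_zero (Ideal.Quotient.mk _), eq_comm,
      mk_eq_mk_iff_X_pow_dvd, sub_zero, pow_one]
    exact hc i
  let F (N : ℕ) : {f : R →ₐ[k] TruncPS B (N + 1) // X.IsTruncArc c (N + 1) f} :=
    Nat.rec ⟨f0, hf0⟩ (fun N f => ⟨f.2.exists_succ.choose, f.2.exists_succ.choose_spec.1⟩) N
  have hF : ∀ N, (Ideal.Quotient.factorₐ k (Ideal.pow_le_pow_right (N + 1).le_succ)).comp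
      (F (N + 1)).1 = (F N).1 := fun N => (F N).2.exists_succ.choose_spec.2
  have hF' : ∀ (M N : ℕ) (h : M ≤ N) (z : R) (y : PowerSeries B),
      (F N).1 z = Ideal.Quotient.mk _ y → (F M).1 z = Ideal.Quotient.mk _ y := by
    intro M N h
    induction N, h using Nat.le_induction with
    | base => exact fun z y h => h
    | succ N h ih =>
      intro z y hz
      refine ih z y ?_
      rw [← hF, AlgHom.comp_apply, hz]
      rfl
  -- The recursion begins with truncation modulo X. Reducing F N once more gives a compatible family
  -- for all N including 0, as the limit requires.
  let f (N : ℕ) : R →ₐ[k] TruncPS B N :=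
    (Ideal.Quotient.factorₐ k (Ideal.pow_le_pow_right N.le_succ)).comp (F N).1
  have hf : ∀ N z (y : PowerSeries B), (F N).1 z = Ideal.Quotient.mk _ y →
      f N z = Ideal.Quotient.mk _ y := fun N z y h => by
    rw [AlgHom.comp_apply, h]
    rfl
  have hcompat : ∀ {m n : ℕ} (hle : m ≤ n),
      (Ideal.Quotient.factorₐ k (Ideal.pow_le_pow_right hle)).comp (f n) = f m := by
    intro m n hle
    refine AlgHom.ext fun z => ?_
    obtain ⟨y, hy⟩ := Ideal.Quotient.mk_surjective ((F n).1 z)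
    rw [hf m z y (hF' m n hle z y hy.symm), AlgHom.comp_apply, hf n z y hy.symm]
    rfl
  let a : R →ₐ[k] PowerSeries B :=
    IsAdicComplete.liftAlgHom (Ideal.span {(PowerSeries.X : PowerSeries B)}) f hcompat
  have ha : ∀ N z (y : PowerSeries B), (F N).1 z = Ideal.Quotient.mk _ y →
      PowerSeries.X ^ N ∣ a z - y := fun N z y h => by
    rw [← mk_eq_mk_iff_X_pow_dvd, ← hf N z y h]
    exact IsAdicComplete.mk_liftAlgHom _ f hcompat N z
  refine ⟨.toConv a, mem_arcs.2 fun z hz => ?_, fun i => eq_of_forall_X_pow_dvd fun N =>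
    ha N _ _ ((F N).2.1 i)⟩
  obtain ⟨y, hy, hy'⟩ := (F 1).2.2 z
  rw [mem_augm.1 hz, map_zero, sub_zero] at hy'
  have := ha 1 z y hy
  rw [pow_one] at this
  exact (dvd_iff_dvd_of_dvd_sub this).2 hy'

end ArcExistence

/-! ### Weight vectors in powers of the augmentation ideal. -/

section Density

variable {k : Type u} [Field k] {R : Type u} [CommRing R] [HopfAlgebra k R]
variable {ell : Pts k R (LaurentPolynomial k)} {B : Type u} [CommRing B] [Algebra k B]

variable (ell) in
/-- The projection onto the functions of weight `n`. -/
def wtProj (n : ℤ) : R →ₗ[k] R :=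
  (TensorProduct.rid k R).toLinearMap ∘ₗ
    (Finsupp.lapply n ∘ₗ (AddMonoidAlgebra.coeffLinearEquiv k).toLinearMap :
        LaurentPolynomial k →ₗ[k] k).lTensor R ∘ₗ (adj ell).toLinearMap

theorem wtProj_of_mem {m : ℤ} {f : R} (hf : f ∈ wt ell m) (n : ℤ) :
    wtProj ell n f = if m = n then f else 0 := by
  simp only [wtProj, LinearMap.comp_apply, AlgHom.toLinearMap_apply, mem_wt.1 hf,
    LinearMap.lTensor_tmul]
  simp [LaurentPolynomial.T, -LaurentPolynomial.single_eq_C_mul_T,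
      AddMonoidAlgebra.coeff_single, Finsupp.single_apply]

/-- A weight vector of `I²`, where `I` is the augmentation ideal, is a sum of products of weight
vectors of `I`. -/
theorem IsCochar.mem_of_mem_augm_sq (hell : IsCochar ell) {n : ℤ} {P : Submodule k R}
    (hP : ∀ p q, p + q = n → ∀ f ∈ wt ell p ⊓ augm k R, ∀ g ∈ wt ell q ⊓ augm k R, f * g ∈ P)
    {f : R} (hf : f ∈ augm k R * augm k R) : wtProj ell n f ∈ P := by
  have h1 : augm k R * augm k R ≤ P.comap (wtProj ell n) := by
    rw [Submodule.mul_le]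
    intro f hf g hg
    have hf' := hell.augm_le_iSup hf
    have hg' := hell.augm_le_iSup hg
    clear hf hg
    induction hf' using Submodule.iSup_induction' with
    | mem p f hf =>
      induction hg' using Submodule.iSup_induction' with
      | mem q g hg =>
        rw [Submodule.mem_comap, wtProj_of_mem (mul_mem_wt hf.1 hg.1)]
        split_ifs with h
        · exact hP p q h f hf g hg
        · exact P.zero_mem
      | zero => simp
      | add x y _ _ hx hy =>
        rw [mul_add]
        exact Submodule.add_mem _ hx hy
    | zero => simp
    | add x y _ _ hx hy =>
      rw [add_mul]
      exact Submodule.add_mem _ hx hy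
  exact h1 hf

/-- This is the weight n part of the congruence f ≡ Σ ξ_i(f) x_i modulo I²: only coordinates of
weight n survive. -/
theorem Coords.eq_sum_add (X : Coords ell) {n : ℤ} {f : R} (hf : f ∈ wt ell n ⊓ augm k R) :
    f = ∑ i, X.ξ i f • (if X.deg i = n then X.x i else 0) +
      wtProj ell n (f - ∑ i, X.ξ i f • X.x i) := by
  rw [map_sub, map_sum, wtProj_of_mem hf.1, if_pos rfl]
  have : ∑ i, wtProj ell n (X.ξ i f • X.x i) =
      ∑ i, X.ξ i f • (if X.deg i = n then X.x i else 0) :=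
    Finset.sum_congr rfl fun i _ => by rw [map_smul, wtProj_of_mem (X.x_wt i)]
  rw [this, add_sub_cancel]

/-- To check that an arc takes the weight vectors of the augmentation ideal to a given closed
multiplicative family of subspaces, it suffices to look at its coordinates. -/
theorem Coords.mem_of_coords_mem (X : Coords ell) (hell : IsCochar ell)
    (M : ℤ → Submodule k (PowerSeries B)) (hX : ∀ n, ∀ y ∈ M n, PowerSeries.X ∣ y)
    (hmul : ∀ p q, ∀ y ∈ M p, ∀ z ∈ M q, y * z ∈ M (p + q))
    (hcl : ∀ n y, (∀ N : ℕ, ∃ z ∈ M n, PowerSeries.X ^ N ∣ y - z) → y ∈ M n)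
    {a : Pts k R (PowerSeries B)} (ha : a ∈ arcs k R B)
    (hx : ∀ i, a.ofConv (X.x i) ∈ M (X.deg i)) {n : ℤ} {f : R} (hf : f ∈ wt ell n ⊓ augm k R) :
    a.ofConv f ∈ M n := by
  refine hcl n _ fun N => ?_
  induction N generalizing n f with
  | zero => exact ⟨0, Submodule.zero_mem _, by simp⟩
  | succ N ih =>
    let Q (n : ℤ) : Submodule k R :=
      { carrier := {f | ∃ z ∈ M n, PowerSeries.X ^ (N + 1) ∣ a.ofConv f - z}
        add_mem' := by
          rintro f g ⟨y, hy, hy'⟩ ⟨z, hz, hz'⟩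
          exact ⟨y + z, Submodule.add_mem _ hy hz, by
            rw [map_add, add_sub_add_comm]
            exact dvd_add hy' hz'⟩
        zero_mem' := ⟨0, Submodule.zero_mem _, by simp⟩
        smul_mem' := by
          rintro c f ⟨y, hy, hy'⟩
          refine ⟨c • y, Submodule.smul_mem _ _ hy, ?_⟩
          rw [map_smul, ← smul_sub, Algebra.smul_def]
          exact hy'.mul_left _ }
    change f ∈ Q n
    -- The coordinates have values in M by hypothesis. For a product of two weight vectors of I,
    -- approximations modulo X^N give one modulo X^(N+1), since all the values are divisible by X.
    rw [X.eq_sum_add hf]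
    refine Submodule.add_mem _ (Submodule.sum_mem _ fun i _ => Submodule.smul_mem _ _ ?_)
      (hell.mem_of_mem_augm_sq ?_ (X.sub_mem f hf.2))
    · split_ifs with h
      · exact ⟨_, h ▸ hx i, by simp⟩
      · exact Submodule.zero_mem _
    · rintro p q rfl g hg h hh
      obtain ⟨y, hy, hy'⟩ := ih hg
      obtain ⟨z, hz, hz'⟩ := ih hh
      refine ⟨y * z, hmul p q y hy z hz, ?_⟩
      have e : a.ofConv (g * h) - y * z =
        (a.ofConv g - y) * a.ofConv h + (a.ofConv h - z) * y := by
        rw [map_mul]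
        ring
      rw [e, pow_succ]
      exact dvd_add (mul_dvd_mul hy' (mem_arcs.1 ha h hh.2)) (mul_dvd_mul hz' (hX p y hy))

end Density

end

section

/-! ### The group law to first order. -/

section Congruence

variable {k : Type u} [Field k] {R : Type u} [CommRing R] [HopfAlgebra k R]
variable {ell : Pts k R (LaurentPolynomial k)} {D D' : Type u} [CommRing D] [Algebra k D]
  [CommRing D'] [Algebra k D']

theorem coeff_T_mul_C (m n : ℤ) (a : D) :
    ((LaurentPolynomial.T m * LaurentPolynomial.C a : LaurentPolynomial D)).coeff n =
      if m = n then a else 0 := by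
  rw [mul_comm, ← LaurentPolynomial.single_eq_C_mul_T, AddMonoidAlgebra.coeff_single,
    Finsupp.single_apply]

/-- On a weight vector of the augmentation ideal, the product of two points of `G` is the sum, up
to products of values at weight vectors of complementary weights. -/
theorem IsCochar.mul_apply_sub_mem (hell : IsCochar ell) (g h : Pts k R D) {n : ℤ} {f : R}
    (hf : f ∈ wt ell n ⊓ augm k R) (P : Submodule k D)
    (hP : ∀ p q, p + q = n → ∀ a ∈ wt ell p ⊓ augm k R, ∀ b ∈ wt ell q ⊓ augm k R,
      g.ofConv a * h.ofConv b ∈ P) :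
    (g * h).ofConv f - g.ofConv f - h.ofConv f ∈ P := by
  let c : LaurentPolynomial D →ₗ[k] D :=
    { toFun := fun z => z.coeff n
      map_add' := fun _ _ => rfl
      map_smul' := fun _ _ => rfl }
  -- The coefficient of T^n in the product of the values at the two conjugates by λ(T). It
  -- annihilates a ⊗ b unless the weights of a and b add up to n.
  let Ψ : R ⊗[k] R →ₗ[k] D := c ∘ₗ (Algebra.TensorProduct.lift (conjBy D ell g).ofConv
    (conjBy D ell h).ofConv (fun _ _ => Commute.all _ _)).toLinearMap
  have hΨ : ∀ p q, ∀ a ∈ wt ell p, ∀ b ∈ wt ell q, Ψ (a ⊗ₜ b) =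
      if p + q = n then g.ofConv a * h.ofConv b else 0 := by
    intro p q a ha b hb
    change ((conjBy D ell g).ofConv a * (conjBy D ell h).ofConv b).coeff n = _
    rw [conjBy_apply ha, conjBy_apply hb, mul_mul_mul_comm, ← LaurentPolynomial.T_add, ← map_mul,
      coeff_T_mul_C]
  have h1 : Ψ (Coalgebra.comul (R := k) f) = (g * h).ofConv f := by
    have : (conjBy D ell (g * h)).ofConv f = Algebra.TensorProduct.lift (conjBy D ell g).ofConv
      (conjBy D ell h).ofConv (fun _ _ => Commute.all _ _) (Coalgebra.comul (R := k) f) := by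
      rw [map_mul, Pts.mul_apply]
    rw [conjBy_apply hf.1] at this
    exact (congrArg c this.symm).trans ((coeff_T_mul_C n n _).trans (if_pos rfl))
  have h2 : Ψ (f ⊗ₜ 1) = g.ofConv f := by
    rw [hΨ n 0 f hf.1 1 one_mem_wt, if_pos (add_zero n), map_one, mul_one]
  have h3 : Ψ (1 ⊗ₜ f) = h.ofConv f := by
    rw [hΨ 0 n 1 one_mem_wt f hf.1, if_pos (zero_add n), map_one, one_mul]
  have h4 : ∀ a ∈ augm k R, ∀ b ∈ augm k R, Ψ (a ⊗ₜ b) ∈ P := by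
    intro a ha b hb
    have ha' := hell.augm_le_iSup ha
    have hb' := hell.augm_le_iSup hb
    clear ha hb
    induction ha' using Submodule.iSup_induction' with
    | mem p a ha =>
      induction hb' using Submodule.iSup_induction' with
      | mem q b hb =>
        rw [hΨ p q a ha.1 b hb.1]
        split_ifs with hpq
        · exact hP p q hpq a ha b hb
        · exact P.zero_mem
      | zero => simp
      | add x y _ _ hx hy =>
        rw [tmul_add, map_add]
        exact P.add_mem hx hy
    | zero => simp
    | add x y _ _ hx hy =>
      rw [add_tmul, map_add]
      exact P.add_mem hx hy
  -- The argument of Ψ is the projection of z to I ⊗ I. For the comultiplication of f with ε(f) = 0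
  -- it is Δ(f) - f ⊗ 1 - 1 ⊗ f.
  have h5 : ∀ z : R ⊗[k] R, Ψ (z -
      (TensorProduct.rid k R ((Coalgebra.counit (R := k) (A := R)).lTensor R z)) ⊗ₜ 1 -
      1 ⊗ₜ (TensorProduct.lid k R ((Coalgebra.counit (R := k) (A := R)).rTensor R z)) +
      Coalgebra.counit (R := k) (TensorProduct.rid k R
        ((Coalgebra.counit (R := k) (A := R)).lTensor R z)) • 1) ∈ P := by
    intro z
    induction z with
    | zero => simp
    | add x y hx hy =>
      have := P.add_mem hx hy
      rw [← map_add] at this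
      convert! this using 2
      simp only [map_add, add_tmul, tmul_add, add_smul]
      abel
    | tmul a b =>
      have := h4 _ (sub_algebraMap_counit_mem (k := k) a) _ (sub_algebraMap_counit_mem (k := k) b)
      convert! this using 2
      simp only [LinearMap.lTensor_tmul, LinearMap.rTensor_tmul, TensorProduct.rid_tmul,
        TensorProduct.lid_tmul, sub_tmul, tmul_sub, Algebra.algebraMap_eq_smul_one, map_smul,
        ← smul_tmul', tmul_smul, smul_eq_mul, Algebra.TensorProduct.one_def, smul_smul,
        smul_sub, mul_comm (Coalgebra.counit (R := k) b)]
      abel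
  have h6 := h5 (Coalgebra.comul (R := k) f)
  rw [Coalgebra.lTensor_counit_comul, Coalgebra.rTensor_counit_comul, TensorProduct.rid_tmul,
    TensorProduct.lid_tmul, one_smul, mem_augm.1 hf.2, zero_smul, add_zero, map_sub,
    map_sub, h1, h2, h3] at h6
  exact h6

variable (k R) in
/-- The points of `G` that are congruent to the unit element modulo an ideal. -/
def congr (J : Ideal D) : Subgroup (Pts k R D) := (Pts.map (Ideal.Quotient.mkₐ k J)).ker

theorem mem_congr {J : Ideal D} {g : Pts k R D} :
    g ∈ congr k R J ↔ ∀ f ∈ augm k R, g.ofConv f ∈ J := by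
  rw [congr, MonoidHom.mem_ker]
  constructor
  · intro h f hf
    have := congrArg (fun p : Pts k R _ => p.ofConv f) h
    rw [Pts.one_apply, mem_augm.1 hf, map_zero] at this
    exact Ideal.Quotient.eq_zero_iff_mem.1 this
  · intro h
    refine Pts.ext fun f => ?_
    have := h _ (sub_algebraMap_counit_mem (k := k) f)
    rw [← Ideal.Quotient.eq_zero_iff_mem, map_sub, map_sub, sub_eq_zero, AlgHom.commutes] at this
    exact this

/-- The cross terms of the group law lie in I ⊗ I, so their values lie in J J'. On a quotient where
J J' vanishes, the product of such points is addition of values. -/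
theorem IsCochar.mul_apply_sub_mem_mul (hell : IsCochar ell) {J J' : Ideal D} {g h : Pts k R D}
    (hg : g ∈ congr k R J) (hh : h ∈ congr k R J') {f : R} (hf : f ∈ augm k R) :
    (g * h).ofConv f - g.ofConv f - h.ofConv f ∈ J * J' := by
  have hf' := hell.augm_le_iSup hf
  clear hf
  induction hf' using Submodule.iSup_induction' with
  | mem n f hf =>
    exact hell.mul_apply_sub_mem g h hf ((J * J').restrictScalars k) fun p q _ a ha b hb =>
      Ideal.mul_mem_mul (mem_congr.1 hg a ha.2) (mem_congr.1 hh b hb.2)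
  | zero => simp
  | add x y _ _ hx hy =>
    have : (g * h).ofConv (x + y) - g.ofConv (x + y) - h.ofConv (x + y) =
      ((g * h).ofConv x - g.ofConv x - h.ofConv x) +
      ((g * h).ofConv y - g.ofConv y - h.ofConv y) := by
      simp only [map_add]
      ring
    rw [this]
    exact add_mem hx hy

theorem IsCochar.inv_apply_add_mem_mul (hell : IsCochar ell) {J : Ideal D} {g : Pts k R D}
    (hg : g ∈ congr k R J) {f : R} (hf : f ∈ augm k R) :
    (g⁻¹).ofConv f + g.ofConv f ∈ J * J := by
  have := hell.mul_apply_sub_mem_mul hg (inv_mem hg) hf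
  rw [mul_inv_cancel, Pts.one_apply, mem_augm.1 hf, map_zero, zero_sub, ← neg_mem_iff] at this
  convert! this using 1
  ring

theorem congr_map {J : Ideal D} {J' : Ideal D'} (φ : D →ₐ[k] D') (h : ∀ y ∈ J, φ y ∈ J')
    {g : Pts k R D} (hg : g ∈ congr k R J) : Pts.map φ g ∈ congr k R J' :=
  mem_congr.2 fun f hf => h _ (mem_congr.1 hg f hf)

theorem congr_mono {J J' : Ideal D} (h : J ≤ J') : congr k R J ≤ congr k R J' := fun _ hg =>
  mem_congr.2 fun f hf => h (mem_congr.1 hg f hf)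

theorem mem_congr_X_pow {B : Type u} [CommRing B] [Algebra k B] {N : ℕ}
    {a : Pts k R (PowerSeries B)} : a ∈ congr k R (Ideal.span {PowerSeries.X ^ N}) ↔
      ∀ f ∈ augm k R, PowerSeries.X ^ N ∣ a.ofConv f := by
  simp only [mem_congr, Ideal.mem_span_singleton]

theorem mem_arcs_iff_congr {B : Type u} [CommRing B] [Algebra k B] {a : Pts k R (PowerSeries B)} :
    a ∈ arcs k R B ↔ a ∈ congr k R (Ideal.span {PowerSeries.X ^ 1}) := by
  rw [mem_congr_X_pow, mem_arcs, pow_one]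

end Congruence

/-! ### The group of arcs preserved by conjugation with t^λ. -/

section ArcGroup

variable {k : Type u} [Field k] {R : Type u} [CommRing R] [HopfAlgebra k R]
variable {ell : Pts k R (LaurentPolynomial k)} {B C : Type u} [CommRing B] [Algebra k B]
  [CommRing C] [Algebra k C]

theorem psLaur_X_pow (m : ℕ) :
    psLaur k B (PowerSeries.X ^ m) = Laur.tpow B (m : ℤ) := by
  change (HahnSeries.ofPowerSeries ℤ B (PowerSeries.X ^ m)) = HahnSeries.single (m : ℤ) 1
  exact HahnSeries.ofPowerSeries_X_pow m

theorem tpow_neg_mul_tpow (n : ℤ) : Laur.tpow B (-n) * Laur.tpow B n = 1 := by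
  rw [← Laur.tpow_add, neg_add_cancel, Laur.tpow_zero]

theorem laurentToLaur_T (n : ℤ) : laurentToLaur k B (LaurentPolynomial.T n) = Laur.tpow B n := by
  simp [laurentToLaur, LaurentPolynomial.T, -LaurentPolynomial.single_eq_C_mul_T]

/-- The exponent 1 + max(0, -n) is the least one for which both y and t^n y are divisible by t. -/
theorem tpow_mul_psLaur_eq (n : ℤ) {y : PowerSeries B}
    (h : PowerSeries.X ^ (1 + (-n).toNat) ∣ y) :
    ∃ z, PowerSeries.X ∣ z ∧ psLaur k B z = Laur.tpow B n * psLaur k B y := by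
  rcases le_or_gt 0 n with hn | hn
  · obtain ⟨m, rfl⟩ := Int.eq_ofNat_of_zero_le hn
    refine ⟨PowerSeries.X ^ m * y, ?_, ?_⟩
    · exact ((dvd_pow_self _ (by omega)).trans h).mul_left _
    · rw [map_mul, psLaur_X_pow]
  · obtain ⟨m, rfl⟩ : ∃ m : ℕ, n = -(m : ℤ) := ⟨n.natAbs, by omega⟩
    obtain ⟨w, rfl⟩ := h
    refine ⟨PowerSeries.X * w, dvd_mul_right _ _, ?_⟩
    rw [neg_neg, Int.toNat_natCast, pow_add, pow_one, mul_right_comm, mul_comm _ (_ ^ m),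
      map_mul (psLaur k B) (_ ^ m), psLaur_X_pow, ← mul_assoc, tpow_neg_mul_tpow, one_mul]

theorem X_pow_dvd_of_tpow_mul (n : ℤ) {y z : PowerSeries B} (hy : PowerSeries.X ∣ y)
    (hz : PowerSeries.X ∣ z) (h : psLaur k B z = Laur.tpow B n * psLaur k B y) :
    PowerSeries.X ^ (1 + (-n).toNat) ∣ y := by
  rcases le_or_gt 0 n with hn | hn
  · rwa [Int.toNat_of_nonpos (by omega), add_zero, pow_one]
  · obtain ⟨m, rfl⟩ : ∃ m : ℕ, n = -(m : ℤ) := ⟨n.natAbs, by omega⟩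
    have h2 : psLaur k B (PowerSeries.X ^ m * z) = psLaur k B y := by
      rw [map_mul, h, psLaur_X_pow, ← mul_assoc, mul_comm (Laur.tpow B m), tpow_neg_mul_tpow,
        one_mul]
    rw [← psLaur_injective h2, neg_neg, Int.toNat_natCast, add_comm, pow_add, pow_one]
    exact mul_dvd_mul_left _ hz

/-- The arcs `a` in `G` starting at the unit element such that `κ a κ⁻¹` is again an arc starting
at the unit element. -/
def arcGroup (κ : Pts k R (Laur B)) : Subgroup (Pts k R (PowerSeries B)) :=
  arcs k R B ⊓ ((arcs k R B).map (Pts.map (psLaur k B))).comap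
    ((MulAut.conj κ).toMonoidHom.comp (Pts.map (psLaur k B)))

theorem mem_arcGroup {κ : Pts k R (Laur B)} {a : Pts k R (PowerSeries B)} :
    a ∈ arcGroup κ ↔ a ∈ arcs k R B ∧ ∃ b ∈ arcs k R B,
      Pts.map (psLaur k B) b * κ = κ * Pts.map (psLaur k B) a := by
  refine and_congr_right fun _ => exists_congr fun b => and_congr_right fun _ => ?_
  change Pts.map (psLaur k B) b = κ * Pts.map (psLaur k B) a * κ⁻¹ ↔ _
  rw [eq_mul_inv_iff_mul_eq]

theorem map_mem_arcs (φ : B →ₐ[k] C) {a : Pts k R (PowerSeries B)} (ha : a ∈ arcs k R B) :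
    Pts.map (psMap φ) a ∈ arcs k R C := by
  rw [MonoidHom.mem_ker] at *
  rw [Pts.map_map, psEval_comp_psMap, ← Pts.map_map, ha, map_one]

theorem map_mem_arcGroup (φ : B →ₐ[k] C) {κ : Pts k R (Laur B)} {a : Pts k R (PowerSeries B)}
    (ha : a ∈ arcGroup κ) : Pts.map (psMap φ) a ∈ arcGroup (Pts.map (laurMap φ) κ) := by
  rw [mem_arcGroup] at *
  obtain ⟨ha, b, hb, h⟩ := ha
  refine ⟨map_mem_arcs φ ha, _, map_mem_arcs φ hb, ?_⟩
  have := congrArg (Pts.map (laurMap φ)) h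
  rw [map_mul, map_mul, Pts.map_map, Pts.map_map, laurMap_comp_psLaur] at this
  rw [Pts.map_map, Pts.map_map]
  exact this

theorem laurMap_comp_laurentToLaur (φ : B →ₐ[k] C) :
    (laurMap φ).comp (laurentToLaur k B) = laurentToLaur k C := by
  refine AlgHom.ext fun z => ?_
  induction z using LaurentPolynomial.induction_on' with
  | add p q hp hq => rw [map_add, hp, hq, map_add]
  | C_mul_T m a =>
    rw [← LaurentPolynomial.smul_eq_C_mul, map_smul, map_smul, AlgHom.comp_apply, laurentToLaur_T,
      laurentToLaur_T, laurMap_tpow]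

variable (B) in
/-- The power series divisible by `t` whose product with `t ^ n` is also a power series divisible
by `t`. -/
def shiftSub (n : ℤ) : Ideal (PowerSeries B) := Ideal.span {PowerSeries.X ^ (1 + (-n).toNat)}

theorem mem_shiftSub {n : ℤ} {y : PowerSeries B} :
    y ∈ shiftSub B n ↔ PowerSeries.X ^ (1 + (-n).toNat) ∣ y := Ideal.mem_span_singleton

theorem conj_tpow_apply {n : ℤ} {f : R} (hf : f ∈ wt ell n) (a : Pts k R (PowerSeries B)) :
    (Pts.map (laurentToLaur k B) ell * Pts.map (psLaur k B) a *
      (Pts.map (laurentToLaur k B) ell)⁻¹).ofConv f =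
      Laur.tpow B n * psLaur k B (a.ofConv f) := by
  rw [conj_apply_of_mem _ _ hf, laurentToLaur_T]
  rfl

theorem tpow_mul_eq_of_conj {a b : Pts k R (PowerSeries B)}
    (h : Pts.map (psLaur k B) b * Pts.map (laurentToLaur k B) ell =
      Pts.map (laurentToLaur k B) ell * Pts.map (psLaur k B) a) {n : ℤ} {f : R}
    (hf : f ∈ wt ell n) :
    psLaur k B (b.ofConv f) = Laur.tpow B n * psLaur k B (a.ofConv f) := by
  rw [← conj_tpow_apply hf, ← h, mul_inv_cancel_right]
  rfl

/-- Conjugation by t^λ multiplies the value at a function of weight n by t^n. Since weight vectors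
of I and 1 span k[G], integrality of these products makes the conjugate an arc, and divisibility by
t makes it start at 1. -/
theorem IsCochar.exists_conj_arc (hell : IsCochar ell) {a : Pts k R (PowerSeries B)}
    (h : ∀ n, ∀ f ∈ wt ell n ⊓ augm k R, ∃ z, PowerSeries.X ∣ z ∧
      psLaur k B z = Laur.tpow B n * psLaur k B (a.ofConv f)) :
    ∃ b ∈ arcs k R B, Pts.map (psLaur k B) b * Pts.map (laurentToLaur k B) ell =
      Pts.map (laurentToLaur k B) ell * Pts.map (psLaur k B) a := by
  obtain ⟨b, hb⟩ := Pts.exists_map_eq (psLaur_injective (k := k))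
    (Pts.map (laurentToLaur k B) ell * Pts.map (psLaur k B) a *
    (Pts.map (laurentToLaur k B) ell)⁻¹) (fun x => by
      have := hell.eq_top_of_augm_le (N := (LinearMap.range (psLaur k B).toLinearMap).comap
        (Pts.map (laurentToLaur k B) ell * Pts.map (psLaur k B) a *
        (Pts.map (laurentToLaur k B) ell)⁻¹).ofConv.toLinearMap)
        ⟨1, (map_one (psLaur k B)).trans (map_one (Pts.map (laurentToLaur k B) ell *
          Pts.map (psLaur k B) a * (Pts.map (laurentToLaur k B) ell)⁻¹).ofConv).symm⟩
        fun n f hf => by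
          obtain ⟨z, -, hz⟩ := h n f hf
          exact ⟨z, hz.trans (conj_tpow_apply hf.1 a).symm⟩
      exact this.ge (Submodule.mem_top : x ∈ ⊤))
  refine ⟨b, ?_, by rw [hb, inv_mul_cancel_right]⟩
  rw [mem_arcs]
  intro f hf
  have hf' := hell.augm_le_iSup hf
  clear hf
  induction hf' using Submodule.iSup_induction' with
  | mem n f hf =>
    obtain ⟨z, hz', hz⟩ := h n f hf
    rw [← conj_tpow_apply hf.1, ← hb] at hz
    exact psLaur_injective hz ▸ hz'
  | zero => simp
  | add x y _ _ hx hy =>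
    rw [map_add]
    exact dvd_add hx hy

theorem IsCochar.mem_arcGroup_iff (hell : IsCochar ell) {a : Pts k R (PowerSeries B)} :
    a ∈ arcGroup (Pts.map (laurentToLaur k B) ell) ↔
      ∀ n, ∀ f ∈ wt ell n ⊓ augm k R, a.ofConv f ∈ shiftSub B n := by
  constructor
  · intro h n f hf
    obtain ⟨ha, b, hb, h⟩ := mem_arcGroup.1 h
    exact mem_shiftSub.2 (X_pow_dvd_of_tpow_mul (k := k) n (mem_arcs.1 ha f hf.2)
      (mem_arcs.1 hb f hf.2) (tpow_mul_eq_of_conj h hf.1))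
  · intro h
    refine mem_arcGroup.2 ⟨?_, hell.exists_conj_arc fun n f hf =>
      tpow_mul_psLaur_eq (k := k) n (mem_shiftSub.1 (h n f hf))⟩
    rw [mem_arcs]
    intro f hf
    have hf' := hell.augm_le_iSup hf
    clear hf
    induction hf' using Submodule.iSup_induction' with
    | mem n f hf => exact (dvd_pow_self _ (by omega)).trans (mem_shiftSub.1 (h n f hf))
    | zero => simp
    | add x y _ _ hx hy =>
      rw [map_add]
      exact dvd_add hx hy

theorem mul_mem_shiftSub {p q : ℤ} {y z : PowerSeries B} (hy : y ∈ shiftSub B p)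
    (hz : z ∈ shiftSub B q) : y * z ∈ shiftSub B (p + q) := by
  rw [mem_shiftSub] at *
  refine (pow_dvd_pow _ ?_).trans ((pow_add (PowerSeries.X : PowerSeries B)
    (1 + (-p).toNat) (1 + (-q).toNat)).dvd.trans (mul_dvd_mul hy hz))
  omega

theorem X_dvd_of_mem_shiftSub {n : ℤ} {y : PowerSeries B} (hy : y ∈ shiftSub B n) :
    PowerSeries.X ∣ y := (dvd_pow_self _ (by omega)).trans (mem_shiftSub.1 hy)

theorem mem_shiftSub_of_forall {n : ℤ} {y : PowerSeries B}
    (h : ∀ N : ℕ, ∃ z ∈ shiftSub B n, PowerSeries.X ^ N ∣ y - z) : y ∈ shiftSub B n := by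
  obtain ⟨z, hz, hyz⟩ := h (1 + (-n).toNat)
  rw [mem_shiftSub] at *
  exact (dvd_iff_dvd_of_dvd_sub hyz).2 hz

/-- The ideals `shiftSub` are closed and multiplicative in the weight, so `mem_of_coords_mem`
reduces the condition to the coordinates. Together with `Coords.exists_arc` this describes the group
as an infinite-dimensional affine space. -/
theorem Coords.mem_arcGroup_iff (X : Coords ell) (hell : IsCochar ell)
    {a : Pts k R (PowerSeries B)} : a ∈ arcGroup (Pts.map (laurentToLaur k B) ell) ↔
      a ∈ arcs k R B ∧ ∀ i, a.ofConv (X.x i) ∈ shiftSub B (X.deg i) := by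
  constructor
  · intro h
    exact ⟨h.1, fun i => hell.mem_arcGroup_iff.1 h _ _ ⟨X.x_wt i, X.x_augm i⟩⟩
  · rintro ⟨h1, h2⟩
    exact hell.mem_arcGroup_iff.2 fun n f hf => X.mem_of_coords_mem hell
      (fun n => (shiftSub B n).restrictScalars k) (fun _ _ h => X_dvd_of_mem_shiftSub h)
      (fun _ _ _ h _ h' => mul_mem_shiftSub h h') (fun _ _ h => mem_shiftSub_of_forall h) h1 h2 hf

end ArcGroup

end

section

/-! ### Čech cohomology of coverings and of the group of arcs. -/

section Descent

/-- The first terms of the Čech complex of a covering `Spec C → Spec B`, where `D = C ⊗ C` and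
`E = C ⊗ C ⊗ C` over `B`. -/
structure CechData (k : Type u) [Field k] (B C D E : Type u) [CommRing B] [Algebra k B]
    [CommRing C] [Algebra k C] [CommRing D] [Algebra k D] [CommRing E] [Algebra k E] where
  j : B →ₐ[k] C
  i₀ : C →ₐ[k] D
  i₁ : C →ₐ[k] D
  p₀₁ : D →ₐ[k] E
  p₁₂ : D →ₐ[k] E
  p₀₂ : D →ₐ[k] E
  i_comp_j : i₀.comp j = i₁.comp j
  p_comp_i₀ : p₀₁.comp i₀ = p₀₂.comp i₀
  p_comp_i₁ : p₀₁.comp i₁ = p₁₂.comp i₀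
  p_comp_i₂ : p₀₂.comp i₁ = p₁₂.comp i₁
  injective : Function.Injective j
  exact₀ : ∀ c, i₀ c = i₁ c → ∃ b, j b = c
  exact₁ : ∀ w, p₀₂ w = p₀₁ w + p₁₂ w → ∃ v, w = i₁ v - i₀ v

section FaithfullyFlat

variable (B C : Type u) [CommRing B] [CommRing C] [Algebra B C]

/-- After tensoring with C the map has a retraction, namely multiplication. -/
theorem algebraMap_injective_of_faithfullyFlat [Module.FaithfullyFlat B C] :
    Function.Injective (algebraMap B C) := by
  have : Function.Injective ((Algebra.linearMap B C).lTensor C) := by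
    refine Function.LeftInverse.injective
      (g := fun z => (TensorProduct.rid B C).symm (LinearMap.mul' B C z)) fun z => ?_
    induction z with
    | zero => simp
    | add x y hx hy => simp only [map_add, hx, hy]
    | tmul x y =>
      simp only [LinearMap.lTensor_tmul, Algebra.linearMap_apply, LinearMap.mul'_apply,
        TensorProduct.rid_symm_apply]
      rw [mul_comm, ← Algebra.smul_def, smul_tmul, smul_eq_mul, mul_one]
  exact (Module.FaithfullyFlat.lTensor_injective_iff_injective B C (Algebra.linearMap B C)).1 this

/-- Multiplication of the first two factors. -/
def contract (M : Type u) [AddCommGroup M] [Module B M] : C ⊗[B] (C ⊗[B] M) →ₗ[B] C ⊗[B] M :=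
  (LinearMap.mul' B C).rTensor M ∘ₗ (TensorProduct.assoc B C C M).symm.toLinearMap

theorem contract_tmul (M : Type u) [AddCommGroup M] [Module B M] (x y : C) (m : M) :
    contract B C M (x ⊗ₜ (y ⊗ₜ m)) = (x * y) ⊗ₜ m := by simp [contract]

/-- Exactness may be tested after tensoring with C, where multiplication of the first two factors is
a contracting homotopy. The same homotopy serves in `exact_sub_add`. -/
theorem exact_linearMap_sub [Module.FaithfullyFlat B C] : Function.Exact (Algebra.linearMap B C)
    ((Algebra.TensorProduct.includeRight : C →ₐ[B] C ⊗[B] C).toLinearMap -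
      (Algebra.TensorProduct.includeLeft : C →ₐ[B] C ⊗[B] C).toLinearMap) := by
  apply Module.FaithfullyFlat.lTensor_reflects_exact B C
  intro z
  constructor
  · intro h
    refine ⟨(LinearMap.mul' B C).rTensor B ((TensorProduct.rid B (C ⊗[B] C)).symm z), ?_⟩
    have key : ∀ z : C ⊗[B] C, contract B C C ((((Algebra.TensorProduct.includeRight :
        C →ₐ[B] C ⊗[B] C).toLinearMap -
        (Algebra.TensorProduct.includeLeft : C →ₐ[B] C ⊗[B] C).toLinearMap).lTensor C) z) =
        z - (Algebra.linearMap B C).lTensor C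
          ((LinearMap.mul' B C).rTensor B ((TensorProduct.rid B (C ⊗[B] C)).symm z)) := by
      intro z
      induction z with
      | zero => simp
      | add x y hx hy =>
        simp only [map_add, hx, hy]
        abel
      | tmul x y =>
        simp [contract_tmul]
    have := key z
    rw [h, map_zero, eq_comm, sub_eq_zero] at this
    exact this.symm
  · rintro ⟨z, rfl⟩
    rw [← LinearMap.comp_apply, ← LinearMap.lTensor_comp]
    have : ((Algebra.TensorProduct.includeRight : C →ₐ[B] C ⊗[B] C).toLinearMap -
      (Algebra.TensorProduct.includeLeft : C →ₐ[B] C ⊗[B] C).toLinearMap) ∘ₗ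
      Algebra.linearMap B C = 0 := by
      ext
      simp
    rw [this, LinearMap.lTensor_zero, LinearMap.zero_apply]

theorem exact_sub_add [Module.FaithfullyFlat B C] : Function.Exact
    ((Algebra.TensorProduct.includeRight : C →ₐ[B] C ⊗[B] C).toLinearMap -
      (Algebra.TensorProduct.includeLeft : C →ₐ[B] C ⊗[B] C).toLinearMap)
    ((Algebra.TensorProduct.map (AlgHom.id B C) (Algebra.TensorProduct.includeLeft :
        C →ₐ[B] C ⊗[B] C)).toLinearMap +
      (Algebra.TensorProduct.includeRight : C ⊗[B] C →ₐ[B] C ⊗[B] (C ⊗[B] C)).toLinearMap -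
      (Algebra.TensorProduct.map (AlgHom.id B C) (Algebra.TensorProduct.includeRight :
        C →ₐ[B] C ⊗[B] C)).toLinearMap) := by
  apply Module.FaithfullyFlat.lTensor_reflects_exact B C
  intro z
  constructor
  · intro h
    refine ⟨contract B C C z, ?_⟩
    have key : ∀ z : C ⊗[B] (C ⊗[B] C), contract B C (C ⊗[B] C)
        (((((Algebra.TensorProduct.map (AlgHom.id B C) (Algebra.TensorProduct.includeLeft :
        C →ₐ[B] C ⊗[B] C)).toLinearMap +
      (Algebra.TensorProduct.includeRight : C ⊗[B] C →ₐ[B] C ⊗[B] (C ⊗[B] C)).toLinearMap -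
      (Algebra.TensorProduct.map (AlgHom.id B C) (Algebra.TensorProduct.includeRight :
        C →ₐ[B] C ⊗[B] C)).toLinearMap)).lTensor C) z) =
        z - (((Algebra.TensorProduct.includeRight : C →ₐ[B] C ⊗[B] C).toLinearMap -
          (Algebra.TensorProduct.includeLeft : C →ₐ[B] C ⊗[B] C).toLinearMap).lTensor C)
            (contract B C C z) := by
      intro z
      induction z with
      | zero => simp
      | add x y hx hy =>
        simp only [map_add, hx, hy]
        abel
      | tmul x y =>
        induction y with
        | zero => simp
        | add y z hx hy =>
          simp only [map_add, tmul_add, hx, hy]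
          abel
        | tmul y z =>
          rw [contract_tmul]
          simp only [LinearMap.lTensor_tmul, LinearMap.sub_apply, LinearMap.add_apply,
            AlgHom.toLinearMap_apply, Algebra.TensorProduct.map_tmul, AlgHom.id_apply,
            Algebra.TensorProduct.includeLeft_apply, Algebra.TensorProduct.includeRight_apply,
            tmul_sub, tmul_add, map_sub, map_add, contract_tmul, mul_one]
          abel
    have := key z
    rw [h, map_zero, eq_comm, sub_eq_zero] at this
    exact this.symm
  · rintro ⟨z, rfl⟩
    rw [← LinearMap.comp_apply, ← LinearMap.lTensor_comp]
    have : ((Algebra.TensorProduct.map (AlgHom.id B C) (Algebra.TensorProduct.includeLeft :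
        C →ₐ[B] C ⊗[B] C)).toLinearMap +
      (Algebra.TensorProduct.includeRight : C ⊗[B] C →ₐ[B] C ⊗[B] (C ⊗[B] C)).toLinearMap -
      (Algebra.TensorProduct.map (AlgHom.id B C) (Algebra.TensorProduct.includeRight :
        C →ₐ[B] C ⊗[B] C)).toLinearMap) ∘ₗ
        ((Algebra.TensorProduct.includeRight : C →ₐ[B] C ⊗[B] C).toLinearMap -
      (Algebra.TensorProduct.includeLeft : C →ₐ[B] C ⊗[B] C).toLinearMap) = 0 := by
      ext x
      simp [tmul_sub]
    rw [this, LinearMap.lTensor_zero, LinearMap.zero_apply]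

variable (k : Type u) [Field k] [Algebra k B] [Algebra k C] [IsScalarTower k B C]

/-- The Čech data of a faithfully flat covering. -/
def CechData.ofFaithfullyFlat [Module.FaithfullyFlat B C] :
    CechData k B C (C ⊗[B] C) (C ⊗[B] (C ⊗[B] C)) where
  j := IsScalarTower.toAlgHom k B C
  i₀ := (Algebra.TensorProduct.includeLeft : C →ₐ[B] C ⊗[B] C).restrictScalars k
  i₁ := (Algebra.TensorProduct.includeRight : C →ₐ[B] C ⊗[B] C).restrictScalars k
  p₀₁ := (Algebra.TensorProduct.map (AlgHom.id B C) (Algebra.TensorProduct.includeLeft :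
        C →ₐ[B] C ⊗[B] C)).restrictScalars k
  p₁₂ := (Algebra.TensorProduct.includeRight :
    C ⊗[B] C →ₐ[B] C ⊗[B] (C ⊗[B] C)).restrictScalars k
  p₀₂ := (Algebra.TensorProduct.map (AlgHom.id B C) (Algebra.TensorProduct.includeRight :
        C →ₐ[B] C ⊗[B] C)).restrictScalars k
  i_comp_j := AlgHom.ext fun b => by
    change (algebraMap B C b) ⊗ₜ[B] (1 : C) = (1 : C) ⊗ₜ[B] (algebraMap B C b)
    rw [Algebra.algebraMap_eq_smul_one, smul_tmul]
  p_comp_i₀ := AlgHom.ext fun c => by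
    simp
  p_comp_i₁ := AlgHom.ext fun c => by
    simp
  p_comp_i₂ := AlgHom.ext fun c => by
    simp
  injective := algebraMap_injective_of_faithfullyFlat B C
  exact₀ c hc := by
    refine (exact_linearMap_sub B C c).1 ?_
    rw [LinearMap.sub_apply, sub_eq_zero]
    exact hc.symm
  exact₁ w hw := by
    obtain ⟨v, hv⟩ := (exact_sub_add B C w).1 (by
      rw [LinearMap.sub_apply, LinearMap.add_apply, sub_eq_zero]
      exact hw.symm)
    exact ⟨v, hv.symm⟩

end FaithfullyFlat

variable {k : Type u} [Field k] {B C D E : Type u} [CommRing B] [Algebra k B]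
    [CommRing C] [Algebra k C] [CommRing D] [Algebra k D] [CommRing E] [Algebra k E]

/-- The Čech data of power series rings, without exactness in degree one. -/
theorem CechData.exists_psMap_eq (c : CechData k B C D E) (y : PowerSeries C)
    (h : psMap c.i₀ y = psMap c.i₁ y) : ∃ b, psMap c.j b = y := by
  have h1 : ∀ n, ∃ b, c.j b = PowerSeries.coeff n y := fun n => c.exact₀ _ (by
    rw [← coeff_psMap, ← coeff_psMap, h])
  choose b hb using h1
  exact ⟨PowerSeries.mk b, PowerSeries.ext fun n => by simp [hb]⟩

variable {R : Type u} [CommRing R] [HopfAlgebra k R] {ell : Pts k R (LaurentPolynomial k)}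

/-- The step of the proof of `exists_eq_of_cocycle` improving the congruence by one. -/
theorem CechData.exists_congr_succ (c : CechData k B C D E) (X : Coords ell) (hell : IsCochar ell)
    [Algebra.FormallySmooth k R] {N : ℕ} (hN : 1 ≤ N) {a : Pts k R (PowerSeries D)}
    (ha : a ∈ arcGroup (Pts.map (laurentToLaur k D) ell))
    (haN : a ∈ congr k R (Ideal.span {PowerSeries.X ^ N}))
    (hc : Pts.map (psMap c.p₀₂) a = Pts.map (psMap c.p₀₁) a * Pts.map (psMap c.p₁₂) a) :
    ∃ v ∈ arcGroup (Pts.map (laurentToLaur k C) ell),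
      v ∈ congr k R (Ideal.span {PowerSeries.X ^ N}) ∧
      (Pts.map (psMap c.i₀) v)⁻¹ * a * Pts.map (psMap c.i₁) v ∈
        congr k R (Ideal.span {PowerSeries.X ^ (N + 1)}) := by
  have hXmul : ∀ {A : Type u} [CommRing A], (Ideal.span {(PowerSeries.X : PowerSeries A) ^ N}) *
      Ideal.span {PowerSeries.X ^ N} ≤ Ideal.span {PowerSeries.X ^ (N + 1)} := by
    intro A _
    rw [Ideal.span_singleton_mul_span_singleton, ← pow_add, Ideal.span_singleton_le_span_singleton]
    exact pow_dvd_pow _ (by omega)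
  have hXc : ∀ {A A' : Type u} [CommRing A] [Algebra k A] [CommRing A'] [Algebra k A']
      (φ : A →ₐ[k] A') (g : Pts k R (PowerSeries A)),
      g ∈ congr k R (Ideal.span {PowerSeries.X ^ N}) →
      Pts.map (psMap φ) g ∈ congr k R (Ideal.span {PowerSeries.X ^ N}) := by
    intro A A' _ _ _ _ φ g hg
    refine congr_map _ (fun y hy => ?_) hg
    rw [Ideal.mem_span_singleton] at *
    have := map_dvd (psMap φ) hy
    rwa [map_pow, show psMap φ PowerSeries.X = PowerSeries.X from PowerSeries.map_X _] at this
  have hcoef : ∀ {A : Type u} [CommRing A] {y : PowerSeries A},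
      y ∈ Ideal.span {PowerSeries.X ^ (N + 1)} → PowerSeries.coeff N y = 0 := by
    intro A _ y hy
    exact PowerSeries.X_pow_dvd_iff.1 (Ideal.mem_span_singleton.1 hy) N N.lt_succ_self
  -- Modulo X^(N+1) the product of arcs congruent to 1 modulo X^N is addition, because 2N ≥ N + 1.
  -- So the coefficients of X^N in each coordinate of a form an additive cocycle.
  have hw : ∀ i, ∃ v, PowerSeries.coeff N (a.ofConv (X.x i)) = c.i₁ v - c.i₀ v := by
    intro i
    refine c.exact₁ _ ?_
    have h1 := hcoef (hXmul (hell.mul_apply_sub_mem_mul (hXc c.p₀₁ a haN) (hXc c.p₁₂ a haN)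
      (X.x_augm i)))
    rw [← hc] at h1
    simp only [Pts.map_apply, map_sub, coeff_psMap] at h1
    linear_combination h1
  choose u hu using hw
  -- In coordinates required to vanish to order greater than N, the coefficient of a is already 0
  -- and the correction has to be 0. The sign matches the form i₀ w - i₁ w of the coboundary.
  let w (i : X.ι) : C := if N < 1 + (-X.deg i).toNat then 0 else -u i
  have hw : ∀ i, PowerSeries.coeff N (a.ofConv (X.x i)) = c.i₀ (w i) - c.i₁ (w i) := by
    intro i
    by_cases h : N < 1 + (-X.deg i).toNat
    · simp only [w, if_pos h, map_zero, sub_zero]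
      have := mem_shiftSub.1 (((X.mem_arcGroup_iff hell).1 ha).2 i)
      exact PowerSeries.X_pow_dvd_iff.1 this N h
    · simp only [w, if_neg h, map_neg]
      rw [hu]
      ring
  obtain ⟨v, hv, hvx⟩ := X.exists_arc (fun i => PowerSeries.X ^ N * PowerSeries.C (w i))
    (fun i => (dvd_pow_self _ (by omega)).mul_right _)
  have hvN : v ∈ congr k R (Ideal.span {PowerSeries.X ^ N}) := by
    rw [mem_congr_X_pow]
    intro f hf
    have := X.dvd_sub hv (one_mem _) N (fun i => by
      rw [hvx, Pts.one_apply, mem_augm.1 (X.x_augm i), map_zero, sub_zero]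
      exact dvd_mul_right _ _) f
    rwa [Pts.one_apply, mem_augm.1 hf, map_zero, sub_zero] at this
  have hvG : v ∈ arcGroup (Pts.map (laurentToLaur k C) ell) := by
    refine (X.mem_arcGroup_iff hell).2 ⟨hv, fun i => ?_⟩
    rw [hvx, mem_shiftSub]
    by_cases h : N < 1 + (-X.deg i).toNat
    · simp [w, if_pos h]
    · exact (pow_dvd_pow _ (not_lt.1 h)).mul_right _
  refine ⟨v, hvG, hvN, ?_⟩
  have h1 := hXc c.i₀ v hvN
  have h2 := hXc c.i₁ v hvN
  have hb : (Pts.map (psMap c.i₀) v)⁻¹ * a * Pts.map (psMap c.i₁) v ∈ arcs k R D :=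
    mul_mem (mul_mem (inv_mem (map_mem_arcs _ hv)) ha.1) (map_mem_arcs _ hv)
  have hbN := mul_mem (mul_mem (inv_mem h1) haN) h2
  rw [mem_congr_X_pow]
  intro f hf
  have := X.dvd_sub hb (one_mem _) (N + 1) (fun i => ?_) f
  · rwa [Pts.one_apply, mem_augm.1 hf, map_zero, sub_zero] at this
  rw [Pts.one_apply, mem_augm.1 (X.x_augm i), map_zero, sub_zero, PowerSeries.X_pow_dvd_iff]
  intro m hm
  rcases Nat.lt_succ_iff_lt_or_eq.1 hm with hm | rfl
  · exact PowerSeries.X_pow_dvd_iff.1 (mem_congr_X_pow.1 hbN _ (X.x_augm i)) m hm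
  -- In degree N the coordinates of the corrected element are -i₀(w) + a_N + i₁(w) = 0, again
  -- because the group law is additive there.
  · have e1 := hcoef (hXmul (hell.mul_apply_sub_mem_mul (mul_mem (inv_mem h1) haN) h2
      (X.x_augm i)))
    have e2 := hcoef (hXmul (hell.mul_apply_sub_mem_mul (inv_mem h1) haN (X.x_augm i)))
    have e3 := hcoef (hXmul (hell.inv_apply_add_mem_mul h1 (X.x_augm i)))
    simp only [map_sub, map_add] at e1 e2 e3
    have e4 : PowerSeries.coeff m ((Pts.map (psMap c.i₀) v).ofConv (X.x i)) = c.i₀ (w i) := by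
      rw [Pts.map_apply, coeff_psMap, hvx]
      simp
    have e5 : PowerSeries.coeff m ((Pts.map (psMap c.i₁) v).ofConv (X.x i)) = c.i₁ (w i) := by
      rw [Pts.map_apply, coeff_psMap, hvx]
      simp
    linear_combination e1 + e2 + e3 + hw i - e4 + e5

/-- Vanishing of `H¹` with coefficients in the group `arcGroup (t ^ λ)`. -/
theorem CechData.exists_eq_of_cocycle (c : CechData k B C D E) (X : Coords ell)
    (hell : IsCochar ell) [Algebra.FormallySmooth k R] {a : Pts k R (PowerSeries D)}
    (ha : a ∈ arcGroup (Pts.map (laurentToLaur k D) ell))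
    (hc : Pts.map (psMap c.p₀₂) a = Pts.map (psMap c.p₀₁) a * Pts.map (psMap c.p₁₂) a) :
    ∃ v ∈ arcGroup (Pts.map (laurentToLaur k C) ell),
      a = Pts.map (psMap c.i₀) v * (Pts.map (psMap c.i₁) v)⁻¹ := by
  -- The cocycle a changed by the cochain v. Making it trivial is the goal. It stays a cocycle in
  -- the same group, so the correction can be iterated.
  let tw (v : Pts k R (PowerSeries C)) : Pts k R (PowerSeries D) :=
    (Pts.map (psMap c.i₀) v)⁻¹ * a * Pts.map (psMap c.i₁) v
  have htw : ∀ v w, tw (v * w) = (Pts.map (psMap c.i₀) w)⁻¹ * tw v * Pts.map (psMap c.i₁) w := by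
    intro v w
    simp only [tw, map_mul, mul_inv_rev, mul_assoc]
  have hcoc : ∀ v, Pts.map (psMap c.p₀₂) (tw v) =
      Pts.map (psMap c.p₀₁) (tw v) * Pts.map (psMap c.p₁₂) (tw v) := by
    intro v
    simp only [tw, map_mul, map_inv, hc, Pts.map_map, psMap_comp, c.p_comp_i₀, c.p_comp_i₁,
      c.p_comp_i₂]
    group
  have hG : ∀ {A A' : Type u} [CommRing A] [Algebra k A] [CommRing A'] [Algebra k A']
      (φ : A →ₐ[k] A') (g : Pts k R (PowerSeries A)),
      g ∈ arcGroup (Pts.map (laurentToLaur k A) ell) →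
      Pts.map (psMap φ) g ∈ arcGroup (Pts.map (laurentToLaur k A') ell) := by
    intro A A' _ _ _ _ φ g hg
    have := map_mem_arcGroup φ hg
    rwa [Pts.map_map, laurMap_comp_laurentToLaur] at this
  have htwG : ∀ v ∈ arcGroup (Pts.map (laurentToLaur k C) ell),
      tw v ∈ arcGroup (Pts.map (laurentToLaur k D) ell) := fun v hv =>
    mul_mem (mul_mem (inv_mem (hG _ _ hv)) ha) (hG _ _ hv)
  let S (N : ℕ) : Type u := {v : Pts k R (PowerSeries C) //
    v ∈ arcGroup (Pts.map (laurentToLaur k C) ell) ∧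
      tw v ∈ congr k R (Ideal.span {PowerSeries.X ^ (N + 1)})}
  have step : ∀ N (v : S N), ∃ v' : S (N + 1), ∃ w ∈ congr k R
      (Ideal.span {(PowerSeries.X : PowerSeries C) ^ (N + 1)}), v'.1 = v.1 * w := by
    rintro N ⟨v, hv, hvN⟩
    obtain ⟨w, hw, hwN, hw'⟩ := c.exists_congr_succ X hell N.succ_pos (htwG v hv) hvN (hcoc v)
    exact ⟨⟨v * w, mul_mem hv hw, by rwa [htw]⟩, w, hwN, rfl⟩
  choose nxt hnxt using step
  -- The iteration starts from v = 1: the arc a itself is congruent to 1 modulo X.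
  let V (N : ℕ) : S N := Nat.rec ⟨1, one_mem _, by
    have : tw 1 = a := by simp [tw]
    rw [this, ← mem_arcs_iff_congr]
    exact ha.1⟩ nxt N
  have hV : ∀ N f, PowerSeries.X ^ N ∣ (V (N + 1)).1.ofConv f - (V N).1.ofConv f := by
    intro N f
    obtain ⟨w, hw, hw'⟩ := hnxt N (V N)
    have hw2 : w ∈ congr k R (Ideal.span {(PowerSeries.X : PowerSeries C) ^ N}) :=
      congr_mono (Ideal.span_singleton_le_span_singleton.2 (pow_dvd_pow _ N.le_succ)) hw
    have e : Pts.map (Ideal.Quotient.mkₐ k (Ideal.span {(PowerSeries.X : PowerSeries C) ^ N}))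
        (V (N + 1)).1 = Pts.map (Ideal.Quotient.mkₐ k _) (V N).1 := by
      change Pts.map _ (nxt N (V N)).1 = _
      rw [hw', map_mul, MonoidHom.mem_ker.1 hw2, mul_one]
    have := congrArg (fun p : Pts k R _ => p.ofConv f) e
    exact Ideal.mem_span_singleton.1 (Ideal.Quotient.eq.1 this)
  -- Successive corrections are congruent to 1 modulo growing powers of X, so they converge. The
  -- conditions defining the group are closed.
  obtain ⟨v, hv⟩ := exists_limit_of_dvd (fun N => (V N).1) hV
  refine ⟨v, hell.mem_arcGroup_iff.2 fun n f hf => mem_shiftSub_of_forall fun N =>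
    ⟨_, hell.mem_arcGroup_iff.1 (V N).2.1 n f hf, hv N f⟩, ?_⟩
  have h1 : tw v = 1 := by
    refine Pts.ext fun f => eq_of_forall_X_pow_dvd fun N => ?_
    have h2 : ∀ (φ : C →ₐ[k] D), Pts.map (Ideal.Quotient.mkₐ k (Ideal.span
        {(PowerSeries.X : PowerSeries D) ^ N})) (Pts.map (psMap φ) v) =
        Pts.map (Ideal.Quotient.mkₐ k _) (Pts.map (psMap φ) (V N).1) := by
      intro φ
      refine Pts.ext fun f => Ideal.Quotient.eq.2 (Ideal.mem_span_singleton.2 ?_)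
      have := map_dvd (psMap φ) (hv N f)
      rw [map_sub, map_pow, show psMap φ PowerSeries.X = PowerSeries.X from PowerSeries.map_X _]
        at this
      exact this
    have h3 : Pts.map (Ideal.Quotient.mkₐ k (Ideal.span {(PowerSeries.X : PowerSeries D) ^ N}))
        (tw v) = 1 := by
      have h4 : tw (V N).1 ∈ congr k R (Ideal.span {(PowerSeries.X : PowerSeries D) ^ N}) :=
        congr_mono (Ideal.span_singleton_le_span_singleton.2 (pow_dvd_pow _ N.le_succ))
          (V N).2.2
      rw [← MonoidHom.mem_ker.1 h4]
      simp only [tw, map_mul, map_inv, h2]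
    rw [← map_one (Pts.map (Ideal.Quotient.mkₐ k (Ideal.span
      {(PowerSeries.X : PowerSeries D) ^ N})))] at h3
    have := congrArg (fun p : Pts k R _ => p.ofConv f) h3
    exact Ideal.mem_span_singleton.1 (Ideal.Quotient.eq.1 this)
  rw [eq_mul_inv_iff_mul_eq, ← inv_mul_eq_one, ← inv_inj, inv_one, ← h1]
  simp only [tw]
  group

end Descent

end

section

/-! ### Framings and their descent. -/

section Framings

variable {k : Type u} [Field k] {R : Type u} [CommRing R] [HopfAlgebra k R]
variable {ell : Pts k R (LaurentPolynomial k)}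
variable {A B C D E : Type u} [CommRing A] [Algebra k A] [CommRing B] [Algebra k B]
  [CommRing C] [Algebra k C] [CommRing D] [Algebra k D] [CommRing E] [Algebra k E]

/-- There are sections of the two bundles over `f : A → C` which carry `κ` to the matrix `κ`, and
whose values at `t = 0` are `g` and `h`. -/
structure HeckeTuple.IsFraming (X : HeckeTuple k R A) (f : A →ₐ[k] C) (κ : Pts k R (Laur C))
    (g h : Pts k R C) (σ₁ : X.F₁.S →ₐ[k] PowerSeries C) (σ₂ : X.F₂.S →ₐ[k] PowerSeries C) :
    Prop where
  isSections : X.IsSections f κ σ₁ σ₂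
  eval₁ : (psEval k C).comp σ₁ = X.F₁.pmul (f.comp X.e₁) g
  eval₂ : (psEval k C).comp σ₂ = X.F₂.pmul (f.comp X.e₂) h

/-- See `HeckeTuple.IsFraming`. -/
def HeckeTuple.Framed (X : HeckeTuple k R A) (f : A →ₐ[k] C) (κ : Pts k R (Laur C))
    (g h : Pts k R C) : Prop := ∃ σ₁ σ₂, X.IsFraming f κ g h σ₁ σ₂

namespace HeckeTuple.IsFraming

variable {X : HeckeTuple k R A} {f : A →ₐ[k] C} {κ κ' : Pts k R (Laur C)} {g h g' h' : Pts k R C}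
  {σ₁ σ₁' : X.F₁.S →ₐ[k] PowerSeries C} {σ₂ σ₂' : X.F₂.S →ₐ[k] PowerSeries C}

theorem map (H : X.IsFraming f κ g h σ₁ σ₂) (φ : C →ₐ[k] D) :
    X.IsFraming (φ.comp f) (Pts.map (laurMap φ) κ) (Pts.map φ g) (Pts.map φ h)
      ((psMap φ).comp σ₁) ((psMap φ).comp σ₂) where
  isSections := H.isSections.map φ
  eval₁ := by
    rw [← AlgHom.comp_assoc, psEval_comp_psMap, AlgHom.comp_assoc, H.eval₁, Torsor.comp_pmul,
      AlgHom.comp_assoc]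
  eval₂ := by
    rw [← AlgHom.comp_assoc, psEval_comp_psMap, AlgHom.comp_assoc, H.eval₂, Torsor.comp_pmul,
      AlgHom.comp_assoc]

theorem of_map {φ : C →ₐ[k] D} (hφ : Function.Injective φ)
    (H : X.IsFraming (φ.comp f) (Pts.map (laurMap φ) κ) (Pts.map φ g) (Pts.map φ h)
      ((psMap φ).comp σ₁) ((psMap φ).comp σ₂)) : X.IsFraming f κ g h σ₁ σ₂ where
  isSections := .of_map hφ H.isSections
  eval₁ := by
    have := H.eval₁
    rw [← AlgHom.comp_assoc, psEval_comp_psMap, AlgHom.comp_assoc, AlgHom.comp_assoc,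
      ← Torsor.comp_pmul] at this
    exact AlgHom.ext fun s => hφ (congrArg (fun p : X.F₁.S →ₐ[k] D => p s) this)
  eval₂ := by
    have := H.eval₂
    rw [← AlgHom.comp_assoc, psEval_comp_psMap, AlgHom.comp_assoc, AlgHom.comp_assoc,
      ← Torsor.comp_pmul] at this
    exact AlgHom.ext fun s => hφ (congrArg (fun p : X.F₂.S →ₐ[k] D => p s) this)

theorem pmul (H : X.IsFraming f κ g h σ₁ σ₂) (a b : Pts k R (PowerSeries C))
    (hab : Pts.map (psLaur k C) b * κ' = κ * Pts.map (psLaur k C) a) :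
    X.IsFraming f κ' (g * Pts.map (psEval k C) a) (h * Pts.map (psEval k C) b)
      (X.F₁.pmul σ₁ a) (X.F₂.pmul σ₂ b) where
  isSections := H.isSections.pmul a b hab
  eval₁ := by rw [Torsor.comp_pmul, H.eval₁, Torsor.pmul_pmul]
  eval₂ := by rw [Torsor.comp_pmul, H.eval₂, Torsor.pmul_pmul]

theorem exists_pmul (H : X.IsFraming f κ g h σ₁ σ₂) (H' : X.IsFraming f κ' g' h' σ₁' σ₂') :
    ∃ a b : Pts k R (PowerSeries C), σ₁' = X.F₁.pmul σ₁ a ∧ σ₂' = X.F₂.pmul σ₂ b ∧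
      Pts.map (psLaur k C) b * κ' = κ * Pts.map (psLaur k C) a ∧
      g' = g * Pts.map (psEval k C) a ∧ h' = h * Pts.map (psEval k C) b := by
  obtain ⟨a, b, rfl, rfl, hab⟩ := H.isSections.exists_pmul H'.isSections
  refine ⟨a, b, rfl, rfl, hab, ?_, ?_⟩
  · have := H'.eval₁
    rw [Torsor.comp_pmul, H.eval₁, Torsor.pmul_pmul] at this
    exact (X.F₁.pmul_left_injective _ this).symm
  · have := H'.eval₂
    rw [Torsor.comp_pmul, H.eval₂, Torsor.pmul_pmul] at this
    exact (X.F₂.pmul_left_injective _ this).symm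

theorem comp_hom {Y : HeckeTuple k R B} {j : A →ₐ[k] B} {i : B →ₐ[k] C}
    (φ : HeckeTuple.Hom j X Y)
    {τ₁ : Y.F₁.S →ₐ[k] PowerSeries C} {τ₂ : Y.F₂.S →ₐ[k] PowerSeries C}
    (H : Y.IsFraming i κ g h τ₁ τ₂) :
    X.IsFraming (i.comp j) κ g h (τ₁.comp φ.hom₁.toAlgHom) (τ₂.comp φ.hom₂.toAlgHom) where
  isSections := H.isSections.comp_hom φ
  eval₁ := by
    have e : (i.comp j).comp X.e₁ = (i.comp Y.e₁).comp φ.hom₁.toAlgHom :=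
      AlgHom.ext fun s => congrArg i (φ.map_e₁ s).symm
    rw [← AlgHom.comp_assoc, H.eval₁, e, TorsorHom.pmul_comp]
  eval₂ := by
    have e : (i.comp j).comp X.e₂ = (i.comp Y.e₂).comp φ.hom₂.toAlgHom :=
      AlgHom.ext fun s => congrArg i (φ.map_e₂ s).symm
    rw [← AlgHom.comp_assoc, H.eval₂, e, TorsorHom.pmul_comp]

end HeckeTuple.IsFraming

/-- At t = 0 a section and the given trivialization are two points of a torsor over the same base
point, so they differ by a group element. -/
theorem HeckeTuple.IsSections.exists_isFraming {X : HeckeTuple k R A} {f : A →ₐ[k] C}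
    {κ : Pts k R (Laur C)} {σ₁ : X.F₁.S →ₐ[k] PowerSeries C} {σ₂ : X.F₂.S →ₐ[k] PowerSeries C}
    (H : X.IsSections f κ σ₁ σ₂) : ∃ g h, X.IsFraming f κ g h σ₁ σ₂ := by
  have e : ∀ a, psEval k C (psMap f a) = f (PowerSeries.constantCoeff a) := fun a =>
    congrArg (fun p : PowerSeries A →ₐ[k] C => p a) (psEval_comp_psMap f)
  obtain ⟨g, hg⟩ := X.F₁.exists_pmul_eq (f.comp X.e₁) ((psEval k C).comp σ₁) fun b => by
    rw [AlgHom.comp_apply, AlgHom.comp_apply, X.e₁_base, H.base₁, e]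
  obtain ⟨h, hh⟩ := X.F₂.exists_pmul_eq (f.comp X.e₂) ((psEval k C).comp σ₂) fun b => by
    rw [AlgHom.comp_apply, AlgHom.comp_apply, X.e₂_base, H.base₂, e]
  exact ⟨g, h, H, hg, hh⟩

theorem HeckeTuple.trivTuple_isFraming (κ : Pts k R (Laur B)) :
    (trivTuple B κ).IsFraming (AlgHom.id k B) κ 1 1 (trivPt (AlgHom.id k (PowerSeries B)) 1)
      (trivPt (AlgHom.id k (PowerSeries B)) 1) where
  isSections := trivTuple_isSections κ
  eval₁ := by
    rw [Torsor.pmul_one, comp_trivPt, map_one]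
    rfl
  eval₂ := by
    rw [Torsor.pmul_one, comp_trivPt, map_one]
    rfl

/-- The vanishing of `H¹` of the group `arcGroup κ` on a covering. -/
def CechData.HasTrivialH1 (c : CechData k B C D E) (κ : Pts k R (Laur B)) : Prop :=
  ∀ a ∈ arcGroup (Pts.map (laurMap (c.i₀.comp c.j)) κ),
    Pts.map (psMap c.p₀₂) a = Pts.map (psMap c.p₀₁) a * Pts.map (psMap c.p₁₂) a →
    ∃ v ∈ arcGroup (Pts.map (laurMap c.j) κ),
      a = Pts.map (psMap c.i₀) v * (Pts.map (psMap c.i₁) v)⁻¹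

theorem CechData.hasTrivialH1_tpow (c : CechData k B C D E) (X : Coords ell)
    (hell : IsCochar ell) [Algebra.FormallySmooth k R] :
    c.HasTrivialH1 (Pts.map (laurentToLaur k B) ell) := by
  intro a ha h
  rw [Pts.map_map, laurMap_comp_laurentToLaur] at ha ⊢
  exact c.exists_eq_of_cocycle X hell ha h

theorem CechData.exists_section (c : CechData k B C D E) {S : Type u} [CommRing S] [Algebra k S]
    (σ : S →ₐ[k] PowerSeries C) (h : (psMap c.i₀).comp σ = (psMap c.i₁).comp σ) :
    ∃ τ : S →ₐ[k] PowerSeries B, (psMap c.j).comp τ = σ :=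
  exists_algHom_comp_eq (psMap_injective c.injective) σ fun x =>
    c.exists_psMap_eq _ (congrArg (fun p : S →ₐ[k] PowerSeries D => p x) h)

/-- Descent of framings along a covering. -/
theorem HeckeTuple.Framed.descend (c : CechData k B C D E) {X : HeckeTuple k R A} {f : A →ₐ[k] B}
    {κ : Pts k R (Laur B)} {g h : Pts k R B} (hc : c.HasTrivialH1 κ)
    (H : X.Framed (c.j.comp f) (Pts.map (laurMap c.j) κ) (Pts.map c.j g) (Pts.map c.j h)) :
    X.Framed f κ g h := by
  obtain ⟨σ₁, σ₂, H⟩ := H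
  have H₀ := H.map c.i₀
  have H₁ := H.map c.i₁
  rw [← AlgHom.comp_assoc, Pts.map_map, Pts.map_map, Pts.map_map, laurMap_comp] at H₀ H₁
  rw [← c.i_comp_j] at H₁
  -- The two pull-backs of the framing have the same matrix and the same values, because κ, g and h
  -- come from B. Hence they differ by an element a of the group of arcs, which is a cocycle.
  obtain ⟨a, b, ha, hb, hab, hga, hhb⟩ := H₀.exists_pmul H₁
  have hb1 : b ∈ arcs k R D := mul_eq_left.1 hhb.symm
  have haG : a ∈ arcGroup (Pts.map (laurMap (c.i₀.comp c.j)) κ) :=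
    mem_arcGroup.2 ⟨mul_eq_left.1 hga.symm, b, hb1, hab⟩
  have hcoc : Pts.map (psMap c.p₀₂) a = Pts.map (psMap c.p₀₁) a * Pts.map (psMap c.p₁₂) a := by
    have key : ∀ p : D →ₐ[k] E, (psMap (p.comp c.i₁)).comp σ₁ =
        X.F₁.pmul ((psMap (p.comp c.i₀)).comp σ₁) (Pts.map (psMap p) a) := by
      intro p
      rw [← psMap_comp, AlgHom.comp_assoc, ha, Torsor.comp_pmul, ← AlgHom.comp_assoc, psMap_comp]
    apply X.F₁.pmul_left_injective ((psMap (c.p₀₂.comp c.i₀)).comp σ₁)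
    rw [← key, c.p_comp_i₂, key, ← c.p_comp_i₁, key, Torsor.pmul_pmul, c.p_comp_i₀]
  obtain ⟨v, hv, hav⟩ := hc a haG hcoc
  obtain ⟨hv1, w, hw1, hvw⟩ := mem_arcGroup.1 hv
  have H' := H.pmul v w hvw
  rw [MonoidHom.mem_ker.1 hv1, MonoidHom.mem_ker.1 hw1, mul_one, mul_one] at H'
  have e₁ : (psMap c.i₀).comp (X.F₁.pmul σ₁ v) = (psMap c.i₁).comp (X.F₁.pmul σ₁ v) := by
    rw [Torsor.comp_pmul, Torsor.comp_pmul, ha, Torsor.pmul_pmul, hav, inv_mul_cancel_right]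
  have H'₀ := H'.map c.i₀
  have H'₁ := H'.map c.i₁
  rw [← AlgHom.comp_assoc, Pts.map_map, Pts.map_map, Pts.map_map, laurMap_comp] at H'₀ H'₁
  rw [← c.i_comp_j] at H'₁
  obtain ⟨a', b', ha', hb', hab', -, -⟩ := H'₀.exists_pmul H'₁
  -- The first section has been corrected so that its pull-backs agree. The matrix of κ then
  -- determines the second section, so its pull-backs agree too.
  have ha'1 : a' = 1 := by
    rw [← e₁] at ha'
    exact (X.F₁.pmul_left_injective _ ((X.F₁.pmul_one _).trans ha')).symm
  rw [ha'1, map_one, mul_one, mul_eq_right] at hab'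
  have hb'1 : b' = 1 := Pts.map_injective psLaur_injective (hab'.trans (map_one _).symm)
  rw [hb'1, Torsor.pmul_one] at hb'
  obtain ⟨τ₁, hτ₁⟩ := c.exists_section _ e₁
  obtain ⟨τ₂, hτ₂⟩ := c.exists_section _ hb'.symm
  refine ⟨τ₁, τ₂, .of_map c.injective ?_⟩
  rw [hτ₁, hτ₂]
  exact H'

end Framings

/-! ### Values at t = 0 of arcs related by t^λ. -/

section Values

variable {k : Type u} [Field k] {R : Type u} [CommRing R] [HopfAlgebra k R]
variable {ell : Pts k R (LaurentPolynomial k)} {A : Type u} [CommRing A] [Algebra k A]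

theorem psEval_X_pow_mul {m : ℕ} (hm : m ≠ 0) (y : PowerSeries A) :
    psEval k A (PowerSeries.X ^ m * y) = 0 := by
  change PowerSeries.constantCoeff (PowerSeries.X ^ m * y) = 0
  simp [hm]

/-- If `t ^ λ a t ^ (-λ) = b` then `a(0) ∈ P_λ` and `b(0) ∈ P_λ⁻` have the same image in the Levi
subgroup. -/
theorem IsCochar.exists_levi_of_conj (hell : IsCochar ell) {a b : Pts k R (PowerSeries A)}
    (h : Pts.map (psLaur k A) b * Pts.map (laurentToLaur k A) ell =
      Pts.map (laurentToLaur k A) ell * Pts.map (psLaur k A) a) :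
    ∃ m ∈ levi A ell, Pts.map (psEval k A) a * m⁻¹ ∈ unipotentRadical A ell ∧
      Pts.map (psEval k A) b * m⁻¹ ∈ unipotentRadical A ell⁻¹ := by
  have key : ∀ n, ∀ f ∈ wt ell n, psLaur k A (b.ofConv f) =
      Laur.tpow A n * psLaur k A (a.ofConv f) := fun n f hf => tpow_mul_eq_of_conj h hf
  -- For f of weight n one has f(b) = t^n f(a). For n < 0 this makes f(a) vanish at 0, and for n > 0
  -- it makes f(b) vanish there. In weight 0 the values agree, and these determine the Levi
  -- components.
  obtain ⟨m, hm, hma, hm0⟩ := hell.exists_levi (p := Pts.map (psEval k A) a) fun n hn f hf => by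
    obtain ⟨d, rfl⟩ : ∃ d : ℕ, n = -(d : ℤ) := ⟨n.natAbs, by omega⟩
    have e : psLaur k A (PowerSeries.X ^ d * b.ofConv f) = psLaur k A (a.ofConv f) := by
      rw [map_mul, key _ f hf, psLaur_X_pow, ← mul_assoc, mul_comm (Laur.tpow A d),
        tpow_neg_mul_tpow, one_mul]
    rw [Pts.map_apply, ← psLaur_injective e, psEval_X_pow_mul (by omega)]
  obtain ⟨m', hm', hmb, hm0'⟩ := hell.inv.exists_levi (p := Pts.map (psEval k A) b)
    fun n hn f hf => by
      rw [hell.wt_inv] at hf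
      obtain ⟨d, rfl⟩ : ∃ d : ℕ, n = -(d : ℤ) := ⟨n.natAbs, by omega⟩
      rw [neg_neg] at hf
      have e : psLaur k A (b.ofConv f) = psLaur k A (PowerSeries.X ^ d * a.ofConv f) := by
        rw [map_mul, key _ f hf, psLaur_X_pow]
      rw [Pts.map_apply, psLaur_injective e, psEval_X_pow_mul (by omega)]
  rw [hell.levi_inv] at hm'
  have hmm : m = m' := hell.levi_ext hm hm' fun f hf => by
    rw [hm0 f hf, hm0' f (by rwa [hell.wt_inv, neg_zero])]
    have := key 0 f hf
    rw [Laur.tpow_zero, one_mul] at this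
    rw [Pts.map_apply, Pts.map_apply, psLaur_injective this]
  subst hmm
  exact ⟨m, hm, hma, hmb⟩

theorem map_psEval_psConst (g : Pts k R A) : Pts.map (psEval k A) (Pts.map (psConst k A) g) = g := by
  rw [Pts.map_map, psEval_comp_psConst, Pts.map_id]

theorem IsCochar.conj_psConst_of_mem_levi (hell : IsCochar ell) {m : Pts k R A}
    (hm : m ∈ levi A ell) :
    Pts.map (psLaur k A) (Pts.map (psConst k A) m) * Pts.map (laurentToLaur k A) ell =
      Pts.map (laurentToLaur k A) ell * Pts.map (psLaur k A) (Pts.map (psConst k A) m) := by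
  rw [← eq_mul_inv_iff_mul_eq]
  refine hell.ext_wt fun n f hf => ?_
  rw [conj_tpow_apply hf]
  by_cases hn : n = 0
  · rw [hn, Laur.tpow_zero, one_mul]
    rfl
  · rw [Pts.map_apply, Pts.map_apply, hell.mem_levi_iff.1 hm n hn f hf, map_zero, map_zero,
      mul_zero]

/-- The conjugate t^λ u t^(-λ) takes the value t^n f(u) at f of weight n. For f in the augmentation
ideal this is zero if n ≤ 0 and divisible by t if n > 0. So a change of the first value by U_λ does
not affect the second. -/
theorem IsCochar.exists_conj_of_mem_unipotentRadical (hell : IsCochar ell) {u : Pts k R A}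
    (hu : u ∈ unipotentRadical A ell) : ∃ b ∈ arcs k R A,
    Pts.map (psLaur k A) b * Pts.map (laurentToLaur k A) ell =
      Pts.map (laurentToLaur k A) ell * Pts.map (psLaur k A) (Pts.map (psConst k A) u) := by
  refine hell.exists_conj_arc fun n f hf => ?_
  rcases le_or_gt n 0 with hn | hn
  · refine ⟨0, dvd_zero _, ?_⟩
    rw [Pts.map_apply, hell.mem_unipotentRadical_iff.1 hu n hn f hf, map_zero, map_zero, map_zero,
      mul_zero]
  · obtain ⟨d, rfl⟩ := Int.eq_ofNat_of_zero_le hn.le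
    refine ⟨PowerSeries.X ^ d * psConst k A (u.ofConv f),
      (dvd_pow_self _ (by omega)).mul_right _, ?_⟩
    rw [map_mul, psLaur_X_pow]
    rfl

theorem IsCochar.exists_conj_of_mem_unipotentRadical_inv (hell : IsCochar ell) {u : Pts k R A}
    (hu : u ∈ unipotentRadical A ell⁻¹) : ∃ a ∈ arcs k R A,
    Pts.map (psLaur k A) (Pts.map (psConst k A) u) * Pts.map (laurentToLaur k A) ell =
      Pts.map (laurentToLaur k A) ell * Pts.map (psLaur k A) a := by
  obtain ⟨a, ha, h⟩ := hell.inv.exists_conj_of_mem_unipotentRadical hu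
  refine ⟨a, ha, ?_⟩
  have := congrArg (fun z => Pts.map (laurentToLaur k A) ell * z * Pts.map (laurentToLaur k A) ell) h
  simpa [mul_assoc] using this.symm

end Values

end

section

/-! ### The equivalence relation defining X_λ. -/

section PreQuotient

variable {k : Type u} [Field k] {R : Type u} [CommRing R] [HopfAlgebra k R]
variable {ell : Pts k R (LaurentPolynomial k)} {A : Type u} [CommRing A] [Algebra k A]

theorem conj_mem_unipotentRadical {m u : Pts k R A} (hm : m ∈ levi A ell)
    (hu : u ∈ unipotentRadical A ell) : m * u * m⁻¹ ∈ unipotentRadical A ell := by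
  obtain ⟨P, hP, hPu⟩ := hu
  let c : A →ₐ[k] Polynomial A := IsScalarTower.toAlgHom k A (Polynomial A)
  have hc : (polyToLaurent k A).comp c = IsScalarTower.toAlgHom k A (LaurentPolynomial A) :=
    AlgHom.ext fun a => by
      simp only [polyToLaurent, c, AlgHom.comp_apply, IsScalarTower.coe_toAlgHom',
        AlgHom.restrictScalars_apply]
      exact (Polynomial.toLaurentAlg (R := A)).commutes a
  refine ⟨Pts.map c m * P * (Pts.map c m)⁻¹, ?_, ?_⟩
  · rw [SetLike.mem_coe, MonoidHom.mem_ker] at hP ⊢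
    rw [map_mul, map_mul, map_inv, hP, mul_one, mul_inv_cancel]
  · rw [map_mul, map_mul, map_inv, hPu, Pts.map_map, hc, map_mul, map_mul, map_inv]
    have : conjBy A ell m = Pts.map (IsScalarTower.toAlgHom k A (LaurentPolynomial A)) m := hm
    rw [this]

theorem IsCochar.conj_mem_unipotentRadical_inv (hell : IsCochar ell) {m u : Pts k R A}
    (hm : m ∈ levi A ell) (hu : u ∈ unipotentRadical A ell⁻¹) :
    m * u * m⁻¹ ∈ unipotentRadical A ell⁻¹ :=
  conj_mem_unipotentRadical (by rwa [hell.levi_inv]) hu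

theorem IsCochar.preQuot_mk_eq_iff (hell : IsCochar ell) {x y : Pts k R A × Pts k R A} :
    PreQuot.mk ell x = PreQuot.mk ell y ↔ ∃ m ∈ levi A ell, ∃ u ∈ unipotentRadical A ell,
      ∃ v ∈ unipotentRadical A ell⁻¹, y = (x.1 * m * u, x.2 * m * v) := by
  constructor
  · intro h
    -- A quotient by a relation only sees the equivalence it generates. The predicate S, being in
    -- the M_λ-orbit of x, is invariant under the generating relation, because M_λ normalizes both
    -- unipotent radicals and the choice of representatives is irrelevant.
    let S (z : (Pts k R A ⧸ unipotentRadical A ell) × (Pts k R A ⧸ unipotentRadical A ell⁻¹)) :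
      Prop := ∃ m ∈ levi A ell, z = (QuotientGroup.mk (x.1 * m), QuotientGroup.mk (x.2 * m))
    have key : ∀ (g h : Pts k R A) (m : Pts k R A), m ∈ levi A ell →
        S (QuotientGroup.mk g, QuotientGroup.mk h) →
        S (QuotientGroup.mk (g * m), QuotientGroup.mk (h * m)) := by
      rintro g h m hm ⟨n, hn, hz⟩
      refine ⟨n * m, mul_mem hn hm, ?_⟩
      rw [Prod.mk.injEq, QuotientGroup.eq, QuotientGroup.eq] at hz ⊢
      have hm' := inv_mem hm
      refine ⟨?_, ?_⟩
      · have := conj_mem_unipotentRadical hm' hz.1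
        convert! this using 1
        group
      · have := hell.conj_mem_unipotentRadical_inv hm' hz.2
        convert! this using 1
        group
    have hS : ∀ z w, (∃ (g h : Pts k R A) (m : Pts k R A), m ∈ levi A ell ∧
      z = (QuotientGroup.mk g, QuotientGroup.mk h) ∧
      w = (QuotientGroup.mk (g * m), QuotientGroup.mk (h * m))) → S z = S w := by
      rintro z w ⟨g, h, m, hm, rfl, rfl⟩
      refine propext ⟨key g h m hm, fun H => ?_⟩
      have := key _ _ _ (inv_mem hm) H
      rwa [mul_inv_cancel_right, mul_inv_cancel_right] at this
    have h1 : S (QuotientGroup.mk y.1, QuotientGroup.mk y.2) :=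
      (congrArg (Quot.lift S hS) h).mp ⟨1, one_mem _, by rw [mul_one, mul_one]⟩
    obtain ⟨m, hm, hz⟩ := h1
    rw [Prod.mk.injEq, eq_comm, QuotientGroup.eq, eq_comm, QuotientGroup.eq] at hz
    exact ⟨m, hm, _, hz.1, _, hz.2, by simp [← mul_assoc]⟩
  · rintro ⟨m, hm, u, hu, v, hv, rfl⟩
    have e : PreQuot.mk ell (x.1 * m * u, x.2 * m * v) = PreQuot.mk ell (x.1 * m, x.2 * m) := by
      refine congrArg (Quot.mk _) (Prod.ext ?_ ?_)
      · exact (QuotientGroup.mk_mul_of_mem _ hu)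
      · exact (QuotientGroup.mk_mul_of_mem _ hv)
    rw [e]
    exact Quot.sound ⟨x.1, x.2, m, hm, rfl, rfl⟩

end PreQuotient

/-! ### Étale coverings and equality of points of X_λ. -/

section Covers

variable {k : Type u} [Field k]

theorem IsEtaleCover.exists_cechData {B C : CommAlgCat.{u} k} {f : B ⟶ C} (hf : IsEtaleCover f) :
    ∃ (D E : CommAlgCat.{u} k) (c : CechData k B C D E), c.j = f.hom := by
  let _ := f.hom.toRingHom.toAlgebra
  have hf' : (algebraMap B C).FaithfullyFlat := hf.2
  have : IsScalarTower k B C := .of_algebraMap_eq' f.hom.comp_algebraMap.symm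
  have : Module.FaithfullyFlat B C := hf'
  exact ⟨.of k (C ⊗[B] C), .of k (C ⊗[B] (C ⊗[B] C)), CechData.ofFaithfullyFlat B C k, rfl⟩

variable {R : Type u} [CommRing R] [HopfAlgebra k R] {ell : Pts k R (LaurentPolynomial k)}

/-- Two points of `X_λ` over `A` with an inclusion between their preimages in `G × G` are equal. -/
theorem QuotPt.eq_of_le {A : CommAlgCat.{u} k} (x y : QuotPt ell A)
    (h : ∀ C f, x.carrier C f ⊆ y.carrier C f) : x = y := by
  apply QuotPt.ext
  funext C f
  refine Set.Subset.antisymm (h C f) fun z hz => ?_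
  obtain ⟨D, g, hg, w, hw⟩ := (x.map f).locally_nonempty
  have h1 : w ∈ x.carrier D (f ≫ g) := hw
  have h2 := y.map_mem f g z hz
  exact x.descent f g z hg (((x.fibre _ w _ h1).2 (((y.fibre _ w _ (h _ _ h1)).1 h2))))

/-- Two points of `X_λ` over `A` which agree over a covering are equal. -/
theorem QuotPt.eq_of_mem {A C : CommAlgCat.{u} k} (x y : QuotPt ell A) (f : A ⟶ C)
    (hf : IsEtaleCover f) (z : Pts k R C × Pts k R C) (hx : z ∈ x.carrier C f)
    (hy : z ∈ y.carrier C f) : x = y := by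
  refine QuotPt.eq_of_le x y fun D g w hw => ?_
  let _ := f.hom.toRingHom.toAlgebra
  let _ := g.hom.toRingHom.toAlgebra
  have hf₁ : (algebraMap A C).Etale := hf.1
  have hf₂ : (algebraMap A C).FaithfullyFlat := hf.2
  have : IsScalarTower k A C := .of_algebraMap_eq' f.hom.comp_algebraMap.symm
  have : IsScalarTower k A D := .of_algebraMap_eq' g.hom.comp_algebraMap.symm
  let j : D ⟶ CommAlgCat.of k (D ⊗[A] C) := CommAlgCat.ofHom
    ((Algebra.TensorProduct.includeLeft : D →ₐ[A] D ⊗[A] C).restrictScalars k)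
  let i : C ⟶ CommAlgCat.of k (D ⊗[A] C) := CommAlgCat.ofHom
    ((Algebra.TensorProduct.includeRight : C →ₐ[A] D ⊗[A] C).restrictScalars k)
  have hij : f ≫ i = g ≫ j := by
    apply CommAlgCat.hom_ext
    apply AlgHom.ext
    intro a
    exact (Algebra.TensorProduct.includeRight (R := A) (A := D) (B := C)).commutes a
  have hj : IsEtaleCover j :=
    ⟨RingHom.Etale.isStableUnderBaseChange.tensorProduct D hf₁,
      RingHom.FaithfullyFlat.isStableUnderBaseChange.tensorProduct D hf₂⟩
  have h1 := x.map_mem f i z hx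
  have h2 := y.map_mem f i z hy
  have h3 := x.map_mem g j w hw
  rw [hij] at h1 h2
  exact y.descent g j w hj ((y.fibre _ _ _ h2).2 ((x.fibre _ _ _ h1).1 h3))

end Covers

/-! ### The morphism Φ. -/

section Morphism

variable {k : Type u} [Field k] {R : Type u} [CommRing R] [HopfAlgebra k R]
variable {ell : Pts k R (LaurentPolynomial k)}
variable {A C : Type u} [CommRing A] [Algebra k A] [CommRing C] [Algebra k C]

/-- Two framings differ by arcs a, b with b t^λ = t^λ a, whose values at 0 are controlled by
`exists_levi_of_conj`. Conversely, a constant m in M_λ commutes with t^λ, while constants in U_λ and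
U_λ⁻ can be used on one side with an arc starting at 1 on the other. -/
theorem HeckeTuple.Framed.iff_preQuot (hell : IsCochar ell) {X : HeckeTuple k R A}
    {f : A →ₐ[k] C} {x y : Pts k R C × Pts k R C}
    (hx : X.Framed f (Pts.map (laurentToLaur k C) ell) x.1 x.2) :
    X.Framed f (Pts.map (laurentToLaur k C) ell) y.1 y.2 ↔
      PreQuot.mk ell x = PreQuot.mk ell y := by
  obtain ⟨σ₁, σ₂, hσ⟩ := hx
  rw [hell.preQuot_mk_eq_iff]
  constructor
  · rintro ⟨τ₁, τ₂, hτ⟩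
    obtain ⟨a, b, -, -, hab, h₁, h₂⟩ := hσ.exists_pmul hτ
    obtain ⟨m, hm, hu, hv⟩ := hell.exists_levi_of_conj hab
    refine ⟨m, hm, _, conj_mem_unipotentRadical (inv_mem hm) hu, _,
      hell.conj_mem_unipotentRadical_inv (inv_mem hm) hv, Prod.ext ?_ ?_⟩
    · rw [h₁]
      group
    · rw [h₂]
      group
  · rintro ⟨m, hm, u, hu, v, hv, rfl⟩
    obtain ⟨b, hb, hb'⟩ := hell.exists_conj_of_mem_unipotentRadical hu
    obtain ⟨a, ha, ha'⟩ := hell.exists_conj_of_mem_unipotentRadical_inv hv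
    have := ((hσ.pmul _ _ (hell.conj_psConst_of_mem_levi hm)).pmul _ _ hb').pmul _ _ ha'
    rw [map_psEval_psConst, map_psEval_psConst, map_psEval_psConst, MonoidHom.mem_ker.1 ha,
      MonoidHom.mem_ker.1 hb, mul_one, mul_one] at this
    exact ⟨_, _, this⟩

theorem HeckeTuple.Framed.map {X : HeckeTuple k R A} {f : A →ₐ[k] C} {κ : Pts k R (Laur C)}
    {g h : Pts k R C} (H : X.Framed f κ g h) {D : Type u} [CommRing D] [Algebra k D]
    (φ : C →ₐ[k] D) :
    X.Framed (φ.comp f) (Pts.map (laurMap φ) κ) (Pts.map φ g) (Pts.map φ h) := by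
  obtain ⟨σ₁, σ₂, H⟩ := H
  exact ⟨_, _, H.map φ⟩

theorem HeckeTuple.Framed.comp_hom {X : HeckeTuple k R A} {B : Type u} [CommRing B] [Algebra k B]
    {Y : HeckeTuple k R B} {j : A →ₐ[k] B} {i : B →ₐ[k] C} (φ : HeckeTuple.Hom j X Y)
    {κ : Pts k R (Laur C)} {g h : Pts k R C} (H : Y.Framed i κ g h) :
    X.Framed (i.comp j) κ g h := by
  obtain ⟨σ₁, σ₂, H⟩ := H
  exact ⟨_, _, H.comp_hom φ⟩

theorem HeckeTuple.InStratum.exists_framed {A : CommAlgCat.{u} k} {X : HeckeTuple k R A}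
    (hX : X.InStratum ell) : ∃ (C : CommAlgCat.{u} k) (f : A ⟶ C) (g h : Pts k R C),
      IsEtaleCover f ∧ X.Framed f.hom (Pts.map (laurentToLaur k C) ell) g h := by
  obtain ⟨C, f, Y, hf, ⟨φ⟩, hY⟩ := hX
  obtain ⟨σ₁, σ₂, hσ⟩ := (isStandard_iff ell Y).1 hY
  obtain ⟨g, h, H⟩ := (hσ.comp_hom φ).exists_isFraming
  exact ⟨C, f, g, h, hf, _, _, H⟩

theorem HeckeTuple.Framed.descend_etale (hell : IsCochar ell) [Algebra.Smooth k R]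
    {X : HeckeTuple k R A} {B C : CommAlgCat.{u} k} {f : A →ₐ[k] B} {φ : B ⟶ C}
    (hφ : IsEtaleCover φ) {g h : Pts k R B}
    (H : X.Framed (φ.hom.comp f) (Pts.map (laurentToLaur k C) ell) (Pts.map φ.hom g)
      (Pts.map φ.hom h)) : X.Framed f (Pts.map (laurentToLaur k B) ell) g h := by
  obtain ⟨D, E, c, hc⟩ := hφ.exists_cechData
  obtain ⟨x⟩ := hell.nonempty_coords
  refine HeckeTuple.Framed.descend c (c.hasTrivialH1_tpow x hell) ?_
  rw [Pts.map_map, laurMap_comp_laurentToLaur, hc]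
  exact H

/-- The morphism `Φ : H^λ → X_λ`. Over an algebra over which there are sections `σ₁`, `σ₂` of the
two bundles such that `κ` takes `σ₁` to `σ₂ t^λ`, it is given by the class of `(g, h)`, where
`σ₁(0) = φ₁⁻¹(g)` and `σ₂(0) = φ₂⁻¹(h)`. -/
def jantzenMap (hell : IsCochar ell) [Algebra.Smooth k R] : StackMap ell where
  obj X :=
    { carrier := fun C f =>
        {x | X.tuple.Framed f.hom (Pts.map (laurentToLaur k C) ell) x.1 x.2}
      map_mem := fun {C D} f g x hx => by
        have := HeckeTuple.Framed.map hx g.hom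
        rw [Pts.map_map, laurMap_comp_laurentToLaur] at this
        exact this
      descent := fun f g x hg hx => HeckeTuple.Framed.descend_etale hell hg hx
      fibre := fun f x y hx => HeckeTuple.Framed.iff_preQuot hell hx
      locally_nonempty := by
        obtain ⟨C, f, g, h, hf, H⟩ := X.mem.exists_framed
        exact ⟨C, f, hf, (g, h), H⟩ }
  map {X Y} f := QuotPt.eq_of_le _ _ fun C g x hx => by
    have : Y.tuple.Framed g.hom (Pts.map (laurentToLaur k C) ell) x.1 x.2 := hx
    exact this.comp_hom f.hom

theorem mem_jantzenMap (hell : IsCochar ell) [Algebra.Smooth k R] {X : HeckeStratum ell}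
    {C : CommAlgCat.{u} k} {f : X.base ⟶ C} {x : Pts k R C × Pts k R C} :
    x ∈ ((jantzenMap hell).obj X).carrier C f ↔
      X.tuple.Framed f.hom (Pts.map (laurentToLaur k C) ell) x.1 x.2 := Iff.rfl

end Morphism

end

section

/-! ### The action of points of G on a representation. -/

section Representations

variable {k : Type u} [Field k] {R : Type u} [CommRing R] [HopfAlgebra k R]
variable (V : FinRep k R)
variable {C D : Type u} [CommRing C] [Algebra k C] [CommRing D] [Algebra k D]

theorem FinRep.act_tmul (g : Pts k R C) (c : C) (v : V.V) :
    V.act g (c ⊗ₜ v) = c • TensorProduct.comm k V.V C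
      (g.ofConv.toLinearMap.lTensor V.V (V.coact v)) := by
  simp [FinRep.act]

theorem FinRep.rTensor_smul (f : C →ₐ[k] D) (c : C) (w : C ⊗[k] V.V) :
    f.toLinearMap.rTensor V.V (c • w) = f c • f.toLinearMap.rTensor V.V w := by
  induction w with
  | zero => simp
  | add x y hx hy => simp only [smul_add, map_add, hx, hy]
  | tmul x y => simp [smul_tmul']

theorem FinRep.map_act (f : C →ₐ[k] D) (g : Pts k R C) (w : C ⊗[k] V.V) :
    f.toLinearMap.rTensor V.V (V.act g w) =
      V.act (Pts.map f g) (f.toLinearMap.rTensor V.V w) := by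
  induction w with
  | zero => simp
  | add x y hx hy => simp only [map_add, hx, hy]
  | tmul c v =>
    rw [V.act_tmul, V.rTensor_smul, LinearMap.rTensor_tmul, AlgHom.toLinearMap_apply, V.act_tmul]
    congr 1
    generalize V.coact v = z
    induction z with
    | zero => simp
    | add x y hx hy => simp only [map_add, hx, hy]
    | tmul x y => simp

theorem FinRep.act_mul (g h : Pts k R C) (w : C ⊗[k] V.V) :
    V.act (g * h) w = V.act g (V.act h w) := by
  induction w with
  | zero => simp
  | add x y hx hy => simp only [map_add, hx, hy]
  | tmul c v =>
    rw [V.act_tmul, V.act_tmul, map_smul]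
    congr 1
    let Φ : V.V ⊗[k] (R ⊗[k] R) →ₗ[k] C ⊗[k] V.V := (TensorProduct.comm k V.V C).toLinearMap ∘ₗ
      (Algebra.TensorProduct.lift g.ofConv h.ofConv
        (fun _ _ => Commute.all _ _)).toLinearMap.lTensor V.V
    have e := congrArg (fun f => Φ (f v)) V.coassoc
    simp only [LinearMap.comp_apply] at e
    have e₁ : ∀ z, TensorProduct.comm k V.V C ((g * h).ofConv.toLinearMap.lTensor V.V z) =
        Φ ((Coalgebra.comul (R := k) (A := R)).lTensor V.V z) := fun z => by
      induction z with
      | zero => simp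
      | add x y hx hy => simp only [map_add, hx, hy]
      | tmul x y => simp [Φ, Pts.mul_apply]
    have e₂ : ∀ z, V.act g (TensorProduct.comm k V.V C (h.ofConv.toLinearMap.lTensor V.V z)) =
        Φ ((TensorProduct.assoc k V.V R R).toLinearMap (V.coact.rTensor R z)) := fun z => by
      induction z with
      | zero => simp
      | add x y hx hy => simp only [map_add, hx, hy]
      | tmul x r =>
        rw [LinearMap.lTensor_tmul, TensorProduct.comm_tmul, V.act_tmul, LinearMap.rTensor_tmul]
        generalize V.coact x = y
        induction y with
        | zero => simp
        | add x y hx hy => simp only [map_add, add_tmul, smul_add, hx, hy]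
        | tmul x y => simp [Φ, smul_tmul', mul_comm]
    rw [e₁, ← e, e₂]

theorem FinRep.act_one (w : C ⊗[k] V.V) : V.act 1 w = w := by
  induction w with
  | zero => simp
  | add x y hx hy => simp only [map_add, hx, hy]
  | tmul c v =>
    rw [V.act_tmul]
    have e := congrArg (fun f => (1 : C) ⊗ₜ[k] f v) V.counit
    simp only [LinearMap.comp_apply, LinearMap.id_apply] at e
    have e₁ : ∀ z, TensorProduct.comm k V.V C ((1 : Pts k R C).ofConv.toLinearMap.lTensor V.V z) =
        (1 : C) ⊗ₜ[k] ((TensorProduct.rid k V.V).toLinearMap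
          ((Coalgebra.counit (R := k) (A := R)).lTensor V.V z)) := fun z => by
      induction z with
      | zero => simp
      | add x y hx hy => simp only [map_add, tmul_add, hx, hy]
      | tmul x y => simp [Algebra.algebraMap_eq_smul_one]
    rw [e₁, e, smul_tmul', smul_eq_mul, mul_one]

theorem FinRep.act_inv_act (g : Pts k R C) (w : C ⊗[k] V.V) : V.act g⁻¹ (V.act g w) = w := by
  rw [← V.act_mul, inv_mul_cancel, V.act_one]

theorem FinRep.act_act_inv (g : Pts k R C) (w : C ⊗[k] V.V) : V.act g (V.act g⁻¹ w) = w := by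
  rw [← V.act_mul, mul_inv_cancel, V.act_one]

end Representations

/-! ### Sections of associated bundles. -/

section AssociatedBundle

variable {k : Type u} [Field k] {R : Type u} [CommRing R] [HopfAlgebra k R]
variable (V : FinRep k R)
variable {B C D : Type u} [CommRing B] [Algebra k B] [CommRing C] [Algebra k C]
  [CommRing D] [Algebra k D] {F : Torsor k R B}

theorem Torsor.evalAt_comp (f : C →ₐ[k] D) (p : F.S →ₐ[k] C) (s : F.S ⊗[k] V.V) :
    F.evalAt V (f.comp p) s = f.toLinearMap.rTensor V.V (F.evalAt V p s) := by
  rw [Torsor.evalAt, Torsor.evalAt, ← LinearMap.comp_apply, ← LinearMap.rTensor_comp]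
  rfl

theorem mem_assocSections {s : F.S ⊗[k] V.V} : s ∈ F.assocSections V ↔
    ∀ (C : Type u) [CommRing C] [Algebra k C] (p : F.S →ₐ[k] C) (g : Pts k R C),
      V.act g (F.evalAt V (F.pmul p g) s) = F.evalAt V p s := by
  constructor
  · intro h C _ _ p g
    let _ : Algebra B C := ((p : F.S →+* C).comp (algebraMap B F.S)).toAlgebra
    have : IsScalarTower k B C := .of_algebraMap_eq fun x => by
      change _ = p (algebraMap B F.S (algebraMap k B x))
      rw [← IsScalarTower.algebraMap_apply, AlgHom.commutes]
    exact h C { p with commutes' := fun b => rfl } g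
  · intro h C _ _ _ _ p g
    exact h C (p.restrictScalars k) g

theorem evalAt_pmul {s : F.S ⊗[k] V.V} (hs : s ∈ F.assocSections V) (p : F.S →ₐ[k] C)
    (g : Pts k R C) : F.evalAt V (F.pmul p g) s = V.act g⁻¹ (F.evalAt V p s) := by
  rw [← (mem_assocSections V).1 hs C p g, V.act_inv_act]

/-- A trivialization of a torsor trivializes the associated bundles. -/
theorem exists_assocSection (σ : F.S →ₐ[k] B) (hσ : ∀ b, σ (algebraMap B F.S b) = b)
    (w : B ⊗[k] V.V) : ∃ s ∈ F.assocSections V, F.evalAt V σ s = w := by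
  let α : B →ₐ[k] F.S := IsScalarTower.toAlgHom k B F.S
  -- The universal point of F is σ γ, so the equivariant function with value w at σ has to be γ⁻¹ w.
  obtain ⟨γ, hγ⟩ := F.exists_pmul_eq (α.comp σ) (AlgHom.id k F.S) fun b => by
    rw [AlgHom.comp_apply, hσ]
    rfl
  have h1 : ∀ (C : Type u) [CommRing C] [Algebra k C] (p : F.S →ₐ[k] C),
      F.pmul ((p.comp α).comp σ) (Pts.map p γ) = p := fun C _ _ p => by
    rw [AlgHom.comp_assoc, ← Torsor.comp_pmul, ← hγ, AlgHom.comp_id]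
  have h2 : ∀ (C : Type u) [CommRing C] [Algebra k C] (p : F.S →ₐ[k] C),
      F.evalAt V p (V.act γ⁻¹ (α.toLinearMap.rTensor V.V w)) =
        V.act (Pts.map p γ)⁻¹ ((p.comp α).toLinearMap.rTensor V.V w) := fun C _ _ p => by
    rw [Torsor.evalAt, V.map_act, map_inv, ← LinearMap.comp_apply, ← LinearMap.rTensor_comp]
    rfl
  refine ⟨V.act γ⁻¹ (α.toLinearMap.rTensor V.V w), (mem_assocSections V).2 fun C _ _ p g => ?_, ?_⟩
  · have hp : (F.pmul p g).comp α = p.comp α := AlgHom.ext fun b => F.pmul_algebraMap p g b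
    have : Pts.map (F.pmul p g) γ = Pts.map p γ * g := by
      apply F.pmul_left_injective ((p.comp α).comp σ)
      rw [← Torsor.pmul_pmul, h1]
      conv_lhs => rw [← hp]
      exact h1 _ _
    rw [h2, h2, this, hp, mul_inv_rev, V.act_mul, V.act_act_inv]
  · have hα : σ.comp α = AlgHom.id k B := AlgHom.ext hσ
    have : Pts.map σ γ = 1 := by
      apply F.pmul_left_injective σ
      have := h1 _ σ
      rw [hα, AlgHom.id_comp] at this
      rw [this, F.pmul_one]
    rw [h2, this, hα, inv_one, V.act_one]
    exact LinearMap.rTensor_id_apply _ _ _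

end AssociatedBundle

end

section

/-! ### Bases of weight vectors in representations. -/

section WeightBasis

variable {k : Type u} [Field k] {R : Type u} [CommRing R] [HopfAlgebra k R]
variable {ell : Pts k R (LaurentPolynomial k)}
variable {C D : Type u} [CommRing C] [Algebra k C] [CommRing D] [Algebra k D]

/-- A basis of a representation consisting of weight vectors. -/
structure WeightBasis (ell : Pts k R (LaurentPolynomial k)) (V : FinRep k R) where
  ι : Type u
  basis : Module.Basis ι k V.V
  deg : ι → ℤ
  coact_basis : ∀ j, ell.ofConv.toLinearMap.lTensor V.V (V.coact (basis j)) =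
    basis j ⊗ₜ LaurentPolynomial.T (deg j)

/-- Restriction along λ makes V a comodule over k[T, T⁻¹], and a basis can be selected from its
weight vectors. -/
theorem IsCochar.nonempty_weightBasis (hell : IsCochar ell) (V : FinRep k R) :
    Nonempty (WeightBasis ell V) := by
  let e : R →ₗ[k] LaurentPolynomial k := ell.ofConv.toLinearMap
  let ρ : V.V →ₗ[k] V.V ⊗[k] LaurentPolynomial k := e.lTensor V.V ∘ₗ V.coact
  have hρ : (TensorProduct.assoc k V.V _ _).toLinearMap ∘ₗ ρ.rTensor (LaurentPolynomial k) ∘ₗ ρ =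
      (Coalgebra.comul (R := k) (A := LaurentPolynomial k)).lTensor V.V ∘ₗ ρ := by
    have h1 : ∀ z : V.V ⊗[k] R, (TensorProduct.assoc k V.V _ _).toLinearMap
        (ρ.rTensor (LaurentPolynomial k) (e.lTensor V.V z)) =
        (TensorProduct.map e e).lTensor V.V
          ((TensorProduct.assoc k V.V R R).toLinearMap (V.coact.rTensor R z)) := fun z => by
      induction z with
      | zero => simp
      | add x y hx hy => simp only [map_add, hx, hy]
      | tmul x r =>
        simp only [LinearMap.lTensor_tmul, LinearMap.rTensor_tmul, ρ, LinearMap.comp_apply]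
        generalize V.coact x = y
        induction y with
        | zero => simp
        | add x y hx hy => simp only [map_add, add_tmul, hx, hy]
        | tmul x y => simp
    have h2 : ∀ z : V.V ⊗[k] R, (TensorProduct.map e e).lTensor V.V
        ((Coalgebra.comul (R := k) (A := R)).lTensor V.V z) =
        (Coalgebra.comul (R := k) (A := LaurentPolynomial k)).lTensor V.V (e.lTensor V.V z) :=
      fun z => by
      rw [← LinearMap.comp_apply, ← LinearMap.comp_apply, ← LinearMap.lTensor_comp,
        ← LinearMap.lTensor_comp]
      congr 2
      exact congrArg AlgHom.toLinearMap hell.comul_comp.symm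
    apply LinearMap.ext
    intro v
    have e3 := congrArg (fun f => f v) V.coassoc
    simp only [LinearMap.comp_apply] at e3
    rw [LinearMap.comp_apply, LinearMap.comp_apply, LinearMap.comp_apply, LinearMap.comp_apply,
      h1, e3, h2]
    rfl
  have hρ' : (TensorProduct.rid k V.V).toLinearMap ∘ₗ
      (Coalgebra.counit (R := k) (A := LaurentPolynomial k)).lTensor V.V ∘ₗ ρ =
        LinearMap.id := by
    rw [← V.counit]
    simp only [ρ, ← LinearMap.comp_assoc]
    congr 1
    rw [LinearMap.comp_assoc, ← LinearMap.lTensor_comp]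
    congr 2
    apply LinearMap.ext
    intro x
    exact congrArg (fun p : Pts k R k => p.ofConv x) hell.map_counit
  have hs : ⊤ ≤ Submodule.span k {m | ∃ n : ℤ, ρ m = m ⊗ₜ LaurentPolynomial.T n} :=
    fun m _ => mem_span_weightVectors ρ hρ hρ' m
  let b := Module.Basis.ofSpan (K := k) hs
  have hb : ∀ j, ∃ n : ℤ, ρ (b j) = b j ⊗ₜ LaurentPolynomial.T n := fun j =>
    Module.Basis.ofSpan_subset hs (Set.mem_range_self j)
  choose d hd using hb
  exact ⟨⟨_, b, d, hd⟩⟩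

namespace WeightBasis

variable {V : FinRep k R} (b : WeightBasis ell V)

/-- Coordinates of the elements of `C ⊗ V`. -/
def coord (w : C ⊗[k] V.V) (j : b.ι) : C := (b.basis.baseChange C).repr w j

variable {b} in
theorem ext {w w' : C ⊗[k] V.V} (h : ∀ j, b.coord w j = b.coord w' j) : w = w' :=
  (b.basis.baseChange C).repr.injective (Finsupp.ext h)

theorem coord_smul (c : C) (w : C ⊗[k] V.V) (j) : b.coord (c • w) j = c * b.coord w j := by
  simp [coord]

theorem coord_rTensor (f : C →ₐ[k] D) (w : C ⊗[k] V.V) (j) :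
    b.coord (f.toLinearMap.rTensor V.V w) j = f (b.coord w j) := by
  unfold coord
  induction w with
  | zero => simp
  | add x y hx hy => simp only [map_add, Finsupp.add_apply, hx, hy]
  | tmul c v => simp [Module.Basis.baseChange_repr_tmul]

theorem exists_coord (c : b.ι → C) : ∃ w : C ⊗[k] V.V, ∀ j, b.coord w j = c j := by
  have : Finite b.ι := Module.Finite.finite_basis b.basis
  exact ⟨(b.basis.baseChange C).repr.symm (Finsupp.equivFunOnFinite.symm c), fun j => by
    simp [coord]⟩

theorem coord_act (φ : LaurentPolynomial k →ₐ[k] C) (w : C ⊗[k] V.V) (j) :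
    b.coord (V.act (Pts.map φ ell) w) j = φ (.T (b.deg j)) * b.coord w j := by
  unfold coord
  have h : ∀ i, V.act (Pts.map φ ell) (b.basis.baseChange C i) =
      φ (.T (b.deg i)) • b.basis.baseChange C i := fun i => by
    rw [Module.Basis.baseChange_apply, V.act_tmul, one_smul]
    have e : (Pts.map φ ell).ofConv.toLinearMap = φ.toLinearMap ∘ₗ ell.ofConv.toLinearMap := rfl
    rw [e, LinearMap.lTensor_comp, LinearMap.comp_apply, b.coact_basis]
    simp [smul_tmul']
  rw [← (b.basis.baseChange C).linearCombination_repr w, Finsupp.linearCombination_apply,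
    Finsupp.sum, map_sum, map_sum, map_sum, Finsupp.finsetSum_apply, Finsupp.finsetSum_apply,
    Finset.mul_sum]
  refine Finset.sum_congr rfl fun i _ => ?_
  rw [map_smul, h, smul_smul, map_smul, map_smul, Module.Basis.repr_self]
  by_cases hij : i = j
  · subst hij
    simp [mul_comm]
  · simp [Finsupp.single_eq_of_ne (Ne.symm hij)]

theorem _root_.KOneHecke.T_smul_injective (n : ℤ) {x y : LaurentPolynomial C}
    (h : LaurentPolynomial.T n * x = LaurentPolynomial.T n * y) : x = y := by
  have := congrArg (LaurentPolynomial.T (-n) * ·) h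
  simpa [← mul_assoc, ← LaurentPolynomial.T_add] using this

theorem coord_cocharAct (w : C ⊗[k] V.V) (j) : b.coord (cocharAct ell V w) j =
    LaurentPolynomial.T (b.deg j) * LaurentPolynomial.C (b.coord w j) := by
  rw [cocharAct, coord_act, laurentBaseChange_T, coord_rTensor]
  rfl

/-- The element λ(T) multiplies the j-th coordinate, a constant, by T^(deg j). The product lies in
T^i A[T] only if the coordinate is 0 or deg j ≥ i. -/
theorem mem_weightGE {i : ℤ} {w : C ⊗[k] V.V} :
    w ∈ weightGE ell V C i ↔ ∀ j, b.deg j < i → b.coord w j = 0 := by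
  constructor
  · rintro ⟨w', hw'⟩ j hj
    have e := congrArg (fun w => b.coord w j) hw'
    simp only [coord_cocharAct, coord_smul, coord_rTensor] at e
    obtain ⟨d, hd⟩ := Int.eq_ofNat_of_zero_le (a := i - b.deg j) (by omega)
    have hi : i = b.deg j + d := by omega
    rw [hi, LaurentPolynomial.T_add, mul_assoc] at e
    have e' := T_smul_injective _ e
    have e2 : (Polynomial.C (b.coord w j)).toLaurent =
        (Polynomial.X ^ d * b.coord w' j).toLaurent := by
      rw [map_mul, Polynomial.toLaurent_C, Polynomial.toLaurent_X_pow]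
      exact e'
    -- Since d > 0, comparing constant terms shows that the coordinate vanishes.
    have e3 := congrArg (Polynomial.coeff · 0) (Polynomial.toLaurent_injective e2)
    have hd0 : d ≠ 0 := by omega
    simpa [hd0.symm, Polynomial.coeff_X_pow_mul', hd0] using e3
  · intro h
    obtain ⟨w', hw'⟩ := b.exists_coord (C := Polynomial C)
      fun j => Polynomial.X ^ (b.deg j - i).toNat * Polynomial.C (b.coord w j)
    refine ⟨w', b.ext fun j => ?_⟩
    rw [coord_cocharAct, coord_smul, coord_rTensor, hw']
    by_cases hj : b.deg j < i
    · simp [h j hj]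
    · have : polyToLaurent k C (Polynomial.X ^ (b.deg j - i).toNat * Polynomial.C (b.coord w j)) =
        LaurentPolynomial.T (b.deg j - i) * LaurentPolynomial.C (b.coord w j) := by
        have hn : (((b.deg j - i).toNat : ℕ) : ℤ) = b.deg j - i := Int.toNat_of_nonneg (by omega)
        conv_rhs => rw [← hn]
        change (Polynomial.X ^ (b.deg j - i).toNat * Polynomial.C (b.coord w j)).toLaurent = _
        rw [map_mul, Polynomial.toLaurent_C, Polynomial.toLaurent_X_pow]
      rw [this, ← mul_assoc, ← LaurentPolynomial.T_add]
      congr 2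
      omega

theorem mem_weightEq {i : ℤ} {w : C ⊗[k] V.V} (hw : w ∈ weightEq ell V C i) (j) (hj : b.deg j ≠ i) :
    b.coord w j = 0 := by
  have e := congrArg (fun w => b.coord w j) hw
  simp only [coord_cocharAct, coord_smul, coord_rTensor] at e
  change _ = LaurentPolynomial.T i * LaurentPolynomial.C (b.coord w j) at e
  have e' := congrArg (fun p : LaurentPolynomial C => p.coeff (b.deg j)) e
  rwa [coeff_T_mul_C, coeff_T_mul_C, if_pos rfl, if_neg (Ne.symm hj)] at e'

/-- The same basis for the inverse cocharacter. -/
def neg : WeightBasis ell⁻¹ V where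
  ι := b.ι
  basis := b.basis
  deg j := -b.deg j
  coact_basis j := by
    have h : (1 : LaurentPolynomial k) ⊗ₜ[k] b.basis j =
        b.basis.baseChange (LaurentPolynomial k) j := by
      rw [Module.Basis.baseChange_apply]
    have e : V.act ell⁻¹ ((1 : LaurentPolynomial k) ⊗ₜ[k] b.basis j) =
        LaurentPolynomial.T (-b.deg j) ⊗ₜ[k] b.basis j := by
      have e1 : V.act ell (LaurentPolynomial.T (-b.deg j) ⊗ₜ[k] b.basis j) =
          (1 : LaurentPolynomial k) ⊗ₜ[k] b.basis j := by
        rw [V.act_tmul, b.coact_basis, TensorProduct.comm_tmul, smul_tmul', smul_eq_mul,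
          ← LaurentPolynomial.T_add, neg_add_cancel, LaurentPolynomial.T_zero]
      rw [← e1, V.act_inv_act]
    rw [V.act_tmul, one_smul] at e
    have := congrArg (TensorProduct.comm k V.V (LaurentPolynomial k)).symm e
    simpa using this

end WeightBasis

end WeightBasis

end

section

/-! ### Jantzen filtrations in terms of a framing. -/

section Jantzen

variable {k : Type u} [Field k] {R : Type u} [CommRing R] [HopfAlgebra k R]
variable {ell : Pts k R (LaurentPolynomial k)} {A : Type u} [CommRing A] [Algebra k A]
variable {X : HeckeTuple k R A} {κ : Pts k R (Laur A)} {g h : Pts k R A}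
  {σ₁ : X.F₁.S →ₐ[k] PowerSeries A} {σ₂ : X.F₂.S →ₐ[k] PowerSeries A} {V : FinRep k R}

namespace HeckeTuple

theorem IsSections.base₁_id (H : X.IsSections (AlgHom.id k A) κ σ₁ σ₂) (a) :
    σ₁ (algebraMap _ X.F₁.S a) = a := by rw [H.base₁, psMap_id, AlgHom.id_apply]

theorem IsSections.base₂_id (H : X.IsSections (AlgHom.id k A) κ σ₁ σ₂) (a) :
    σ₂ (algebraMap _ X.F₂.S a) = a := by rw [H.base₂, psMap_id, AlgHom.id_apply]

/-- Equivariant functions are determined by their values at a section. The relation is an equation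
at the universal point of F₁ over A((t)). That point is σ₁ γ, and κ sends it to σ₂ κ γ, so γ can be
removed. -/
theorem IsSections.kappaRel_iff (H : X.IsSections (AlgHom.id k A) κ σ₁ σ₂)
    {s₁ : X.F₁.S ⊗[k] V.V} {s₂ : X.F₂.S ⊗[k] V.V} (h₁ : s₁ ∈ X.F₁.assocSections V)
    (h₂ : s₂ ∈ X.F₂.assocSections V) (i : ℤ) :
    X.KappaRel V i s₁ s₂ ↔
      V.act κ ((psLaur k A).toLinearMap.rTensor V.V (X.F₁.evalAt V σ₁ s₁)) =
        Laur.tpow A i • (psLaur k A).toLinearMap.rTensor V.V (X.F₂.evalAt V σ₂ s₂) := by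
  let ω := laurIncl A X.F₁
  -- Specialization to the section σ₁. It provides a retraction of the inclusion of A((t)), so that
  -- the equation can be brought back there.
  let r : Laur A ⊗[PowerSeries A] X.F₁.S →ₐ[k] Laur A :=
    baseLift (AlgHom.id k (Laur A)) ((psLaur k A).comp σ₁) (fun a => by
      rw [AlgHom.comp_apply, H.base₁_id]
      rfl)
  have hr : r.comp ω = AlgHom.id k _ := AlgHom.ext fun b => by
    rw [AlgHom.comp_apply]
    exact (baseLift_tmul _ _ _ _ _).trans (by rw [map_one, mul_one])
  obtain ⟨γ, hγ⟩ := X.F₁.exists_pmul_eq ((ω.comp (psLaur k A)).comp σ₁) (resIncl X.F₁ (Laur A))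
    fun a => by
      rw [resIncl_algebraMap, AlgHom.comp_apply, H.base₁_id]
      rfl
  have e₁ : X.F₁.evalAt V (resIncl X.F₁ (Laur A)) s₁ = V.act γ⁻¹ (ω.toLinearMap.rTensor V.V
      ((psLaur k A).toLinearMap.rTensor V.V (X.F₁.evalAt V σ₁ s₁))) := by
    rw [hγ, evalAt_pmul V h₁, Torsor.evalAt_comp, AlgHom.comp_toLinearMap, LinearMap.rTensor_comp]
    rfl
  have hk : X.kappaIncl.restrictScalars k =
      X.F₂.pmul ((ω.comp (psLaur k A)).comp σ₂) (Pts.map ω κ * γ) := by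
    rw [← H.kapPt_eq ω γ (fun a => by
      rw [← hγ, resIncl_algebraMap, laurMap_id]
      rfl)]
    have : X.kappaIncl.restrictScalars k =
        X.kapPt ω (resIncl X.F₁ (Laur A)) (resIncl_algebraMap X.F₁) := by
      rw [kapPt, baseLift_incl, AlgHom.id_comp]
    rw [this]
    exact X.kapPt_congr (by rw [laurMap_id, AlgHom.comp_id]) hγ
  have e₂ : X.F₂.evalAt V (X.kappaIncl.restrictScalars k) s₂ =
      V.act γ⁻¹ (ω.toLinearMap.rTensor V.V (V.act κ⁻¹
        ((psLaur k A).toLinearMap.rTensor V.V (X.F₂.evalAt V σ₂ s₂)))) := by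
    rw [hk, evalAt_pmul V h₂, Torsor.evalAt_comp, AlgHom.comp_toLinearMap, LinearMap.rTensor_comp,
      V.map_act, mul_inv_rev, V.act_mul, map_inv]
    rfl
  have hsm : ∀ w : (Laur A ⊗[PowerSeries A] X.F₁.S) ⊗[k] V.V,
      Laur.tpow A i • w = ω (Laur.tpow A i) • w := fun w =>
    (algebraMap_smul (Laur A ⊗[PowerSeries A] X.F₁.S) (Laur.tpow A i) w).symm
  have key : X.KappaRel V i s₁ s₂ ↔
      V.act γ⁻¹ (ω.toLinearMap.rTensor V.V
        ((psLaur k A).toLinearMap.rTensor V.V (X.F₁.evalAt V σ₁ s₁))) =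
      V.act γ⁻¹ (ω.toLinearMap.rTensor V.V (V.act κ⁻¹ (Laur.tpow A i •
        (psLaur k A).toLinearMap.rTensor V.V (X.F₂.evalAt V σ₂ s₂)))) := by
    rw [KappaRel, e₂, hsm, map_smul (V.act κ⁻¹), V.rTensor_smul, map_smul (V.act γ⁻¹), ← e₁]
  rw [key]
  constructor
  · intro e
    have e' := congrArg (fun w => r.toLinearMap.rTensor V.V (V.act γ w)) e
    have hrω : ∀ w, r.toLinearMap.rTensor V.V (ω.toLinearMap.rTensor V.V w) = w := fun w => by
      rw [← LinearMap.comp_apply, ← LinearMap.rTensor_comp, ← AlgHom.comp_toLinearMap, hr]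
      exact LinearMap.rTensor_id_apply _ _ _
    simp only [V.act_act_inv, hrω] at e'
    rw [e', V.act_act_inv]
  · intro e
    rw [← e, V.act_inv_act]

theorem IsFraming.evalAt_e₁ (H : X.IsFraming (AlgHom.id k A) κ g h σ₁ σ₂)
    {s : X.F₁.S ⊗[k] V.V} (hs : s ∈ X.F₁.assocSections V) : X.F₁.evalAt V X.e₁ s =
      V.act g ((psEval k A).toLinearMap.rTensor V.V (X.F₁.evalAt V σ₁ s)) := by
  rw [← Torsor.evalAt_comp, H.eval₁, evalAt_pmul V hs, V.act_act_inv, AlgHom.id_comp]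

theorem IsFraming.evalAt_e₂ (H : X.IsFraming (AlgHom.id k A) κ g h σ₁ σ₂)
    {s : X.F₂.S ⊗[k] V.V} (hs : s ∈ X.F₂.assocSections V) : X.F₂.evalAt V X.e₂ s =
      V.act h ((psEval k A).toLinearMap.rTensor V.V (X.F₂.evalAt V σ₂ s)) := by
  rw [← Torsor.evalAt_comp, H.eval₂, evalAt_pmul V hs, V.act_act_inv, AlgHom.id_comp]

end HeckeTuple

namespace WeightBasis

variable (b : WeightBasis ell V)

theorem act_tpow_eq_iff (w₁ w₂ : PowerSeries A ⊗[k] V.V) (i : ℤ) :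
    V.act (Pts.map (laurentToLaur k A) ell) ((psLaur k A).toLinearMap.rTensor V.V w₁) =
        Laur.tpow A i • (psLaur k A).toLinearMap.rTensor V.V w₂ ↔
      ∀ j, Laur.tpow A (b.deg j) * psLaur k A (b.coord w₁ j) =
        Laur.tpow A i * psLaur k A (b.coord w₂ j) := by
  constructor
  · intro e j
    have := congrArg (fun w => b.coord w j) e
    simpa only [coord_act, coord_smul, coord_rTensor, laurentToLaur_T] using this
  · intro e
    refine b.ext fun j => ?_
    simpa only [coord_act, coord_smul, coord_rTensor, laurentToLaur_T] using e j

end WeightBasis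

/-- Here x = t^(n-m) y with n - m > 0. -/
theorem eq_zero_of_tpow_mul_eq {m n : ℤ} (hmn : m < n) {x y : PowerSeries A}
    (h : Laur.tpow A m * psLaur k A x = Laur.tpow A n * psLaur k A y) : psEval k A x = 0 := by
  obtain ⟨d, hd⟩ := Int.eq_ofNat_of_zero_le (a := n - m) (by omega)
  have hn : n = m + d := by omega
  have e := congrArg (Laur.tpow A (-m) * ·) h
  simp only [← mul_assoc, hn, Laur.tpow_add] at e
  rw [tpow_neg_mul_tpow, one_mul, one_mul, ← psLaur_X_pow (k := k), ← map_mul] at e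
  rw [psLaur_injective (k := k) e]
  exact psEval_X_pow_mul (by omega) _

theorem exists_tpow_mul_eq {m n : ℤ} (hmn : n ≤ m) (x : PowerSeries A) :
    ∃ y, Laur.tpow A m * psLaur k A x = Laur.tpow A n * psLaur k A y := by
  obtain ⟨d, hd⟩ := Int.eq_ofNat_of_zero_le (a := m - n) (by omega)
  have hm : m = n + d := by omega
  exact ⟨PowerSeries.X ^ d * x, by rw [hm, Laur.tpow_add, map_mul, psLaur_X_pow, mul_assoc]⟩

namespace HeckeTuple.IsFraming

variable (H : X.IsFraming (AlgHom.id k A) (Pts.map (laurentToLaur k A) ell) g h σ₁ σ₂)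
include H

theorem exists_kappaRel (b : WeightBasis ell V) (w₁ w₂ : PowerSeries A ⊗[k] V.V) (i : ℤ)
    (hw : ∀ j, Laur.tpow A (b.deg j) * psLaur k A (b.coord w₁ j) =
      Laur.tpow A i * psLaur k A (b.coord w₂ j)) :
    ∃ s₁ ∈ X.F₁.assocSections V, ∃ s₂ ∈ X.F₂.assocSections V, X.KappaRel V i s₁ s₂ ∧
      X.F₁.evalAt V X.e₁ s₁ = V.act g ((psEval k A).toLinearMap.rTensor V.V w₁) ∧
      X.F₂.evalAt V X.e₂ s₂ = V.act h ((psEval k A).toLinearMap.rTensor V.V w₂) := by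
  obtain ⟨s₁, hs₁, rfl⟩ := exists_assocSection V σ₁ H.isSections.base₁_id w₁
  obtain ⟨s₂, hs₂, rfl⟩ := exists_assocSection V σ₂ H.isSections.base₂_id w₂
  exact ⟨s₁, hs₁, s₂, hs₂,
    (H.isSections.kappaRel_iff hs₁ hs₂ i).2 ((b.act_tpow_eq_iff _ _ i).2 hw),
    H.evalAt_e₁ hs₁, H.evalAt_e₂ hs₂⟩

/-- In the framing κ is diagonal with entries t^(deg j), so t^(-i) κ(s) is integral when the j-th
coordinate of s is divisible by t^(i - deg j). On s(0) this imposes vanishing of the coordinates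
with deg j < i, and the constant section lifts every such vector. -/
theorem jantzen₁_eq (b : WeightBasis ell V) (i : ℤ) :
    X.jantzen₁ V i = V.act g '' weightGE ell V A i := by
  ext w
  constructor
  · rintro ⟨s₁, hs₁, s₂, hs₂, hrel, rfl⟩
    rw [H.evalAt_e₁ hs₁]
    refine ⟨_, b.mem_weightGE.2 fun j hj => ?_, rfl⟩
    rw [b.coord_rTensor]
    exact eq_zero_of_tpow_mul_eq hj
      ((b.act_tpow_eq_iff _ _ i).1 ((H.isSections.kappaRel_iff hs₁ hs₂ i).1 hrel) j)
  · rintro ⟨w, hw, rfl⟩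
    have hc : ∀ j, ∃ y, Laur.tpow A (b.deg j) *
        psLaur k A (b.coord ((psConst k A).toLinearMap.rTensor V.V w) j) =
          Laur.tpow A i * psLaur k A y := fun j => by
      rcases lt_or_ge (b.deg j) i with hj | hj
      · exact ⟨0, by rw [b.coord_rTensor, b.mem_weightGE.1 hw j hj, map_zero, map_zero, mul_zero,
          mul_zero]⟩
      · exact exists_tpow_mul_eq hj _
    choose y hy using hc
    obtain ⟨w₂, hw₂⟩ := b.exists_coord y
    obtain ⟨s₁, hs₁, s₂, hs₂, hrel, e, -⟩ := H.exists_kappaRel b _ w₂ i (by simpa only [hw₂] using hy)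
    refine ⟨s₁, hs₁, s₂, hs₂, hrel, ?_⟩
    rw [e, ← LinearMap.comp_apply (LinearMap.rTensor V.V (psEval k A).toLinearMap),
      ← LinearMap.rTensor_comp, ← AlgHom.comp_toLinearMap, psEval_comp_psConst]
    exact congrArg _ (LinearMap.rTensor_id_apply _ _ _)

theorem jantzen₂_eq (b : WeightBasis ell V) (i : ℤ) :
    X.jantzen₂ V i = V.act h '' weightGE ell⁻¹ V A i := by
  ext w
  constructor
  · rintro ⟨s₁, hs₁, s₂, hs₂, hrel, rfl⟩
    rw [H.evalAt_e₂ hs₂]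
    refine ⟨_, b.neg.mem_weightGE.2 fun j hj => ?_, rfl⟩
    have hj' : -b.deg j < i := hj
    rw [b.neg.coord_rTensor]
    exact eq_zero_of_tpow_mul_eq (by omega : -i < b.deg j)
      ((b.act_tpow_eq_iff _ _ (-i)).1 ((H.isSections.kappaRel_iff hs₁ hs₂ (-i)).1 hrel) j).symm
  · rintro ⟨w, hw, rfl⟩
    have hc : ∀ j, ∃ y, Laur.tpow A (-i) *
        psLaur k A (b.coord ((psConst k A).toLinearMap.rTensor V.V w) j) =
          Laur.tpow A (b.deg j) * psLaur k A y := fun j => by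
      rcases lt_or_ge (-b.deg j) i with hj | hj
      · have : b.coord w j = 0 := b.neg.mem_weightGE.1 hw j hj
        exact ⟨0, by rw [b.coord_rTensor, this, map_zero, map_zero, mul_zero, mul_zero]⟩
      · exact exists_tpow_mul_eq (by omega) _
    choose y hy using hc
    obtain ⟨w₁, hw₁⟩ := b.exists_coord y
    obtain ⟨s₁, hs₁, s₂, hs₂, hrel, -, e⟩ :=
      H.exists_kappaRel b w₁ ((psConst k A).toLinearMap.rTensor V.V w) (-i)
        (by simpa only [hw₁] using fun j => (hy j).symm)
    refine ⟨s₁, hs₁, s₂, hs₂, hrel, ?_⟩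
    rw [e, ← LinearMap.comp_apply (LinearMap.rTensor V.V (psEval k A).toLinearMap),
      ← LinearMap.rTensor_comp, ← AlgHom.comp_toLinearMap, psEval_comp_psConst]
    exact congrArg _ (LinearMap.rTensor_id_apply _ _ _)

end HeckeTuple.IsFraming

theorem jantzenMap_isJantzen (hell : IsCochar ell) [Algebra.Smooth k R] :
    (jantzenMap hell).IsJantzen := by
  rintro X g h ⟨σ₁, σ₂, H⟩ V i
  replace H : X.tuple.IsFraming (AlgHom.id k X.base) (Pts.map (laurentToLaur k X.base) ell) g h
    σ₁ σ₂ := H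
  obtain ⟨b⟩ := hell.nonempty_weightBasis V
  refine ⟨H.jantzen₁_eq b i, H.jantzen₂_eq b i, fun v hv => ?_⟩
  have hev : (psEval k X.base).toLinearMap.rTensor V.V
      ((psConst k X.base).toLinearMap.rTensor V.V v) = v := by
    rw [← LinearMap.comp_apply (LinearMap.rTensor V.V (psEval k X.base).toLinearMap),
      ← LinearMap.rTensor_comp, ← AlgHom.comp_toLinearMap, psEval_comp_psConst]
    exact LinearMap.rTensor_id_apply _ _ _
  -- For v of weight i the constant section v, in both framings, satisfies t^λ v = t^i v. So the
  -- difference to be bounded is 0.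
  obtain ⟨s₁, hs₁, s₂, hs₂, hrel, e₁, e₂⟩ :=
    H.exists_kappaRel b ((psConst k X.base).toLinearMap.rTensor V.V v)
      ((psConst k X.base).toLinearMap.rTensor V.V v) i fun j => by
        by_cases hj : b.deg j = i
        · rw [hj]
        · rw [b.coord_rTensor, b.mem_weightEq hv j hj, map_zero, map_zero, mul_zero, mul_zero]
  refine ⟨s₁, hs₁, s₂, hs₂, hrel, by rw [e₁, hev], ?_⟩
  rw [e₂, hev, sub_self, H.jantzen₂_eq b]
  exact ⟨0, b.neg.mem_weightGE.2 fun j _ => by simp [WeightBasis.coord], map_zero _⟩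

end Jantzen

end

section

/-! ### Conjugation by the Levi subgroup and weights. -/

section LeviConjugation

variable {k : Type u} [Field k] {R : Type u} [CommRing R] [HopfAlgebra k R]
variable {ell : Pts k R (LaurentPolynomial k)}
variable {C D D' : Type u} [CommRing C] [Algebra k C] [CommRing D] [Algebra k D]
  [CommRing D'] [Algebra k D']

theorem IsCochar.commute_levi (hell : IsCochar ell) {m : Pts k R D} (hm : m ∈ levi D ell)
    (φ : D →ₐ[k] D') (z : LaurentPolynomial k →ₐ[k] D') :
    Pts.map z ell * Pts.map φ m = Pts.map φ m * Pts.map z ell := by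
  rw [← mul_inv_eq_iff_eq_mul]
  refine hell.ext_wt fun n f hf => ?_
  rw [conj_apply_of_mem z _ hf]
  by_cases hn : n = 0
  · rw [hn, LaurentPolynomial.T_zero, _root_.map_one, one_mul]
  · rw [Pts.map_apply, hell.mem_levi_iff.1 hm n hn f hf, map_zero, mul_zero]

/-- The conjugate of the universal point by a point of the Levi subgroup. -/
def conjUniv (m : Pts k R D) : Pts k R (D ⊗[k] R) :=
  Pts.map Algebra.TensorProduct.includeLeft m *
    Pts.map Algebra.TensorProduct.includeRight (Pts.univ k R) *
      (Pts.map Algebra.TensorProduct.includeLeft m)⁻¹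

theorem map_conjUniv (m : Pts k R D) (F : D ⊗[k] R →ₐ[k] D') :
    Pts.map F (conjUniv m) = Pts.map (F.comp Algebra.TensorProduct.includeLeft) m *
      Pts.map (F.comp Algebra.TensorProduct.includeRight) (Pts.univ k R) *
        (Pts.map (F.comp Algebra.TensorProduct.includeLeft) m)⁻¹ := by
  simp only [conjUniv, _root_.map_mul, _root_.map_inv, Pts.map_map]

/-- As m commutes with λ, replacing g by λ(T) g λ(T)⁻¹ in m g m⁻¹ conjugates the whole product by
λ(T). Here F performs this substitution and G leaves g unchanged, so f(m g m⁻¹) keeps the weight n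
as a function of g. -/
theorem IsCochar.conj_levi_apply (hell : IsCochar ell) {m : Pts k R D} (hm : m ∈ levi D ell)
    (F G : D ⊗[k] R →ₐ[k] D') (jD : D →ₐ[k] D') (jR : R ⊗[k] LaurentPolynomial k →ₐ[k] D')
    (e₁ : F.comp Algebra.TensorProduct.includeLeft = jD)
    (e₂ : F.comp Algebra.TensorProduct.includeRight = jR.comp (adj ell))
    (e₃ : G.comp Algebra.TensorProduct.includeLeft = jD)
    (e₄ : G.comp Algebra.TensorProduct.includeRight = jR.comp Algebra.TensorProduct.includeLeft)
    {n : ℤ} {f : R} (hf : f ∈ wt ell n) :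
    F ((conjUniv m).ofConv f) = jR (1 ⊗ₜ LaurentPolynomial.T n) * G ((conjUniv m).ofConv f) := by
  let z : LaurentPolynomial k →ₐ[k] D' := jR.comp Algebra.TensorProduct.includeRight
  have hF : Pts.map F (conjUniv m) =
      Pts.map z ell * Pts.map G (conjUniv m) * (Pts.map z ell)⁻¹ := by
    have e5 : Pts.map (jR.comp (adj ell)) (Pts.univ k R) = Pts.map z ell *
      Pts.map (jR.comp Algebra.TensorProduct.includeLeft) (Pts.univ k R) * (Pts.map z ell)⁻¹ :=
      map_adj jR
    have hc := hell.commute_levi hm jD z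
    have hc' : (Pts.map z ell)⁻¹ * (Pts.map jD m)⁻¹ = (Pts.map jD m)⁻¹ * (Pts.map z ell)⁻¹ := by
      rw [← mul_inv_rev, ← mul_inv_rev, hc]
    rw [map_conjUniv, map_conjUniv, e₁, e₂, e₃, e₄, e5]
    simp only [← mul_assoc]
    rw [hc]
    simp only [mul_assoc]
    rw [hc']
  have := congrArg (fun p : Pts k R _ => p.ofConv f) hF
  simp only [conj_apply_of_mem z _ hf] at this
  exact this

/-- Conjugation by a point of the Levi subgroup preserves weights. -/
theorem IsCochar.exists_conj_levi (hell : IsCochar ell) {m : Pts k R D} (hm : m ∈ levi D ell)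
    {n : ℤ} {f : R} (hf : f ∈ wt ell n ⊓ augm k R) :
    ∃ (ι : Type u) (s : Finset ι) (d : ι → D) (x : ι → R), (∀ j, x j ∈ wt ell n ⊓ augm k R) ∧
      ∀ (D' : Type u) [CommRing D'] [Algebra k D'] (φ : D →ₐ[k] D') (v : Pts k R D'),
        (Pts.map φ m * v * (Pts.map φ m)⁻¹).ofConv f = ∑ j ∈ s, φ (d j) * v.ofConv (x j) := by
  let ψ : Pts k R (D ⊗[k] R) := conjUniv m
  have hψ : ∀ (D' : Type u) [CommRing D'] [Algebra k D'] (φ : D →ₐ[k] D') (v : Pts k R D'),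
      Pts.map φ m * v * (Pts.map φ m)⁻¹ =
        Pts.map (Algebra.TensorProduct.lift φ v.ofConv (fun _ _ => Commute.all _ _)) ψ := by
    intro D' _ _ φ v
    rw [map_conjUniv, lift_comp_inclLeft, lift_comp_inclRight, Pts.map_univ]
  let F : D ⊗[k] R →ₐ[k] D ⊗[k] (R ⊗[k] LaurentPolynomial k) :=
    Algebra.TensorProduct.map (AlgHom.id k D) (adj ell)
  let G : D ⊗[k] R →ₐ[k] D ⊗[k] (R ⊗[k] LaurentPolynomial k) :=
    Algebra.TensorProduct.map (AlgHom.id k D) Algebra.TensorProduct.includeLeft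
  let jD : D →ₐ[k] D ⊗[k] (R ⊗[k] LaurentPolynomial k) := Algebra.TensorProduct.includeLeft
  let jR : R ⊗[k] LaurentPolynomial k →ₐ[k] D ⊗[k] (R ⊗[k] LaurentPolynomial k) :=
    Algebra.TensorProduct.includeRight
  let z : LaurentPolynomial k →ₐ[k] D ⊗[k] (R ⊗[k] LaurentPolynomial k) :=
    jR.comp Algebra.TensorProduct.includeRight
  have hF' : F (ψ.ofConv f) = z (LaurentPolynomial.T n) * G (ψ.ofConv f) :=
    hell.conj_levi_apply (D' := D ⊗[k] (R ⊗[k] LaurentPolynomial k)) hm F G jD jR (AlgHom.ext fun d => by simp [F, jD])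
      (AlgHom.ext fun r => by simp [F, jR])
      (AlgHom.ext fun d => by simp [G, jD, Algebra.TensorProduct.one_def])
      (AlgHom.ext fun r => by simp [G, jR]) hf.1
  have hε : Algebra.TensorProduct.lift (AlgHom.id k D) (1 : Pts k R D).ofConv
      (fun _ _ => Commute.all _ _) (ψ.ofConv f) = 0 := by
    have := congrArg (fun p : Pts k R _ => p.ofConv f) (hψ D (AlgHom.id k D) 1)
    simp only [mul_one, mul_inv_cancel] at this
    rw [Pts.one_apply, mem_augm.1 hf.2, map_zero] at this
    exact this.symm
  classical
  -- The function g ↦ f(m g m⁻¹), with coefficients in D, is expanded in a basis of D over k. Its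
  -- weight and its vanishing at 1 pass to the coefficients x j, which do not depend on φ and v.
  let b := Module.Basis.ofVectorSpace k D
  let x := TensorProduct.equivFinsuppOfBasisLeft b (ψ.ofConv f) (N := R)
  refine ⟨_, x.support, b, x, fun j => ⟨?_, ?_⟩, fun D' _ _ φ v => ?_⟩
  · let Φ : D ⊗[k] (R ⊗[k] LaurentPolynomial k) →ₗ[k] R ⊗[k] LaurentPolynomial k :=
      (TensorProduct.lid k _).toLinearMap ∘ₗ (b.coord j).rTensor _
    have hx : x j = TensorProduct.lid k R ((b.coord j).rTensor R (ψ.ofConv f)) :=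
      TensorProduct.equivFinsuppOfBasisLeft_apply _ _ _
    have h1 : ∀ y, Φ (F y) = adj ell (TensorProduct.lid k R ((b.coord j).rTensor R y)) := by
      intro y
      induction y with
      | zero => simp
      | add x y hx hy => simp only [map_add, hx, hy]
      | tmul x y => simp [Φ, F]
    let μ := LinearMap.mulLeft k (z (LaurentPolynomial.T n))
    have h2 : ∀ y, Φ (μ (G y)) =
        (TensorProduct.lid k R ((b.coord j).rTensor R y)) ⊗ₜ LaurentPolynomial.T n := by
      intro y
      induction y with
      | zero => simp
      | add x y hx hy => simp only [map_add, add_tmul, hx, hy]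
      | tmul x y => simp [μ, Φ, G, z, jR, smul_tmul']
    change adj ell (x j) = _
    rw [hx, ← h1, hF']
    exact h2 _
  · have hx : x j = TensorProduct.lid k R ((b.coord j).rTensor R (ψ.ofConv f)) :=
      TensorProduct.equivFinsuppOfBasisLeft_apply _ _ _
    have h1 : ∀ y, Coalgebra.counit (R := k) (TensorProduct.lid k R ((b.coord j).rTensor R y)) =
        b.coord j (Algebra.TensorProduct.lift (AlgHom.id k D) (1 : Pts k R D).ofConv
          (fun _ _ => Commute.all _ _) y) := by
      intro y
      induction y with
      | zero => simp
      | add x y hx hy => simp only [map_add, hx, hy]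
      | tmul x y =>
        rw [Algebra.TensorProduct.lift_tmul, Pts.one_apply, mul_comm, ← Algebra.smul_def, map_smul]
        simp [mul_comm]
    change x j ∈ augm k R
    rw [mem_augm, hx, h1, hε, map_zero]
  · have hx : ψ.ofConv f = ∑ j ∈ x.support, b j ⊗ₜ x j := by
      have := TensorProduct.equivFinsuppOfBasisLeft_symm_apply b x
      rw [LinearEquiv.symm_apply_apply] at this
      exact this
    rw [hψ, Pts.map_apply, hx, map_sum]
    exact Finset.sum_congr rfl fun j _ => Algebra.TensorProduct.lift_tmul _ _ _ _ _

end LeviConjugation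

/-! ### The filtration of U_λ by weights. -/

section UnipotentFiltration

variable {k : Type u} [Field k] {R : Type u} [CommRing R] [HopfAlgebra k R]
variable {ell : Pts k R (LaurentPolynomial k)}
variable {C D D' : Type u} [CommRing C] [Algebra k C] [CommRing D] [Algebra k D]
  [CommRing D'] [Algebra k D']

/-- The subgroup of `U_λ` whose Lie algebra is the sum of the weight spaces of weights `> N`. -/
def uFilt (ell : Pts k R (LaurentPolynomial k)) (N : ℕ) (D : Type u) [CommRing D] [Algebra k D] :
    Set (Pts k R D) :=
  {g | ∀ n ≤ (N : ℤ), ∀ f ∈ wt ell n ⊓ augm k R, g.ofConv f = 0}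

theorem IsCochar.mem_uFilt_zero (hell : IsCochar ell) {g : Pts k R D} :
    g ∈ uFilt ell 0 D ↔ g ∈ unipotentRadical D ell := by
  rw [hell.mem_unipotentRadical_iff]
  rfl

theorem uFilt_mono {M N : ℕ} (h : M ≤ N) : uFilt ell N D ⊆ uFilt ell M D :=
  fun _ hg n hn f hf => hg n (by omega) f hf

/-- The cross terms of the group law have weights p + q = n ≤ N + 1. Either p ≤ N, where g vanishes,
or q ≤ 0, where h vanishes. -/
theorem IsCochar.uFilt_mul_apply (hell : IsCochar ell) {N : ℕ} {g h : Pts k R D}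
    (hg : g ∈ uFilt ell N D) (hh : h ∈ uFilt ell 0 D) {n : ℤ} (hn : n ≤ N + 1) {f : R}
    (hf : f ∈ wt ell n ⊓ augm k R) : (g * h).ofConv f = g.ofConv f + h.ofConv f := by
  have := hell.mul_apply_sub_mem g h hf ⊥ fun p q hpq a ha b hb => by
    rw [Submodule.mem_bot]
    rcases le_or_gt p N with hp | hp
    · rw [hg p hp a ha, zero_mul]
    · rw [hh q (by push_cast; omega) b hb, mul_zero]
  rw [Submodule.mem_bot, sub_sub, sub_eq_zero] at this
  exact this

theorem IsCochar.uFilt_mul_mem (hell : IsCochar ell) {N : ℕ} {g h : Pts k R D}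
    (hg : g ∈ uFilt ell N D) (hh : h ∈ uFilt ell N D) : g * h ∈ uFilt ell N D :=
  fun n hn f hf => by
    rw [hell.uFilt_mul_apply hg (uFilt_mono (Nat.zero_le N) hh) (by omega) hf, hg n hn f hf, hh n hn f hf,
      add_zero]

theorem IsCochar.uFilt_inv_apply (hell : IsCochar ell) {N : ℕ} {g : Pts k R D}
    (hg : g ∈ uFilt ell N D) {n : ℤ} (hn : n ≤ N + 1) {f : R}
    (hf : f ∈ wt ell n ⊓ augm k R) : (g⁻¹).ofConv f = -g.ofConv f := by
  have hg' : g⁻¹ ∈ uFilt ell 0 D :=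
    hell.mem_uFilt_zero.2 (inv_mem (hell.mem_uFilt_zero.1 (uFilt_mono (Nat.zero_le N) hg)))
  have := hell.uFilt_mul_apply hg hg' hn hf
  rw [mul_inv_cancel, Pts.one_apply, mem_augm.1 hf.2, map_zero, eq_comm, add_comm] at this
  exact eq_neg_of_add_eq_zero_left this

theorem IsCochar.uFilt_inv_mem (hell : IsCochar ell) {N : ℕ} {g : Pts k R D}
    (hg : g ∈ uFilt ell N D) : g⁻¹ ∈ uFilt ell N D :=
  fun n hn f hf => by
    rw [hell.uFilt_inv_apply hg (by omega) hf, hg n hn f hf, neg_zero]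

theorem uFilt_map {N : ℕ} (φ : D →ₐ[k] D') {g : Pts k R D} (hg : g ∈ uFilt ell N D) :
    Pts.map φ g ∈ uFilt ell N D' :=
  fun n hn f hf => by rw [Pts.map_apply, hg n hn f hf, map_zero]

theorem IsCochar.uFilt_conj_mem (hell : IsCochar ell) {N : ℕ} {m g : Pts k R D}
    (hm : m ∈ levi D ell) (hg : g ∈ uFilt ell N D) : m * g * m⁻¹ ∈ uFilt ell N D := by
  intro n hn f hf
  obtain ⟨ι, s, d, x, hx, h⟩ := hell.exists_conj_levi hm hf
  have := h D (AlgHom.id k D) g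
  rw [Pts.map_id] at this
  rw [this]
  exact Finset.sum_eq_zero fun j _ => by rw [hg n hn _ (hx j), mul_zero]

/-- Once N bounds the weights of all coordinates, the arc t^λ u t^(-λ) has zero coordinates. Hence
it is 1, and so is u. -/
theorem Coords.exists_uFilt_eq_one (X : Coords ell) (hell : IsCochar ell) :
    ∃ N : ℕ, ∀ (D : Type u) [CommRing D] [Algebra k D], ∀ u ∈ uFilt ell N D, u = 1 := by
  refine ⟨∑ i, (X.deg i).toNat, fun D _ _ u hu => ?_⟩
  obtain ⟨b, hb, h⟩ := hell.exists_conj_of_mem_unipotentRadical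
    (hell.mem_uFilt_zero.1 (uFilt_mono (Nat.zero_le _) hu))
  have hb1 : b = 1 := X.arc_ext hb (one_mem _) fun i => by
    have := tpow_mul_eq_of_conj h (X.x_wt i)
    have hd : X.deg i ≤ ((∑ i, (X.deg i).toNat : ℕ) : ℤ) := by
      have := Finset.single_le_sum (f := fun i => (X.deg i).toNat) (fun _ _ => Nat.zero_le _)
        (Finset.mem_univ i)
      have h2 := Int.self_le_toNat (X.deg i)
      omega
    rw [Pts.map_apply, hu _ hd _ ⟨X.x_wt i, X.x_augm i⟩, map_zero, map_zero, mul_zero] at this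
    rw [Pts.one_apply, mem_augm.1 (X.x_augm i), map_zero]
    exact psLaur_injective (this.trans (map_zero _).symm)
  rw [hb1, _root_.map_one, one_mul, eq_comm, mul_eq_left] at h
  have h1 := Pts.map_injective psLaur_injective (h.trans (_root_.map_one _).symm)
  rw [← map_psEval_psConst u, h1, _root_.map_one]

/-- The inclusion `C[T] → C[[T]]`. -/
def polyPS (k : Type u) [Field k] (C : Type u) [CommRing C] [Algebra k C] :
    Polynomial C →ₐ[k] PowerSeries C :=
  (Polynomial.coeToPowerSeries.algHom C).restrictScalars k

theorem coeff_polyPS (p : Polynomial C) (n : ℕ) :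
    PowerSeries.coeff n (polyPS k C p) = p.coeff n := by
  simp [polyPS]

theorem polyPS_injective : Function.Injective (polyPS k C) := fun p q h =>
  Polynomial.ext fun n => by rw [← coeff_polyPS (k := k), h, coeff_polyPS]

/-- The power series with a single term of degree `n > N`. -/
def homPart (k : Type u) [Field k] (C : Type u) [CommRing C] [Algebra k C] (N : ℕ) (n : ℤ) :
    Submodule k (PowerSeries C) where
  carrier := {y | ∀ j : ℕ, (j : ℤ) ≠ n ∨ j ≤ N → PowerSeries.coeff j y = 0}
  add_mem' {y z} hy hz j hj := by rw [map_add, hy j hj, hz j hj, add_zero]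
  zero_mem' j _ := map_zero _
  smul_mem' c y hy j hj := by
    rw [PowerSeries.coeff_smul, hy j hj, smul_zero]

/-- A point of the filtration of `U_λ` with prescribed leading term. -/
theorem Coords.exists_uFilt (X : Coords ell) (hell : IsCochar ell) [Algebra.FormallySmooth k R]
    {N : ℕ} {u : Pts k R D} (hu : u ∈ uFilt ell N D) (s : D →ₗ[k] C) :
    ∃ v ∈ uFilt ell N C, ∀ f ∈ wt ell (N + 1) ⊓ augm k R, v.ofConv f = s (u.ofConv f) := by
  -- The point v is recovered from the arc T ↦ λ(T) v λ(T)⁻¹, on which functions of weight n have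
  -- values homogeneous of degree n. So the coordinates of weight N + 1 are prescribed as monomials
  -- of that degree, and the others as 0.
  obtain ⟨a, ha, hax⟩ := X.exists_arc (B := C)
    (fun i => if X.deg i = N + 1 then
      PowerSeries.monomial (N + 1) (s (u.ofConv (X.x i))) else 0) fun i => by
    split_ifs
    · rw [PowerSeries.X_dvd_iff, ← PowerSeries.coeff_zero_eq_constantCoeff_apply,
        PowerSeries.coeff_monomial, if_neg (by omega)]
    · exact dvd_zero _
  have hM : ∀ n, ∀ f ∈ wt ell n ⊓ augm k R, a.ofConv f ∈ homPart k C N n := by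
    refine fun n f hf => X.mem_of_coords_mem hell (homPart k C N) ?_ ?_ ?_ ha ?_ hf
    · intro n y hy
      rw [PowerSeries.X_dvd_iff, ← PowerSeries.coeff_zero_eq_constantCoeff_apply]
      exact hy 0 (Or.inr (Nat.zero_le N))
    · intro p q y hy z hz j hj
      rw [PowerSeries.coeff_mul]
      refine Finset.sum_eq_zero fun ab hab => ?_
      have hab := Finset.HasAntidiagonal.mem_antidiagonal.1 hab
      by_cases h1 : (ab.1 : ℤ) ≠ p ∨ ab.1 ≤ N
      · rw [hy _ h1, zero_mul]
      · by_cases h2 : (ab.2 : ℤ) ≠ q ∨ ab.2 ≤ N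
        · rw [hz _ h2, mul_zero]
        · omega
    · intro n y h j hj
      obtain ⟨z, hz, hyz⟩ := h (j + 1)
      have := PowerSeries.X_pow_dvd_iff.1 hyz j (Nat.lt_succ_self j)
      rw [map_sub, sub_eq_zero] at this
      rw [this, hz j hj]
    · intro i j hj
      rw [hax]
      split_ifs with hi
      · rw [PowerSeries.coeff_monomial, if_neg (by omega)]
      · rw [map_zero]
  -- Homogeneous values are polynomials, so the arc can be evaluated at T = 1.
  obtain ⟨P, hP⟩ := Pts.exists_map_eq (polyPS_injective (k := k)) a fun f => by
    have : (LinearMap.range (polyPS k C).toLinearMap).comap a.ofConv.toLinearMap = ⊤ := by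
      refine hell.eq_top_of_augm_le ⟨1, ?_⟩ fun n f hf => ?_
      · exact (_root_.map_one (polyPS k C)).trans (_root_.map_one a.ofConv).symm
      · refine ⟨Polynomial.monomial n.toNat (PowerSeries.coeff n.toNat (a.ofConv f)), ?_⟩
        ext j
        change PowerSeries.coeff j (polyPS k C _) = PowerSeries.coeff j (a.ofConv f)
        rw [coeff_polyPS, Polynomial.coeff_monomial]
        split_ifs with hj
        · rw [hj]
        · exact (hM n f hf j (by omega)).symm
    have h : f ∈ (LinearMap.range (polyPS k C).toLinearMap).comap a.ofConv.toLinearMap :=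
      this ▸ Submodule.mem_top
    exact h
  have hPa : ∀ f j, (P.ofConv f).coeff j = PowerSeries.coeff j (a.ofConv f) := fun f j => by
    rw [← hP, Pts.map_apply, coeff_polyPS]
  let ev : Polynomial C →ₐ[k] C := (Polynomial.aeval (1 : C)).restrictScalars k
  have hv : ∀ n, ∀ f ∈ wt ell n ⊓ augm k R, (Pts.map ev P).ofConv f =
      PowerSeries.coeff n.toNat (a.ofConv f) := fun n f hf => by
    have : P.ofConv f = Polynomial.monomial n.toNat (PowerSeries.coeff n.toNat (a.ofConv f)) := by
      ext j
      rw [hPa, Polynomial.coeff_monomial]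
      split_ifs with hj
      · rw [hj]
      · exact hM n f hf j (by omega)
    rw [Pts.map_apply, this]
    simp [ev]
  have hvN : Pts.map ev P ∈ uFilt ell N C := fun n hn f hf => by
    rw [hv n f hf]
    exact hM n f hf _ (by omega)
  refine ⟨_, hvN, fun f hf => ?_⟩
  -- The map s is only linear, but both sides vanish on products of total weight N + 1, one factor
  -- having weight at most N. So it suffices to compare them on the coordinates.
  have hle : ∀ f ∈ augm k R * augm k R, wtProj ell (N + 1) f ∈ LinearMap.eqLocus
      (Pts.map ev P).ofConv.toLinearMap (s ∘ₗ u.ofConv.toLinearMap) := fun f hf => by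
    refine hell.mem_of_mem_augm_sq (fun p q hpq f hf g hg => ?_) hf
    rw [LinearMap.mem_eqLocus]
    change (Pts.map ev P).ofConv (f * g) = s (u.ofConv (f * g))
    rw [_root_.map_mul, _root_.map_mul]
    rcases le_or_gt p N with hp | hp
    · rw [hvN p hp f hf, hu p hp f hf, zero_mul, zero_mul, map_zero]
    · rw [hvN q (by omega) g hg, hu q (by omega) g hg, mul_zero, mul_zero, map_zero]
  have hfe := X.eq_sum_add hf
  have : f ∈ LinearMap.eqLocus (Pts.map ev P).ofConv.toLinearMap (s ∘ₗ u.ofConv.toLinearMap) := by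
    rw [hfe]
    refine add_mem (sum_mem fun i _ => Submodule.smul_mem _ _ ?_) (hle _ (X.sub_mem f hf.2))
    split_ifs with hi
    · rw [LinearMap.mem_eqLocus]
      refine (hv _ _ ⟨X.x_wt i, X.x_augm i⟩).trans ?_
      rw [hax, if_pos hi, hi]
      simp
    · exact zero_mem _
  exact this

end UnipotentFiltration

end

section

/-! ### First cohomology of twisted forms of U_λ over a field. -/

section Contraction

variable {k : Type u} [Field k] {B C D E : Type u} [CommRing B] [Algebra k B]
    [CommRing C] [Algebra k C] [CommRing D] [Algebra k D] [CommRing E] [Algebra k E]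

/-- The homotopy of the Čech complex given by a linear retraction of `B → C`. -/
structure CechData.Contraction (c : CechData k B C D E) where
  s₁ : D →ₗ[k] C
  s₂ : E →ₗ[k] D
  s₂_mul : ∀ d e, s₂ (c.p₀₁ d * e) = d * s₂ e
  s₂_one : s₂ 1 = 1
  s₂_p₀₂ : ∀ d, s₂ (c.p₀₂ d) = c.i₀ (s₁ d)
  s₂_p₁₂ : ∀ d, s₂ (c.p₁₂ d) = c.i₁ (s₁ d)

theorem CechData.Contraction.s₂_p₀₁ {c : CechData k B C D E} (S : c.Contraction) (d : D) :
    S.s₂ (c.p₀₁ d) = d := by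
  have := S.s₂_mul d 1
  rwa [mul_one, S.s₂_one, mul_one] at this

/-- Over a field the inclusion L → C has a linear retraction s. Applying s to the last tensor factor
gives s₁ and s₂. -/
theorem CechData.nonempty_contraction (L C : Type u) [Field L] [CommRing C] [Algebra L C]
    [Algebra k L] [Algebra k C] [IsScalarTower k L C] [Module.FaithfullyFlat L C] :
    Nonempty (CechData.ofFaithfullyFlat L C k).Contraction := by
  obtain ⟨s, hs⟩ := LinearMap.exists_leftInverse_of_injective (Algebra.linearMap L C)
    (LinearMap.ker_eq_bot.2 (algebraMap_injective_of_faithfullyFlat L C))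
  have hs1 : s 1 = 1 := by
    have := congrArg (fun f => f 1) hs
    simpa using this
  let s₁ : C ⊗[L] C →ₗ[L] C := (TensorProduct.rid L C).toLinearMap ∘ₗ s.lTensor C
  refine ⟨⟨s₁.restrictScalars k, (s₁.lTensor C).restrictScalars k, fun d e => ?_, ?_, fun d => ?_,
    fun d => ?_⟩⟩
  · change s₁.lTensor C ((Algebra.TensorProduct.map (AlgHom.id L C)
      (Algebra.TensorProduct.includeLeft : C →ₐ[L] C ⊗[L] C)) d * e) = d * s₁.lTensor C e
    induction e with
    | zero => simp
    | add x y hx hy => simp only [map_add, mul_add, hx, hy]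
    | tmul x e =>
      induction e with
      | zero => simp
      | add x y hx hy => simp only [map_add, mul_add, tmul_add, hx, hy]
      | tmul y z =>
        induction d with
        | zero => simp
        | add x y hx hy => simp only [map_add, add_mul, hx, hy]
        | tmul v w => simp [s₁]
  · change s₁.lTensor C ((1 : C) ⊗ₜ ((1 : C) ⊗ₜ (1 : C))) = _
    simp [s₁, hs1, Algebra.TensorProduct.one_def]
  · change s₁.lTensor C (Algebra.TensorProduct.map (AlgHom.id L C)
      (Algebra.TensorProduct.includeRight : C →ₐ[L] C ⊗[L] C) d) = (s₁ d) ⊗ₜ 1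
    induction d with
    | zero => simp
    | add x y hx hy => simp only [map_add, add_tmul, hx, hy]
    | tmul v w => simp [s₁, smul_tmul']
  · change s₁.lTensor C ((1 : C) ⊗ₜ d) = 1 ⊗ₜ (s₁ d)
    rw [LinearMap.lTensor_tmul]

variable {R : Type u} [CommRing R] [HopfAlgebra k R] {ell : Pts k R (LaurentPolynomial k)}

/-- On f of weight N + 1 the cocycle condition is additive: f(p₀₂ u) = f(p₀₁ u) + Σ p₀₁(d_j) x_j(p₁₂
u). Applying s₂ gives i₀(s₁ f(u)) = f(u) + Σ d_j i₁(s₁ x_j(u)). So an element v with leading term s₁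
∘ u cancels the leading term of u. Only linearity of s₁ is available, as in `Coords.exists_uFilt`.
-/
theorem CechData.Contraction.exists_uFilt_succ {c : CechData k B C D E} (S : c.Contraction)
    (X : Coords ell) (hell : IsCochar ell) [Algebra.FormallySmooth k R] {N : ℕ} {u m : Pts k R D}
    (hm : m ∈ levi D ell) (hu : u ∈ uFilt ell N D)
    (h : Pts.map c.p₀₂ u = Pts.map c.p₀₁ u * (Pts.map c.p₀₁ m * Pts.map c.p₁₂ u *
      (Pts.map c.p₀₁ m)⁻¹)) :
    ∃ v ∈ uFilt ell N C, (Pts.map c.i₀ v)⁻¹ * u * (m * Pts.map c.i₁ v * m⁻¹) ∈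
      uFilt ell (N + 1) D := by
  obtain ⟨v, hv, hvs⟩ := X.exists_uFilt hell hu S.s₁
  have hv₀ := uFilt_map c.i₀ hv
  have hv₁ := hell.uFilt_conj_mem hm (uFilt_map c.i₁ hv)
  have hmul := hell.uFilt_mul_mem (hell.uFilt_inv_mem hv₀) hu
  refine ⟨v, hv, fun n hn f hf => ?_⟩
  rcases hn.lt_or_eq with hn' | rfl
  · exact hell.uFilt_mul_mem hmul hv₁ n (by push_cast at hn'; omega) f hf
  · push_cast at hn hf
    rw [hell.uFilt_mul_apply hmul (uFilt_mono (Nat.zero_le N) hv₁) le_rfl hf,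
      hell.uFilt_mul_apply (hell.uFilt_inv_mem hv₀) (uFilt_mono (Nat.zero_le N) hu) le_rfl hf,
      hell.uFilt_inv_apply hv₀ le_rfl hf]
    obtain ⟨ι, s, d, x, hx, hmx⟩ := hell.exists_conj_levi hm hf
    have e₁ := congrArg (fun p : Pts k R E => p.ofConv f) h
    have hm' : Pts.map c.p₀₁ m * Pts.map c.p₁₂ u * (Pts.map c.p₀₁ m)⁻¹ ∈ uFilt ell N E := by
      intro n hn f hf
      obtain ⟨ι, s, d, x, hx, hmx⟩ := hell.exists_conj_levi hm hf
      rw [hmx]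
      exact Finset.sum_eq_zero fun j _ => by
        rw [uFilt_map c.p₁₂ hu n hn _ (hx j), mul_zero]
    rw [hell.uFilt_mul_apply (uFilt_map c.p₀₁ hu) (uFilt_mono (Nat.zero_le N) hm') le_rfl hf,
      hmx] at e₁
    have e₂ := congrArg S.s₂ e₁
    simp only [map_add, map_sum, Pts.map_apply, S.s₂_mul, S.s₂_p₀₁, S.s₂_p₀₂, S.s₂_p₁₂] at e₂
    have e₃ := hmx D (AlgHom.id k D) (Pts.map c.i₁ v)
    rw [Pts.map_id] at e₃
    rw [e₃, Pts.map_apply, hvs f hf, e₂]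
    simp only [AlgHom.id_apply, Pts.map_apply]
    simp only [fun j => hvs _ (hx j)]
    ring

theorem CechData.Contraction.exists_uFilt_of_le {c : CechData k B C D E} (S : c.Contraction)
    (X : Coords ell) (hell : IsCochar ell) [Algebra.FormallySmooth k R] {u m : Pts k R D}
    (hm : m ∈ levi D ell) (hu : u ∈ uFilt ell 0 D)
    (hmc : Pts.map c.p₀₂ m = Pts.map c.p₀₁ m * Pts.map c.p₁₂ m)
    (hum : Pts.map c.p₀₂ (u * m) = Pts.map c.p₀₁ (u * m) * Pts.map c.p₁₂ (u * m)) (N : ℕ) :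
    ∃ v ∈ uFilt ell 0 C, (Pts.map c.i₀ v)⁻¹ * u * (m * Pts.map c.i₁ v * m⁻¹) ∈ uFilt ell N D := by
  induction N with
  | zero => exact ⟨1, fun n hn f hf => by rw [Pts.one_apply, mem_augm.1 hf.2, map_zero], by
      simpa using hu⟩
  | succ N ih =>
    obtain ⟨v, hv, hvN⟩ := ih
    -- The corrected element u' satisfies u' m = (i₀ v)⁻¹ (u m) (i₁ v), so u' m is again a cocycle.
    -- With the cocycle condition for m, this is the twisted condition for u'.
    obtain ⟨w, hw, hwN⟩ := S.exists_uFilt_succ X hell hm hvN (by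
      have h₀ := congrArg (fun p => Pts.map p v) c.p_comp_i₀
      have h₁ := congrArg (fun p => Pts.map p v) c.p_comp_i₁
      have h₂ := congrArg (fun p => Pts.map p v) c.p_comp_i₂
      simp only [_root_.map_mul, _root_.map_inv, Pts.map_map] at hum ⊢
      rw [← h₀, h₂, ← h₁, hmc]
      have hum' : Pts.map c.p₀₂ u = Pts.map c.p₀₁ u * Pts.map c.p₀₁ m *
          (Pts.map c.p₁₂ u * Pts.map c.p₁₂ m) * (Pts.map c.p₀₁ m * Pts.map c.p₁₂ m)⁻¹ := by
        rw [← hmc, ← hum, mul_inv_cancel_right]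
      rw [hum']
      group)
    refine ⟨v * w, hell.uFilt_mul_mem hv (uFilt_mono (Nat.zero_le N) hw), ?_⟩
    convert! hwN using 1
    simp only [_root_.map_mul]
    group

/-- Vanishing of the first cohomology of `U_λ` and of its twisted forms. -/
theorem CechData.Contraction.exists_unipotent {c : CechData k B C D E} (S : c.Contraction)
    (X : Coords ell) (hell : IsCochar ell) [Algebra.FormallySmooth k R] {u m : Pts k R D}
    (hm : m ∈ levi D ell) (hu : u ∈ unipotentRadical D ell)
    (hmc : Pts.map c.p₀₂ m = Pts.map c.p₀₁ m * Pts.map c.p₁₂ m)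
    (hum : Pts.map c.p₀₂ (u * m) = Pts.map c.p₀₁ (u * m) * Pts.map c.p₁₂ (u * m)) :
    ∃ v ∈ unipotentRadical C ell, u * m * Pts.map c.i₁ v = Pts.map c.i₀ v * m := by
  obtain ⟨N, hN⟩ := X.exists_uFilt_eq_one hell
  obtain ⟨v, hv, h⟩ := S.exists_uFilt_of_le X hell hm (hell.mem_uFilt_zero.2 hu) hmc hum N
  refine ⟨v, hell.mem_uFilt_zero.1 hv, ?_⟩
  have := hN D _ h
  rw [mul_assoc, inv_mul_eq_one, ← mul_assoc, ← mul_assoc, eq_mul_inv_iff_mul_eq] at this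
  exact this.symm

theorem IsCochar.eq_of_mul_eq (hell : IsCochar ell) {u u' m m' : Pts k R D}
    (hm : m ∈ levi D ell) (hm' : m' ∈ levi D ell) (hu : u ∈ unipotentRadical D ell)
    (hu' : u' ∈ unipotentRadical D ell) (h : u * m = u' * m') : m = m' := by
  have h1 : u'⁻¹ * u = m' * m⁻¹ := by
    rw [inv_mul_eq_iff_eq_mul, ← mul_assoc, eq_mul_inv_iff_mul_eq, h]
  have hU : m' * m⁻¹ ∈ unipotentRadical D ell := h1 ▸ mul_mem (inv_mem hu') hu
  have hM : m' * m⁻¹ ∈ levi D ell := mul_mem hm' (inv_mem hm)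
  rw [hell.mem_unipotentRadical_iff] at hU
  rw [hell.mem_levi_iff] at hM
  have : m' * m⁻¹ = 1 := hell.ext_augm fun n f hf => by
    rw [Pts.one_apply, mem_augm.1 hf.2, map_zero]
    rcases le_or_gt n 0 with hn | hn
    · exact hU n hn f hf
    · exact hM n hn.ne' f hf.1
  exact (mul_inv_eq_one.1 this).symm

theorem IsCochar.levi_map (hell : IsCochar ell) (φ : C →ₐ[k] D) {m : Pts k R C}
    (hm : m ∈ levi C ell) : Pts.map φ m ∈ levi D ell := by
  rw [hell.mem_levi_iff] at hm ⊢
  exact fun n hn f hf => by rw [Pts.map_apply, hm n hn f hf, map_zero]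

theorem IsCochar.unipotentRadical_map (hell : IsCochar ell) (φ : C →ₐ[k] D) {m : Pts k R C}
    (hm : m ∈ unipotentRadical C ell) : Pts.map φ m ∈ unipotentRadical D ell := by
  rw [hell.mem_unipotentRadical_iff] at hm ⊢
  exact fun n hn f hf => by rw [Pts.map_apply, hm n hn f hf, map_zero]

/-- If two pull-backs of `g` differ by an element of `U_λ M_λ`, then `g` may be changed by an
element of `U_λ` such that they differ by an element of `M_λ`. -/
theorem CechData.Contraction.exists_mul_eq {c : CechData k B C D E} (S : c.Contraction)
    (X : Coords ell) (hell : IsCochar ell) [Algebra.FormallySmooth k R] {u m : Pts k R D}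
    {g : Pts k R C} (hm : m ∈ levi D ell) (hu : u ∈ unipotentRadical D ell)
    (h : Pts.map c.i₁ g = Pts.map c.i₀ g * (u * m)) :
    ∃ v ∈ unipotentRadical C ell, Pts.map c.i₁ (g * v) = Pts.map c.i₀ (g * v) * m := by
  -- The product u m = (i₀ g)⁻¹ (i₁ g) is a coboundary in G, hence a cocycle.
  have hum : Pts.map c.p₀₂ (u * m) = Pts.map c.p₀₁ (u * m) * Pts.map c.p₁₂ (u * m) := by
    have h₀ := congrArg (fun p => Pts.map p g) c.p_comp_i₀
    have h₁ := congrArg (fun p => Pts.map p g) c.p_comp_i₁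
    have h₂ := congrArg (fun p => Pts.map p g) c.p_comp_i₂
    have h' : u * m = (Pts.map c.i₀ g)⁻¹ * Pts.map c.i₁ g := by rw [h, inv_mul_cancel_left]
    rw [h']
    simp only [_root_.map_mul, _root_.map_inv, Pts.map_map]
    rw [← h₀, h₂, ← h₁]
    group
  -- The Levi component is unique and multiplicative on U_λ M_λ, so m is a cocycle as well.
  have hmc : Pts.map c.p₀₂ m = Pts.map c.p₀₁ m * Pts.map c.p₁₂ m := by
    have hm₀ := hell.levi_map c.p₀₁ hm
    refine hell.eq_of_mul_eq (hell.levi_map c.p₀₂ hm) (mul_mem hm₀ (hell.levi_map c.p₁₂ hm))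
      (hell.unipotentRadical_map c.p₀₂ hu) (mul_mem (hell.unipotentRadical_map c.p₀₁ hu)
        (conj_mem_unipotentRadical hm₀ (hell.unipotentRadical_map c.p₁₂ hu))) ?_
    rw [← _root_.map_mul, hum]
    simp only [_root_.map_mul]
    group
  obtain ⟨v, hv, hvm⟩ := S.exists_unipotent X hell hm hu hmc hum
  refine ⟨v, hv, ?_⟩
  rw [_root_.map_mul, h, mul_assoc, hvm, _root_.map_mul, mul_assoc]

end Contraction

/-! ### Representatives of a point of X_λ over a field. -/

section Splitting

variable {k : Type u} [Field k] {R : Type u} [CommRing R] [HopfAlgebra k R]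
  {ell : Pts k R (LaurentPolynomial k)}

/-- A point of `X_λ` over a field is locally the class of a pair `(g, h)` whose two pull-backs
differ by an element of `M_λ`. -/
theorem QuotPt.exists_levi (hell : IsCochar ell) [Algebra.Smooth k R] {L : Type u} [Field L]
    [Algebra k L] (x : QuotPt ell (CommAlgCat.of k L)) :
    ∃ (C : Type u) (_ : CommRing C) (_ : Algebra L C) (_ : Algebra k C) (_ : IsScalarTower k L C)
      (_ : Module.FaithfullyFlat L C) (g h : Pts k R C) (m : Pts k R (C ⊗[L] C)),
      (algebraMap L C).Etale ∧
      (g, h) ∈ x.carrier (CommAlgCat.of k C) (CommAlgCat.ofHom (IsScalarTower.toAlgHom k L C)) ∧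
      m ∈ levi (C ⊗[L] C) ell ∧
      Pts.map (CechData.ofFaithfullyFlat L C k).i₁ g =
        Pts.map (CechData.ofFaithfullyFlat L C k).i₀ g * m ∧
      Pts.map (CechData.ofFaithfullyFlat L C k).i₁ h =
        Pts.map (CechData.ofFaithfullyFlat L C k).i₀ h * m := by
  obtain ⟨C, f, hf, ⟨g, h⟩, hgh⟩ := x.locally_nonempty
  let _ : Algebra L C := f.hom.toRingHom.toAlgebra
  have : IsScalarTower k L C := .of_algebraMap_eq' f.hom.comp_algebraMap.symm
  have hf' : (algebraMap L C).FaithfullyFlat := hf.2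
  have : Module.FaithfullyFlat L C := hf'
  have hfe : f = CommAlgCat.ofHom (IsScalarTower.toAlgHom k L C) := rfl
  let c := CechData.ofFaithfullyFlat L C k
  obtain ⟨X⟩ := hell.nonempty_coords
  obtain ⟨X'⟩ := hell.inv.nonempty_coords
  obtain ⟨S⟩ := CechData.nonempty_contraction (k := k) L C
  let q₀ : C ⟶ CommAlgCat.of k (C ⊗[L] C) := CommAlgCat.ofHom c.i₀
  let q₁ : C ⟶ CommAlgCat.of k (C ⊗[L] C) := CommAlgCat.ofHom c.i₁
  have hq : f ≫ q₀ = f ≫ q₁ := CommAlgCat.hom_ext c.i_comp_j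
  have h₀ := x.map_mem f q₀ _ hgh
  have h₁ := x.map_mem f q₁ _ hgh
  rw [← hq] at h₁
  obtain ⟨m, hm, u, hu, v, hv, huv⟩ := hell.preQuot_mk_eq_iff.1 ((x.fibre _ _ _ h₀).1 h₁)
  have hg : Pts.map c.i₁ g = Pts.map c.i₀ g * (m * u * m⁻¹ * m) := by
    rw [inv_mul_cancel_right, ← mul_assoc]
    exact congrArg Prod.fst huv
  have hh : Pts.map c.i₁ h = Pts.map c.i₀ h * (m * v * m⁻¹ * m) := by
    rw [inv_mul_cancel_right, ← mul_assoc]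
    exact congrArg Prod.snd huv
  -- The corrections are made separately in U_λ for g and in U_λ⁻ for h. Neither changes m nor the
  -- class of (g, h).
  obtain ⟨a, ha, hga⟩ := S.exists_mul_eq X hell hm (conj_mem_unipotentRadical hm hu) hg
  obtain ⟨b, hb, hhb⟩ := S.exists_mul_eq X' hell.inv (by rwa [hell.levi_inv])
    (hell.conj_mem_unipotentRadical_inv hm hv) hh
  refine ⟨C, inferInstance, inferInstance, inferInstance, inferInstance, inferInstance, g * a,
    h * b, m, hf.1, ?_, hm, hga, hhb⟩
  exact (x.fibre f _ _ hgh).2 (hell.preQuot_mk_eq_iff.2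
    ⟨1, one_mem _, a, ha, b, hb, by simp⟩)

end Splitting

end

section

/-! ### Points of 𝔾_m. -/

section LaurentPoints

variable {k : Type u} [Field k] {D : Type u} [CommRing D] [Algebra k D]

theorem laurentPolynomial_algHom_ext {f g : LaurentPolynomial k →ₐ[k] D}
    (h : ∀ n : ℤ, f (LaurentPolynomial.T n) = g (LaurentPolynomial.T n)) : f = g := by
  refine AlgHom.ext fun z => ?_
  induction z using LaurentPolynomial.induction_on' with
  | add p q hp hq => rw [map_add, map_add, hp, hq]
  | C_mul_T m a => rw [← LaurentPolynomial.smul_eq_C_mul, map_smul, map_smul, h]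

theorem laurentPoint_mul_T (z w : Pts k (LaurentPolynomial k) D) (n : ℤ) :
    (z * w).ofConv (LaurentPolynomial.T n) =
      z.ofConv (LaurentPolynomial.T n) * w.ofConv (LaurentPolynomial.T n) := by
  rw [Pts.mul_apply, LaurentPolynomial.comul_T, Algebra.TensorProduct.lift_tmul]

end LaurentPoints

/-! ### Descent of a conjugate of the cocharacter. -/

section ConjugateCochar

variable {k : Type u} [Field k] {R : Type u} [CommRing R] [HopfAlgebra k R]
  {ell : Pts k R (LaurentPolynomial k)}
variable {B C : Type u} [CommRing B] [Algebra k B] [CommRing C] [Algebra k C] [Algebra B C]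
  [IsScalarTower k B C]

theorem CechData.exists_lift [Module.FaithfullyFlat B C] {W : Type u} [CommRing W] [Algebra B W] [Algebra k W]
    [IsScalarTower k B W] (f₀ f₁ : C →ₐ[B] W) : ∃ δ : C ⊗[B] C →ₐ[k] W,
      δ.comp (CechData.ofFaithfullyFlat B C k).i₀ = f₀.restrictScalars k ∧
      δ.comp (CechData.ofFaithfullyFlat B C k).i₁ = f₁.restrictScalars k := by
  refine ⟨(Algebra.TensorProduct.lift f₀ f₁ (fun _ _ => Commute.all _ _)).restrictScalars k,
    AlgHom.ext fun x => ?_, AlgHom.ext fun x => ?_⟩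
  · change Algebra.TensorProduct.lift f₀ f₁ (fun _ _ => Commute.all _ _) (x ⊗ₜ 1) = f₀ x
    simp
  · change Algebra.TensorProduct.lift f₀ f₁ (fun _ _ => Commute.all _ _) (1 ⊗ₜ x) = f₁ x
    simp

theorem exists_algHom_of_comp_eq {N D : Type u} [CommRing N] [Algebra k N] [Algebra B N]
    [IsScalarTower k B N] [CommRing D] [Algebra k D] (z : N →ₐ[k] D) (φ : C →ₐ[k] D)
    (h : ∀ b : B, z (algebraMap B N b) = φ (algebraMap B C b)) :
    ∃ ζ : N ⊗[B] C →ₐ[k] D, (∀ x, ζ (x ⊗ₜ 1) = z x) ∧ ∀ x, ζ (1 ⊗ₜ x) = φ x := by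
  let _ : Algebra B D := ((φ : C →+* D).comp (algebraMap B C)).toAlgebra
  let z' : N →ₐ[B] D := { z with commutes' := fun b => h b }
  let φ' : C →ₐ[B] D := { φ with commutes' := fun b => rfl }
  have : IsScalarTower k B D := .of_algebraMap_eq fun x => by
    change _ = φ (algebraMap B C (algebraMap k B x))
    rw [← IsScalarTower.algebraMap_apply, AlgHom.commutes]
  refine ⟨(Algebra.TensorProduct.lift z' φ' (fun _ _ => Commute.all _ _)).restrictScalars k,
    fun x => ?_, fun x => ?_⟩
  · rw [AlgHom.restrictScalars_apply, Algebra.TensorProduct.lift_tmul, map_one, mul_one]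
    rfl
  · rw [AlgHom.restrictScalars_apply, Algebra.TensorProduct.lift_tmul, map_one, one_mul]
    rfl

/-- The pull-backs of g differ by m, which commutes with λ. So the pull-backs of g λ g⁻¹ agree, and
its values on functions descend. -/
theorem IsCochar.exists_conj_of_cechData (hell : IsCochar ell) {N W C D E F : Type u} [CommRing N]
    [Algebra k N] [CommRing W] [Algebra k W] [CommRing C] [Algebra k C] [CommRing D] [Algebra k D]
    [CommRing E] [Algebra k E] [CommRing F] [Algebra k F] (c : CechData k N W E F) {i₀ i₁ : C →ₐ[k] D}
    {iC : C →ₐ[k] W} {δ : D →ₐ[k] E} (hδ₀ : δ.comp i₀ = c.i₀.comp iC) (hδ₁ : δ.comp i₁ = c.i₁.comp iC)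
    (z : LaurentPolynomial k →ₐ[k] N) {g : Pts k R C} {m : Pts k R D} (hm : m ∈ levi D ell)
    (h : Pts.map i₁ g = Pts.map i₀ g * m) : ∃ l : Pts k R N, Pts.map c.j l =
      Pts.map iC g * Pts.map (c.j.comp z) ell * (Pts.map iC g)⁻¹ := by
  have hP : Pts.map c.i₀ (Pts.map iC g * Pts.map (c.j.comp z) ell * (Pts.map iC g)⁻¹) =
      Pts.map c.i₁ (Pts.map iC g * Pts.map (c.j.comp z) ell * (Pts.map iC g)⁻¹) := by
    have e := congrArg (Pts.map δ) h
    rw [_root_.map_mul, Pts.map_map, Pts.map_map, hδ₀, hδ₁] at e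
    simp only [_root_.map_mul, _root_.map_inv, Pts.map_map]
    rw [e, ← AlgHom.comp_assoc, ← AlgHom.comp_assoc, ← c.i_comp_j]
    have hc := hell.commute_levi hm δ ((c.i₀.comp c.j).comp z)
    rw [mul_assoc _ (Pts.map δ m), ← hc]
    group
  exact Pts.exists_map_eq c.injective _ fun f =>
    c.exact₀ _ (congrArg (fun p : Pts k R _ => p.ofConv f) hP)

/-- The conjugate `g λ g⁻¹` is defined over `B` if the pull-backs of `g` differ by an element
which centralizes `λ`. -/
theorem IsCochar.exists_conj [Module.FaithfullyFlat B C] (hell : IsCochar ell) {g : Pts k R C} {m : Pts k R (C ⊗[B] C)}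
    (hm : m ∈ levi (C ⊗[B] C) ell)
    (h : Pts.map (CechData.ofFaithfullyFlat B C k).i₁ g =
      Pts.map (CechData.ofFaithfullyFlat B C k).i₀ g * m) {N : Type u} [CommRing N] [Algebra k N]
    [Algebra B N] [IsScalarTower k B N] (y : LaurentPolynomial k →ₐ[k] N) :
    ∃ l : Pts k R N, ∀ (D : Type u) [CommRing D] [Algebra k D]
      (z : N →ₐ[k] D) (φ : C →ₐ[k] D), (∀ b : B, z (algebraMap B N b) = φ (algebraMap B C b)) →
      Pts.map z l = Pts.map φ g * Pts.map (z.comp y) ell * (Pts.map φ g)⁻¹ := by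
  -- The covering is base changed to N, the ring over which the point of λ given by y lives, and δ
  -- transports the relation between the pull-backs of g.
  let W := N ⊗[B] C
  have : Module.FaithfullyFlat N W := Module.FaithfullyFlat.instTensorProduct B C N
  let c := CechData.ofFaithfullyFlat N W k
  let iC : C →ₐ[B] W := Algebra.TensorProduct.includeRight
  let q₀ : W →ₐ[B] W ⊗[N] W :=
    (Algebra.TensorProduct.includeLeft : W →ₐ[N] W ⊗[N] W).restrictScalars B
  let q₁ : W →ₐ[B] W ⊗[N] W :=
    (Algebra.TensorProduct.includeRight : W →ₐ[N] W ⊗[N] W).restrictScalars B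
  obtain ⟨δ, hδ₀, hδ₁⟩ :=
    CechData.exists_lift (k := k) (W := W ⊗[N] W) (q₀.comp iC) (q₁.comp iC)
  obtain ⟨l, hl⟩ := hell.exists_conj_of_cechData c (D := C ⊗[B] C) (E := W ⊗[N] W)
    (iC := iC.restrictScalars k) (δ := δ) hδ₀ hδ₁ y hm h
  refine ⟨l, fun D _ _ z φ hzφ => ?_⟩
  obtain ⟨ζ, hζ₁, hζ₂⟩ := exists_algHom_of_comp_eq z φ hzφ
  have e₁ : ζ.comp c.j = z := AlgHom.ext hζ₁
  have e₂ : ζ.comp (iC.restrictScalars k) = φ := AlgHom.ext hζ₂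
  have := congrArg (Pts.map ζ) hl
  rw [Pts.map_map, e₁] at this
  rw [this]
  simp only [_root_.map_mul, _root_.map_inv, Pts.map_map, e₂, ← AlgHom.comp_assoc, e₁]

end ConjugateCochar

/-! ### Extension of the ground field from k to L. -/

section ExtensionOfScalars

variable {k L : Type u} [Field k] [Field L] [Algebra k L] {R : Type u} [CommRing R]
  [HopfAlgebra k R]
variable {B C : Type u} [CommRing B] [Algebra k B] [Algebra L B] [IsScalarTower k L B]
  [CommRing C] [Algebra k C] [Algebra L C] [IsScalarTower k L C]

/-- Points of the base change of a group, as points of the group. -/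
def resPt : Pts L (L ⊗[k] R) B →* Pts k R B where
  toFun p := .toConv ((p.ofConv.restrictScalars k).comp Algebra.TensorProduct.includeRight)
  map_one' := Pts.ext fun r => by
    change algebraMap L B (Coalgebra.counit (R := L) ((1 : L) ⊗ₜ[k] r)) = _
    rw [TensorProduct.counit_tmul, Pts.one_apply]
    simp [Algebra.smul_def, ← IsScalarTower.algebraMap_apply]
  map_mul' p q := Pts.ext fun r => by
    change (p * q).ofConv ((1 : L) ⊗ₜ[k] r) = _
    rw [Pts.mul_apply, Pts.mul_apply, TensorProduct.comul_tmul]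
    generalize Coalgebra.comul (R := k) r = w
    induction w with
    | zero => simp
    | add x y hx hy => simp only [map_add, tmul_add, hx, hy]
    | tmul x y => simp

theorem resPt_apply (p : Pts L (L ⊗[k] R) B) (r : R) :
    (resPt p).ofConv r = p.ofConv (1 ⊗ₜ r) := rfl

theorem resPt_injective : Function.Injective (resPt : Pts L (L ⊗[k] R) B → Pts k R B) := by
  intro p q h
  apply WithConv.ext
  apply Algebra.TensorProduct.ext
  · ext
  · exact congrArg WithConv.ofConv h

theorem resPt_surjective : Function.Surjective (resPt : Pts L (L ⊗[k] R) B → Pts k R B) := by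
  intro p
  refine ⟨.toConv (Algebra.TensorProduct.lift (Algebra.ofId L B) p.ofConv
    (fun _ _ => Commute.all _ _)), Pts.ext fun r => ?_⟩
  rw [resPt_apply]
  simp

instance : IsScalarTower k L (Laur B) :=
  .of_algebraMap_eq fun x => by
    rw [IsScalarTower.algebraMap_apply k (PowerSeries B) (Laur B),
      IsScalarTower.algebraMap_apply L (PowerSeries B) (Laur B),
      ← IsScalarTower.algebraMap_apply k L (PowerSeries B)]

theorem resPt_mem_arcs {a : Pts L (L ⊗[k] R) (PowerSeries B)} :
    resPt a ∈ arcs k R B ↔ a ∈ arcs L (L ⊗[k] R) B := by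
  have : Pts.map (psEval k B) (resPt a) = resPt (Pts.map (psEval L B) a) := rfl
  rw [arcs, arcs, MonoidHom.mem_ker, MonoidHom.mem_ker, this, ← resPt_injective.eq_iff,
    _root_.map_one]

theorem resPt_mem_arcGroup {κ : Pts L (L ⊗[k] R) (Laur B)}
    {a : Pts L (L ⊗[k] R) (PowerSeries B)} :
    resPt a ∈ arcGroup (resPt κ : Pts k R (Laur B)) ↔ a ∈ arcGroup κ := by
  have hl : ∀ b : Pts L (L ⊗[k] R) (PowerSeries B),
      Pts.map (psLaur k B) (resPt b) = resPt (Pts.map (psLaur L B) b) := fun _ => rfl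
  rw [mem_arcGroup, mem_arcGroup, resPt_mem_arcs]
  refine and_congr_right fun _ => ⟨?_, ?_⟩
  · rintro ⟨b, hb, h⟩
    obtain ⟨b, rfl⟩ := resPt_surjective (L := L) b
    refine ⟨b, resPt_mem_arcs.1 hb, resPt_injective ?_⟩
    rw [_root_.map_mul, _root_.map_mul, ← hl, ← hl, h]
  · rintro ⟨b, hb, h⟩
    refine ⟨resPt b, resPt_mem_arcs.2 hb, ?_⟩
    rw [hl, hl, ← _root_.map_mul, ← _root_.map_mul, h]

/-- Čech data over an extension field. -/
def CechData.restrictScalars {D E : Type u} [CommRing D] [Algebra k D] [Algebra L D]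
    [IsScalarTower k L D] [CommRing E] [Algebra k E] [Algebra L E] [IsScalarTower k L E]
    (c : CechData L B C D E) : CechData k B C D E where
  j := c.j.restrictScalars k
  i₀ := c.i₀.restrictScalars k
  i₁ := c.i₁.restrictScalars k
  p₀₁ := c.p₀₁.restrictScalars k
  p₁₂ := c.p₁₂.restrictScalars k
  p₀₂ := c.p₀₂.restrictScalars k
  i_comp_j := congrArg (AlgHom.restrictScalars k) c.i_comp_j
  p_comp_i₀ := congrArg (AlgHom.restrictScalars k) c.p_comp_i₀
  p_comp_i₁ := congrArg (AlgHom.restrictScalars k) c.p_comp_i₁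
  p_comp_i₂ := congrArg (AlgHom.restrictScalars k) c.p_comp_i₂
  injective := c.injective
  exact₀ := c.exact₀
  exact₁ := c.exact₁

theorem CechData.HasTrivialH1.restrictScalars {D E : Type u} [CommRing D] [Algebra k D]
    [Algebra L D] [IsScalarTower k L D] [CommRing E] [Algebra k E] [Algebra L E]
    [IsScalarTower k L E] {c : CechData L B C D E} {κ : Pts L (L ⊗[k] R) (Laur B)}
    (h : c.HasTrivialH1 κ) :
    (c.restrictScalars (k := k)).HasTrivialH1 (resPt κ : Pts k R (Laur B)) := by
  intro a ha hc
  obtain ⟨a, rfl⟩ := resPt_surjective (L := L) a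
  have ha' : resPt a ∈ arcGroup (resPt (Pts.map (laurMap (c.i₀.comp c.j)) κ) : Pts k R (Laur D)) :=
    ha
  have hc' : resPt (k := k) (Pts.map (psMap c.p₀₂) a) =
      resPt (Pts.map (psMap c.p₀₁) a) * resPt (Pts.map (psMap c.p₁₂) a) := hc
  obtain ⟨v, hv, hva⟩ := h a (resPt_mem_arcGroup.1 ha') (resPt_injective (k := k)
    (hc'.trans (_root_.map_mul _ _ _).symm))
  have hv' : resPt v ∈ arcGroup (resPt (Pts.map (laurMap c.j) κ) : Pts k R (Laur C)) :=
    resPt_mem_arcGroup.2 hv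
  refine ⟨resPt v, hv', ?_⟩
  have e : resPt (k := k) a = resPt (Pts.map (psMap c.i₀) v) *
      (resPt (Pts.map (psMap c.i₁) v))⁻¹ := by rw [hva, _root_.map_mul, _root_.map_inv]
  exact e

/-- The group `arcGroup κ` does not change if `κ` is multiplied on the left by a constant. -/
theorem arcGroup_const_mul (y : Pts k R B) (κ : Pts k R (Laur B)) :
    arcGroup (Pts.map (psLaur k B) (Pts.map (psConst k B) y) * κ) = arcGroup κ := by
  have key : ∀ (y : Pts k R B) (κ : Pts k R (Laur B)), arcGroup κ ≤
      arcGroup (Pts.map (psLaur k B) (Pts.map (psConst k B) y) * κ) := by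
    intro y κ a ha
    obtain ⟨ha, b, hb, h⟩ := mem_arcGroup.1 ha
    refine mem_arcGroup.2 ⟨ha, Pts.map (psConst k B) y * b * (Pts.map (psConst k B) y)⁻¹,
      (MonoidHom.normal_ker _).conj_mem b hb _, ?_⟩
    rw [_root_.map_mul, _root_.map_mul, _root_.map_inv, mul_assoc _ κ, ← h]
    group
  refine le_antisymm ?_ (key y κ)
  have := key y⁻¹ (Pts.map (psLaur k B) (Pts.map (psConst k B) y) * κ)
  rwa [_root_.map_inv, _root_.map_inv, inv_mul_cancel_left] at this

end ExtensionOfScalars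

end

section

/-! ### The matrix h t^λ g⁻¹ over L((t)). -/

section Charts

variable {k : Type u} [Field k] {R : Type u} [CommRing R] [HopfAlgebra k R]
  {ell : Pts k R (LaurentPolynomial k)} {L : Type u} [Field L] [Algebra k L]

/-- The inclusion of constants `A → A((t))`. -/
def laurConst (k A : Type u) [Field k] [CommRing A] [Algebra k A] : A →ₐ[k] Laur A :=
  (psLaur k A).comp (psConst k A)

theorem laurMap_comp_laurConst {A B : Type u} [CommRing A] [Algebra k A] [CommRing B] [Algebra k B]
    (f : A →ₐ[k] B) : (laurMap f).comp (laurConst k A) = (laurConst k B).comp f := by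
  rw [laurConst, ← AlgHom.comp_assoc, laurMap_comp_psLaur, AlgHom.comp_assoc, psMap_comp_psConst]
  rfl

theorem CechData.HasTrivialH1.const_mul {B C D E : Type u} [CommRing B] [Algebra k B] [CommRing C]
    [Algebra k C] [CommRing D] [Algebra k D] [CommRing E] [Algebra k E] {c : CechData k B C D E}
    {κ : Pts k R (Laur B)} (h : c.HasTrivialH1 κ) (y : Pts k R B) :
    c.HasTrivialH1 (Pts.map (laurConst k B) y * κ) := by
  intro a ha hc
  rw [_root_.map_mul, Pts.map_map, laurMap_comp_laurConst] at ha ⊢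
  rw [← Pts.map_map (f := c.i₀.comp c.j)] at ha
  obtain ⟨v, hv, e⟩ := h a ((arcGroup_const_mul _ _).le ha) hc
  rw [← Pts.map_map (f := c.j)]
  exact ⟨v, (arcGroup_const_mul _ _).ge hv, e⟩

/-- A point `x` of `X_λ` over a field `L` as the class of a pair `(g, h)` over a covering such that
`h t^λ g⁻¹` is defined over `L((t))`, and up to a constant is given by a cocharacter over `L`. -/
structure QuotPt.Chart (x : QuotPt ell (CommAlgCat.of k L)) where
  C : Type u
  [commRing : CommRing C]
  [algebra : Algebra L C]
  [algebraBase : Algebra k C]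
  [isScalarTower : IsScalarTower k L C]
  [faithfullyFlat : Module.FaithfullyFlat L C]
  etale : (algebraMap L C).Etale
  g : Pts k R C
  h : Pts k R C
  mem : (g, h) ∈
    x.carrier (CommAlgCat.of k C) (CommAlgCat.ofHom (IsScalarTower.toAlgHom k L C))
  l : Pts L (L ⊗[k] R) (LaurentPolynomial L)
  isCochar : IsCochar l
  y : Pts k R L
  map_eq : Pts.map (laurMap (IsScalarTower.toAlgHom k L C))
      (Pts.map (laurConst k L) y * resPt (Pts.map (laurentToLaur L L) l)) =
    Pts.map (laurConst k C) h * Pts.map (laurentToLaur k C) ell * (Pts.map (laurConst k C) g)⁻¹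

attribute [instance] QuotPt.Chart.commRing QuotPt.Chart.algebra QuotPt.Chart.algebraBase
  QuotPt.Chart.isScalarTower QuotPt.Chart.faithfullyFlat

/-- Multiplicativity may be checked after the injective base change D → D ⊗ C, where l is the
conjugate of λ by g. -/
theorem isCochar_of_conj (hell : IsCochar ell) {C : Type u} [CommRing C] [Algebra L C]
    [Algebra k C] [IsScalarTower k L C] [Module.FaithfullyFlat L C] {g : Pts k R C}
    {l : Pts L (L ⊗[k] R) (LaurentPolynomial L)}
    (hl : ∀ (D : Type u) [CommRing D] [Algebra k D]
      (z : LaurentPolynomial L →ₐ[k] D) (φ : C →ₐ[k] D),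
      (∀ b : L, z (algebraMap L _ b) = φ (algebraMap L C b)) →
      Pts.map z (resPt l) = Pts.map φ g * Pts.map (z.comp (laurentBaseChange k L)) ell *
        (Pts.map φ g)⁻¹) : IsCochar l := by
  intro D _ _ z₁ z₂
  let _ : Algebra k D := Algebra.compHom D (algebraMap k L)
  have : IsScalarTower k L D := .of_algebraMap_eq fun _ => rfl
  have : Module.FaithfullyFlat D (D ⊗[L] C) := Module.FaithfullyFlat.instTensorProduct L C D
  let j : D →ₐ[L] D ⊗[L] C := Algebra.TensorProduct.includeLeft
  have hj : Function.Injective (j.restrictScalars k) :=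
    algebraMap_injective_of_faithfullyFlat D (D ⊗[L] C)
  let φ : C →ₐ[k] D ⊗[L] C :=
    (Algebra.TensorProduct.includeRight : C →ₐ[L] D ⊗[L] C).restrictScalars k
  let w (z : Pts L (LaurentPolynomial L) D) : Pts k (LaurentPolynomial k) (D ⊗[L] C) :=
    .toConv (((j.comp z.ofConv).restrictScalars k).comp (laurentBaseChange k L))
  have hw : w (z₁ * z₂) = w z₁ * w z₂ :=
    WithConv.ext (laurentPolynomial_algHom_ext fun n => by
      change (w (z₁ * z₂)).ofConv _ = (w z₁ * w z₂).ofConv _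
      rw [laurentPoint_mul_T]
      have e : ∀ z, (w z).ofConv (LaurentPolynomial.T n) = j (z.ofConv (LaurentPolynomial.T n)) :=
        fun z => congrArg (fun q => j (z.ofConv q)) (laurentBaseChange_T n)
      rw [e, e, e, laurentPoint_mul_T, _root_.map_mul])
  have key : ∀ z : Pts L (LaurentPolynomial L) D,
      Pts.map (j.restrictScalars k) (resPt (Pts.map z.ofConv l)) =
        Pts.map φ g * Pts.map (w z).ofConv ell * (Pts.map φ g)⁻¹ := fun z =>
    hl (D ⊗[L] C) ((j.comp z.ofConv).restrictScalars k) φ fun b => by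
      rw [AlgHom.restrictScalars_apply, AlgHom.commutes]
      exact ((Algebra.TensorProduct.includeRight : C →ₐ[L] D ⊗[L] C).commutes b).symm
  refine resPt_injective (k := k) (Pts.map_injective hj ?_)
  rw [_root_.map_mul, _root_.map_mul, key, key, key, hw, ← hell]
  group

/-- Both g and h are multiplied by the same m on passing from one pull-back to the other. So h g⁻¹
descends to y in G(L), and g λ g⁻¹ to a cocharacter l over L. The matrix is their product, as h t^λ
g⁻¹ = (h g⁻¹)(g t^λ g⁻¹). -/
theorem QuotPt.nonempty_chart (hell : IsCochar ell) [Algebra.Smooth k R]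
    (x : QuotPt ell (CommAlgCat.of k L)) : Nonempty x.Chart := by
  obtain ⟨C, _, _, _, _, _, g, h, m, hC, hgh, hm, hg, hh⟩ := x.exists_levi hell
  let c := CechData.ofFaithfullyFlat L C k
  obtain ⟨l, hl⟩ := hell.exists_conj hm hg (laurentBaseChange k L)
  obtain ⟨l, rfl⟩ := resPt_surjective (L := L) l
  obtain ⟨y, hy⟩ := Pts.exists_map_eq c.injective (h * g⁻¹) fun f => c.exact₀ _ (by
    have : Pts.map c.i₀ (h * g⁻¹) = Pts.map c.i₁ (h * g⁻¹) := by
      rw [_root_.map_mul, _root_.map_mul, _root_.map_inv, _root_.map_inv]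
      refine Eq.trans ?_ (congrArg₂ (fun a b => a * b⁻¹) hh hg).symm
      group
      rfl
    exact congrArg (fun p : Pts k R _ => p.ofConv f) this)
  refine ⟨⟨C, hC, g, h, hgh, l, isCochar_of_conj hell hl, y, ?_⟩⟩
  have h1 := hl (Laur C) ((laurMap (IsScalarTower.toAlgHom k L C)).comp
    ((laurentToLaur L L).restrictScalars k)) (laurConst k C) fun b => by
      rw [AlgHom.comp_apply, AlgHom.restrictScalars_apply, AlgHom.commutes]
      have : algebraMap L (Laur L) b = laurConst k L b := by
        rw [IsScalarTower.algebraMap_apply L (PowerSeries L) (Laur L), PowerSeries.algebraMap_apply]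
        rfl
      rw [this]
      exact congrArg (fun f : L →ₐ[k] Laur C => f b) (laurMap_comp_laurConst _)
  have h2 : ((laurMap (IsScalarTower.toAlgHom k L C)).comp
      ((laurentToLaur L L).restrictScalars k)).comp (laurentBaseChange k L) = laurentToLaur k C :=
    laurentPolynomial_algHom_ext fun n => by
      rw [AlgHom.comp_apply, laurentBaseChange_T, AlgHom.comp_apply, AlgHom.restrictScalars_apply,
        laurentToLaur_T, laurentToLaur_T, laurMap_tpow]
  have h3 : Pts.map ((laurMap (IsScalarTower.toAlgHom k L C)).comp (laurConst k L)) y =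
      Pts.map (laurConst k C) (h * g⁻¹) := by
    rw [laurMap_comp_laurConst, ← hy]
    rfl
  rw [h2] at h1
  rw [_root_.map_mul, Pts.map_map, h3]
  refine (congrArg (_ * ·) h1).trans ?_
  rw [_root_.map_mul, _root_.map_inv]
  group

namespace QuotPt.Chart

variable {x : QuotPt ell (CommAlgCat.of k L)} (X : x.Chart)

/-- The point `h t^λ g⁻¹` over `B((t))`. -/
def κ (B : Type u) [CommRing B] [Algebra k B] [Algebra L B] [IsScalarTower k L B] :
    Pts k R (Laur B) :=
  Pts.map (laurMap (IsScalarTower.toAlgHom k L B))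
    (Pts.map (laurConst k L) X.y * resPt (Pts.map (laurentToLaur L L) X.l))

variable {B B' : Type u} [CommRing B] [Algebra k B] [Algebra L B] [IsScalarTower k L B]
  [CommRing B'] [Algebra k B'] [Algebra L B'] [IsScalarTower k L B']

theorem map_κ (f : B →ₐ[L] B') : Pts.map (laurMap (f.restrictScalars k)) (X.κ B) = X.κ B' := by
  have : (f.restrictScalars k).comp (IsScalarTower.toAlgHom k L B) =
    IsScalarTower.toAlgHom k L B' := AlgHom.ext fun b => f.commutes b
  rw [κ, κ, Pts.map_map, laurMap_comp, this]

theorem κ_eq : X.κ B = Pts.map (laurConst k B) (Pts.map (IsScalarTower.toAlgHom k L B) X.y) *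
    resPt (Pts.map (laurentToLaur L B) X.l) := by
  rw [κ, _root_.map_mul, Pts.map_map, laurMap_comp_laurConst, ← Pts.map_map]
  congr 1
  have : Pts.map (laurMap (IsScalarTower.toAlgHom k L B))
      (resPt (Pts.map (laurentToLaur L L) X.l)) =
    resPt (Pts.map ((laurMap (IsScalarTower.toAlgHom L L B)).comp (laurentToLaur L L)) X.l) := rfl
  rw [this, laurMap_comp_laurentToLaur]

theorem arcGroup_κ : arcGroup (X.κ B) = arcGroup (resPt (Pts.map (laurentToLaur L B) X.l)) := by
  rw [κ_eq]
  exact arcGroup_const_mul _ _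

theorem resPt_mem_arcGroup_κ {a : Pts L (L ⊗[k] R) (PowerSeries B)} :
    resPt a ∈ arcGroup (X.κ B) ↔ a ∈ arcGroup (Pts.map (laurentToLaur L B) X.l) := by
  rw [arcGroup_κ, resPt_mem_arcGroup]

/-- Up to a constant on the left, which does not affect the group of arcs, the matrix is t^l for a
cocharacter of the group over L. So the vanishing theorem applies with L in place of k. -/
theorem hasTrivialH1 [Algebra.Smooth k R] {D E : Type u} [CommRing D] [Algebra k D]
    [Algebra L D] [IsScalarTower k L D] [CommRing E] [Algebra k E] [Algebra L E]
    [IsScalarTower k L E] (c : CechData L B B' D E) :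
    (c.restrictScalars (k := k)).HasTrivialH1 (X.κ B) := by
  obtain ⟨Y⟩ := X.isCochar.nonempty_coords
  rw [κ_eq]
  exact ((c.hasTrivialH1_tpow Y X.isCochar).restrictScalars (k := k)).const_mul _

end QuotPt.Chart

end Charts

end

section

/-! ### Hopf algebras from group-valued functors of points. -/

section PointGroups

variable {k : Type u} [Field k] {S : Type u} [CommRing S] [Algebra k S]

variable (k S) in
/-- A group structure on the functor of points of `Spec S`. -/
structure PointGroup where
  mul : ∀ {B : Type u} [CommRing B] [Algebra k B], (S →ₐ[k] B) → (S →ₐ[k] B) → (S →ₐ[k] B)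
  one : S →ₐ[k] k
  inv : S →ₐ[k] S
  comp_mul : ∀ {B C : Type u} [CommRing B] [Algebra k B] [CommRing C] [Algebra k C]
    (φ : B →ₐ[k] C) (p q : S →ₐ[k] B), φ.comp (mul p q) = mul (φ.comp p) (φ.comp q)
  mul_assoc : ∀ {B : Type u} [CommRing B] [Algebra k B] (p q r : S →ₐ[k] B),
    mul (mul p q) r = mul p (mul q r)
  one_mul : ∀ {B : Type u} [CommRing B] [Algebra k B] (p : S →ₐ[k] B),
    mul ((Algebra.ofId k B).comp one) p = p
  mul_one : ∀ {B : Type u} [CommRing B] [Algebra k B] (p : S →ₐ[k] B),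
    mul p ((Algebra.ofId k B).comp one) = p
  inv_mul : mul inv (AlgHom.id k S) = (Algebra.ofId k S).comp one
  mul_inv : mul (AlgHom.id k S) inv = (Algebra.ofId k S).comp one

namespace PointGroup

variable (P : PointGroup k S)

/-- The comultiplication: the product of the two projections. -/
def comul : S →ₐ[k] S ⊗[k] S :=
  P.mul Algebra.TensorProduct.includeLeft Algebra.TensorProduct.includeRight

theorem lift_comp_comul {B : Type u} [CommRing B] [Algebra k B] (p q : S →ₐ[k] B) :
    (Algebra.TensorProduct.lift p q (fun _ _ => Commute.all _ _)).comp P.comul = P.mul p q := by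
  rw [comul, P.comp_mul]
  congr 1 <;> exact AlgHom.ext fun _ => by simp

theorem map_comp_comul {B C : Type u} [CommRing B] [Algebra k B] [CommRing C] [Algebra k C]
    (p : S →ₐ[k] B) (q : S →ₐ[k] C) :
    (Algebra.TensorProduct.map p q).comp P.comul =
      P.mul ((Algebra.TensorProduct.includeLeft : B →ₐ[k] B ⊗[k] C).comp p)
        ((Algebra.TensorProduct.includeRight : C →ₐ[k] B ⊗[k] C).comp q) := by
  rw [comul, P.comp_mul]
  congr 1 <;> exact AlgHom.ext fun _ => by simp

/-- The Hopf algebra of an affine group scheme given by its functor of points. -/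
abbrev hopfAlgebra : HopfAlgebra k S :=
  letI : Bialgebra k S := Bialgebra.ofAlgHom P.comul P.one
    (by
      rw [map_comp_comul, map_comp_comul, P.comp_mul, comul, P.comp_mul, P.comp_mul, P.comp_mul,
        P.mul_assoc]
      congr 1)
    (by
      rw [map_comp_comul]
      exact (P.one_mul _))
    (by
      rw [map_comp_comul]
      refine Eq.trans (congrArg (P.mul _) (AlgHom.ext fun s => ?_)) (P.mul_one _)
      exact ((Algebra.TensorProduct.algebraMap_apply' _).symm))
  HopfAlgebra.ofAlgHom P.inv
    ((P.lift_comp_comul _ _).trans P.inv_mul)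
    ((P.lift_comp_comul _ _).trans P.mul_inv)

theorem ofConv_mul {B : Type u} [CommRing B] [Algebra k B] :
    letI := P.hopfAlgebra
    ∀ p q : Pts k S B, (p * q).ofConv = P.mul p.ofConv q.ofConv := by
  let := P.hopfAlgebra
  intro p q
  exact (AlgHom.ext fun x => Pts.mul_apply p q x).trans (P.lift_comp_comul _ _)

/-- The group structure induced on a retract of the underlying scheme. -/
def retract {S' : Type u} [CommRing S'] [Algebra k S'] (i : S' →ₐ[k] S) (r : S →ₐ[k] S')
    (hr : r.comp i = AlgHom.id k S')
    (hmul : ∀ {B : Type u} [CommRing B] [Algebra k B] (p p' q q' : S →ₐ[k] B),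
      p.comp i = p'.comp i → q.comp i = q'.comp i → (P.mul p q).comp i = (P.mul p' q').comp i)
    : PointGroup k S' where
  mul p q := (P.mul (p.comp r) (q.comp r)).comp i
  one := P.one.comp i
  inv := (r.comp P.inv).comp i
  comp_mul φ p q := by rw [← AlgHom.comp_assoc, P.comp_mul]; rfl
  mul_assoc p q s := by
    -- By `hmul` a factor may be replaced by any other point with the same restriction along i. In
    -- this way the axioms are inherited from P.
    have e : ∀ {B : Type u} [CommRing B] [Algebra k B] (u : S →ₐ[k] B),
        ((u.comp i).comp r).comp i = u.comp i := fun u => by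
      rw [AlgHom.comp_assoc, hr, AlgHom.comp_id]
    rw [hmul _ (P.mul (p.comp r) (q.comp r)) _ (s.comp r) (e _) rfl,
      hmul (p.comp r) (p.comp r) _ (P.mul (q.comp r) (s.comp r)) rfl (e _), P.mul_assoc]
  one_mul p := by
    refine (hmul _ ((Algebra.ofId k _).comp P.one) _ (p.comp r) ?_ rfl).trans ?_
    · rw [AlgHom.comp_assoc, hr]
      rfl
    · rw [P.one_mul, AlgHom.comp_assoc, hr, AlgHom.comp_id]
  mul_one p := by
    refine (hmul _ (p.comp r) _ ((Algebra.ofId k _).comp P.one) rfl ?_).trans ?_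
    · rw [AlgHom.comp_assoc, hr]
      rfl
    · rw [P.mul_one, AlgHom.comp_assoc, hr, AlgHom.comp_id]
  inv_mul := by
    refine (hmul _ (r.comp P.inv) _ (r.comp (AlgHom.id k S)) ?_ rfl).trans ?_
    · rw [AlgHom.comp_assoc, hr]
      rfl
    · rw [← P.comp_mul, P.inv_mul, ← AlgHom.comp_assoc, Algebra.comp_ofId]
      rfl
  mul_inv := by
    refine (hmul _ (r.comp (AlgHom.id k S)) _ (r.comp P.inv) rfl ?_).trans ?_
    · rw [AlgHom.comp_assoc, hr]
      rfl
    · rw [← P.comp_mul, P.mul_inv, ← AlgHom.comp_assoc, Algebra.comp_ofId]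
      rfl

/-- The inclusion of the coordinate ring of a retract, as a homomorphism of Hopf algebras. -/
def retractHom {S' : Type u} [CommRing S'] [Algebra k S'] (i : S' →ₐ[k] S) (r : S →ₐ[k] S')
    (hr : r.comp i = AlgHom.id k S')
    (hmul : ∀ {B : Type u} [CommRing B] [Algebra k B] (p p' q q' : S →ₐ[k] B),
      p.comp i = p'.comp i → q.comp i = q'.comp i → (P.mul p q).comp i = (P.mul p' q').comp i) :
    letI := P.hopfAlgebra
    letI := (P.retract i r hr hmul).hopfAlgebra
    S' →ₐc[k] S :=
  letI := P.hopfAlgebra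
  letI := (P.retract i r hr hmul).hopfAlgebra
  BialgHom.ofAlgHom i rfl (by
    refine ((P.retract i r hr hmul).map_comp_comul i i).trans (hmul _ _ _ _ ?_ ?_) <;>
    · rw [AlgHom.comp_assoc, hr]
      rfl)

end PointGroup

end PointGroups

end

section

/-! ### Criteria for unipotence. -/

section Unipotent

variable {k : Type u} [Field k] {R : Type u} [CommRing R] [HopfAlgebra k R]

/-- A representation of the quotient group is a representation of the group. A vector fixed by the
group is fixed by the quotient, because V ⊗ R' → V ⊗ R is injective. -/
theorem IsUnipotent.of_injective {R' : Type u} [CommRing R'] [HopfAlgebra k R'] (h : IsUnipotent k R)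
    (j : R' →ₐc[k] R) (hj : Function.Injective j) : IsUnipotent k R' := by
  intro V hV
  let J : R' →ₗ[k] R := (j : R' →ₐ[k] R).toLinearMap
  let W : FinRep k R :=
    { V := V.V
      coact := J.lTensor V.V ∘ₗ V.coact
      coassoc := by
        have h1 : (TensorProduct.assoc k V.V R R).toLinearMap ∘ₗ
            (J.lTensor V.V ∘ₗ V.coact).rTensor R ∘ₗ J.lTensor V.V =
          (TensorProduct.map J J).lTensor V.V ∘ₗ
            (TensorProduct.assoc k V.V R' R').toLinearMap ∘ₗ V.coact.rTensor R' := by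
          refine TensorProduct.ext' fun v f => ?_
          simp only [LinearMap.comp_apply, LinearMap.lTensor_tmul, LinearMap.rTensor_tmul]
          generalize V.coact v = z
          induction z with
          | zero => simp
          | add x y hx hy => simp only [map_add, add_tmul, hx, hy]
          | tmul x y => simp
        have h2 : (Coalgebra.comul (R := k) (A := R)) ∘ₗ J =
            TensorProduct.map J J ∘ₗ Coalgebra.comul (R := k) (A := R') :=
          (CoalgHomClass.map_comp_comul j).symm
        refine (congrArg (fun z => z ∘ₗ V.coact) h1).trans ?_
        change (TensorProduct.map J J).lTensor V.V ∘ₗ ((TensorProduct.assoc k V.V R' R').toLinearMap ∘ₗ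
          V.coact.rTensor R' ∘ₗ V.coact) = _
        rw [V.coassoc, ← LinearMap.comp_assoc V.coact, ← LinearMap.lTensor_comp, ← h2,
          LinearMap.lTensor_comp, LinearMap.comp_assoc]
      counit := by
        rw [← LinearMap.comp_assoc V.coact (J.lTensor V.V), ← LinearMap.lTensor_comp]
        have h2 : (Coalgebra.counit (R := k) (A := R)) ∘ₗ J = Coalgebra.counit (R := k) (A := R') :=
          CoalgHomClass.counit_comp j
        rw [h2, V.counit] }
  obtain ⟨v, hv, e⟩ := h W hV
  refine ⟨v, hv, Module.Flat.lTensor_preserves_injective_linearMap (M := V.V) J hj ?_⟩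
  refine Eq.trans e ?_
  rw [LinearMap.lTensor_tmul]
  congr 1
  exact (map_one j).symm

/-- Contraction of the second tensor factor. -/
def contractRight {V W : Type u} [AddCommGroup V] [Module k V] [AddCommGroup W] [Module k W]
    (φ : W →ₗ[k] k) : V ⊗[k] W →ₗ[k] V :=
  (TensorProduct.rid k V).toLinearMap ∘ₗ φ.lTensor V

/-- Contraction of the first tensor factor. -/
def contractLeft {V W : Type u} [AddCommGroup V] [Module k V] [AddCommGroup W] [Module k W]
    (φ : V →ₗ[k] k) : V ⊗[k] W →ₗ[k] W :=
  (TensorProduct.lid k W).toLinearMap ∘ₗ φ.rTensor W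

@[simp]
theorem contractRight_tmul {V W : Type u} [AddCommGroup V] [Module k V] [AddCommGroup W]
    [Module k W] (φ : W →ₗ[k] k) (v : V) (w : W) : contractRight φ (v ⊗ₜ[k] w) = φ w • v := by
  simp [contractRight]

@[simp]
theorem contractLeft_tmul {V W : Type u} [AddCommGroup V] [Module k V] [AddCommGroup W]
    [Module k W] (φ : V →ₗ[k] k) (v : V) (w : W) : contractLeft φ (v ⊗ₜ[k] w) = φ v • w := by
  simp [contractLeft]

theorem eq_of_contractRight_eq {V W : Type u} [AddCommGroup V] [Module k V] [AddCommGroup W]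
    [Module k W] {x y : V ⊗[k] W} (h : ∀ φ : W →ₗ[k] k, contractRight φ x = contractRight φ y) :
    x = y := by
  classical
  let b := Module.Basis.ofVectorSpace k W
  apply (TensorProduct.equivFinsuppOfBasisRight (M := V) b).injective
  refine Finsupp.ext fun i => ?_
  have key : ∀ z, TensorProduct.equivFinsuppOfBasisRight (M := V) b z i =
      contractRight (b.coord i) z := by
    intro z
    induction z with
    | zero => simp
    | add x y hx hy => simp only [map_add, Finsupp.add_apply, hx, hy]
    | tmul x y => simp
  rw [key, key, h]

/-- A group is unipotent if its Hopf algebra has an exhaustive filtration on which it acts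
unipotently. -/
theorem isUnipotent_of_filtration (F : ℕ → Submodule k R) (hF : Monotone F) (h0 : F 0 = ⊥)
    (hex : ∀ x, ∃ n, x ∈ F n)
    (hcomul : ∀ n, ∀ x ∈ F (n + 1), ∀ φ : R →ₗ[k] k, φ 1 = 0 →
      contractRight φ (Coalgebra.comul (R := k) x) ∈ F n) : IsUnipotent k R := by
  intro V hV
  have hcounit : ∀ v, contractRight (Coalgebra.counit (R := k)) (V.coact v) = v := fun v =>
    congrArg (fun f : V.V →ₗ[k] V.V => f v) V.counit
  -- Induction on a filtration step containing all matrix coefficients of v. If v is not fixed, some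
  -- functional φ with φ(1) = 0 moves it to a nonzero vector whose matrix coefficients lie one step
  -- lower.
  have key : ∀ n, ∀ v : V.V, v ≠ 0 → (∀ ψ : V.V →ₗ[k] k, contractLeft ψ (V.coact v) ∈ F n) →
      ∃ v : V.V, v ≠ 0 ∧ V.coact v = v ⊗ₜ[k] (1 : R) := by
    intro n
    induction n with
    | zero =>
      intro v hv h
      refine (hv ?_).elim
      refine (Module.forall_dual_apply_eq_zero_iff k v).1 fun ψ => ?_
      have h1 := h ψ
      rw [h0, Submodule.mem_bot] at h1
      have h2 : ∀ z : V.V ⊗[k] R, ψ (contractRight (Coalgebra.counit (R := k)) z) =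
          Coalgebra.counit (R := k) (contractLeft ψ z) := by
        intro z
        induction z with
        | zero => simp
        | add x y hx hy => simp only [map_add, hx, hy]
        | tmul x y => simp [mul_comm]
      rw [← hcounit v, h2, h1, map_zero]
    | succ n ih =>
      intro v hv h
      by_cases hφ : ∀ φ : R →ₗ[k] k, φ 1 = 0 → contractRight φ (V.coact v) = 0
      · refine ⟨v, hv, eq_of_contractRight_eq fun φ => ?_⟩
        -- Subtracting φ(1) ε makes an arbitrary functional vanish on 1.
        have h1 := hφ (φ - φ 1 • Coalgebra.counit (R := k)) (by simp)
        have h2 : ∀ z : V.V ⊗[k] R, contractRight (φ - φ 1 • Coalgebra.counit (R := k)) z =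
            contractRight φ z - φ 1 • contractRight (Coalgebra.counit (R := k)) z := by
          intro z
          induction z with
          | zero => simp
          | add x y hx hy => simp only [map_add, hx, hy, smul_add]; abel
          | tmul x y => simp [sub_smul, mul_smul]
        rw [h2, hcounit, sub_eq_zero] at h1
        rw [h1, contractRight_tmul]
      · push Not at hφ
        obtain ⟨φ, h1, h2⟩ := hφ
        refine ih _ h2 fun ψ => ?_
        have h3 := hcomul n _ (h ψ) φ h1
        have e1 : ∀ z : V.V ⊗[k] R, contractRight φ (Coalgebra.comul (R := k) (contractLeft ψ z)) =
            contractLeft ψ (contractRight (V := V.V ⊗[k] R) φ ((TensorProduct.assoc k V.V R R).symm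
              ((Coalgebra.comul (R := k) (A := R)).lTensor V.V z))) := by
          intro z
          induction z with
          | zero => simp
          | add x y hx hy => simp only [map_add, hx, hy]
          | tmul x y =>
            simp only [contractLeft_tmul, map_smul, LinearMap.lTensor_tmul]
            generalize Coalgebra.comul (R := k) y = w
            induction w with
            | zero => simp
            | add x y hx hy => simp only [map_add, smul_add, tmul_add, hx, hy]
            | tmul y y' =>
              rw [contractRight_tmul, TensorProduct.assoc_symm_tmul, contractRight_tmul,
                map_smul, contractLeft_tmul, smul_comm]
        have e2 : ∀ z : V.V ⊗[k] R, V.coact (contractRight φ z) =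
            contractRight (V := V.V ⊗[k] R) φ (V.coact.rTensor R z) := by
          intro z
          induction z with
          | zero => simp
          | add x y hx hy => simp only [map_add, hx, hy]
          | tmul x y => simp
        have e3 : (Coalgebra.comul (R := k) (A := R)).lTensor V.V (V.coact v) =
            TensorProduct.assoc k V.V R R (V.coact.rTensor R (V.coact v)) :=
          congrArg (fun f : V.V →ₗ[k] _ => f v) V.coassoc.symm
        rwa [e1, e3, LinearEquiv.symm_apply_apply, ← e2] at h3
  obtain ⟨v, hv⟩ := exists_ne (0 : V.V)
  have hfin : ∀ z : V.V ⊗[k] R, ∃ n, ∀ ψ : V.V →ₗ[k] k, contractLeft ψ z ∈ F n := by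
    intro z
    induction z with
    | zero => exact ⟨0, fun ψ => by rw [map_zero]; exact Submodule.zero_mem _⟩
    | add x y hx hy =>
      obtain ⟨m, hm⟩ := hx
      obtain ⟨n, hn⟩ := hy
      exact ⟨max m n, fun ψ => by
        rw [map_add]
        exact Submodule.add_mem _ (hF (le_max_left m n) (hm ψ)) (hF (le_max_right m n) (hn ψ))⟩
    | tmul x y =>
      obtain ⟨n, hn⟩ := hex y
      exact ⟨n, fun ψ => by
        rw [contractLeft_tmul]
        exact Submodule.smul_mem _ _ hn⟩
  obtain ⟨n, hn⟩ := hfin (V.coact v)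
  exact key n v hv hn

theorem span_tmul_mul_mem (W : ℕ → Submodule k R)
    (hW : ∀ m n, ∀ x ∈ W m, ∀ y ∈ W n, x * y ∈ W (m + n)) {m n : ℕ} {x y : R ⊗[k] R}
    (hx : x ∈ Submodule.span k {z | ∃ a b, a + b = m ∧ ∃ p ∈ W a, ∃ q ∈ W b, z = p ⊗ₜ[k] q})
    (hy : y ∈ Submodule.span k {z | ∃ a b, a + b = n ∧ ∃ p ∈ W a, ∃ q ∈ W b, z = p ⊗ₜ[k] q}) :
    x * y ∈ Submodule.span k
      {z | ∃ a b, a + b = m + n ∧ ∃ p ∈ W a, ∃ q ∈ W b, z = p ⊗ₜ[k] q} := by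
  refine Submodule.mul_le.1 ?_ x hx y hy
  rw [Submodule.span_mul_span]
  refine Submodule.span_mono ?_
  rintro _ ⟨_, ⟨a, b, e, p, hp, q, hq, rfl⟩, _, ⟨a', b', e', p', hp', q', hq', rfl⟩, rfl⟩
  exact ⟨a + a', b + b', by omega, p * p', hW _ _ _ hp _ hp', q * q', hW _ _ _ hq _ hq',
    Algebra.TensorProduct.tmul_mul_tmul _ _ _ _⟩

/-- A group whose Hopf algebra is generated by homogeneous elements of positive degree, with
homogeneous comultiplication, is unipotent. -/
theorem isUnipotent_of_grading (W : ℕ → Submodule k R) (h0 : W 0 ≤ k ∙ (1 : R))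
    (htop : ⨆ n, W n = ⊤)
    (hcomul : ∀ n, ∀ x ∈ W n, Coalgebra.comul (R := k) x ∈ Submodule.span k
      {z | ∃ a b, a + b = n ∧ ∃ p ∈ W a, ∃ q ∈ W b, z = p ⊗ₜ[k] q}) : IsUnipotent k R := by
  have hmono : Monotone fun n => ⨆ a : Fin n, W a := fun m n h =>
    iSup_le fun a => le_iSup (fun a : Fin n => W a) (Fin.castLE h a)
  -- The filtration step n is the sum of the degrees below n. A functional vanishing on 1 kills the
  -- terms of Δ(x) whose second factor has degree 0, so the first factor has smaller degree than x.
  refine isUnipotent_of_filtration (fun n => ⨆ a : Fin n, W a) hmono (by simp) (fun x => ?_) ?_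
  · have hx : x ∈ ⨆ n, W n := htop.ge trivial
    induction hx using Submodule.iSup_induction' with
    | mem n x hx =>
      exact ⟨n + 1, Submodule.mem_iSup_of_mem (p := fun a : Fin (n + 1) => W a) (Fin.last n) hx⟩
    | zero => exact ⟨0, Submodule.zero_mem _⟩
    | add x y _ _ hx hy =>
      obtain ⟨m, hm⟩ := hx
      obtain ⟨n, hn⟩ := hy
      exact ⟨max m n, Submodule.add_mem _ (hmono (le_max_left m n) hm)
        (hmono (le_max_right m n) hn)⟩
  · intro n x hx φ hφ
    induction hx using Submodule.iSup_induction' with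
    | mem a x hx =>
      have h := hcomul a x hx
      refine Submodule.span_induction (p := fun z _ => contractRight φ z ∈ ⨆ a : Fin n, W a)
        ?_ ?_ ?_ ?_ h
      · rintro _ ⟨b, c, e, p, hp, q, hq, rfl⟩
        rw [contractRight_tmul]
        rcases Nat.eq_zero_or_pos c with rfl | hc
        · obtain ⟨y, rfl⟩ := Submodule.mem_span_singleton.1 (h0 hq)
          rw [map_smul, hφ, smul_zero, zero_smul]
          exact Submodule.zero_mem _
        · exact Submodule.smul_mem _ _ (Submodule.mem_iSup_of_mem (p := fun a : Fin n => W a)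
            ⟨b, by omega⟩ hp)
      · rw [map_zero]
        exact Submodule.zero_mem _
      · intro y z _ _ hy hz
        rw [map_add]
        exact Submodule.add_mem _ hy hz
      · intro c y _ hy
        rw [map_smul]
        exact Submodule.smul_mem _ _ hy
    | zero =>
      rw [map_zero, map_zero]
      exact Submodule.zero_mem _
    | add x y _ _ hx hy =>
      rw [map_add, map_add]
      exact Submodule.add_mem _ hx hy

end Unipotent

end

section

/-! ### The group of arcs as a pro-unipotent group scheme. -/

section ArcHopfAlgebra

variable {k : Type u} [Field k] {R : Type u} [CommRing R] [HopfAlgebra k R]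
variable {ell : Pts k R (LaurentPolynomial k)} {B C : Type u} [CommRing B] [Algebra k B]
  [CommRing C] [Algebra k C]

/-- The indices of the coordinates of the group of arcs: the `j`-th coefficient of the `i`-th
coordinate, where the order of vanishing is at least the one prescribed by the weight. -/
def Coords.Idx (X : Coords ell) : Type u := {p : X.ι × ℕ // 1 + (-X.deg p.1).toNat ≤ p.2}

/-- The polynomial ring of the coordinates of the group of arcs. -/
abbrev Coords.Ring (X : Coords ell) : Type u := MvPolynomial X.Idx k

/-- The `i`-th coordinate of the arc with given coefficients. -/
def Coords.series (X : Coords ell) (p : X.Ring →ₐ[k] B) (i : X.ι) : PowerSeries B :=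
  PowerSeries.mk fun j => if h : 1 + (-X.deg i).toNat ≤ j then p (.X ⟨(i, j), h⟩) else 0

theorem Coords.series_mem (X : Coords ell) (p : X.Ring →ₐ[k] B) (i : X.ι) :
    X.series p i ∈ shiftSub B (X.deg i) := by
  rw [mem_shiftSub, PowerSeries.X_pow_dvd_iff]
  intro m hm
  rw [Coords.series, PowerSeries.coeff_mk, dif_neg (by omega)]

variable [Algebra.FormallySmooth k R]

theorem Coords.exists_arcOf (X : Coords ell) (p : X.Ring →ₐ[k] B) :
    ∃ a ∈ arcs k R B, ∀ i, a.ofConv (X.x i) = X.series p i :=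
  X.exists_arc _ fun i => X_dvd_of_mem_shiftSub (X.series_mem p i)

/-- The arc with given coefficients. -/
def Coords.arcOf (X : Coords ell) (p : X.Ring →ₐ[k] B) : Pts k R (PowerSeries B) :=
  (X.exists_arcOf p).choose

theorem Coords.arcOf_mem_arcs (X : Coords ell) (p : X.Ring →ₐ[k] B) : X.arcOf p ∈ arcs k R B :=
  (X.exists_arcOf p).choose_spec.1

theorem Coords.arcOf_x (X : Coords ell) (p : X.Ring →ₐ[k] B) (i : X.ι) :
    (X.arcOf p).ofConv (X.x i) = X.series p i :=
  (X.exists_arcOf p).choose_spec.2 i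

theorem Coords.coeff_arcOf (X : Coords ell) (p : X.Ring →ₐ[k] B) (s : X.Idx) :
    PowerSeries.coeff s.1.2 ((X.arcOf p).ofConv (X.x s.1.1)) = p (.X s) := by
  rw [X.arcOf_x, Coords.series, PowerSeries.coeff_mk, dif_pos s.2]
  rfl

theorem Coords.arcOf_mem (X : Coords ell) (hell : IsCochar ell) (p : X.Ring →ₐ[k] B) :
    X.arcOf p ∈ arcGroup (Pts.map (laurentToLaur k B) ell) :=
  (X.mem_arcGroup_iff hell).2 ⟨X.arcOf_mem_arcs p, fun i => X.arcOf_x p i ▸ X.series_mem p i⟩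

theorem Coords.arcOf_injective (X : Coords ell) : Function.Injective (X.arcOf (B := B)) :=
  fun p q h => MvPolynomial.algHom_ext fun s => by
    rw [← X.coeff_arcOf, ← X.coeff_arcOf, h]

theorem Coords.exists_arcOf_eq (X : Coords ell) (hell : IsCochar ell) {a : Pts k R (PowerSeries B)}
    (ha : a ∈ arcGroup (Pts.map (laurentToLaur k B) ell)) : ∃ p, X.arcOf p = a := by
  obtain ⟨h1, h2⟩ := (X.mem_arcGroup_iff hell).1 ha
  refine ⟨MvPolynomial.aeval fun s => PowerSeries.coeff s.1.2 (a.ofConv (X.x s.1.1)),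
    X.arc_ext (X.arcOf_mem_arcs _) h1 fun i => PowerSeries.ext fun j => ?_⟩
  rw [X.arcOf_x, Coords.series, PowerSeries.coeff_mk]
  split_ifs with h
  · exact MvPolynomial.aeval_X _ _
  · exact (PowerSeries.X_pow_dvd_iff.1 (mem_shiftSub.1 (h2 i)) j (by omega)).symm

theorem Coords.map_arcOf (X : Coords ell) (φ : B →ₐ[k] C) (p : X.Ring →ₐ[k] B) :
    Pts.map (psMap φ) (X.arcOf p) = X.arcOf (φ.comp p) := by
  refine X.arc_ext (map_mem_arcs φ (X.arcOf_mem_arcs p)) (X.arcOf_mem_arcs _) fun i =>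
    PowerSeries.ext fun j => ?_
  rw [Pts.map_apply, X.arcOf_x, X.arcOf_x, coeff_psMap, Coords.series, Coords.series,
    PowerSeries.coeff_mk, PowerSeries.coeff_mk]
  split_ifs
  · rfl
  · rw [_root_.map_zero]

theorem Coords.exists_mul (X : Coords ell) (hell : IsCochar ell) (p q : X.Ring →ₐ[k] B) :
    ∃ r, X.arcOf r = X.arcOf p * X.arcOf q :=
  X.exists_arcOf_eq hell (mul_mem (X.arcOf_mem hell p) (X.arcOf_mem hell q))

/-- The group of arcs as a group scheme. -/
def Coords.pointGroup (X : Coords ell) (hell : IsCochar ell) : PointGroup k X.Ring :=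
  -- Product, unit and inverse are transported along `arcOf`, a natural bijection from points of the
  -- polynomial ring to the group of arcs. By its injectivity the axioms hold because they hold for
  -- arcs.
  have hmul : ∀ {B : Type u} [CommRing B] [Algebra k B] (p q : X.Ring →ₐ[k] B),
    X.arcOf (X.exists_mul hell p q).choose = X.arcOf p * X.arcOf q :=
    fun p q => (X.exists_mul hell p q).choose_spec
  have hone := (X.exists_arcOf_eq (B := k) hell (one_mem _)).choose_spec
  have hone' : ∀ {B : Type u} [CommRing B] [Algebra k B], X.arcOf ((Algebra.ofId k B).comp
      (X.exists_arcOf_eq (B := k) hell (one_mem _)).choose) = 1 := by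
    intro B _ _
    rw [← X.map_arcOf, hone, map_one]
  have hinv := (X.exists_arcOf_eq hell
      (inv_mem (X.arcOf_mem hell (AlgHom.id k X.Ring)))).choose_spec
  { mul p q := (X.exists_mul hell p q).choose
    one := (X.exists_arcOf_eq (B := k) hell (one_mem _)).choose
    inv := (X.exists_arcOf_eq hell (inv_mem (X.arcOf_mem hell (AlgHom.id k X.Ring)))).choose
    comp_mul φ p q := X.arcOf_injective (by
      rw [← X.map_arcOf, hmul, hmul, map_mul, X.map_arcOf, X.map_arcOf])
    mul_assoc p q r := X.arcOf_injective (by simp only [hmul, mul_assoc])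
    one_mul p := X.arcOf_injective (by rw [hmul, hone', one_mul])
    mul_one p := X.arcOf_injective (by rw [hmul, hone', mul_one])
    inv_mul := X.arcOf_injective (by rw [hmul, hone', hinv, inv_mul_cancel])
    mul_inv := X.arcOf_injective (by rw [hmul, hone', hinv, mul_inv_cancel]) }

theorem Coords.arcOf_mul (X : Coords ell) (hell : IsCochar ell) (p q : X.Ring →ₐ[k] B) :
    X.arcOf ((X.pointGroup hell).mul p q) = X.arcOf p * X.arcOf q :=
  (X.exists_mul hell p q).choose_spec

omit [Algebra.FormallySmooth k R] in
-- Power series whose coefficient of t^j lies in G j form a closed multiplicative family. So the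
-- condition on coordinates extends to all functions in the augmentation ideal and is stable under
-- the group law. It expresses homogeneity under rescaling of t.
theorem Coords.coeff_mul_mem (X : Coords ell) (hell : IsCochar ell) (G : ℕ → Submodule k B)
    (hG : ∀ m n, ∀ x ∈ G m, ∀ y ∈ G n, x * y ∈ G (m + n)) {a b : Pts k R (PowerSeries B)}
    (ha : a ∈ arcs k R B) (hb : b ∈ arcs k R B)
    (ha' : ∀ i j, PowerSeries.coeff j (a.ofConv (X.x i)) ∈ G j)
    (hb' : ∀ i j, PowerSeries.coeff j (b.ofConv (X.x i)) ∈ G j) (i : X.ι) (j : ℕ) :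
    PowerSeries.coeff j ((a * b).ofConv (X.x i)) ∈ G j := by
  let M : Submodule k (PowerSeries B) :=
    { carrier := {y | PowerSeries.X ∣ y ∧ ∀ j, PowerSeries.coeff j y ∈ G j}
      add_mem' := fun hx hy => ⟨dvd_add hx.1 hy.1, fun j => by
        rw [map_add]
        exact add_mem (hx.2 j) (hy.2 j)⟩
      zero_mem' := ⟨dvd_zero _, fun j => by
        rw [map_zero]
        exact zero_mem _⟩
      smul_mem' := fun c y hy => ⟨dvd_smul_of_dvd c hy.1, fun j => Submodule.smul_mem _ c (hy.2 j)⟩ }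
  have hmul : ∀ y ∈ M, ∀ z ∈ M, y * z ∈ M := fun y hy z hz => ⟨hy.1.mul_right z, fun j => by
    rw [PowerSeries.coeff_mul]
    refine sum_mem fun p hp => ?_
    rw [← Finset.HasAntidiagonal.mem_antidiagonal.1 hp]
    exact hG _ _ _ (hy.2 _) _ (hz.2 _)⟩
  have key : ∀ {a : Pts k R (PowerSeries B)}, a ∈ arcs k R B →
      (∀ i j, PowerSeries.coeff j (a.ofConv (X.x i)) ∈ G j) →
      ∀ {n : ℤ} {f : R}, f ∈ wt ell n ⊓ augm k R → a.ofConv f ∈ M := fun {a} ha ha' {n f} hf =>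
    X.mem_of_coords_mem hell (fun _ => M) (fun _ _ h => h.1) (fun _ _ => hmul)
      (fun _ y h => ⟨by
        obtain ⟨z, hz, hyz⟩ := h 1
        rw [pow_one] at hyz
        exact (dvd_iff_dvd_of_dvd_sub hyz).2 hz.1, fun j => by
        obtain ⟨z, hz, hyz⟩ := h (j + 1)
        have := PowerSeries.X_pow_dvd_iff.1 hyz j j.lt_succ_self
        rw [map_sub, sub_eq_zero] at this
        rw [this]
        exact hz.2 j⟩) ha (fun i => ⟨mem_arcs.1 ha _ (X.x_augm i), ha' i⟩) hf
  have h := hell.mul_apply_sub_mem a b ⟨X.x_wt i, X.x_augm i⟩ M fun p q _ f hf g hg =>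
    hmul _ (key ha ha' hf) _ (key hb hb' hg)
  have h1 := h.2 j
  rw [map_sub, map_sub] at h1
  have := add_mem (add_mem h1 (hb' i j)) (ha' i j)
  rwa [sub_add_cancel, sub_add_cancel] at this

/-- The span of the elements of degree `n` of a family. -/
def gradeSpan {S D : Type u} [CommRing S] [Algebra k S] (m : D → S) (w : D → ℕ) (n : ℕ) :
    Submodule k S :=
  Submodule.span k (m '' {d | w d = n})

/-- The weighted homogeneous part of a polynomial ring. -/
def weightSpan {σ : Type u} (k : Type u) [Field k] (w : σ → ℕ) (n : ℕ) :=
  gradeSpan (k := k) (S := MvPolynomial σ k) (fun d => MvPolynomial.monomial d 1)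
    (Finsupp.weight w) n

theorem weightSpan_mul_mem {σ : Type u} (w : σ → ℕ) (m n : ℕ) :
    ∀ x ∈ weightSpan k w m, ∀ y ∈ weightSpan k w n, x * y ∈ weightSpan k w (m + n) := by
  intro x hx y hy
  refine Submodule.mul_le.1 ?_ x hx y hy
  rw [weightSpan, weightSpan, gradeSpan, gradeSpan, Submodule.span_mul_span]
  refine Submodule.span_mono ?_
  rintro _ ⟨_, ⟨d, rfl, rfl⟩, _, ⟨e, rfl, rfl⟩, rfl⟩
  exact ⟨d + e, map_add _ _ _, by simp [MvPolynomial.monomial_mul]⟩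

omit [Algebra.FormallySmooth k R] in
-- As comultiplication is a ring homomorphism and degrees are additive, homogeneity on the variables
-- gives homogeneity on all monomials. Since the variables have positive degree, degree 0 consists
-- of constants.
theorem isUnipotent_mvPolynomial {σ : Type u} (w : σ → ℕ) (hw : ∀ s, 0 < w s)
    (P : PointGroup k (MvPolynomial σ k))
    (H : ∀ s, P.comul (MvPolynomial.X s : MvPolynomial σ k) ∈ Submodule.span k
      {z | ∃ a b, a + b = w s ∧ ∃ p ∈ weightSpan k w a, ∃ q ∈ weightSpan k w b, z = p ⊗ₜ[k] q}) :
    letI := P.hopfAlgebra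
    IsUnipotent k (MvPolynomial σ k) := by
  let _ := P.hopfAlgebra
  have hmem : ∀ d : σ →₀ ℕ, MvPolynomial.monomial d (1 : k) ∈ weightSpan k w (Finsupp.weight w d) :=
    fun d => Submodule.subset_span ⟨d, rfl, rfl⟩
  have hmul := weightSpan_mul_mem (k := k) w
  refine isUnipotent_of_grading (weightSpan k w) (Submodule.span_le.2 ?_) (eq_top_iff.2 ?_) ?_
  · rintro _ ⟨d, hd, rfl⟩
    have : d = 0 := by
      refine Finsupp.ext fun s => ?_
      by_contra hs
      have h1 := Finsupp.le_weight w (s := s) (hw s).ne' d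
      rw [show Finsupp.weight w d = 0 from hd] at h1
      exact hs (Nat.le_zero.1 h1)
    rw [this]
    exact Submodule.mem_span_singleton_self _
  · intro x _
    induction x using MvPolynomial.induction_on' with
    | monomial d a =>
      rw [← mul_one a, ← smul_eq_mul, ← MvPolynomial.smul_monomial]
      exact Submodule.smul_mem _ _ (Submodule.mem_iSup_of_mem _ (hmem d))
    | add p q hp hq => exact add_mem (hp trivial) (hq trivial)
  · intro n x hx
    have hone : (1 : MvPolynomial σ k) ∈ weightSpan k w 0 := by
      have := hmem 0
      rwa [map_zero] at this
    have h0 : P.comul (MvPolynomial.monomial 0 1 : MvPolynomial σ k) ∈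
        Submodule.span k {z | ∃ a b, a + b = 0 ∧ ∃ p ∈ weightSpan k w a,
          ∃ q ∈ weightSpan k w b, z = p ⊗ₜ[k] q} :=
      Submodule.subset_span ⟨0, 0, rfl, 1, hone, 1, hone, map_one P.comul⟩
    change P.comul x ∈ _
    refine Submodule.mem_comap.1 ((Submodule.span_le (p := Submodule.comap
      P.comul.toLinearMap _)).2 ?_ hx)
    rintro _ ⟨d, rfl, rfl⟩
    clear hx
    rw [SetLike.mem_coe, Submodule.mem_comap, AlgHom.toLinearMap_apply]
    induction d using Finsupp.induction_linear with
    | zero =>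
      rw [map_zero]
      exact h0
    | add d e hd he =>
      have : MvPolynomial.monomial (d + e) (1 : k) =
        MvPolynomial.monomial d 1 * MvPolynomial.monomial e 1 := by simp [MvPolynomial.monomial_mul]
      rw [map_add (Finsupp.weight w)]
      change P.comul (MvPolynomial.monomial (d + e) (1 : k)) ∈ _
      rw [this, map_mul P.comul]
      exact span_tmul_mul_mem _ hmul hd he
    | single s n =>
      induction n with
      | zero =>
        rw [Finsupp.single_zero, map_zero]
        exact h0
      | succ n ih =>
        have : MvPolynomial.monomial (Finsupp.single s (n + 1)) (1 : k) =
          MvPolynomial.monomial (Finsupp.single s n) 1 * MvPolynomial.X s := by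
          simp [MvPolynomial.X, MvPolynomial.monomial_mul, ← Finsupp.single_add]
        change P.comul (MvPolynomial.monomial (Finsupp.single s (n + 1)) (1 : k)) ∈ _
        rw [this, map_mul P.comul, Finsupp.single_add, map_add (Finsupp.weight w)]
        have h1 : Finsupp.weight w (Finsupp.single s 1) = w s := by simp [Finsupp.weight_single]
        rw [h1]
        exact span_tmul_mul_mem _ hmul ih (H s)

/-- The coefficient of t^j is given degree j, which is at least 1 because arcs start at the unit
element. Homogeneity of the comultiplication is `coeff_mul_mem` for the universal pair of arcs. -/
theorem Coords.isUnipotent (X : Coords ell) (hell : IsCochar ell) :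
    letI := (X.pointGroup hell).hopfAlgebra
    IsUnipotent k X.Ring := by
  let _ := (X.pointGroup hell).hopfAlgebra
  refine isUnipotent_mvPolynomial (fun s : X.Idx => s.1.2) (fun s => by have := s.2; omega)
    (X.pointGroup hell) fun s => ?_
  have hX : ∀ s : X.Idx, (MvPolynomial.X s : X.Ring) ∈ weightSpan k (fun s : X.Idx => s.1.2) s.1.2 :=
    fun s => Submodule.subset_span ⟨Finsupp.single s 1, by simp [Finsupp.weight_single], rfl⟩
  have hone : (1 : X.Ring) ∈ weightSpan k (fun s : X.Idx => s.1.2) 0 :=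
    Submodule.subset_span ⟨0, by simp, rfl⟩
  have hmul := fun (m n : ℕ) (x : X.Ring ⊗[k] X.Ring) hx y hy =>
    span_tmul_mul_mem (m := m) (n := n) (x := x) (y := y)
      (weightSpan k (fun s : X.Idx => s.1.2)) (weightSpan_mul_mem _) hx hy
  have h := X.coeff_mul_mem hell _ hmul (X.arcOf_mem_arcs Algebra.TensorProduct.includeLeft)
    (X.arcOf_mem_arcs Algebra.TensorProduct.includeRight) (fun i j => ?_) (fun i j => ?_) s.1.1 s.1.2
  · rw [← X.arcOf_mul hell, X.coeff_arcOf] at h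
    exact h
  all_goals
    rw [X.arcOf_x, Coords.series, PowerSeries.coeff_mk]
    split_ifs with hij
    swap
    · exact zero_mem _
    refine Submodule.subset_span ?_
  · exact ⟨j, 0, rfl, _, hX ⟨(i, j), hij⟩, 1, hone, rfl⟩
  · exact ⟨0, j, zero_add j, 1, hone, _, hX ⟨(i, j), hij⟩, rfl⟩

/-- The coefficients up to order N determine an arc modulo t^(N+1), and reduction modulo t^(N+1) is
a homomorphism. So they also determine these coefficients of the product. -/
theorem Coords.mul_comp_rename_eq (X : Coords ell) (hell : IsCochar ell) (N : ℕ)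
    (p p' q q' : X.Ring →ₐ[k] B)
    (hp : p.comp (MvPolynomial.rename (Subtype.val : {s : X.Idx // s.1.2 ≤ N} → X.Idx)) =
      p'.comp (MvPolynomial.rename Subtype.val))
    (hq : q.comp (MvPolynomial.rename (Subtype.val : {s : X.Idx // s.1.2 ≤ N} → X.Idx)) =
      q'.comp (MvPolynomial.rename Subtype.val)) :
    ((X.pointGroup hell).mul p q).comp
        (MvPolynomial.rename (Subtype.val : {s : X.Idx // s.1.2 ≤ N} → X.Idx)) =
      ((X.pointGroup hell).mul p' q').comp (MvPolynomial.rename Subtype.val) := by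
  have key : ∀ p p' : X.Ring →ₐ[k] B,
      p.comp (MvPolynomial.rename (Subtype.val : {s : X.Idx // s.1.2 ≤ N} → X.Idx)) =
        p'.comp (MvPolynomial.rename Subtype.val) →
      Pts.map (Ideal.Quotient.mkₐ k (Ideal.span {PowerSeries.X ^ (N + 1)})) (X.arcOf p) =
        Pts.map (Ideal.Quotient.mkₐ k (Ideal.span {PowerSeries.X ^ (N + 1)})) (X.arcOf p') := by
    intro p p' h
    refine Pts.ext fun f => ?_
    refine Ideal.Quotient.eq.2 (Ideal.mem_span_singleton.2 (X.dvd_sub (X.arcOf_mem_arcs p)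
      (X.arcOf_mem_arcs p') (N + 1) (fun i => ?_) f))
    rw [PowerSeries.X_pow_dvd_iff]
    intro m hm
    rw [map_sub, X.arcOf_x, X.arcOf_x, Coords.series, Coords.series, PowerSeries.coeff_mk,
      PowerSeries.coeff_mk, sub_eq_zero]
    split_ifs with hi
    · have := congrArg (fun φ : MvPolynomial {s : X.Idx // s.1.2 ≤ N} k →ₐ[k] B =>
        φ (.X ⟨⟨(i, m), hi⟩, Nat.lt_succ_iff.1 hm⟩)) h
      simpa using! this
    · rfl
  refine MvPolynomial.algHom_ext fun s => ?_
  rw [AlgHom.comp_apply, AlgHom.comp_apply, MvPolynomial.rename_X, ← X.coeff_arcOf,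
    ← X.coeff_arcOf, X.arcOf_mul, X.arcOf_mul]
  have h := congrArg (fun g : Pts k R _ => g.ofConv (X.x s.1.1.1))
    (congrArg₂ (· * ·) (key p p' hp) (key q q' hq))
  simp only [← map_mul] at h
  have h2 := PowerSeries.X_pow_dvd_iff.1 (Ideal.mem_span_singleton.1 (Ideal.Quotient.eq.1 h)) _
    (Nat.lt_succ_iff.2 s.2)
  rwa [map_sub, sub_eq_zero] at h2

/-- The group of arcs is pro-unipotent. -/
theorem Coords.isProUnipotent (X : Coords ell) (hell : IsCochar ell) :
    letI := (X.pointGroup hell).hopfAlgebra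
    IsProUnipotent k X.Ring := by
  let _ := (X.pointGroup hell).hopfAlgebra
  intro s
  classical
  -- The finitely many given functions involve coefficients of bounded order. The finitely many
  -- coefficients up to that order generate the Hopf subalgebra of arcs truncated after t^N.
  let N : ℕ := (s.biUnion MvPolynomial.vars).sup fun s : X.Idx => s.1.2
  let σ := {s : X.Idx // s.1.2 ≤ N}
  let i : MvPolynomial σ k →ₐ[k] X.Ring := MvPolynomial.rename Subtype.val
  have hr := MvPolynomial.killCompl_comp_rename (R := k)
    (Subtype.val_injective : Function.Injective (Subtype.val : σ → X.Idx))
  let P := (X.pointGroup hell).retract i _ hr (X.mul_comp_rename_eq hell N)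
  let _ := P.hopfAlgebra
  let j := (X.pointGroup hell).retractHom i _ hr (X.mul_comp_rename_eq hell N)
  have hj : Function.Injective j := MvPolynomial.rename_injective _ Subtype.val_injective
  have : Finite σ := Finite.of_injective
    (fun t : σ => (t.1.1.1, (⟨t.1.1.2, Nat.lt_succ_iff.2 t.2⟩ : Fin (N + 1)))) fun t t' h => by
      simp only [Prod.mk.injEq, Fin.mk.injEq] at h
      exact Subtype.ext (Subtype.ext (Prod.ext h.1 h.2))
  refine ⟨MvPolynomial σ k, _, P.hopfAlgebra, j, hj, inferInstance,
    (X.isUnipotent hell).of_injective j hj, fun x hx => ?_⟩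
  obtain ⟨y, hy⟩ := MvPolynomial.exists_rename_eq_of_vars_subset_range x
    (Subtype.val : σ → X.Idx) Subtype.val_injective fun t ht =>
      ⟨⟨t, Finset.le_sup (f := fun s : X.Idx => s.1.2) (Finset.mem_biUnion.2 ⟨x, hx, ht⟩)⟩, rfl⟩
  exact ⟨y, hy⟩

end ArcHopfAlgebra

end

section

/-! ### Morphisms of torsors in terms of sections. -/

section TorsorSections

variable {k : Type u} [Field k] {R : Type u} [CommRing R] [HopfAlgebra k R]
variable {B C : Type u} [CommRing B] [Algebra k B] [CommRing C] [Algebra k C]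

/-- The universal point of a torsor in terms of a section. -/
theorem Torsor.exists_pmul_section (F : Torsor k R B) (τ : F.S →ₐ[k] B)
    (hτ : ∀ b, τ (algebraMap B F.S b) = b) : ∃ g : Pts k R F.S,
      AlgHom.id k F.S = F.pmul ((IsScalarTower.toAlgHom k B F.S).comp τ) g :=
  F.exists_pmul_eq _ _ fun b => by simp [hτ]

/-- The universal point of F' is a translate of the section τ, so by equivariance a morphism is
determined by the pull-back of τ. -/
theorem TorsorHom.ext_section {b : B →+* C} {F : Torsor k R B} {F' : Torsor k R C}
    (τ : F'.S →ₐ[k] C) (hτ : ∀ c, τ (algebraMap C F'.S c) = c) {φ ψ : TorsorHom b F F'}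
    (h : τ.comp φ.toAlgHom = τ.comp ψ.toAlgHom) : φ = ψ := by
  obtain ⟨g, hg⟩ := F'.exists_pmul_section τ hτ
  have key : ∀ φ : TorsorHom b F F', φ.toAlgHom =
      F.pmul ((IsScalarTower.toAlgHom k C F'.S).comp (τ.comp φ.toAlgHom)) g := fun φ => by
    rw [← AlgHom.comp_assoc, φ.pmul_comp, ← hg, AlgHom.id_comp]
  apply TorsorHom.ext
  rw [key φ, key ψ, h]

/-- A morphism of torsors is given by the pull-back of a section of the target. -/
theorem TorsorHom.exists_comp_eq (b : B →ₐ[k] C) (F : Torsor k R B) (F' : Torsor k R C)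
    (τ : F'.S →ₐ[k] C) (hτ : ∀ c, τ (algebraMap C F'.S c) = c) (σ : F.S →ₐ[k] C)
    (hσ : ∀ x, σ (algebraMap B F.S x) = b x) {b' : B →+* C} (hb : ∀ x, b' x = b x) :
    ∃ φ : TorsorHom b' F F', τ.comp φ.toAlgHom = σ := by
  obtain ⟨g, hg⟩ := F'.exists_pmul_section τ hτ
  let ι := IsScalarTower.toAlgHom k C F'.S
  let incl : F'.S →ₐ[k] F'.S ⊗[k] R := Algebra.TensorProduct.includeLeft
  have hι : (F'.coact.restrictScalars k).comp ι = incl.comp ι :=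
    AlgHom.ext fun c => F'.coact.commutes c
  have hcoact : F'.coact.restrictScalars k = F'.pmul incl (.toConv Algebra.TensorProduct.includeRight) := by
    rw [Torsor.pmul]
    refine AlgHom.ext fun s => ?_
    simp only [AlgHom.comp_apply]
    generalize F'.coact.restrictScalars k s = z
    induction z with
    | zero => simp
    | add x y hx hy => simp only [map_add, ← hx, ← hy]
    | tmul x y => simp [incl]
  -- The element g is the coordinate on F' given by τ. Translating the point multiplies it on the
  -- right, which makes σ g an equivariant map.
  have hg' : Pts.map (F'.coact.restrictScalars k) g =
      Pts.map incl g * .toConv Algebra.TensorProduct.includeRight := by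
    apply F'.pmul_left_injective (incl.comp (ι.comp τ))
    rw [← Torsor.pmul_pmul, ← Torsor.comp_pmul, ← hg, AlgHom.comp_id, ← hcoact,
      ← AlgHom.comp_assoc, ← hι, AlgHom.comp_assoc, ← Torsor.comp_pmul, ← hg, AlgHom.comp_id]
  refine ⟨⟨F.pmul (ι.comp σ) g, fun x => ?_, ?_⟩, ?_⟩
  · rw [F.pmul_algebraMap, AlgHom.comp_apply, hσ, hb]
    rfl
  · rw [torsorHom_coact_iff, Torsor.comp_pmul, Torsor.comp_pmul, Torsor.pmul_pmul, hg',
      ← AlgHom.comp_assoc, ← AlgHom.comp_assoc, hι]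
  · have h1 : τ.comp ι = AlgHom.id k C := AlgHom.ext hτ
    have h2 := congrArg τ.comp hg
    rw [AlgHom.comp_id, Torsor.comp_pmul, ← AlgHom.comp_assoc, h1, AlgHom.id_comp] at h2
    have h3 : Pts.map τ g = 1 := F'.pmul_left_injective τ (h2.symm.trans (F'.pmul_one τ).symm)
    change τ.comp (F.pmul (ι.comp σ) g) = σ
    rw [Torsor.comp_pmul, ← AlgHom.comp_assoc, h1, AlgHom.id_comp, h3, F.pmul_one]

end TorsorSections

/-! ### Morphisms in H in terms of framings. -/

section HeckeHoms

variable {k : Type u} [Field k] {R : Type u} [CommRing R] [HopfAlgebra k R]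
variable {A B : Type u} [CommRing A] [Algebra k A] [CommRing B] [Algebra k B]

namespace HeckeTuple

theorem Hom.ext_isSections {f : A →ₐ[k] B} {X : HeckeTuple k R A} {Y : HeckeTuple k R B}
    {κ : Pts k R (Laur B)} {τ₁ τ₂} (hτ : Y.IsSections (AlgHom.id k B) κ τ₁ τ₂)
    {φ ψ : HeckeTuple.Hom f X Y}
    (h₁ : τ₁.comp φ.hom₁.toAlgHom = τ₁.comp ψ.hom₁.toAlgHom)
    (h₂ : τ₂.comp φ.hom₂.toAlgHom = τ₂.comp ψ.hom₂.toAlgHom) : φ = ψ :=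
  HeckeTuple.Hom.ext (TorsorHom.ext_section τ₁ hτ.base₁_id h₁)
    (TorsorHom.ext_section τ₂ hτ.base₂_id h₂)

/-- A morphism of tuples is given by the pull-back of a framing of the target. -/
theorem IsFraming.exists_hom {f : A →ₐ[k] B} {X : HeckeTuple k R A} {Y : HeckeTuple k R B}
    {κ : Pts k R (Laur B)} {g h : Pts k R B} {τ₁ τ₂ σ₁ σ₂}
    (hτ : Y.IsFraming (AlgHom.id k B) κ g h τ₁ τ₂) (hσ : X.IsFraming f κ g h σ₁ σ₂) :
    ∃ φ : HeckeTuple.Hom f X Y, τ₁.comp φ.hom₁.toAlgHom = σ₁ ∧ τ₂.comp φ.hom₂.toAlgHom = σ₂ := by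
  obtain ⟨φ₁, h₁⟩ := TorsorHom.exists_comp_eq (psMap f) X.F₁ Y.F₁ τ₁ hτ.isSections.base₁_id σ₁
    hσ.isSections.base₁ (b' := PowerSeries.map f.toRingHom) fun _ => rfl
  obtain ⟨φ₂, h₂⟩ := TorsorHom.exists_comp_eq (psMap f) X.F₂ Y.F₂ τ₂ hτ.isSections.base₂_id σ₂
    hσ.isSections.base₂ (b' := PowerSeries.map f.toRingHom) fun _ => rfl
  -- The value at t = 0 of either section is the given trivialization translated by the same g, and
  -- g can be cancelled.
  have e : ∀ {F : Torsor k R (PowerSeries A)} {F' : Torsor k R (PowerSeries B)}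
      (φ : TorsorHom (PowerSeries.map f.toRingHom) F F') (e : F.S →ₐ[k] A) (e' : F'.S →ₐ[k] B)
      (τ : F'.S →ₐ[k] PowerSeries B) (σ : F.S →ₐ[k] PowerSeries B) (g : Pts k R B),
      τ.comp φ.toAlgHom = σ → (psEval k B).comp τ = F'.pmul ((AlgHom.id k B).comp e') g →
      (psEval k B).comp σ = F.pmul (f.comp e) g → ∀ s, e' (φ.toAlgHom s) = f (e s) := by
    intro F F' φ e e' τ σ g h1 h2 h3 s
    rw [← h1, ← AlgHom.comp_assoc, h2, ← φ.pmul_comp, AlgHom.id_comp] at h3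
    have h4 := congrArg (fun p => F.pmul p g⁻¹) h3
    simp only [Torsor.pmul_pmul, mul_inv_cancel, Torsor.pmul_one] at h4
    exact congrArg (fun p : F.S →ₐ[k] B => p s) h4
  refine ⟨⟨φ₁, φ₂, e φ₁ _ _ τ₁ σ₁ g h₁ hτ.eval₁ hσ.eval₁, e φ₂ _ _ τ₂ σ₂ h h₂ hτ.eval₂ hσ.eval₂,
    ?_⟩, h₁, h₂⟩
  refine map_kappa_of_isSections hτ.isSections φ₁ φ₂ ?_
  rw [h₁, h₂]
  exact hσ.isSections

end HeckeTuple

end HeckeHoms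

/-! ### Torsors under the group of arcs. -/

section ArcTorsors

variable {k : Type u} [Field k] {R : Type u} [CommRing R] [HopfAlgebra k R]
variable {ell : Pts k R (LaurentPolynomial k)}
variable {B C : Type u} [CommRing B] [Algebra k B] [CommRing C] [Algebra k C]

variable (ell) in
/-- A pro-unipotent group scheme whose points are the arcs in `arcGroup (t^λ)`. -/
structure ArcScheme where
  K : Type u
  [commRing : CommRing K]
  [hopfAlgebra : HopfAlgebra k K]
  isProUnipotent : IsProUnipotent k K
  pt : ∀ {B : Type u} [CommRing B] [Algebra k B], Pts k K B → Pts k R (PowerSeries B)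
  pt_mul : ∀ {B : Type u} [CommRing B] [Algebra k B] (p q : Pts k K B), pt (p * q) = pt p * pt q
  pt_injective : ∀ {B : Type u} [CommRing B] [Algebra k B], Function.Injective (pt (B := B))
  pt_mem : ∀ {B : Type u} [CommRing B] [Algebra k B] (p : Pts k K B),
    pt p ∈ arcGroup (Pts.map (laurentToLaur k B) ell)
  exists_pt_eq : ∀ {B : Type u} [CommRing B] [Algebra k B] {a : Pts k R (PowerSeries B)},
    a ∈ arcGroup (Pts.map (laurentToLaur k B) ell) → ∃ p, pt p = a
  map_pt : ∀ {B C : Type u} [CommRing B] [Algebra k B] [CommRing C] [Algebra k C] (φ : B →ₐ[k] C)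
    (p : Pts k K B), Pts.map (psMap φ) (pt p) = pt (Pts.map φ p)
  hasTrivialH1 : ∀ {B C D E : Type u} [CommRing B] [Algebra k B] [CommRing C]
    [Algebra k C] [CommRing D] [Algebra k D] [CommRing E] [Algebra k E] (c : CechData k B C D E),
    c.HasTrivialH1 (Pts.map (laurentToLaur k B) ell)

attribute [instance] ArcScheme.commRing ArcScheme.hopfAlgebra

theorem IsCochar.nonempty_arcScheme [Algebra.Smooth k R] (hell : IsCochar ell) :
    Nonempty (ArcScheme ell) := by
  obtain ⟨X⟩ := hell.nonempty_coords
  exact ⟨{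
    K := X.Ring
    hopfAlgebra := (X.pointGroup hell).hopfAlgebra
    isProUnipotent := X.isProUnipotent hell
    pt := fun p => X.arcOf p.ofConv
    pt_mul := fun p q => (congrArg X.arcOf ((X.pointGroup hell).ofConv_mul p q)).trans
      (X.arcOf_mul hell _ _)
    pt_injective := fun h => WithConv.ext (X.arcOf_injective h)
    pt_mem := fun p => X.arcOf_mem hell _
    exists_pt_eq := fun ha => by
      obtain ⟨p, hp⟩ := X.exists_arcOf_eq hell ha
      exact ⟨.toConv p, hp⟩
    map_pt := fun φ p => X.map_arcOf φ _
    hasTrivialH1 := fun c => c.hasTrivialH1_tpow X hell }⟩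

namespace ArcScheme

variable (K : ArcScheme ell)

theorem pt_inv (p : Pts k K.K B) : K.pt p⁻¹ = (K.pt p)⁻¹ := by
  have h1 : K.pt (1 : Pts k K.K B) = 1 := by
    have := K.pt_mul (1 : Pts k K.K B) 1
    rwa [one_mul, left_eq_mul] at this
  rw [eq_inv_iff_mul_eq_one, ← K.pt_mul, inv_mul_cancel, h1]

/-- Every torsor under the group of arcs over an affine base has a section. -/
theorem exists_section (P : Torsor k K.K B) :
    ∃ σ : P.S →ₐ[k] B, ∀ b, σ (algebraMap B P.S b) = b := by
  have := P.faithfullyFlat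
  let c := CechData.ofFaithfullyFlat B P.S k
  have hi : ∀ b, c.i₀ (algebraMap B P.S b) = c.i₁ (algebraMap B P.S b) := fun b =>
    congrArg (fun f : B →ₐ[k] _ => f b) c.i_comp_j
  -- The torsor is used as a covering of its own base, over which it has a tautological section. The
  -- pull-backs of this section differ by a cocycle p.
  obtain ⟨p, hp⟩ := P.exists_pmul_eq c.i₀ c.i₁ hi
  have hcoc : Pts.map c.p₀₂ p = Pts.map c.p₀₁ p * Pts.map c.p₁₂ p := by
    apply P.pmul_left_injective (c.p₀₂.comp c.i₀)
    rw [← Torsor.comp_pmul, ← hp, ← Torsor.pmul_pmul, ← c.p_comp_i₀, ← Torsor.comp_pmul, ← hp,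
      c.p_comp_i₁, ← Torsor.comp_pmul, ← hp, c.p_comp_i₂]
  obtain ⟨v, hv, e⟩ := K.hasTrivialH1 c (K.pt p) (by
    rw [Pts.map_map, laurMap_comp_laurentToLaur]
    exact K.pt_mem p) (by rw [K.map_pt, K.map_pt, K.map_pt, hcoc, K.pt_mul])
  rw [Pts.map_map, laurMap_comp_laurentToLaur] at hv
  obtain ⟨q, rfl⟩ := K.exists_pt_eq hv
  have e' : p = Pts.map c.i₀ q * (Pts.map c.i₁ q)⁻¹ := K.pt_injective (by
    rw [K.pt_mul, K.pt_inv, ← K.map_pt, ← K.map_pt]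
    exact e)
  -- Once p is written as a coboundary, the tautological section translated by q has equal
  -- pull-backs. So it takes values in B.
  have h := fun s => c.exact₀ (P.pmul (AlgHom.id k P.S) q s) (by
    have : c.i₀.comp (P.pmul (AlgHom.id k P.S) q) = c.i₁.comp (P.pmul (AlgHom.id k P.S) q) := by
      have h1 : P.pmul c.i₁ (Pts.map c.i₁ q) = P.pmul c.i₀ (Pts.map c.i₀ q) := by
        refine (congrArg (fun f => P.pmul f (Pts.map c.i₁ q)) hp).trans ?_
        rw [Torsor.pmul_pmul, e', inv_mul_cancel_right]
      rw [Torsor.comp_pmul, Torsor.comp_pmul, AlgHom.comp_id, AlgHom.comp_id, h1]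
    exact congrArg (fun f : P.S →ₐ[k] _ => f s) this)
  obtain ⟨σ, hσ⟩ := exists_algHom_comp_eq c.injective _ h
  refine ⟨σ, fun b => c.injective ?_⟩
  have := congrArg (fun f : P.S →ₐ[k] P.S => f (algebraMap B P.S b)) hσ
  exact this.trans (P.pmul_algebraMap _ _ _)

end ArcScheme

end ArcTorsors

end

section

/-! ### Normalizing the values of a framing. -/

section StandardForm

variable {k : Type u} [Field k] {R : Type u} [CommRing R] [HopfAlgebra k R]
variable {ell : Pts k R (LaurentPolynomial k)} {A B : Type u} [CommRing A] [Algebra k A]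
  [CommRing B] [Algebra k B]

/-- Multiplying the sections by constants moves the values of the framing into the matrix. With g' =
g and h' = h the values become 1 and the matrix becomes h κ g⁻¹. -/
theorem HeckeTuple.IsFraming.normalize {T : HeckeTuple k R A} {j : A →ₐ[k] B}
    {κ : Pts k R (Laur B)} {g h : Pts k R B} {σ₁ σ₂} (H : T.IsFraming j κ g h σ₁ σ₂)
    (g' h' : Pts k R B) :
    T.IsFraming j (Pts.map (laurConst k B) h' * κ * (Pts.map (laurConst k B) g')⁻¹)
      (g * g'⁻¹) (h * h'⁻¹) (T.F₁.pmul σ₁ (Pts.map (psConst k B) g'⁻¹))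
      (T.F₂.pmul σ₂ (Pts.map (psConst k B) h'⁻¹)) := by
  have := H.pmul (κ' := Pts.map (laurConst k B) h' * κ * (Pts.map (laurConst k B) g')⁻¹)
    (Pts.map (psConst k B) g'⁻¹) (Pts.map (psConst k B) h'⁻¹) (by
      rw [Pts.map_map, Pts.map_map, map_inv, map_inv]
      change (Pts.map (laurConst k B) h')⁻¹ * _ = κ * (Pts.map (laurConst k B) g')⁻¹
      group)
  exact this

theorem HeckeTuple.Framed.normalize {T : HeckeTuple k R A} {j : A →ₐ[k] B}
    {κ : Pts k R (Laur B)} {g h : Pts k R B} (H : T.Framed j κ g h) :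
    T.Framed j (Pts.map (laurConst k B) h * κ * (Pts.map (laurConst k B) g)⁻¹) 1 1 := by
  obtain ⟨σ₁, σ₂, H⟩ := H
  have := H.normalize g h
  rw [mul_inv_cancel, mul_inv_cancel] at this
  exact ⟨_, _, this⟩

theorem HeckeTuple.Framed.of_normalize {T : HeckeTuple k R A} {j : A →ₐ[k] B}
    {κ : Pts k R (Laur B)} {g h : Pts k R B}
    (H : T.Framed j (Pts.map (laurConst k B) h * κ * (Pts.map (laurConst k B) g)⁻¹) 1 1) :
    T.Framed j κ g h := by
  obtain ⟨σ₁, σ₂, H⟩ := H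
  have := H.normalize g⁻¹ h⁻¹
  rw [map_inv, map_inv, inv_inv, inv_inv, inv_inv, one_mul, one_mul] at this
  have e : (Pts.map (laurConst k B) h)⁻¹ * (Pts.map (laurConst k B) h * κ *
    (Pts.map (laurConst k B) g)⁻¹) * Pts.map (laurConst k B) g = κ := by group
  rw [e] at this
  exact ⟨_, _, this⟩

theorem HeckeTuple.Framed.nonempty_hom {T : HeckeTuple k R A} {j : A →ₐ[k] B}
    {κ : Pts k R (Laur B)} (H : T.Framed j κ 1 1) :
    Nonempty (HeckeTuple.Hom j T (trivTuple B κ)) := by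
  obtain ⟨σ₁, σ₂, H⟩ := H
  exact ⟨((trivTuple_isFraming κ).exists_hom H).choose⟩

theorem HeckeTuple.Framed.inStratum {A B : CommAlgCat.{u} k} {T : HeckeTuple k R A} {j : A ⟶ B}
    (hj : IsEtaleCover j) {g h : Pts k R B}
    (H : T.Framed j.hom (Pts.map (laurentToLaur k B) ell) g h) : T.InStratum ell := by
  refine ⟨B, j, _, hj, H.normalize.nonempty_hom, (isStandard_iff ell _).2 ?_⟩
  obtain ⟨σ₁, σ₂, hσ⟩ := Framed.of_normalize (κ := Pts.map (laurentToLaur k B) ell) (g := g) (h := h)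
    ⟨_, _, trivTuple_isFraming _⟩
  exact ⟨σ₁, σ₂, hσ.isSections⟩

end StandardForm

/-! ### Objects over the point of X_λ of a chart. -/

namespace QuotPt.Chart

variable {k : Type u} [Field k] {R : Type u} [CommRing R] [HopfAlgebra k R]
  {ell : Pts k R (LaurentPolynomial k)} {L : Type u} [Field L] [Algebra k L]
  {x : QuotPt ell (CommAlgCat.of k L)} (X : x.Chart)
variable (A : Type u) [CommRing A] [Algebra k A] [Algebra L A] [IsScalarTower k L A]

/-- The covering of an `L`-algebra given by a chart. -/
def cover : CommAlgCat.of k A ⟶ CommAlgCat.of k (A ⊗[L] X.C) :=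
  CommAlgCat.ofHom ((Algebra.TensorProduct.includeLeft : A →ₐ[L] A ⊗[L] X.C).restrictScalars k)

/-- The map from the chart to the covering. -/
def toCover : CommAlgCat.of k X.C ⟶ CommAlgCat.of k (A ⊗[L] X.C) :=
  CommAlgCat.ofHom ((Algebra.TensorProduct.includeRight : X.C →ₐ[L] A ⊗[L] X.C).restrictScalars k)

theorem isEtaleCover_cover : IsEtaleCover (X.cover A) := by
  refine ⟨RingHom.Etale.isStableUnderBaseChange.tensorProduct A X.etale,
    RingHom.FaithfullyFlat.isStableUnderBaseChange.tensorProduct A ?_⟩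
  exact (RingHom.faithfullyFlat_algebraMap_iff).2 inferInstance

theorem mem_carrier_cover : mapPair (X.toCover A) (X.g, X.h) ∈
    (x.map (CommAlgCat.ofHom (IsScalarTower.toAlgHom k L A))).carrier _ (X.cover A) := by
  have h := x.map_mem _ (X.toCover A) _ X.mem
  have e : CommAlgCat.ofHom (IsScalarTower.toAlgHom k L X.C) ≫ X.toCover A =
      CommAlgCat.ofHom (IsScalarTower.toAlgHom k L A) ≫ X.cover A := by
    apply CommAlgCat.hom_ext
    apply AlgHom.ext
    intro b
    exact (Algebra.TensorProduct.includeRight (R := L) (A := A) (B := X.C)).commutes b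
  rw [e] at h
  exact h

theorem κ_cover : X.κ (A ⊗[L] X.C) = Pts.map (laurConst k _) (Pts.map (X.toCover A).hom X.h) *
    Pts.map (laurentToLaur k _) ell *
    (Pts.map (laurConst k _) (Pts.map (X.toCover A).hom X.g))⁻¹ := by
  have h : X.κ X.C = _ := X.map_eq
  rw [← X.map_κ (Algebra.TensorProduct.includeRight : X.C →ₐ[L] A ⊗[L] X.C), h, map_mul, map_mul,
    map_inv, Pts.map_map, Pts.map_map, Pts.map_map, laurMap_comp_laurConst,
    laurMap_comp_laurentToLaur]
  rfl

variable {A}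

/-- Over the covering the object has a framing with matrix t^λ and values (g, h). Normalized, its
matrix is h t^λ g⁻¹ and its values are (1, 1), all of which are defined over A. So it descends by
the vanishing of cohomology. -/
theorem framed (hell : IsCochar ell) [Algebra.Smooth k R] {T : HeckeTuple k R A}
    {hT : T.InStratum (A := CommAlgCat.of k A) ell}
    (h : (jantzenMap hell).obj ⟨CommAlgCat.of k A, T, hT⟩ =
      x.map (CommAlgCat.ofHom (IsScalarTower.toAlgHom k L A))) :
    T.Framed (AlgHom.id k A) (X.κ A) 1 1 := by
  have h1 := X.mem_carrier_cover A
  rw [← h] at h1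
  have h2 := HeckeTuple.Framed.normalize (mem_jantzenMap hell |>.1 h1)
  have h3 := X.κ_cover A
  refine HeckeTuple.Framed.descend _ (X.hasTrivialH1 (CechData.ofFaithfullyFlat A (A ⊗[L] X.C) L)) ?_
  rw [map_one]
  have h4 : Pts.map (laurMap (X.cover A).hom) (X.κ A) = X.κ (A ⊗[L] X.C) :=
    X.map_κ (Algebra.TensorProduct.includeLeft : A →ₐ[L] A ⊗[L] X.C)
  refine Eq.mp ?_ h2
  congr 1
  exact (h4.trans h3).symm

variable (A) in
/-- The standard tuple of a chart. -/
def tuple : HeckeTuple k R A := trivTuple A (X.κ A)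

theorem framed_tuple : (X.tuple A).Framed (X.cover A).hom (Pts.map (laurentToLaur k _) ell)
    (Pts.map (X.toCover A).hom X.g) (Pts.map (X.toCover A).hom X.h) := by
  have h := HeckeTuple.Framed.map ⟨_, _, HeckeTuple.trivTuple_isFraming (X.κ A)⟩ (X.cover A).hom
  have h' : Pts.map (laurMap (X.cover A).hom) (X.κ A) = _ :=
    (X.map_κ (Algebra.TensorProduct.includeLeft : A →ₐ[L] A ⊗[L] X.C)).trans (X.κ_cover A)
  rw [h', map_one] at h
  exact h.of_normalize

theorem inStratum : (X.tuple A).InStratum (A := CommAlgCat.of k A) ell :=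
  X.framed_tuple.inStratum (X.isEtaleCover_cover A)

theorem obj_eq (hell : IsCochar ell) [Algebra.Smooth k R]
    {hT : (X.tuple A).InStratum (A := CommAlgCat.of k A) ell} :
    (jantzenMap hell).obj ⟨CommAlgCat.of k A, X.tuple A, hT⟩ =
      x.map (CommAlgCat.ofHom (IsScalarTower.toAlgHom k L A)) :=
  QuotPt.eq_of_mem _ _ (X.cover A) (X.isEtaleCover_cover A) _
    ((mem_jantzenMap hell).2 X.framed_tuple) (X.mem_carrier_cover A)

end QuotPt.Chart

/-! ### Φ on k-points. -/

section RationalPoints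

variable {k : Type u} [Field k] {R : Type u} [CommRing R] [HopfAlgebra k R]
  {ell : Pts k R (LaurentPolynomial k)}

theorem QuotPt.map_id {A : CommAlgCat.{u} k} (x : QuotPt ell A) (f : A ⟶ A) (hf : f = 𝟙 A) :
    x.map f = x := by
  subst hf
  refine QuotPt.ext (funext fun C => funext fun g => ?_)
  change x.carrier C (𝟙 A ≫ g) = _
  rw [Category.id_comp]

theorem HeckeStratum.Hom.ext_isSections {X Y : HeckeStratum ell} {κ : Pts k R (Laur Y.base)}
    {τ₁ τ₂} (hτ : Y.tuple.IsSections (AlgHom.id k Y.base) κ τ₁ τ₂) {φ ψ : X ⟶ Y}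
    (hb : φ.base = ψ.base) (h₁ : τ₁.comp φ.hom.hom₁.toAlgHom = τ₁.comp ψ.hom.hom₁.toAlgHom)
    (h₂ : τ₂.comp φ.hom.hom₂.toAlgHom = τ₂.comp ψ.hom.hom₂.toAlgHom) : φ = ψ := by
  obtain ⟨b, φ⟩ := φ
  obtain ⟨b', ψ⟩ := ψ
  obtain rfl : b = b' := hb
  exact congrArg (HeckeStratum.Hom.mk b) (HeckeTuple.Hom.ext_isSections hτ h₁ h₂)

/-- Framings with the same matrix and values give morphisms in both directions which match them. The
composites fix a framing, hence are identities. -/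
theorem HeckeStratum.nonempty_iso {A : CommAlgCat.{u} k} {T T' : HeckeTuple k R A}
    (hT : T.InStratum ell) (hT' : T'.InStratum ell) {κ : Pts k R (Laur A)} {g h : Pts k R A}
    (H : T.Framed (AlgHom.id k A) κ g h) (H' : T'.Framed (AlgHom.id k A) κ g h) :
    Nonempty ((⟨A, T, hT⟩ : HeckeStratum ell) ≅ ⟨A, T', hT'⟩) := by
  obtain ⟨σ₁, σ₂, H⟩ := H
  obtain ⟨τ₁, τ₂, H'⟩ := H'
  obtain ⟨φ, hφ₁, hφ₂⟩ := H'.exists_hom H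
  obtain ⟨ψ, hψ₁, hψ₂⟩ := H.exists_hom H'
  refine ⟨⟨⟨𝟙 A, φ⟩, ⟨𝟙 A, ψ⟩, ?_, ?_⟩⟩
  · refine HeckeStratum.Hom.ext_isSections (Y := ⟨A, T, hT⟩) H.isSections rfl ?_ ?_
    · exact (congrArg (fun z => z.comp φ.hom₁.toAlgHom) hψ₁).trans hφ₁
    · exact (congrArg (fun z => z.comp φ.hom₂.toAlgHom) hψ₂).trans hφ₂
  · refine HeckeStratum.Hom.ext_isSections (Y := ⟨A, T', hT'⟩) H'.isSections rfl ?_ ?_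
    · exact (congrArg (fun z => z.comp ψ.hom₁.toAlgHom) hφ₁).trans hψ₁
    · exact (congrArg (fun z => z.comp ψ.hom₂.toAlgHom) hφ₂).trans hψ₂

theorem jantzenMap_surjective (hell : IsCochar ell) [Algebra.Smooth k R]
    (x : QuotPt ell (CommAlgCat.of k k)) :
    ∃ (X : HeckeTuple k R k) (hX : X.InStratum (A := CommAlgCat.of k k) ell),
      (jantzenMap hell).obj ⟨CommAlgCat.of k k, X, hX⟩ = x := by
  obtain ⟨X⟩ := x.nonempty_chart hell
  exact ⟨X.tuple k, X.inStratum, (X.obj_eq hell).trans (x.map_id _ rfl)⟩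

theorem jantzenMap_injective (hell : IsCochar ell) [Algebra.Smooth k R] {X Y : HeckeTuple k R k}
    (hX : X.InStratum (A := CommAlgCat.of k k) ell) (hY : Y.InStratum (A := CommAlgCat.of k k) ell)
    (h : (jantzenMap hell).obj ⟨CommAlgCat.of k k, X, hX⟩ =
      (jantzenMap hell).obj ⟨CommAlgCat.of k k, Y, hY⟩) :
    Nonempty ((⟨CommAlgCat.of k k, X, hX⟩ : HeckeStratum ell) ≅ ⟨CommAlgCat.of k k, Y, hY⟩) := by
  obtain ⟨c⟩ := ((jantzenMap hell).obj ⟨CommAlgCat.of k k, Y, hY⟩).nonempty_chart hell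
  exact HeckeStratum.nonempty_iso hX hY
    (c.framed hell (h.trans (QuotPt.map_id _ _ rfl).symm))
    (c.framed hell (QuotPt.map_id _ _ rfl).symm)

end RationalPoints

end

section

/-! ### Framings with fixed matrix and values. -/

section ArcsAsAutomorphisms

variable {k : Type u} [Field k] {R : Type u} [CommRing R] [HopfAlgebra k R]
variable {A C : Type u} [CommRing A] [Algebra k A] [CommRing C] [Algebra k C]

namespace HeckeTuple.IsFraming

variable {X : HeckeTuple k R A} {f : A →ₐ[k] C} {κ : Pts k R (Laur C)} {g h : Pts k R C}
  {σ₁ σ₁' : X.F₁.S →ₐ[k] PowerSeries C} {σ₂ σ₂' : X.F₂.S →ₐ[k] PowerSeries C}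

theorem exists_mem_arcGroup (H : X.IsFraming f κ g h σ₁ σ₂) (H' : X.IsFraming f κ g h σ₁' σ₂') :
    ∃ a ∈ arcGroup κ, X.F₁.pmul σ₁ a = σ₁' := by
  obtain ⟨a, b, rfl, rfl, hab, hg, hh⟩ := H.exists_pmul H'
  exact ⟨a, mem_arcGroup.2 ⟨MonoidHom.mem_ker.2 (left_eq_mul.1 hg), b,
    MonoidHom.mem_ker.2 (left_eq_mul.1 hh), hab⟩, rfl⟩

theorem exists_pmul_arc (H : X.IsFraming f κ g h σ₁ σ₂) {a : Pts k R (PowerSeries C)}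
    (ha : a ∈ arcGroup κ) : ∃ σ, X.IsFraming f κ g h (X.F₁.pmul σ₁ a) σ := by
  obtain ⟨ha, b, hb, e⟩ := mem_arcGroup.1 ha
  have := H.pmul a b e
  rw [MonoidHom.mem_ker.1 ha, MonoidHom.mem_ker.1 hb, mul_one, mul_one] at this
  exact ⟨_, this⟩

/-- If the first sections agree, the relation b κ = κ a with a = 1 forces b = 1. -/
theorem unique₂ (H : X.IsFraming f κ g h σ₁ σ₂) (H' : X.IsFraming f κ g h σ₁ σ₂') :
    σ₂ = σ₂' := by
  obtain ⟨a, b, ha, rfl, hab, -⟩ := H.exists_pmul H'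
  obtain rfl : a = 1 := X.F₁.pmul_left_injective σ₁ (ha.symm.trans (X.F₁.pmul_one σ₁).symm)
  rw [map_one, mul_one, mul_eq_right, ← map_one (Pts.map (psLaur k C))] at hab
  rw [Pts.map_injective psLaur_injective hab, Torsor.pmul_one]

end HeckeTuple.IsFraming

end ArcsAsAutomorphisms

/-! ### L-algebras as k-algebras. -/

section ResAlg

variable {k : Type u} [Field k] {L : Type u} [Field L] [Algebra k L] (B : CommAlgCat.{u} L)

instance : Algebra L (resAlg (k := k) L B) := inferInstanceAs (Algebra L B)

instance : IsScalarTower k L (resAlg (k := k) L B) := .of_algebraMap_eq fun _ => rfl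

variable {B} in
/-- A homomorphism of `L`-algebras, as a homomorphism of `L`-algebras again. -/
def resAlgHom {C : CommAlgCat.{u} L} (f : B ⟶ C) :
    resAlg (k := k) L B →ₐ[L] resAlg (k := k) L C := f.hom

end ResAlg

/-! ### Points of the group of arcs over L as arcs in G. -/

namespace ArcScheme

variable {k : Type u} [Field k] {R : Type u} [CommRing R] [HopfAlgebra k R]
  {ell : Pts k R (LaurentPolynomial k)} {L : Type u} [Field L] [Algebra k L]
  {x : QuotPt ell (CommAlgCat.of k L)} {X : x.Chart} (K : ArcScheme X.l)

/-- The arcs over `k` given by points of the group of arcs over `L`. -/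
def arc {A : Type u} [CommRing A] [Algebra k A] [Algebra L A] [IsScalarTower k L A]
    (p : Pts L K.K A) : Pts k R (PowerSeries A) := resPt (K.pt p)

variable {A C : Type u} [CommRing A] [Algebra k A] [Algebra L A] [IsScalarTower k L A]
  [CommRing C] [Algebra k C] [Algebra L C] [IsScalarTower k L C]

theorem arc_mul (p q : Pts L K.K A) : K.arc (p * q) = K.arc p * K.arc q := by
  rw [arc, K.pt_mul, _root_.map_mul]
  rfl

theorem arc_injective : Function.Injective (K.arc (A := A)) :=
  fun _ _ h => K.pt_injective (resPt_injective h)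

theorem arc_one : K.arc (1 : Pts L K.K A) = 1 := by
  have := K.arc_mul (A := A) 1 1
  rwa [one_mul, left_eq_mul] at this

theorem arc_mem (p : Pts L K.K A) : K.arc p ∈ arcGroup (X.κ A) :=
  X.resPt_mem_arcGroup_κ.2 (K.pt_mem p)

theorem exists_arc_eq {a : Pts k R (PowerSeries A)} (ha : a ∈ arcGroup (X.κ A)) :
    ∃ p : Pts L K.K A, K.arc p = a := by
  obtain ⟨a, rfl⟩ := resPt_surjective (L := L) a
  obtain ⟨p, rfl⟩ := K.exists_pt_eq (X.resPt_mem_arcGroup_κ.1 ha)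
  exact ⟨p, rfl⟩

theorem map_arc (f : A →ₐ[L] C) (p : Pts L K.K A) :
    Pts.map (psMap (f.restrictScalars k)) (K.arc p) = K.arc (Pts.map f p) :=
  congrArg (resPt (k := k) (R := R)) (K.map_pt f p)

end ArcScheme

/-! ### Morphisms in a fibre of Φ as points of the group of arcs. -/

namespace Fibre

variable {k : Type u} [Field k] {R : Type u} [CommRing R] [HopfAlgebra k R]
  {ell : Pts k R (LaurentPolynomial k)} {L : Type u} [Field L] [Algebra k L]
  {x : QuotPt ell (CommAlgCat.of k L)} (X : x.Chart) {Φ : StackMap ell}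

/-- A framing of an object of the fibre by the matrix of a chart. -/
structure Framing (Y : Fibre Φ x) where
  σ₁ : Y.tuple.F₁.S →ₐ[k] PowerSeries (resAlg (k := k) L Y.base)
  σ₂ : Y.tuple.F₂.S →ₐ[k] PowerSeries (resAlg (k := k) L Y.base)
  isFraming : Y.tuple.IsFraming (AlgHom.id k _) (X.κ (resAlg (k := k) L Y.base)) 1 1 σ₁ σ₂

variable {X} {Y Z W : Fibre Φ x}

theorem Framing.map (s : Framing X Y) {A : CommAlgCat.{u} L} (f : Y.base ⟶ A) :
    Y.tuple.IsFraming (resHom (k := k) f).hom (X.κ (resAlg (k := k) L A)) 1 1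
      ((psMap (resHom (k := k) f).hom).comp s.σ₁) ((psMap (resHom (k := k) f).hom).comp s.σ₂) := by
  have h := s.isFraming.map (resHom (k := k) f).hom
  have e : Pts.map (laurMap (resHom (k := k) f).hom) (X.κ (resAlg (k := k) L Y.base)) =
    X.κ (resAlg (k := k) L A) := X.map_κ (resAlgHom (k := k) f)
  rw [e, map_one] at h
  exact h

theorem Framing.comp_hom (t : Framing X Z) (φ : Y ⟶ Z) :
    Y.tuple.IsFraming (resHom (k := k) φ.base).hom (X.κ (resAlg (k := k) L Z.base)) 1 1
      (t.σ₁.comp φ.hom.hom₁.toAlgHom) (t.σ₂.comp φ.hom.hom₂.toAlgHom) :=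
  t.isFraming.comp_hom φ.hom

variable (K : ArcScheme X.l)

/-- The arc at a point of the group of arcs. -/
def arcAt {B : CommAlgCat.{u} L} (p : Pts L K.K B) :
    Pts k R (PowerSeries (resAlg (k := k) L B)) := K.arc (A := resAlg (k := k) L B) p

variable {K} in
theorem arcAt_mul {B : CommAlgCat.{u} L} (p q : Pts L K.K B) :
    arcAt K (p * q) = arcAt K p * arcAt K q := by
  let p' : Pts L K.K (resAlg (k := k) L B) := p
  let q' : Pts L K.K (resAlg (k := k) L B) := q
  exact K.arc_mul p' q'

variable {K} in
theorem arcAt_mem {B : CommAlgCat.{u} L} (p : Pts L K.K B) :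
    arcAt K p ∈ arcGroup (X.κ (resAlg (k := k) L B)) := by
  let p' : Pts L K.K (resAlg (k := k) L B) := p
  exact K.arc_mem p'

theorem exists_pt (s : Framing X Y) (t : Framing X Z) (φ : Y ⟶ Z) :
    ∃ p : Pts L K.K Z.base, Y.tuple.F₁.pmul ((psMap (resHom (k := k) φ.base).hom).comp s.σ₁)
      (arcAt K p) = t.σ₁.comp φ.hom.hom₁.toAlgHom := by
  obtain ⟨a, ha, e⟩ := (s.map φ.base).exists_mem_arcGroup (t.comp_hom φ)
  obtain ⟨p, rfl⟩ := K.exists_arc_eq (A := resAlg (k := k) L Z.base) ha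
  exact ⟨p, e⟩

/-- A morphism in the fibre as a point of the group of arcs. -/
def pt (s : Framing X Y) (t : Framing X Z) (φ : Y ⟶ Z) : Pts L K.K Z.base :=
  (exists_pt K s t φ).choose

theorem pmul_pt (s : Framing X Y) (t : Framing X Z) (φ : Y ⟶ Z) :
    Y.tuple.F₁.pmul ((psMap (resHom (k := k) φ.base).hom).comp s.σ₁) (arcAt K (pt K s t φ)) =
      t.σ₁.comp φ.hom.hom₁.toAlgHom :=
  (exists_pt K s t φ).choose_spec

variable {K}

theorem eq_pt {s : Framing X Y} {t : Framing X Z} {φ : Y ⟶ Z} {p : Pts L K.K Z.base}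
    (h : Y.tuple.F₁.pmul ((psMap (resHom (k := k) φ.base).hom).comp s.σ₁) (arcAt K p) =
      t.σ₁.comp φ.hom.hom₁.toAlgHom) : pt K s t φ = p :=
  K.arc_injective (A := resAlg (k := k) L Z.base)
    (Y.tuple.F₁.pmul_left_injective _ ((pmul_pt K s t φ).trans h.symm))

theorem pt_id (s : Framing X Y) : pt K s s (𝟙 Y) = 1 := by
  apply eq_pt
  have h1 : arcAt K (1 : Pts L K.K Y.base) = 1 := K.arc_one (A := resAlg (k := k) L Y.base)
  rw [h1, Torsor.pmul_one]
  change (psMap (AlgHom.id k _)).comp s.σ₁ = s.σ₁.comp (AlgHom.id k _)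
  rw [psMap_id]
  rfl

/-- The arc of a morphism compares a framing of the source with the pulled-back framing of the
target. Along a composition these arcs are multiplied after base change of the first, which is also
the rule for morphisms of trivial torsors. -/
theorem pt_comp (s : Framing X Y) (t : Framing X Z) (r : Framing X W) (φ : Y ⟶ Z) (ψ : Z ⟶ W) :
    pt K s r (φ ≫ ψ) = Pts.map ψ.base.hom (pt K s t φ) * pt K t r ψ := by
  apply eq_pt
  have h1 : arcAt K (Pts.map ψ.base.hom (pt K s t φ) * pt K t r ψ) =
      Pts.map (psMap (resHom (k := k) ψ.base).hom) (arcAt K (pt K s t φ)) *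
        arcAt K (pt K t r ψ) :=
    (arcAt_mul _ _).trans (congrArg (· * arcAt K (pt K t r ψ))
      (K.map_arc (resAlgHom (k := k) ψ.base) _).symm)
  change _ = r.σ₁.comp (ψ.hom.hom₁.toAlgHom.comp φ.hom.hom₁.toAlgHom)
  rw [h1, ← AlgHom.comp_assoc, ← pmul_pt K t r ψ, ← TorsorHom.pmul_comp, AlgHom.comp_assoc,
    ← pmul_pt K s t φ, Torsor.comp_pmul, Torsor.pmul_pmul, ← AlgHom.comp_assoc, psMap_comp]
  rfl

theorem hom_ext {s : Framing X Y} {t : Framing X Z} {φ ψ : Y ⟶ Z} (hb : φ.base = ψ.base)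
    (h : pt K s t φ = pt K s t ψ) : φ = ψ := by
  have h1 := pmul_pt K s t φ
  have h1' := pmul_pt K s t ψ
  have h2 := t.comp_hom φ
  have h2' := t.comp_hom ψ
  obtain ⟨b, φ⟩ := φ
  obtain ⟨b', ψ⟩ := ψ
  obtain rfl : b = b' := hb
  have e : t.σ₁.comp φ.hom₁.toAlgHom = t.σ₁.comp ψ.hom₁.toAlgHom := by
    refine h1.symm.trans (Eq.trans ?_ h1')
    rw [h]
  refine congrArg (Fibre.Hom.mk b)
    (HeckeTuple.Hom.ext_isSections t.isFraming.isSections e (h2.unique₂ ?_))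
  rw [e]
  exact h2'

theorem exists_hom (s : Framing X Y) (t : Framing X Z) (f : Y.base ⟶ Z.base)
    (p : Pts L K.K Z.base) : ∃ φ : Y ⟶ Z, φ.base = f ∧ pt K s t φ = p := by
  obtain ⟨σ, hσ⟩ := (s.map f).exists_pmul_arc (arcAt_mem p)
  obtain ⟨φ, h, -⟩ := t.isFraming.exists_hom hσ
  exact ⟨⟨f, φ⟩, rfl, eq_pt h.symm⟩

end Fibre

end

section

/-! ### The trivial torsors in BG. -/

section TrivialTorsors

variable {k : Type u} [Field k] {R : Type u} [CommRing R] [HopfAlgebra k R]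

namespace BG

/-- The trivial torsor as an object of `BG`. -/
abbrev triv (A : CommAlgCat.{u} k) : BG k R := ⟨A, trivTorsor k R A⟩

variable {A B C : CommAlgCat.{u} k}

/-- The morphism of trivial torsors given by a point of the group. -/
def trivHom (f : A ⟶ B) (p : Pts k R B) : (triv A : BG k R) ⟶ triv B :=
  ⟨f, TorsorHom.ofPt _ f.hom (trivPt f.hom p) (trivPt_algebraMap _ _) fun _ => rfl⟩

theorem comp_trivHom (f : A ⟶ B) (p : Pts k R B) {D : Type u} [CommRing D] [Algebra k D]
    (γ : B →ₐ[k] D) (q : Pts k R D) : (trivPt γ q).comp (trivHom f p).hom.toAlgHom =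
      trivPt (γ.comp f.hom) (Pts.map γ p * q) := by
  refine (TorsorHom.comp_ofPt (trivTorsor k R A) f.hom (trivPt f.hom p) (trivPt_algebraMap _ _)
    (fun _ => rfl) γ q).trans ?_
  rw [comp_trivPt]
  exact pmul_trivPt _ _ _

theorem trivPt_comp_trivHom (f : A ⟶ B) (p : Pts k R B) :
    (trivPt (AlgHom.id k B) 1).comp (trivHom f p).hom.toAlgHom = trivPt f.hom p := by
  rw [comp_trivHom, mul_one]
  rfl

theorem hom_ext_section {X Y : BG k R} (τ : Y.torsor.S →ₐ[k] Y.base)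
    (hτ : ∀ c, τ (algebraMap Y.base Y.torsor.S c) = c) {φ ψ : X ⟶ Y} (hb : φ.base = ψ.base)
    (h : τ.comp φ.hom.toAlgHom = τ.comp ψ.hom.toAlgHom) : φ = ψ := by
  obtain ⟨b, φ⟩ := φ
  obtain ⟨b', ψ⟩ := ψ
  obtain rfl : b = b' := hb
  exact congrArg (BG.Hom.mk b) (TorsorHom.ext_section τ hτ h)

theorem hom_ext_triv {X : BG k R} {φ ψ : X ⟶ triv B} (hb : φ.base = ψ.base)
    (h : (trivPt (AlgHom.id k B) 1).comp φ.hom.toAlgHom =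
      (trivPt (AlgHom.id k B) 1).comp ψ.hom.toAlgHom) : φ = ψ :=
  hom_ext_section (Y := triv B) (trivPt (AlgHom.id k B) 1) (trivPt_algebraMap _ _) hb h

theorem trivHom_id : (trivHom (𝟙 A) 1 : (triv A : BG k R) ⟶ triv A) = 𝟙 (triv A) :=
  hom_ext_triv rfl (trivPt_comp_trivHom _ _)

theorem trivHom_comp (f : A ⟶ B) (g : B ⟶ C) (p : Pts k R B) (q : Pts k R C) :
    trivHom f p ≫ trivHom g q = trivHom (f ≫ g) (Pts.map g.hom p * q) := by
  refine hom_ext_triv rfl (Eq.trans ?_ (trivPt_comp_trivHom _ _).symm)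
  change (trivPt (AlgHom.id k C) 1).comp ((trivHom g q).hom.toAlgHom.comp
    (trivHom f p).hom.toAlgHom) = _
  rw [← AlgHom.comp_assoc, trivPt_comp_trivHom]
  exact comp_trivHom _ _ _ _

theorem trivHom_injective {f f' : A ⟶ B} {p p' : Pts k R B} (h : trivHom f p = trivHom f' p') :
    f = f' ∧ p = p' := by
  refine ⟨congrArg BG.Hom.base h, ?_⟩
  have := congrArg (fun φ : (triv A : BG k R) ⟶ triv B =>
    trivCoord ((trivPt (AlgHom.id k B) 1).comp φ.hom.toAlgHom)) h
  rw [trivPt_comp_trivHom, trivPt_comp_trivHom, trivCoord_trivPt, trivCoord_trivPt] at this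
  exact this

theorem exists_trivHom_eq (φ : (triv A : BG k R) ⟶ triv B) : ∃ p, trivHom φ.base p = φ := by
  refine ⟨trivCoord ((trivPt (AlgHom.id k B) 1).comp φ.hom.toAlgHom), hom_ext_triv rfl ?_⟩
  refine (trivPt_comp_trivHom _ _).trans (trivPt_trivCoord _ _ fun b => ?_)
  rw [AlgHom.comp_apply]
  refine (congrArg (trivPt (AlgHom.id k B) 1) (φ.hom.map_base b)).trans ?_
  exact trivPt_algebraMap _ _ _

theorem nonempty_triv_iso (X : BG k R) {σ : X.torsor.S →ₐ[k] X.base}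
    (hσ : ∀ b, σ (algebraMap X.base X.torsor.S b) = b) : Nonempty (triv X.base ≅ X) := by
  have ht : ∀ b, trivPt (R := R) (AlgHom.id k X.base) 1 (algebraMap X.base _ b) = b :=
    trivPt_algebraMap _ _
  obtain ⟨φ, hφ⟩ := TorsorHom.exists_comp_eq (AlgHom.id k X.base) (trivTorsor k R X.base) X.torsor
    σ hσ (trivPt (AlgHom.id k X.base) 1) ht
    (b' := (CommAlgCat.Hom.hom (𝟙 X.base)).toRingHom) fun _ => rfl
  obtain ⟨ψ, hψ⟩ := TorsorHom.exists_comp_eq (AlgHom.id k X.base) X.torsor (trivTorsor k R X.base)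
    (trivPt (AlgHom.id k X.base) 1) ht σ hσ
    (b' := (CommAlgCat.Hom.hom (𝟙 X.base)).toRingHom) fun _ => rfl
  refine ⟨⟨⟨𝟙 _, φ⟩, ⟨𝟙 _, ψ⟩, hom_ext_triv rfl ?_, hom_ext_section σ hσ rfl ?_⟩⟩
  · exact (congrArg (fun z => z.comp φ.toAlgHom) hψ).trans hφ
  · exact (congrArg (fun z => z.comp ψ.toAlgHom) hφ).trans hψ

end BG

end TrivialTorsors

/-! ### The fibres of Φ as classifying stacks. -/

namespace Fibre

variable {k : Type u} [Field k] {R : Type u} [CommRing R] [HopfAlgebra k R]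
  {ell : Pts k R (LaurentPolynomial k)} {L : Type u} [Field L] [Algebra k L]
  {x : QuotPt ell (CommAlgCat.of k L)} {X : x.Chart} {Φ : StackMap ell} (K : ArcScheme X.l)

/-- The functor which sends all objects of the fibre to trivial torsors, and morphisms to the
arcs comparing chosen framings. -/
def toBG (s : ∀ Y : Fibre Φ x, Framing X Y) : Fibre Φ x ⥤ BG L K.K where
  obj Y := BG.triv Y.base
  map {Y Z} φ := BG.trivHom φ.base (pt K (s Y) (s Z) φ)
  map_id Y := (congrArg (BG.trivHom (𝟙 Y.base)) (pt_id (s Y))).trans BG.trivHom_id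
  map_comp {Y Z W} φ ψ := (congrArg (BG.trivHom (φ.base ≫ ψ.base))
    (pt_comp (s Y) (s Z) (s W) φ ψ)).trans (BG.trivHom_comp _ _ _ _).symm

/-- Over a given homomorphism of bases, morphisms on either side correspond to points of K, so the
functor is fully faithful. It is essentially surjective because every K-torsor over an affine base
is trivial and the fibre has an object over every base. -/
theorem isClassifyingStack_of_framing (s : ∀ Y : Fibre Φ x, Framing X Y)
    (h : ∀ B : CommAlgCat.{u} L, ∃ Y : Fibre Φ x, Y.base = B) : IsClassifyingStack Φ x K.K := by
  refine ⟨toBG K s, ⟨⟨fun {Y Z} φ ψ e => ?_⟩, ⟨fun {Y Z} f => ?_⟩, ⟨fun P => ?_⟩⟩, ⟨Iso.refl _⟩⟩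
  · obtain ⟨hb, hp⟩ := BG.trivHom_injective e
    exact hom_ext hb hp
  · obtain ⟨p, hp⟩ := BG.exists_trivHom_eq f
    obtain ⟨φ, hb, hφ⟩ := exists_hom (K := K) (s Y) (s Z) f.base p
    refine ⟨φ, Eq.trans ?_ hp⟩
    change BG.trivHom φ.base (pt K (s Y) (s Z) φ) = _
    rw [hb, hφ]
  · obtain ⟨Y, hY⟩ := h P.base
    obtain ⟨σ, hσ⟩ := K.exists_section P.torsor
    obtain ⟨e⟩ := BG.nonempty_triv_iso P hσ
    exact ⟨Y, ⟨eqToIso (congrArg BG.triv hY) ≪≫ e⟩⟩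

theorem exists_isClassifyingStack [Algebra.Smooth k R] (hell : IsCochar ell)
    (x : QuotPt ell (CommAlgCat.of k L)) : ∃ (K : Type u) (_ : CommRing K) (_ : HopfAlgebra L K),
      IsProUnipotent L K ∧ IsClassifyingStack (jantzenMap hell) x K := by
  obtain ⟨X⟩ := x.nonempty_chart hell
  obtain ⟨K⟩ := X.isCochar.nonempty_arcScheme
  have hs : ∀ Y : Fibre (jantzenMap hell) x, Nonempty (Framing X Y) := fun Y => by
    have h : Y.tuple.Framed (AlgHom.id k (resAlg (k := k) L Y.base))
        (X.κ (resAlg (k := k) L Y.base)) 1 1 := X.framed hell (hT := Y.mem) Y.obj_eq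
    obtain ⟨σ₁, σ₂, h⟩ := h
    exact ⟨⟨σ₁, σ₂, h⟩⟩
  refine ⟨K.K, _, _, K.isProUnipotent, isClassifyingStack_of_framing K (fun Y => (hs Y).some)
    fun B => ⟨⟨B, X.tuple (resAlg (k := k) L B), X.inStratum (A := resAlg (k := k) L B),
      X.obj_eq (A := resAlg (k := k) L B) hell⟩, rfl⟩⟩

end Fibre

end

end KOneHecke

theorem mainTheorem8 {k : Type u} [Field k] [Finite k] {R : Type u} [CommRing R] [HopfAlgebra k R]
    (hG : KOneHecke.IsConnectedReductive k R) (T : KOneHecke.SplitMaximalTorus k R)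
    (lam : T.Coweight) :
    ∃ Φ : KOneHecke.StackMap (T.cochar lam),
      -- `Φ` is the morphism given by Jantzen filtrations
      Φ.IsJantzen ∧
      -- `Φ` is surjective on `k`-points
      (∀ x : KOneHecke.QuotPt (T.cochar lam) (CommAlgCat.of k k),
        ∃ (X : KOneHecke.HeckeTuple k R k) (hX : X.InStratum (A := CommAlgCat.of k k) (T.cochar lam)),
          Φ.obj ⟨CommAlgCat.of k k, X, hX⟩ = x) ∧
      -- the fibres of `Φ` are classifying stacks of pro-unipotent groups
      (∀ (L : Type u) [Field L] [Algebra k L]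
        (x : KOneHecke.QuotPt (T.cochar lam) (CommAlgCat.of k L)),
        ∃ (K : Type u) (_ : CommRing K) (_ : HopfAlgebra L K),
          KOneHecke.IsProUnipotent L K ∧ KOneHecke.Fibre.IsClassifyingStack Φ x K) ∧
      -- `Φ` is injective on isomorphism classes of `k`-points
      (∀ (X Y : KOneHecke.HeckeTuple k R k)
        (hX : X.InStratum (A := CommAlgCat.of k k) (T.cochar lam))
        (hY : Y.InStratum (A := CommAlgCat.of k k) (T.cochar lam)),
        Φ.obj ⟨CommAlgCat.of k k, X, hX⟩ = Φ.obj ⟨CommAlgCat.of k k, Y, hY⟩ →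
          Nonempty ((⟨CommAlgCat.of k k, X, hX⟩ : KOneHecke.HeckeStratum (T.cochar lam)) ≅
            ⟨CommAlgCat.of k k, Y, hY⟩)) := by
  have := hG.smooth
  have hell := T.isCochar lam
  exact ⟨KOneHecke.jantzenMap hell, KOneHecke.jantzenMap_isJantzen hell,
    KOneHecke.jantzenMap_surjective hell,
    fun L _ _ x => KOneHecke.Fibre.exists_isClassifyingStack hell x,
    fun _ _ hX hY h => KOneHecke.jantzenMap_injective hell hX hY h⟩
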